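/- **Setting.** Consider $n$ sensors with outputs $y_i(t)=\alpha_i x(t)+\beta_i$, $\alpha_i\neq 0$, observing a real random signal $x(t)$, $t\in\mathbb Z$. They communicate over a directed graph $\mathcal G$ without self-loops, where an arc $j\to i$ means that $j\in\mathcal N_i$ can send to $i$. The weights satisfy $\gamma_{ij}>0$ for $j\in\mathcal N_i$ and $\gamma_{ij}=0$ otherwise. Let $\Gamma(\gamma)$ be the matrix with off-diagonal entries $\gamma_{ij}$ and diagonal entries $-\sum_{k\ne i}\gamma_{ik}$. Put $$\phi_i(p,q)=\begin{bmatrix}\alpha_i\beta_i p+\alpha_i^2 q&\alpha_i\beta_i+\alpha_i^2p\\(1+\beta_i^2)p+\alpha_i\beta_i q&1+\beta_i^2+\alpha_i\beta_i p\end{bmatrix},\qquad B(\gamma,p,q)=\mathrm{diag}\{\phi_1(p,q),\dots,\phi_n(p,q)\}\,(\Gamma(\gamma)\otimes I_2).$$ **Common assumptions.** $\mathcal G$ has a (directed) spanning tree; $\delta(t)>0$, $\sum_t\delta(t)=\infty$, $\sum_t\delta(t)^2<\infty$; and $\lim_{t\to\infty}(\delta(t+1)^{-1}-\delta(t)^{-1})=\ell$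 for some finite $\ell\ge 0$. Consider any one of the following three situations. **(I) Communication errors.** The $x(t)$ are i.i.d. with $E\,x(t)=\bar x$, $E\,x(t)^2=s^2$, $s^2-\bar x^2>0$, $E\,x(t)^4<\infty$. For each $(i,j)$, $\{u_{ij}(t)\}_{t\ge0}$ is i.i.d. with $u_{ij}(t)=1$ with probability $p_{ij}$ and $u_{ij}(t)=0$ with probability $1-p_{ij}$, where $p_{ij}>0$ if $j\in\mathcal N_i$, and $\{\xi_{ij}(t)\}_{t\ge0}$ is i.i.d. with zero mean and finite variance. The processes $x$, $u_{ij}$, $\xi_{ij}$ $(i,j=1,\dots,n)$ are mutually independent. The estimates $\hat\rho(t)=(\hat\rho_1(t),\dots,\hat\rho_n(t))\in\mathbb R^{2n}$ start from $\hat\rho_i(0)=(\alpha_i,\beta_i)^T$ and $$\hat\rho(t+1)=\bigl[I+\delta(t)B((\gamma_{ij}u_{ij}(t)),x(t),x(t)^2)\bigr]\hat\rho(t)+\delta(t)\nu(t),\qquad \nu_i(t)=\sum_{j\in\mathcal N_i}\gamma_{ij}u_{ij}(t)\xi_{ij}(t)\begin{bmatrix}\alpha_iy_i(t)\\1+\beta_iy_i(t)\end{bmatrix}.$$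 Here $\bar B=B((\gamma_{ij}p_{ij}),\bar x,s^2)$. **(II) Measurement noise with known variances.** $x$ is as in (I). The sensors produce $y_i^\eta(t)=\alpha_ix(t)+\beta_i+\eta_i(t)$, where each $\{\eta_i(t)\}_{t\in\mathbb Z}$ is i.i.d. with $E\,\eta_i(t)=0$, $E\,\eta_i(t)^2=\sigma_i^2$, $E\,\eta_i(t)^4<\infty$, and $x,\eta_1,\dots,\eta_n$ are mutually independent. The parameters $\hat\theta_i(t)=(\hat a_i(t),\hat b_i(t))^T$ start from $\hat\theta_i(0)=(1,0)^T$ and $$\hat\theta_i(t+1)=\hat\theta_i(t)+\delta(t)\Bigl\{\sum_{j\in\mathcal N_i}\gamma_{ij}\,\epsilon^\eta_{ij}(t)\begin{bmatrix}y_i^\eta(t)\\1\end{bmatrix}+\begin{bmatrix}\sigma_i^2\sum_{j\in\mathcal N_i}\gamma_{ij}\,\hat a_i(t)\\0\end{bmatrix}\Bigr\},$$ $\epsilon^\eta_{ij}(t)=\hat z^\eta_j(t)-\hat z^\eta_i(t)$, $\hat z_i^\eta(t)=\hat a_i(t)y_i^\eta(t)+\hat b_i(t)$; $\hat\rho_i(t)=(\hat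 a_i(t)\alpha_i,\ \hat a_i(t)\beta_i+\hat b_i(t))^T$. Here $\bar B=B(\gamma,\bar x,s^2)$. **(III) Instrumental variables.** $x$ is weakly stationary, $E\,x(t)=\bar x$, $E\,x(t)x(t-d)=m(d)$, $m(0)=s^2$, $|x(t)|\le K<\infty$ a.s.; for each $d\ge0$ there are deterministic functions $\varphi(\tau)\to0$ and $\varphi_d(\tau)\to0$ $(\tau\to\infty)$ such that a.s. $|E\{x(t)\mid\mathcal F_{t-\tau}\}-\bar x|\le\varphi(\tau)$ for $0\le\tau\le t$ and $|E\{x(t)x(t-d)\mid\mathcal F_{t-\tau}\}-m(d)|\le\varphi_d(\tau)$ for $d<\tau\le t$, with $\mathcal F_k=\sigma(x(0),\dots,x(k))$. For some $d_0\ge1$, $m(d_0)>\bar x^2$. The noise $\eta$ is as in (II) (independent of this $x$). With the notation of (II), $\hat\theta_i(0)=(1,0)^T$ and $$\hat\theta_i(t+1)=\hat\theta_i(t)+\delta(t)\sum_{j\in\mathcal N_i}\gamma_{ij}\,\epsilon^\eta_{ij}(t)\begin{bmatrix}y_i^\eta(t-d_0)\\1\end{bmatrix}.$$ Here $\bar B=B(\gamma,\bar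 x,s^2)$. **Conclusion.** Let $T=[\,i_1\;\;i_2\;\;T_2\,]$ with $i_1=(1,0,1,0,\dots,1,0)^T$, $i_2=(0,1,0,1,\dots,0,1)^T$, and $T_2$ any $2n\times(2n-2)$ matrix whose columns span the column space of $\bar B$. Every such $T$ is nonsingular. Let $\tilde\rho(t)=T^{-1}\hat\rho(t)$ and let $\tilde\rho(t)^{[2]}$ consist of the last $2n-2$ components of $\tilde\rho(t)$. Then there is $\sigma'$ with $0<\sigma'<1$ (the same for all such $T$) such that for all $0<\sigma<\sigma'$ the expectation $E\|\tilde\rho(t)^{[2]}\|^2$ is finite for every $t$ and $$E\|\tilde\rho(t)^{[2]}\|^2=o(\delta(t)^\sigma)\qquad(t\to\infty).$$ -/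

import Mathlib

open Filter Topology MeasureTheory ProbabilityTheory Asymptotics
open scoped Kronecker Matrix

namespace BlindCalibration

/-! ### Network and matrices -/

/-- `H` is a directed spanning tree of `G` with root `r`: a subgraph in which the root has no
incoming arc, every other node has exactly one incoming arc, and every node is reachable from the
root. An arc `G.Adj j i` means that the sensor `j` can send its message to the sensor `i`. -/
structure IsSpanningTree {V : Type*} (G H : Digraph V) (r : V) : Prop where
  le : ∀ ⦃u v⦄, H.Adj u v → G.Adj u v
  root : ∀ u, ¬ H.Adj u r
  parent : ∀ v, v ≠ r → ∃! u, H.Adj u v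
  reach : ∀ v, Relation.ReflTransGen H.Adj r v

def HasSpanningTree {V : Type*} (G : Digraph V) : Prop :=
  ∃ (H : Digraph V) (r : V), IsSpanningTree G H r

/-- The standing conventions on the sensors and the weights: there are no self-loops, `γ i j` is
positive when `j` is a neighbor of `i` (i.e. there is an arc from `j` to `i`) and zero otherwise,
and the sensor gains do not vanish. -/
structure IsSensorNetwork {n : ℕ} (G : Digraph (Fin n)) (γ : Matrix (Fin n) (Fin n) ℝ)
    (α : Fin n → ℝ) : Prop where
  loopless : ∀ i, ¬ G.Adj i i
  weight_pos : ∀ i j, G.Adj j i → 0 < γ i j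
  weight_zero : ∀ i j, ¬ G.Adj j i → γ i j = 0
  gain_ne : ∀ i, α i ≠ 0

/-- The matrix `Γ`: off-diagonal entries `γ i j`, diagonal entries `-∑_{k ≠ i} γ i k`. -/
def weightMatrix {n : ℕ} (γ : Matrix (Fin n) (Fin n) ℝ) : Matrix (Fin n) (Fin n) ℝ :=
  Matrix.of fun i j => if i = j then -∑ k ∈ Finset.univ.erase i, γ i k else γ i j

/-- The block `Φ_i` as a function of the gain `a`, the offset `b` and of `p`, `q`, which stand for
the signal and its square (`p = x(t)`, `q = x(t)^2`) or for their expectations. -/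
def phiBlock (a b p q : ℝ) : Matrix (Fin 2) (Fin 2) ℝ :=
  !![a * b * p + a ^ 2 * q, a * b + a ^ 2 * p;
     (1 + b ^ 2) * p + a * b * q, 1 + b ^ 2 + a * b * p]

/-- `diag {D_1, …, D_n}`; the vectors of `ℝ^{2n}` are indexed by (node, component). -/
def blockDiag {n : ℕ} (D : Fin n → Matrix (Fin 2) (Fin 2) ℝ) :
    Matrix (Fin n × Fin 2) (Fin n × Fin 2) ℝ :=
  Matrix.of fun k l => if k.1 = l.1 then D k.1 k.2 l.2 else 0

/-- `diag {Φ_1, …, Φ_n} (Γ ⊗ I_2)`. -/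
def systemMatrix {n : ℕ} (α β : Fin n → ℝ) (γ : Matrix (Fin n) (Fin n) ℝ) (p q : ℝ) :
    Matrix (Fin n × Fin 2) (Fin n × Fin 2) ℝ :=
  blockDiag (fun i => phiBlock (α i) (β i) p q) *
    (weightMatrix γ ⊗ₖ (1 : Matrix (Fin 2) (Fin 2) ℝ))

/-- `T = [i₁ ⋮ i₂ ⋮ T₂]`, where `i₁ = (1,0,1,0,…)`, `i₂ = (0,1,0,1,…)` are the columns of the first
`2`-block and the other `2n-2` columns span the column space of `Bbar`. -/
structure IsConsensusTransform {n : ℕ} (Bbar T : Matrix (Fin n × Fin 2) (Fin n × Fin 2) ℝ) :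
    Prop where
  first : ∀ l : Fin n × Fin 2, l.1.val = 0 → ∀ k, T k l = if k.2 = l.2 then 1 else 0
  span_eq : Submodule.span ℝ {v | ∃ l : Fin n × Fin 2, l.1.val ≠ 0 ∧ v = T.col l} =
    Submodule.span ℝ (Set.range Bbar.col)

/-- `‖ρ̃^{[2]}‖²` where `ρ̃ = T⁻¹ ρ` and `ρ̃^{[2]}` consists of all the components of `ρ̃` but the
first two. -/
noncomputable def disagreementSq {n : ℕ} (T : Matrix (Fin n × Fin 2) (Fin n × Fin 2) ℝ)
    (ρ : Fin n × Fin 2 → ℝ) : ℝ :=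
  ∑ k : Fin n × Fin 2, if k.1.val = 0 then 0 else (T⁻¹ *ᵥ ρ) k ^ 2

/-! ### Algorithms -/

section Algorithms

variable {Ω : Type*} {n : ℕ}

/-- Communication noise entering the recursion:
`ν_i(t) = ∑_j γ_ij u_ij(t) ξ_ij(t) [α_i y_i(t), 1 + β_i y_i(t)]ᵀ`, `y_i(t) = α_i x(t) + β_i`. -/
def commNoise (α β : Fin n → ℝ) (γ : Matrix (Fin n) (Fin n) ℝ)
    (x : ℤ → Ω → ℝ) (u ξ : Fin n → Fin n → ℕ → Ω → ℝ) (t : ℕ) (ω : Ω) : Fin n × Fin 2 → ℝ :=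
  fun k => ∑ j, γ k.1 j * u k.1 j t ω * ξ k.1 j t ω *
    ![α k.1 * (α k.1 * x t ω + β k.1), 1 + β k.1 * (α k.1 * x t ω + β k.1)] k.2

/-- The estimates `ρ̂(t)` under communication dropouts and communication noise:
`ρ̂(t+1) = (I + δ(t) B'(t)) ρ̂(t) + δ(t) ν(t)`, `ρ̂_i(0) = (α_i, β_i)`. -/
def lossyEstimate (α β : Fin n → ℝ) (γ : Matrix (Fin n) (Fin n) ℝ) (δ : ℕ → ℝ)
    (x : ℤ → Ω → ℝ) (u ξ : Fin n → Fin n → ℕ → Ω → ℝ) : ℕ → Ω → Fin n × Fin 2 → ℝ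
  | 0, _ => fun k => ![α k.1, β k.1] k.2
  | t + 1, ω =>
      (1 + δ t • systemMatrix α β (Matrix.of fun i j => u i j t ω * γ i j) (x t ω) (x t ω ^ 2)) *ᵥ
          lossyEstimate α β γ δ x u ξ t ω
        + δ t • commNoise α β γ x u ξ t ω

/-- Noisy sensor output `y_i^η(t) = α_i x(t) + β_i + η_i(t)`. -/
def sensorOutput (α β : Fin n → ℝ) (x : ℤ → Ω → ℝ) (η : Fin n → ℤ → Ω → ℝ) (i : Fin n) (t : ℤ)
    (ω : Ω) : ℝ :=
  α i * x t ω + β i + η i t ω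

/-- Equivalent gains and offsets: `ρ_i = (a_i α_i, a_i β_i + b_i)` for `θ_i = (a_i, b_i)`. -/
def equivParams (α β : Fin n → ℝ) (θ : Fin n → Fin 2 → ℝ) : Fin n × Fin 2 → ℝ :=
  fun k => ![θ k.1 0 * α k.1, θ k.1 0 * β k.1 + θ k.1 1] k.2

/-- `ε_ij^η(t) = ẑ_j^η(t) - ẑ_i^η(t)` with `ẑ_i^η(t) = â_i y_i^η(t) + b̂_i`. -/
def outputError (α β : Fin n → ℝ) (x : ℤ → Ω → ℝ) (η : Fin n → ℤ → Ω → ℝ)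
    (θ : Fin n → Fin 2 → ℝ) (t : ℤ) (ω : Ω) (i j : Fin n) : ℝ :=
  (θ j 0 * sensorOutput α β x η j t ω + θ j 1) - (θ i 0 * sensorOutput α β x η i t ω + θ i 1)

/-- The calibration parameters `θ̂_i(t)` of the algorithm which compensates for the known variances
`σ_i²` of the measurement noise; `θ̂_i(0) = (1, 0)`. -/
def compensatedParams (α β : Fin n → ℝ) (γ : Matrix (Fin n) (Fin n) ℝ) (δ : ℕ → ℝ) (σ : Fin n → ℝ)
    (x : ℤ → Ω → ℝ) (η : Fin n → ℤ → Ω → ℝ) : ℕ → Ω → Fin n → Fin 2 → ℝ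
  | 0, _ => fun _ => ![1, 0]
  | t + 1, ω => fun i =>
      compensatedParams α β γ δ σ x η t ω i
        + δ t • ((∑ j, (γ i j *
              outputError α β x η (compensatedParams α β γ δ σ x η t ω) t ω i j) •
                ![sensorOutput α β x η i t ω, 1])
            + ![σ i ^ 2 * (∑ j, γ i j) * compensatedParams α β γ δ σ x η t ω i 0, 0])

/-- The calibration parameters `θ̂_i(t)` of the instrumental variable algorithm with delay `d`;
`θ̂_i(0) = (1, 0)`. -/
def instrumentalParams (α β : Fin n → ℝ) (γ : Matrix (Fin n) (Fin n) ℝ) (δ : ℕ → ℝ) (d : ℕ)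
    (x : ℤ → Ω → ℝ) (η : Fin n → ℤ → Ω → ℝ) : ℕ → Ω → Fin n → Fin 2 → ℝ
  | 0, _ => fun _ => ![1, 0]
  | t + 1, ω => fun i =>
      instrumentalParams α β γ δ d x η t ω i
        + δ t • ∑ j, (γ i j *
              outputError α β x η (instrumentalParams α β γ δ d x η t ω) t ω i j) •
                ![sensorOutput α β x η i ((t : ℤ) - d) ω, 1]

end Algorithms

/-! ### Probabilistic assumptions -/

section Assumptions

variable {Ω : Type*} [mΩ : MeasurableSpace Ω]

/-- The `σ`-algebra generated by a process. -/
@[reducible] def processSigma {τ : Type*} (X : τ → Ω → ℝ) : MeasurableSpace Ω :=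
  ⨆ t, MeasurableSpace.comap (X t) inferInstance

/-- The `σ`-algebra generated by `x(k), x(k-1), …, x(0)`. -/
@[reducible] def history (x : ℤ → Ω → ℝ) (k : ℤ) : MeasurableSpace Ω :=
  ⨆ s ∈ Set.Icc (0 : ℤ) k, MeasurableSpace.comap (x s) inferInstance

/-- An i.i.d. real sequence. -/
structure IsIID {τ : Type*} (X : τ → Ω → ℝ) (P : Measure Ω) : Prop where
  measurable : ∀ t, Measurable (X t)
  indep : iIndepFun X P
  ident : ∀ s t, IdentDistrib (X s) (X t) P P

/-- `x` is i.i.d. with `E x(t) = xbar`, `E x(t)² = s²`; the fourth moment is finite. -/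
structure IIDSignal (x : ℤ → Ω → ℝ) (P : Measure Ω) (xbar s : ℝ) : Prop where
  iid : IsIID x P
  memLp : ∀ t, MemLp (x t) 4 P
  mean : ∀ t, ∫ ω, x t ω ∂P = xbar
  sq : ∀ t, ∫ ω, x t ω ^ 2 ∂P = s ^ 2

/-- `x` is weakly stationary and a.s. bounded, with `E x(t) = xbar`, `E x(t) x(t-d) = m(d)`, and
the conditional first and second moments given the `τ`-delayed past are within `o(1)`, `τ → ∞`,
of the unconditional ones, where `o(1)` is a deterministic function of `τ` tending to zero. -/
structure StationarySignal (x : ℤ → Ω → ℝ) (P : Measure Ω) (xbar s : ℝ) (m : ℕ → ℝ) : Prop where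
  measurable : ∀ t, Measurable (x t)
  bounded : ∃ K : ℝ, ∀ t, ∀ᵐ ω ∂P, |x t ω| ≤ K
  mean : ∀ t, ∫ ω, x t ω ∂P = xbar
  corr : ∀ (t : ℤ) (d : ℕ), ∫ ω, x t ω * x (t - d) ω ∂P = m d
  corr_zero : m 0 = s ^ 2
  mixing_mean : ∃ φ : ℕ → ℝ, Tendsto φ atTop (𝓝 0) ∧ ∀ (t : ℤ) (τ : ℕ), (τ : ℤ) ≤ t →
    ∀ᵐ ω ∂P, |(P[x t | history x (t - τ)]) ω - xbar| ≤ φ τ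
  mixing_corr : ∀ d : ℕ, ∃ φ : ℕ → ℝ, Tendsto φ atTop (𝓝 0) ∧
    ∀ (t : ℤ) (τ : ℕ), d < τ → (τ : ℤ) ≤ t →
      ∀ᵐ ω ∂P, |(P[fun ω' => x t ω' * x (t - d) ω' | history x (t - τ)]) ω - m d| ≤ φ τ

/-- Dropout indicators: for each arc, `u_ij(t)` are i.i.d., equal to `1` with probability `p_ij`
and to `0` with probability `1 - p_ij`, where `p_ij > 0` on the arcs of the network. -/
structure Dropouts {n : ℕ} (G : Digraph (Fin n)) (u : Fin n → Fin n → ℕ → Ω → ℝ) (P : Measure Ω)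
    (p : Matrix (Fin n) (Fin n) ℝ) : Prop where
  iid : ∀ i j, IsIID (u i j) P
  one : ∀ i j t, P.real {ω | u i j t ω = 1} = p i j
  zero : ∀ i j t, P.real {ω | u i j t ω = 0} = 1 - p i j
  pos : ∀ i j, G.Adj j i → 0 < p i j

/-- Communication noise: for each arc, an i.i.d. zero mean sequence with finite variance. -/
structure CommunicationNoise {n : ℕ} (ξ : Fin n → Fin n → ℕ → Ω → ℝ) (P : Measure Ω) : Prop where
  iid : ∀ i j, IsIID (ξ i j) P
  memLp : ∀ i j t, MemLp (ξ i j t) 2 P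
  mean : ∀ i j t, ∫ ω, ξ i j t ω ∂P = 0

/-- The processes `x`, `u_ij`, `ξ_ij` (`i, j = 1, …, n`) are mutually independent. -/
def IndepSignals {n : ℕ} (x : ℤ → Ω → ℝ) (u ξ : Fin n → Fin n → ℕ → Ω → ℝ)
    (P : Measure Ω) : Prop :=
  iIndep (Sum.elim (fun _ : Unit => processSigma x)
    (Sum.elim (fun e : Fin n × Fin n => processSigma (u e.1 e.2))
      (fun e : Fin n × Fin n => processSigma (ξ e.1 e.2)))) P

/-- Measurement noise: `η_i`, `i = 1, …, n`, are i.i.d. zero mean sequences with variances `σ_i²`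
(and finite fourth moments); `x, η_1, …, η_n` are mutually independent. -/
structure MeasurementNoise {n : ℕ} (x : ℤ → Ω → ℝ) (η : Fin n → ℤ → Ω → ℝ) (P : Measure Ω)
    (σ : Fin n → ℝ) : Prop where
  iid : ∀ i, IsIID (η i) P
  memLp : ∀ i t, MemLp (η i t) 4 P
  mean : ∀ i t, ∫ ω, η i t ω ∂P = 0
  sq : ∀ i t, ∫ ω, η i t ω ^ 2 ∂P = σ i ^ 2
  indep : iIndep (fun k : Option (Fin n) =>
    k.elim (processSigma x) (fun i => processSigma (η i))) P

end Assumptions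

/-- Step sizes: positive, `∑ δ(t) = ∞`, `∑ δ(t)² < ∞`. -/
structure IsStepSize (δ : ℕ → ℝ) : Prop where
  pos : ∀ t, 0 < δ t
  not_summable : ¬ Summable δ
  summable_sq : Summable fun t => δ t ^ 2

/-- There is `0 < σ' < 1` such that for all `0 < σ < σ'`, `E ‖ρ̃(t)^{[2]}‖² = o(δ(t)^σ)`, where
`ρ̃(t) = T⁻¹ ρ̂(t)` for any transformation `T` associated with `Bbar` (all of which are
nonsingular). -/
def ConsensusRate {Ω : Type*} [MeasurableSpace Ω] (P : Measure Ω) {n : ℕ} (δ : ℕ → ℝ)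
    (Bbar : Matrix (Fin n × Fin 2) (Fin n × Fin 2) ℝ) (ρ : ℕ → Ω → Fin n × Fin 2 → ℝ) : Prop :=
  ∃ σ' : ℝ, 0 < σ' ∧ σ' < 1 ∧ ∀ σ : ℝ, 0 < σ → σ < σ' →
    ∀ T : Matrix (Fin n × Fin 2) (Fin n × Fin 2) ℝ, IsConsensusTransform Bbar T →
      IsUnit T.det ∧
      (∀ t, Integrable (fun ω => disagreementSq T (ρ t ω)) P) ∧
      (fun t => ∫ ω, disagreementSq T (ρ t ω) ∂P) =o[atTop] fun t => δ t ^ σ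

end BlindCalibration

/-! All three algorithms are linear recursions `ρ(t+1) = (I + δ(t) A(t)) ρ(t) + δ(t) ν(t)` whose
averaged matrix `B` is a `systemMatrix`. At node `i` it acts by `v ↦ M_i S ∑_j γ_ij (v_j - v_i)`
with `M_i = [[α², αβ], [αβ, 1 + β²]]` and `S = [[q, p], [p, 1]]`, both positive definite because
`α_i ≠ 0` and `p² < q`. So `B` behaves like a weighted Laplacian, and maximum principles give its
structure: the spanning tree makes the kernel the set of consensus vectors
(`systemMatrix_mulVec_eq_zero_iff`), kernel and range meet trivially (`systemMatrix_semisimple`),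
and nonzero eigenvalues have negative real part (`systemMatrix_spectrum`). Hence there is a
quadratic form `|L v|²` which vanishes exactly on consensus and decreases along `v' = B v`
(`exists_isLyapunovFactor`). The disagreement is a linear image of `L v`, so it suffices to prove
`E|L ρ(t)|² = O(δ(t)^s)` for one `s` in `(0, 1)` (`consensusRate`). A scalar recursion `V(t+1) ≤ (1
- c δ(t)) V(t) + C δ(t)²` yields such a rate, since the bound on the increments of `1 / δ` makes
`δ^s` vary slowly (`le_rpow_of_recursion`).

In situations (I) and (II) the coefficients at time `t` are independent of the past, with mean `B`;
in (II) the compensating term cancels the bias caused by the square of the noise. The fluctuations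
then contribute only `O(δ²)` to second moments. The coordinates transversal to the range of `B` feel
no drift, so `E|ρ|²` stays bounded because `∑ δ²` converges, and `E|L ρ|²` satisfies the scalar
recursion (`integral_le_rpow`).

In situation (III) the signal is only mixing, and the regressor carries noise of time `t - d₀`, on
which the current state already depends. Three devices deal with this. First, the state is
multiplied by `I + Q(t)`, where `Q` collects the delayed noise terms of the next `d₀` steps; this
replaces each delayed noise by present noise, independent of the past, up to a remainder of order
`δ²` (`corrected_step`). Second, the recursion with the signal-driven drift alone is a flow which
moves little during `τ` steps, while mixing makes the drift negative on average given the signal `τ`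
steps before; so the flow contracts `E|L y|²` and keeps `E|y|²` bounded (`exists_flow_bound`).
Transporting the noise contributions to the final time by this flow, where they are orthogonal to
what came before, gives the bounds (`integral_flow_succ_le`). Third, the noise amplitudes near time
`t` are not independent of the state, so moments weighted by a window of amplitudes are carried
along; they are bounded by plain moments `d₀` steps earlier and closed by Gronwall
(`windowMoment_le`).

The drift has mean `systemMatrix` with `q = m(d₀)` instead of `s²`. This changes nothing in the
conclusion, because both matrices have the same kernel. Signal values at negative times, on which
the early steps depend, lie outside the mixing hypothesis; the state at a later starting time is
therefore dominated by a variable depending on the noise alone, and linearity transfers the rate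
(`exists_integral_le_rpow_of_dominated`). -/

namespace BlindCalibration

/-! ### Squared Euclidean and Frobenius norms -/

section SqNorm

variable {ι κ : Type*} [Fintype ι] [Fintype κ]

/-- The squared Euclidean norm of a vector. -/
def sqNorm (v : ι → ℝ) : ℝ := ∑ i, v i ^ 2

lemma sqNorm_nonneg (v : ι → ℝ) : 0 ≤ sqNorm v := Finset.sum_nonneg fun _ _ => sq_nonneg _

@[simp] lemma sqNorm_zero : sqNorm (0 : ι → ℝ) = 0 := by simp [sqNorm]

lemma sqNorm_eq_zero {v : ι → ℝ} : sqNorm v = 0 ↔ v = 0 := by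
  rw [sqNorm, Finset.sum_eq_zero_iff_of_nonneg (fun _ _ => sq_nonneg _)]
  simp [funext_iff]

lemma sqNorm_smul (a : ℝ) (v : ι → ℝ) : sqNorm (a • v) = a ^ 2 * sqNorm v := by
  simp [sqNorm, mul_pow, Finset.mul_sum]

lemma sqNorm_add (v w : ι → ℝ) : sqNorm (v + w) = sqNorm v + 2 * (v ⬝ᵥ w) + sqNorm w := by
  simp only [sqNorm, dotProduct, Pi.add_apply, Finset.mul_sum, ← Finset.sum_add_distrib]
  exact Finset.sum_congr rfl fun _ _ => by ring

lemma sq_le_sqNorm (v : ι → ℝ) (i : ι) : v i ^ 2 ≤ sqNorm v :=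
  Finset.single_le_sum (f := fun i => v i ^ 2) (fun _ _ => sq_nonneg _) (Finset.mem_univ i)

lemma two_mul_abs_dotProduct_le (v w : ι → ℝ) {θ : ℝ} (hθ : 0 < θ) :
    2 * |v ⬝ᵥ w| ≤ θ * sqNorm v + θ⁻¹ * sqNorm w := by
  have key : ∀ a b : ℝ, 2 * |a * b| ≤ θ * a ^ 2 + θ⁻¹ * b ^ 2 := by
    intro a b
    have h : 0 ≤ θ⁻¹ * (θ * |a| - |b|) ^ 2 := by positivity
    have e : θ⁻¹ * (θ * |a| - |b|) ^ 2 = θ * |a| ^ 2 + θ⁻¹ * |b| ^ 2 - 2 * (|a| * |b|) := by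
      field_simp
      ring
    rw [e, sq_abs, sq_abs] at h
    rw [abs_mul]
    linarith
  calc 2 * |v ⬝ᵥ w| ≤ 2 * ∑ i, |v i * w i| := by
        gcongr; exact Finset.abs_sum_le_sum_abs _ _
    _ ≤ ∑ i, (θ * v i ^ 2 + θ⁻¹ * w i ^ 2) := by
        rw [Finset.mul_sum]; exact Finset.sum_le_sum fun i _ => key _ _
    _ = _ := by simp [sqNorm, Finset.sum_add_distrib, Finset.mul_sum]

lemma sqNorm_add_le (v w : ι → ℝ) {θ : ℝ} (hθ : 0 < θ) :
    sqNorm (v + w) ≤ (1 + θ) * sqNorm v + (1 + θ⁻¹) * sqNorm w := by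
  rw [sqNorm_add]
  have := two_mul_abs_dotProduct_le v w hθ
  have := le_abs_self (v ⬝ᵥ w)
  linarith

lemma sqNorm_add_le_two (v w : ι → ℝ) : sqNorm (v + w) ≤ 2 * sqNorm v + 2 * sqNorm w := by
  have := sqNorm_add_le v w one_pos
  norm_num at this
  exact this

/-- The squared Frobenius norm of a matrix. -/
def frobSq (A : Matrix κ ι ℝ) : ℝ := ∑ k, ∑ i, A k i ^ 2

lemma frobSq_nonneg (A : Matrix κ ι ℝ) : 0 ≤ frobSq A :=
  Finset.sum_nonneg fun _ _ => Finset.sum_nonneg fun _ _ => sq_nonneg _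

lemma sqNorm_mulVec_le (A : Matrix κ ι ℝ) (v : ι → ℝ) :
    sqNorm (A *ᵥ v) ≤ frobSq A * sqNorm v := by
  rw [sqNorm, frobSq, Finset.sum_mul]
  exact Finset.sum_le_sum fun k _ => Finset.sum_mul_sq_le_sq_mul_sq _ _ _

/-- If `A` kills the kernel of `B` then `A v` is controlled by `B v`. -/
lemma exists_sqNorm_mulVec_le {κ' : Type*} [Fintype κ'] (A : Matrix κ ι ℝ) (B : Matrix κ' ι ℝ)
    (h : ∀ v, B *ᵥ v = 0 → A *ᵥ v = 0) :
    ∃ C, 0 ≤ C ∧ ∀ v, sqNorm (A *ᵥ v) ≤ C * sqNorm (B *ᵥ v) := by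
  classical
  -- `s` is a linear section of `B` over its range and `q` extends `A ∘ s`. Since `v - s (B v)` lies
  -- in the kernel of `B`, the hypothesis gives `A = q ∘ B`.
  obtain ⟨s, hs⟩ := B.mulVecLin.rangeRestrict.exists_rightInverse_of_surjective
    (LinearMap.range_rangeRestrict _)
  obtain ⟨q, hq⟩ := LinearMap.exists_extend (A.mulVecLin ∘ₗ s)
  refine ⟨frobSq (LinearMap.toMatrix' q), frobSq_nonneg _, fun v => ?_⟩
  have : A *ᵥ v = LinearMap.toMatrix' q *ᵥ (B *ᵥ v) := by
    rw [LinearMap.toMatrix'_mulVec]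
    have h1 : q (B *ᵥ v) = A *ᵥ (s (B.mulVecLin.rangeRestrict v)) :=
      LinearMap.congr_fun hq (B.mulVecLin.rangeRestrict v)
    rw [h1]
    have h2 : B *ᵥ (v - s (B.mulVecLin.rangeRestrict v)) = 0 := by
      have := LinearMap.congr_fun hs (B.mulVecLin.rangeRestrict v)
      have := congrArg Subtype.val this
      simp only [LinearMap.comp_apply, LinearMap.codRestrict_apply, LinearMap.rangeRestrict,
        LinearMap.id_apply, Matrix.mulVecLin_apply] at this
      rw [Matrix.mulVec_sub, sub_eq_zero]
      exact this.symm
    have h3 := h _ h2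
    rwa [Matrix.mulVec_sub, sub_eq_zero] at h3
  rw [this]
  exact sqNorm_mulVec_le _ _

end SqNorm

/-! ### Power stability from the spectrum -/

section Spectral

-- By Gelfand's formula `‖a ^ k‖ ^ (1 / k)` eventually lies below any `r` between the spectral
-- radius and one, so the powers are dominated by `r ^ k`.
open scoped ENNReal NNReal in
lemma tendsto_norm_pow_zero_of_spectralRadius_lt_one {A : Type*} [NormedRing A] [NormedAlgebra ℂ A]
    [CompleteSpace A] {a : A} (h : spectralRadius ℂ a < 1) :
    Tendsto (fun k : ℕ => ‖a ^ k‖) atTop (𝓝 0) := by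
  obtain ⟨r, hr, hr1⟩ := ENNReal.lt_iff_exists_nnreal_btwn.1 h
  have hr1 : r < 1 := by exact_mod_cast hr1
  have hev := (spectrum.pow_nnnorm_pow_one_div_tendsto_nhds_spectralRadius a).eventually_lt_const hr
  refine squeeze_zero' (Eventually.of_forall fun _ => norm_nonneg _) ?_
    (tendsto_pow_atTop_nhds_zero_of_lt_one r.coe_nonneg (by exact_mod_cast hr1))
  filter_upwards [hev, eventually_gt_atTop 0] with k hk hk0
  have h1 : (‖a ^ k‖₊ : ℝ≥0∞) ≤ (r : ℝ≥0∞) ^ k := by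
    have := ENNReal.rpow_le_rpow hk.le (Nat.cast_nonneg k : (0 : ℝ) ≤ k)
    rwa [← ENNReal.rpow_mul, one_div, inv_mul_cancel₀ (by positivity), ENNReal.rpow_one,
      ENNReal.rpow_natCast] at this
  exact_mod_cast h1

/-- If all eigenvalues of `f` lie in the open left half-plane then `1 + ε f` is power stable for
some `ε > 0`. -/
lemma exists_norm_pow_le_of_eigenvalue_re_neg {E : Type*} [NormedAddCommGroup E] [NormedSpace ℂ E]
    [FiniteDimensional ℂ E] (f : E →L[ℂ] E)
    (hf : ∀ (μ : ℂ) (v : E), v ≠ 0 → f v = μ • v → μ.re < 0) :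
    ∃ ε : ℝ, 0 < ε ∧ ∀ θ : ℝ, 0 < θ → ∃ k : ℕ, ‖(1 + (ε : ℂ) • f) ^ (k + 1)‖ ≤ θ := by
  have := FiniteDimensional.complete ℂ E
  rcases subsingleton_or_nontrivial E with hE | hE
  · refine ⟨1, one_pos, fun θ hθ => ⟨0, ?_⟩⟩
    rw [Subsingleton.elim ((1 + ((1 : ℝ) : ℂ) • f) ^ (0 + 1)) 0, norm_zero]
    exact hθ.le
  have hspec : ∀ μ ∈ spectrum ℂ f, μ.re < 0 := by
    intro μ hμ
    rw [ContinuousLinearMap.spectrum_eq] at hμ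
    obtain ⟨v, hv⟩ := (Module.End.HasEigenvalue.of_mem_spectrum hμ).exists_hasEigenvector
    exact hf μ v hv.2 hv.apply_eq_smul
  have hcomp : IsCompact (spectrum ℂ f) := spectrum.isCompact f
  obtain ⟨μ₀, hμ₀, hmax⟩ := hcomp.exists_isMaxOn (spectrum.nonempty f)
    (Complex.continuous_re.continuousOn)
  set a := -μ₀.re with ha
  have ha0 : 0 < a := by have := hspec μ₀ hμ₀; simp [ha]; exact this
  obtain ⟨R, hR⟩ := hcomp.isBounded.exists_norm_le
  have hR0 : 0 ≤ R := (norm_nonneg _).trans (hR μ₀ hμ₀)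
  -- On the spectrum `Re μ ≤ -a` and `|μ| ≤ R`, so `|1 + εμ|² ≤ 1 - 2εa + ε²R²`; the choice `ε (R² +
  -- 1) = a` makes this smaller than one.
  refine ⟨a / (R ^ 2 + 1), by positivity, fun θ hθ => ?_⟩
  set ε := a / (R ^ 2 + 1) with hε
  have hε0 : 0 < ε := by positivity
  have hlt : spectralRadius ℂ (1 + (ε : ℂ) • f) < ((1 : NNReal) : ENNReal) := by
    apply spectrum.spectralRadius_lt_of_forall_lt
    intro z hz
    have hz' : z ∈ spectrum ℂ (algebraMap ℂ (E →L[ℂ] E) 1 + (ε : ℂ) • f) := by simpa using hz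
    rw [← spectrum.singleton_add_eq] at hz'
    obtain ⟨o, ho, w, hw, rfl⟩ := hz'
    rw [Set.mem_singleton_iff] at ho
    subst ho
    have hu : (ε : ℂ) • f = (Units.mk0 (ε : ℂ) (by exact_mod_cast hε0.ne')) • f := rfl
    rw [hu, spectrum.unit_smul_eq_smul] at hw
    obtain ⟨μ, hμ, rfl⟩ := hw
    have h1 : ‖(1 : ℂ) + ε * μ‖ ^ 2 < 1 := by
      rw [← Complex.normSq_eq_norm_sq, Complex.normSq_apply]
      have hre : μ.re ≤ -a := by rw [ha]; simpa using hmax hμ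
      have hn : μ.re * μ.re + μ.im * μ.im ≤ R ^ 2 := by
        rw [← Complex.normSq_apply, Complex.normSq_eq_norm_sq]
        gcongr
        exact hR μ hμ
      have hεR : ε * (R ^ 2 + 1) = a := by rw [hε]; field_simp
      simp only [Complex.add_re, Complex.one_re, Complex.mul_re, Complex.ofReal_re,
        Complex.ofReal_im, Complex.add_im, Complex.one_im, Complex.mul_im]
      nlinarith [mul_le_mul_of_nonneg_left hre hε0.le, mul_le_mul_of_nonneg_left hn (sq_nonneg ε),
        mul_pos hε0 ha0, mul_pos hε0 hε0]
    have h2 : ‖(1 : ℂ) + ε * μ‖ < 1 := by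
      by_contra hcon
      push Not at hcon
      nlinarith [norm_nonneg ((1 : ℂ) + ε * μ)]
    change ‖(1 : ℂ) + ε * μ‖₊ < 1
    exact_mod_cast h2
  have ht := tendsto_norm_pow_zero_of_spectralRadius_lt_one (by simpa using hlt)
  obtain ⟨k, hk⟩ := ((tendsto_add_atTop_iff_nat 1).2 ht |>.eventually_lt_const hθ).exists
  exact ⟨k, hk.le⟩

end Spectral

/-! ### Quadratic Lyapunov functions vanishing on the kernel -/

section Lyapunov

variable {ι : Type*} [Fintype ι]

lemma map_ofReal_mulVec (A : Matrix ι ι ℝ) (v : ι → ℝ) :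
    A.map ((↑) : ℝ → ℂ) *ᵥ (fun i => (v i : ℂ)) = fun i => ((A *ᵥ v) i : ℂ) := by
  ext i; simp [Matrix.mulVec, dotProduct]

/-- `L` is a factor of a quadratic Lyapunov function `sqNorm (L v)` for the linear system `v' = B v`;
it vanishes precisely on the kernel of `B`. -/
structure IsLyapunovFactor {κ : Type*} [Fintype κ] (B : Matrix ι ι ℝ) (L : Matrix κ ι ℝ) (c : ℝ) :
    Prop where
  pos : 0 < c
  decay : ∀ v, (L *ᵥ v) ⬝ᵥ (L *ᵥ (B *ᵥ v)) ≤ -c * sqNorm (L *ᵥ v)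
  ker_iff : ∀ v, L *ᵥ v = 0 ↔ B *ᵥ v = 0

variable [DecidableEq ι]

/-- If the nonzero eigenvalues of `B` lie in the open left half-plane and `ker B ∩ range B = 0` then
the powers of `1 + ε B` tend to zero on the range of `B` for some `ε > 0`. -/
lemma exists_sqNorm_pow_mulVec_le (B : Matrix ι ι ℝ)
    (hspec : ∀ (μ : ℂ) (v : ι → ℂ), v ≠ 0 → B.map ((↑) : ℝ → ℂ) *ᵥ v = μ • v →
      0 ≤ μ.re → μ = 0)
    (hsemi : ∀ v : ι → ℝ, B *ᵥ (B *ᵥ v) = 0 → B *ᵥ v = 0) :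
    ∃ ε : ℝ, 0 < ε ∧ ∃ k : ℕ, ∀ v, sqNorm ((1 + ε • B) ^ (k + 1) *ᵥ (B *ᵥ v)) ≤ sqNorm (B *ᵥ v) / 4 := by
  set Bc : Matrix ι ι ℂ := B.map ((↑) : ℝ → ℂ) with hBc
  -- A real matrix acts separately on real and imaginary parts, so the trivial intersection of
  -- kernel and range survives complexification.
  have hsemi' : ∀ v : ι → ℂ, Bc *ᵥ (Bc *ᵥ v) = 0 → Bc *ᵥ v = 0 := by
    intro v hv
    have hdec : v = (fun i => ((v i).re : ℂ)) + Complex.I • fun i => ((v i).im : ℂ) := by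
      ext i
      simp [mul_comm Complex.I, Complex.re_add_im]
    have hB : ∀ w : ι → ℂ, Bc *ᵥ w = (fun i => ((B *ᵥ fun i => (w i).re) i : ℂ)) +
        Complex.I • fun i => ((B *ᵥ fun i => (w i).im) i : ℂ) := by
      intro w
      have hw : w = (fun i => ((w i).re : ℂ)) + Complex.I • fun i => ((w i).im : ℂ) := by
        ext i
        simp [mul_comm Complex.I, Complex.re_add_im]
      conv_lhs => rw [hw]
      rw [Matrix.mulVec_add, Matrix.mulVec_smul, map_ofReal_mulVec, map_ofReal_mulVec]
    have hre : ∀ w : ι → ℂ, (fun i => ((Bc *ᵥ w) i).re) = B *ᵥ fun i => (w i).re := by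
      intro w; rw [hB w]; ext i; simp
    have him : ∀ w : ι → ℂ, (fun i => ((Bc *ᵥ w) i).im) = B *ᵥ fun i => (w i).im := by
      intro w; rw [hB w]; ext i; simp
    have h1 : B *ᵥ (B *ᵥ fun i => (v i).re) = 0 := by
      rw [← hre, ← hre, hv]; rfl
    have h2 : B *ᵥ (B *ᵥ fun i => (v i).im) = 0 := by
      rw [← him, ← him, hv]; rfl
    rw [hB v, hsemi _ h1, hsemi _ h2]
    ext i; simp
  -- On the invariant subspace `range B` the eigenvalue `0` is excluded by `hsemi'`, and all other
  -- eigenvalues have negative real part.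
  let U : Submodule ℂ (ι → ℂ) := LinearMap.range Bc.mulVecLin
  have hU : ∀ v ∈ U, Bc.mulVecLin v ∈ U := fun v _ => ⟨v, rfl⟩
  let f : U →L[ℂ] U := (Bc.mulVecLin.restrict hU).toContinuousLinearMap
  have hf : ∀ v : U, ((f v : U) : ι → ℂ) = Bc *ᵥ (v : ι → ℂ) := fun v => rfl
  obtain ⟨ε, hε, hk⟩ := exists_norm_pow_le_of_eigenvalue_re_neg f (by
    intro μ v hv hfv
    by_contra hre
    push Not at hre
    have hv' : (v : ι → ℂ) ≠ 0 := fun h => hv (Subtype.ext h)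
    have hfv' : Bc *ᵥ (v : ι → ℂ) = μ • (v : ι → ℂ) := by rw [← hf, hfv]; rfl
    have hμ := hspec μ v hv' hfv' hre
    rw [hμ, zero_smul] at hfv'
    obtain ⟨⟨_, w, rfl⟩, hv2⟩ : ∃ u : U, v = u := ⟨v, rfl⟩
    subst hv2
    exact hv' (hsemi' w hfv'))
  set N : ℝ := (Fintype.card ι : ℝ) with hN
  have hN0 : 0 ≤ N := by positivity
  -- The norm on `ι → ℂ` is the sup norm; summing `N` squares costs a factor `N`, and `N / (2 (N +
  -- 1))² ≤ 1 / 4`.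
  obtain ⟨k, hk⟩ := hk (1 / (2 * (N + 1))) (by positivity)
  refine ⟨ε, hε, k, fun v => ?_⟩
  let u : U := ⟨fun i => ((B *ᵥ v) i : ℂ), fun i => (v i : ℂ), map_ofReal_mulVec B v⟩
  have hpow : ∀ m : ℕ, ((((1 + (ε : ℂ) • f) ^ m) u : U) : ι → ℂ) =
      fun i => (((1 + ε • B) ^ m *ᵥ (B *ᵥ v)) i : ℂ) := by
    intro m
    induction m with
    | zero => simp [u]
    | succ m ih =>
      rw [pow_succ', mul_apply_eq_comp, pow_succ', ← Matrix.mulVec_mulVec,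
        Matrix.add_mulVec, Matrix.one_mulVec, Matrix.smul_mulVec]
      change ((((1 + (ε : ℂ) • f) ^ m) u : U) : ι → ℂ) +
        (ε : ℂ) • (Bc *ᵥ ((((1 + (ε : ℂ) • f) ^ m) u : U) : ι → ℂ)) = _
      rw [ih, hBc, map_ofReal_mulVec]
      ext i
      simp
  have hu : ‖u‖ ^ 2 ≤ sqNorm (B *ᵥ v) := by
    have h0 := sqNorm_nonneg (B *ᵥ v)
    have : ‖u‖ ≤ √(sqNorm (B *ᵥ v)) := by
      change ‖(u : ι → ℂ)‖ ≤ _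
      rw [pi_norm_le_iff_of_nonneg (Real.sqrt_nonneg _)]
      intro i
      apply Real.le_sqrt_of_sq_le
      change ‖((B *ᵥ v) i : ℂ)‖ ^ 2 ≤ _
      rw [Complex.norm_real, Real.norm_eq_abs, sq_abs]
      exact sq_le_sqNorm _ i
    calc ‖u‖ ^ 2 ≤ √(sqNorm (B *ᵥ v)) ^ 2 := by gcongr
      _ = _ := Real.sq_sqrt h0
  have hle : ‖((1 + (ε : ℂ) • f) ^ (k + 1)) u‖ ≤ 1 / (2 * (N + 1)) * ‖u‖ :=
    ((ContinuousLinearMap.le_opNorm _ _).trans (by gcongr))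
  have hcoord : ∀ i, ((1 + ε • B) ^ (k + 1) *ᵥ (B *ᵥ v)) i ^ 2 ≤
      (1 / (2 * (N + 1)) * ‖u‖) ^ 2 := by
    intro i
    have h1 : ‖((((1 + (ε : ℂ) • f) ^ (k + 1)) u : U) : ι → ℂ) i‖ ≤ 1 / (2 * (N + 1)) * ‖u‖ :=
      (norm_le_pi_norm _ i).trans hle
    rw [hpow (k + 1)] at h1
    simp only [Complex.norm_real, Real.norm_eq_abs] at h1
    rw [← sq_abs]
    gcongr
  calc sqNorm ((1 + ε • B) ^ (k + 1) *ᵥ (B *ᵥ v))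
      ≤ ∑ _i : ι, (1 / (2 * (N + 1)) * ‖u‖) ^ 2 := Finset.sum_le_sum fun i _ => hcoord i
    _ = N * (1 / (2 * (N + 1))) ^ 2 * ‖u‖ ^ 2 := by simp [hN]; ring
    _ ≤ 1 / 4 * sqNorm (B *ᵥ v) := by
        gcongr
        rw [div_pow, mul_pow, one_pow, mul_one_div, div_le_div_iff₀ (by positivity) (by positivity)]
        nlinarith
    _ = _ := by ring

/-- `L` stacks the matrices `M ^ j B`, `j ≤ k`, with `M = 1 + ε B`. Replacing `v` by `M v` shifts
the stack by one: `|L v|²` loses `|B v|²` and gains only `|M ^ (k + 1) B v|² ≤ |B v|² / 4`.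
Expanding `L (v + ε B v)` turns this discrete decrease into the infinitesimal one. -/
theorem exists_isLyapunovFactor (B : Matrix ι ι ℝ)
    (hspec : ∀ (μ : ℂ) (v : ι → ℂ), v ≠ 0 → B.map ((↑) : ℝ → ℂ) *ᵥ v = μ • v →
      0 ≤ μ.re → μ = 0)
    (hsemi : ∀ v : ι → ℝ, B *ᵥ (B *ᵥ v) = 0 → B *ᵥ v = 0) :
    ∃ (m : ℕ) (L : Matrix (Fin m × ι) ι ℝ) (c : ℝ), IsLyapunovFactor B L c := by
  obtain ⟨ε, hε, k, hk⟩ := exists_sqNorm_pow_mulVec_le B hspec hsemi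
  set M := 1 + ε • B with hM
  let L : Matrix (Fin (k + 1) × ι) ι ℝ := Matrix.of fun p i => (M ^ (p.1 : ℕ) * B) p.2 i
  have hL : ∀ v, L *ᵥ v = fun p => (M ^ (p.1 : ℕ) *ᵥ (B *ᵥ v)) p.2 := by
    intro v
    ext p
    rw [Matrix.mulVec_mulVec]
    rfl
  have hsq : ∀ v, sqNorm (L *ᵥ v) = ∑ j ∈ Finset.range (k + 1), sqNorm (M ^ j *ᵥ (B *ᵥ v)) := by
    intro v
    rw [hL, sqNorm, Fintype.sum_prod_type, Finset.sum_range]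
    rfl
  have hle : ∀ v, sqNorm (B *ᵥ v) ≤ sqNorm (L *ᵥ v) := by
    intro v
    rw [hsq, Finset.sum_range_succ']
    have : 0 ≤ ∑ j ∈ Finset.range k, sqNorm (M ^ (j + 1) *ᵥ (B *ᵥ v)) :=
      Finset.sum_nonneg fun _ _ => sqNorm_nonneg _
    simpa using this
  have hker : ∀ v, L *ᵥ v = 0 ↔ B *ᵥ v = 0 := by
    intro v
    constructor
    · intro h
      have := hle v
      rw [h, sqNorm_zero] at this
      exact sqNorm_eq_zero.1 (le_antisymm this (sqNorm_nonneg _))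
    · intro h
      rw [hL, h]
      ext p
      simp
  obtain ⟨C, hC0, hC⟩ := exists_sqNorm_mulVec_le L B fun v h => (hker v).2 h
  have hcomm : ∀ j : ℕ, M ^ j * B = B * M ^ j := by
    intro j
    have : Commute M B := by
      rw [hM]
      exact (Commute.one_left B).add_left ((Commute.refl B).smul_left ε)
    exact this.pow_left j
  have hshift : ∀ v j, M ^ j *ᵥ (B *ᵥ (M *ᵥ v)) = M ^ (j + 1) *ᵥ (B *ᵥ v) := by
    intro v j
    have := hcomm 1
    rw [pow_one] at this
    rw [Matrix.mulVec_mulVec v B M, ← this, pow_succ, Matrix.mulVec_mulVec, Matrix.mulVec_mulVec,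
      Matrix.mul_assoc]
  have hdec : ∀ v, sqNorm (L *ᵥ (M *ᵥ v)) ≤ sqNorm (L *ᵥ v) - 3 / 4 * sqNorm (B *ᵥ v) := by
    intro v
    have h1 := hk v
    rw [hsq, hsq, Finset.sum_range_succ' (fun j => sqNorm (M ^ j *ᵥ (B *ᵥ v))),
      Finset.sum_congr rfl fun j _ => by rw [hshift v j], Finset.sum_range_succ]
    simp only [pow_zero, Matrix.one_mulVec]
    linarith
  refine ⟨k + 1, L, 3 / (8 * ε * (C + 1)), by positivity, fun v => ?_, hker⟩
  have h1 := hdec v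
  rw [hM, Matrix.add_mulVec, Matrix.one_mulVec, Matrix.smul_mulVec, Matrix.mulVec_add,
    Matrix.mulVec_smul, sqNorm_add, dotProduct_smul, smul_eq_mul] at h1
  -- The square `|ε L B v|²` has the favourable sign and is dropped; `h6` below converts `|B v|²`
  -- back into `|L v|²`.
  have h2 := sqNorm_nonneg (ε • L *ᵥ (B *ᵥ v))
  have h3 : (L *ᵥ v) ⬝ᵥ (L *ᵥ (B *ᵥ v)) ≤ -(3 / (8 * ε)) * sqNorm (B *ᵥ v) := by
    have h4 : 2 * ε * ((L *ᵥ v) ⬝ᵥ (L *ᵥ (B *ᵥ v))) ≤ -(3 / 4 * sqNorm (B *ᵥ v)) := by linarith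
    have h5 : (L *ᵥ v) ⬝ᵥ (L *ᵥ (B *ᵥ v)) =
        (2 * ε)⁻¹ * (2 * ε * ((L *ᵥ v) ⬝ᵥ (L *ᵥ (B *ᵥ v)))) := by field_simp
    rw [h5]
    calc _ ≤ (2 * ε)⁻¹ * -(3 / 4 * sqNorm (B *ᵥ v)) := by gcongr
      _ = _ := by field_simp; ring
  have h6 : sqNorm (L *ᵥ v) ≤ (C + 1) * sqNorm (B *ᵥ v) :=
    (hC v).trans (by nlinarith [sqNorm_nonneg (B *ᵥ v)])
  refine h3.trans ?_
  have h7 : 3 / (8 * ε * (C + 1)) * sqNorm (L *ᵥ v) ≤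
      3 / (8 * ε * (C + 1)) * ((C + 1) * sqNorm (B *ᵥ v)) := by gcongr
  have h8 : 3 / (8 * ε * (C + 1)) * ((C + 1) * sqNorm (B *ᵥ v)) =
      3 / (8 * ε) * sqNorm (B *ᵥ v) := by field_simp
  linarith

end Lyapunov

/-! ### The network matrix: kernel, spectrum, admissible transformations -/

section Network

variable {n : ℕ}

lemma systemMatrix_apply (α β : Fin n → ℝ) (γ : Matrix (Fin n) (Fin n) ℝ) (p q : ℝ)
    (k l : Fin n × Fin 2) :
    systemMatrix α β γ p q k l = phiBlock (α k.1) (β k.1) p q k.2 l.2 * weightMatrix γ k.1 l.1 := by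
  simp only [systemMatrix, Matrix.mul_apply, blockDiag, Matrix.of_apply, Fintype.sum_prod_type,
    Matrix.kroneckerMap_apply, Matrix.one_apply]
  simp

/-- The rows of `weightMatrix γ` sum to zero, whatever the value of `γ i i`. -/
lemma sum_weightMatrix_mul {𝕜 : Type*} [RCLike 𝕜] (γ : Matrix (Fin n) (Fin n) ℝ) (f : Fin n → 𝕜)
    (i : Fin n) :
    ∑ j, (weightMatrix γ i j : 𝕜) * f j = ∑ j, (γ i j : 𝕜) * (f j - f i) := by
  rw [← Finset.add_sum_erase _ _ (Finset.mem_univ i), ← Finset.add_sum_erase _ _ (Finset.mem_univ i)]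
  have h : ∑ j ∈ Finset.univ.erase i, (weightMatrix γ i j : 𝕜) * f j =
      ∑ j ∈ Finset.univ.erase i, (γ i j : 𝕜) * f j := by
    refine Finset.sum_congr rfl fun j hj => ?_
    rw [weightMatrix, Matrix.of_apply, if_neg (Finset.ne_of_mem_erase hj).symm]
  rw [h]
  simp only [weightMatrix, Matrix.of_apply, if_true, mul_sub, Finset.sum_sub_distrib,
    ← Finset.sum_mul, sub_self]
  push_cast
  ring

/-- This exhibits the factorization `phiBlock = M_i S`, where `M_i = A Aᵀ` with `A = [[α, 0], [β,
1]]` and `S = [[q, p], [p, 1]]`. All structural facts about the matrix rest on the positivity of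
these two factors. -/
lemma systemMatrix_mulVec (α β : Fin n → ℝ) (γ : Matrix (Fin n) (Fin n) ℝ) (p q : ℝ)
    (v : Fin n × Fin 2 → ℝ) (i : Fin n) :
    let w := fun c => ∑ j, γ i j * (v (j, c) - v (i, c))
    (systemMatrix α β γ p q *ᵥ v) (i, 0) =
        α i ^ 2 * (q * w 0 + p * w 1) + α i * β i * (p * w 0 + w 1) ∧
      (systemMatrix α β γ p q *ᵥ v) (i, 1) =
        α i * β i * (q * w 0 + p * w 1) + (1 + β i ^ 2) * (p * w 0 + w 1) := by
  intro w
  have hw : ∀ c, w c = ∑ j, weightMatrix γ i j * v (j, c) := fun c =>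
    (sum_weightMatrix_mul (𝕜 := ℝ) γ (fun j => v (j, c)) i).symm
  have key : ∀ c, (systemMatrix α β γ p q *ᵥ v) (i, c) =
      phiBlock (α i) (β i) p q c 0 * w 0 + phiBlock (α i) (β i) p q c 1 * w 1 := by
    intro c
    rw [hw, hw, Matrix.mulVec, dotProduct, Fintype.sum_prod_type]
    simp only [systemMatrix_apply, Fin.sum_univ_two, Finset.sum_add_distrib, Finset.mul_sum,
      mul_assoc]
  rw [key, key]
  simp only [phiBlock, Matrix.of_apply, Matrix.cons_val_zero, Matrix.cons_val_one,
    Matrix.cons_val', Matrix.cons_val_fin_one]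
  constructor <;> ring

lemma systemMatrix_mulVec_complex (α β : Fin n → ℝ) (γ : Matrix (Fin n) (Fin n) ℝ) (p q : ℝ)
    (v : Fin n × Fin 2 → ℂ) (i : Fin n) :
    let w := fun c => ∑ j, (γ i j : ℂ) * (v (j, c) - v (i, c))
    ((systemMatrix α β γ p q).map ((↑) : ℝ → ℂ) *ᵥ v) (i, 0) =
        α i ^ 2 * (q * w 0 + p * w 1) + α i * β i * (p * w 0 + w 1) ∧
      ((systemMatrix α β γ p q).map ((↑) : ℝ → ℂ) *ᵥ v) (i, 1) =
        α i * β i * (q * w 0 + p * w 1) + (1 + β i ^ 2) * (p * w 0 + w 1) := by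
  intro w
  have hw : ∀ c, w c = ∑ j, (weightMatrix γ i j : ℂ) * v (j, c) := fun c =>
    (sum_weightMatrix_mul (𝕜 := ℂ) γ (fun j => v (j, c)) i).symm
  have key : ∀ c, ((systemMatrix α β γ p q).map ((↑) : ℝ → ℂ) *ᵥ v) (i, c) =
      phiBlock (α i) (β i) p q c 0 * w 0 + phiBlock (α i) (β i) p q c 1 * w 1 := by
    intro c
    rw [hw, hw, Matrix.mulVec, dotProduct, Fintype.sum_prod_type]
    simp only [Matrix.map_apply, systemMatrix_apply, Fin.sum_univ_two, Finset.sum_add_distrib,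
      Finset.mul_sum, mul_assoc, Complex.ofReal_mul]
  rw [key, key]
  simp only [phiBlock, Matrix.of_apply, Matrix.cons_val_zero, Matrix.cons_val_one,
    Matrix.cons_val', Matrix.cons_val_fin_one]
  push_cast
  constructor <;> ring

variable {G : Digraph (Fin n)} {γ : Matrix (Fin n) (Fin n) ℝ} {α β : Fin n → ℝ}

lemma IsSensorNetwork.weight_nonneg (h : IsSensorNetwork G γ α) (i j : Fin n) : 0 ≤ γ i j := by
  by_cases hij : G.Adj j i
  · exact (h.weight_pos i j hij).le
  · exact (h.weight_zero i j hij).ge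

/-- Maximum principle: the root of a spanning tree is a maximizer of a function which is harmonic
with respect to the weights. -/
lemma IsSensorNetwork.le_root (h : IsSensorNetwork G γ α) {H : Digraph (Fin n)} {r : Fin n}
    (hT : IsSpanningTree G H r) (f : Fin n → ℝ) (hf : ∀ i, ∑ j, γ i j * (f j - f i) = 0) (i : Fin n) :
    f i ≤ f r := by
  have : Nonempty (Fin n) := ⟨r⟩
  obtain ⟨k, hk⟩ := Finite.exists_max f
  have hstep : ∀ a b, H.Adj a b → (∀ i, f i ≤ f b) → ∀ i, f i ≤ f a := by
    intro a b hab hb i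
    have hnonpos : ∀ j ∈ Finset.univ, γ b j * (f j - f b) ≤ 0 := fun j _ =>
      mul_nonpos_of_nonneg_of_nonpos (h.weight_nonneg b j) (by linarith [hb j])
    have h0 := (Finset.sum_eq_zero_iff_of_nonpos hnonpos).1 (hf b) a (Finset.mem_univ a)
    have hpos := h.weight_pos b a (hT.le hab)
    have : f a - f b = 0 := by
      rcases mul_eq_zero.1 h0 with h1 | h1
      · exact absurd h1 hpos.ne'
      · exact h1
    linarith [hb i]
  have := Relation.ReflTransGen.head_induction_on (motive := fun a _ => ∀ i, f i ≤ f a)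
    (hT.reach k) hk (fun {a c} hac _ ih => hstep a c hac ih)
  exact this i

lemma IsSensorNetwork.harmonic_const (h : IsSensorNetwork G γ α) (hA : HasSpanningTree G)
    (f : Fin n → ℝ) (hf : ∀ i, ∑ j, γ i j * (f j - f i) = 0) (i j : Fin n) : f i = f j := by
  obtain ⟨H, r, hT⟩ := hA
  have h1 := h.le_root hT f hf
  have h2 := h.le_root hT (fun i => -f i) (fun i => by
    rw [← neg_eq_zero, ← Finset.sum_neg_distrib, ← hf i]
    exact Finset.sum_congr rfl fun _ _ => by ring)
  linarith [h1 i, h1 j, h2 i, h2 j]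

/-- The blocks are invertible: `s0`, `s1` and `s2` undo the triangular factors of `M_i`, and then
`det S = q - p² > 0` is used. So the kernel consists of vectors with harmonic components, which the
spanning tree forces to be constant. -/
theorem IsSensorNetwork.systemMatrix_mulVec_eq_zero_iff (h : IsSensorNetwork G γ α)
    (hA : HasSpanningTree G) {p q : ℝ} (hpq : p ^ 2 < q) (v : Fin n × Fin 2 → ℝ) :
    systemMatrix α β γ p q *ᵥ v = 0 ↔ ∀ i j c, v (i, c) = v (j, c) := by
  constructor
  · intro hv
    have hw : ∀ i c, ∑ j, γ i j * (v (j, c) - v (i, c)) = 0 := by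
      intro i
      obtain ⟨e0, e1⟩ := systemMatrix_mulVec α β γ p q v i
      rw [hv, Pi.zero_apply] at e0 e1
      set w0 := ∑ j, γ i j * (v (j, 0) - v (i, 0))
      set w1 := ∑ j, γ i j * (v (j, 1) - v (i, 1))
      have hα := h.gain_ne i
      have s0 : α i * (q * w0 + p * w1) + β i * (p * w0 + w1) = 0 := by
        apply mul_left_cancel₀ hα
        linear_combination -e0
      have s1 : p * w0 + w1 = 0 := by linear_combination -e1 - β i * s0
      have s2 : q * w0 + p * w1 = 0 := by
        apply mul_left_cancel₀ hα
        linear_combination s0 - β i * s1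
      have hw0 : w0 = 0 := by
        have : (q - p ^ 2) * w0 = 0 := by linear_combination s2 - p * s1
        rcases mul_eq_zero.1 this with h1 | h1
        · linarith
        · exact h1
      have hw1 : w1 = 0 := by linear_combination s1 - p * hw0
      intro c
      fin_cases c
      · exact hw0
      · exact hw1
    intro i j c
    exact h.harmonic_const hA (fun i => v (i, c)) (fun i => hw i c) i j
  · intro hv
    ext ⟨i, c⟩
    obtain ⟨e0, e1⟩ := systemMatrix_mulVec α β γ p q v i
    have h0 : ∀ c, ∑ j, γ i j * (v (j, c) - v (i, c)) = 0 := fun c =>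
      Finset.sum_eq_zero fun j _ => by rw [hv j i c, sub_self, mul_zero]
    simp only [h0] at e0 e1
    fin_cases c
    · simpa using e0
    · simpa using e1

/-- If `B v` is a consensus vector with value `c`, choose a node maximizing `cᵀ S v_i`. There `cᵀ S
w_i ≤ 0`, where `w_i` is the weighted sum of differences; but `c = M_i S w_i` makes the same number
equal to `|Aᵀ S w_i|²`. Hence it vanishes, and so does `c`. -/
theorem IsSensorNetwork.systemMatrix_semisimple (h : IsSensorNetwork G γ α)
    (hA : HasSpanningTree G) {p q : ℝ} (hpq : p ^ 2 < q) (v : Fin n × Fin 2 → ℝ)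
    (hv : systemMatrix α β γ p q *ᵥ (systemMatrix α β γ p q *ᵥ v) = 0) :
    systemMatrix α β γ p q *ᵥ v = 0 := by
  rw [h.systemMatrix_mulVec_eq_zero_iff hA hpq] at hv
  have hr : Nonempty (Fin n) := by obtain ⟨H, r, -⟩ := hA; exact ⟨r⟩
  obtain ⟨r⟩ := hr
  set z := systemMatrix α β γ p q *ᵥ v with hz
  set c0 := z (r, 0) with hc0
  set c1 := z (r, 1) with hc1
  have : Nonempty (Fin n) := ⟨r⟩
  let f : Fin n → ℝ := fun i => c0 * (q * v (i, 0) + p * v (i, 1)) + c1 * (p * v (i, 0) + v (i, 1))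
  obtain ⟨i, hi⟩ := Finite.exists_max f
  obtain ⟨e0, e1⟩ := systemMatrix_mulVec α β γ p q v i
  rw [← hz, hv i r] at e0 e1
  rw [← hc0] at e0
  rw [← hc1] at e1
  have hf : c0 * (q * (∑ j, γ i j * (v (j, 0) - v (i, 0))) + p * ∑ j, γ i j * (v (j, 1) - v (i, 1))) +
      c1 * (p * (∑ j, γ i j * (v (j, 0) - v (i, 0))) + ∑ j, γ i j * (v (j, 1) - v (i, 1))) =
      ∑ j, γ i j * (f j - f i) := by
    simp only [Finset.mul_sum, ← Finset.sum_add_distrib]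
    exact Finset.sum_congr rfl fun j _ => by simp only [f]; ring
  have hle : ∑ j, γ i j * (f j - f i) ≤ 0 := Finset.sum_nonpos fun j _ =>
    mul_nonpos_of_nonneg_of_nonpos (h.weight_nonneg i j) (by linarith [hi j])
  rw [← hf] at hle
  set w0 := ∑ j, γ i j * (v (j, 0) - v (i, 0))
  set w1 := ∑ j, γ i j * (v (j, 1) - v (i, 1))
  have hα := h.gain_ne i
  set s0 := q * w0 + p * w1
  set s1 := p * w0 + w1
  have hsq : c0 * s0 + c1 * s1 = (α i * s0 + β i * s1) ^ 2 + s1 ^ 2 := by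
    rw [e0, e1]; ring
  have h1 : s1 = 0 := by
    have : s1 ^ 2 = 0 := by nlinarith [sq_nonneg (α i * s0 + β i * s1), sq_nonneg s1]
    simpa using this
  have h0 : α i * s0 + β i * s1 = 0 := by
    have : (α i * s0 + β i * s1) ^ 2 = 0 := by
      nlinarith [sq_nonneg (α i * s0 + β i * s1), sq_nonneg s1]
    simpa using this
  have hc0' : c0 = 0 := by rw [e0]; linear_combination α i * h0
  have hc1' : c1 = 0 := by rw [e1]; linear_combination β i * h0 + h1
  ext ⟨j, c⟩
  fin_cases c
  · exact (hv j r 0).trans hc0'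
  · exact (hv j r 1).trans hc1'

lemma re_conj_mul_expand (z w : ℂ) : ((starRingEnd ℂ) z * w).re = z.re * w.re + z.im * w.im := by
  simp [Complex.mul_re]

/-- Maximum principle for the norm `N` given by `S`, at a node `i` where `N(v_i)` is largest.
Pairing the eigenvalue equation with `M_i⁻¹ v_i` shows that `μ` times a nonnegative number is `v_i*
S w_i`, whose real part is a sum of nonpositive terms. If `Re μ ≥ 0`, all of them vanish, and then
`w_i = 0`. No connectivity is needed. -/
theorem IsSensorNetwork.systemMatrix_spectrum (h : IsSensorNetwork G γ α)
    {p q : ℝ} (hpq : p ^ 2 < q) (μ : ℂ) (v : Fin n × Fin 2 → ℂ) (hv0 : v ≠ 0)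
    (hv : (systemMatrix α β γ p q).map ((↑) : ℝ → ℂ) *ᵥ v = μ • v) (hμ : 0 ≤ μ.re) : μ = 0 := by
  let N : ℂ → ℂ → ℝ := fun a b => q * (a.re ^ 2 + a.im ^ 2) + 2 * p * (a.re * b.re + a.im * b.im) +
    (b.re ^ 2 + b.im ^ 2)
  have hN : ∀ a b, N a b = (q - p ^ 2) * (a.re ^ 2 + a.im ^ 2) +
      ((p * a.re + b.re) ^ 2 + (p * a.im + b.im) ^ 2) := fun a b => by simp only [N]; ring
  have hN0 : ∀ a b, 0 ≤ N a b := fun a b => by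
    rw [hN]
    have : 0 < q - p ^ 2 := by linarith
    positivity
  have hNz : ∀ a b, N a b ≤ 0 → a = 0 ∧ b = 0 := by
    intro a b hab
    rw [hN] at hab
    have h1 : 0 < q - p ^ 2 := by linarith
    have h2 : (q - p ^ 2) * (a.re ^ 2 + a.im ^ 2) ≤ 0 := by
      nlinarith [sq_nonneg (p * a.re + b.re), sq_nonneg (p * a.im + b.im)]
    have h3 : a.re ^ 2 + a.im ^ 2 ≤ 0 := by
      by_contra hc; push Not at hc; nlinarith [mul_pos h1 hc]
    have h4 : a.re = 0 := by nlinarith [sq_nonneg a.re, sq_nonneg a.im]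
    have h5 : a.im = 0 := by nlinarith [sq_nonneg a.re, sq_nonneg a.im]
    rw [h4, h5] at hab
    have h6 : b.re = 0 := by nlinarith [sq_nonneg b.re, sq_nonneg b.im]
    have h7 : b.im = 0 := by nlinarith [sq_nonneg b.re, sq_nonneg b.im]
    exact ⟨Complex.ext h4 h5, Complex.ext h6 h7⟩
  have hne : ∃ k, v k ≠ 0 := Function.ne_iff.1 hv0
  obtain ⟨⟨k, c⟩, hk⟩ := hne
  have : Nonempty (Fin n) := ⟨k⟩
  obtain ⟨i, hi⟩ := Finite.exists_max fun i => N (v (i, 0)) (v (i, 1))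
  obtain ⟨e0, e1⟩ := systemMatrix_mulVec_complex α β γ p q v i
  rw [hv, Pi.smul_apply, smul_eq_mul] at e0 e1
  beta_reduce at e0 e1
  have hα : (α i : ℂ) ≠ 0 := by exact_mod_cast h.gain_ne i
  set w0 := ∑ j, (γ i j : ℂ) * (v (j, 0) - v (i, 0)) with hw0
  set w1 := ∑ j, (γ i j : ℂ) * (v (j, 1) - v (i, 1)) with hw1
  set a := v (i, 0) with ha
  set b := v (i, 1) with hb
  -- Polarization: `2 Re v_i* S (v_j - v_i) = N(v_j) - N(v_i) - N(v_j - v_i)`.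
  have hre : ((starRingEnd ℂ) a * (q * w0 + p * w1) + (starRingEnd ℂ) b * (p * w0 + w1)).re =
      ∑ j, γ i j * ((N (v (j, 0)) (v (j, 1)) - N a b) - N (v (j, 0) - a) (v (j, 1) - b)) / 2 := by
    have : (starRingEnd ℂ) a * (q * w0 + p * w1) + (starRingEnd ℂ) b * (p * w0 + w1) =
        ∑ j, (γ i j : ℂ) * ((starRingEnd ℂ) a * (q * (v (j, 0) - a) + p * (v (j, 1) - b)) +
          (starRingEnd ℂ) b * (p * (v (j, 0) - a) + (v (j, 1) - b))) := by
      simp only [hw0, hw1, Finset.mul_sum, ← Finset.sum_add_distrib]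
      exact Finset.sum_congr rfl fun j _ => by ring
    rw [this, Complex.re_sum]
    refine Finset.sum_congr rfl fun j _ => ?_
    rw [Complex.re_ofReal_mul, Complex.add_re, re_conj_mul_expand, re_conj_mul_expand]
    simp only [N, Complex.add_re, Complex.add_im, Complex.re_ofReal_mul, Complex.im_ofReal_mul,
      Complex.sub_re, Complex.sub_im]
    ring
  -- `E = v_i* M_i⁻¹ v_i = |A⁻¹ v_i|²`, written out with the triangular factor `A` of `M_i`.
  have hE : ∃ E : ℝ, 0 ≤ E ∧
      ((starRingEnd ℂ) a * (q * w0 + p * w1) + (starRingEnd ℂ) b * (p * w0 + w1)) = μ * E := by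
    refine ⟨Complex.normSq (a / α i) + Complex.normSq (b - β i * (a / α i)),
      add_nonneg (Complex.normSq_nonneg _) (Complex.normSq_nonneg _), ?_⟩
    have s1 : p * w0 + w1 = μ * (b - β i * (a / α i)) := by
      have : α i * (p * w0 + w1) = α i * (μ * (b - β i * (a / α i))) := by
        field_simp
        linear_combination β i * e0 - α i * e1
      exact mul_left_cancel₀ hα this
    have s0 : α i * (q * w0 + p * w1) + β i * (p * w0 + w1) = μ * (a / α i) := by
      have : α i * (α i * (q * w0 + p * w1) + β i * (p * w0 + w1)) = α i * (μ * (a / α i)) := by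
        field_simp
        linear_combination -e0
      exact mul_left_cancel₀ hα this
    set r0 := a / α i with hr0
    have har : a = α i * r0 := by rw [hr0]; field_simp
    set r1 := b - β i * r0 with hr1
    have hbr : b = β i * r0 + r1 := by rw [hr1]; ring
    rw [har, hbr]
    push_cast
    rw [Complex.normSq_eq_conj_mul_self, Complex.normSq_eq_conj_mul_self, map_add, map_mul, map_mul,
      Complex.conj_ofReal, Complex.conj_ofReal]
    linear_combination (starRingEnd ℂ) r0 * s0 + (starRingEnd ℂ) r1 * s1
  obtain ⟨E, hE0, hE⟩ := hE
  rw [hE, mul_comm, Complex.re_ofReal_mul] at hre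
  have hterm : ∀ j ∈ Finset.univ,
      γ i j * ((N (v (j, 0)) (v (j, 1)) - N a b) - N (v (j, 0) - a) (v (j, 1) - b)) / 2 ≤ 0 := by
    intro j _
    have h1 := hi j
    have h2 := hN0 (v (j, 0) - a) (v (j, 1) - b)
    have h3 := h.weight_nonneg i j
    have : γ i j * ((N (v (j, 0)) (v (j, 1)) - N a b) - N (v (j, 0) - a) (v (j, 1) - b)) ≤ 0 :=
      mul_nonpos_of_nonneg_of_nonpos h3 (by linarith)
    linarith
  have hsum : ∑ j, γ i j * ((N (v (j, 0)) (v (j, 1)) - N a b) -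
      N (v (j, 0) - a) (v (j, 1) - b)) / 2 = 0 :=
    le_antisymm (Finset.sum_nonpos hterm) (hre ▸ mul_nonneg hE0 hμ)
  have hzero := (Finset.sum_eq_zero_iff_of_nonpos hterm).1 hsum
  have hdiff : ∀ j, (γ i j : ℂ) * (v (j, 0) - a) = 0 ∧ (γ i j : ℂ) * (v (j, 1) - b) = 0 := by
    intro j
    rcases eq_or_ne (γ i j) 0 with h0 | h0
    · simp [h0]
    · have h1 := hzero j (Finset.mem_univ j)
      have h2 : (N (v (j, 0)) (v (j, 1)) - N a b) - N (v (j, 0) - a) (v (j, 1) - b) = 0 := by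
        have : γ i j * ((N (v (j, 0)) (v (j, 1)) - N a b) -
          N (v (j, 0) - a) (v (j, 1) - b)) = 0 := by linarith
        exact (mul_eq_zero.1 this).resolve_left h0
      obtain ⟨h3, h4⟩ := hNz (v (j, 0) - a) (v (j, 1) - b) (by have := hi j; linarith)
      rw [h3, h4]
      simp
  have hw0' : w0 = 0 := Finset.sum_eq_zero fun j _ => (hdiff j).1
  have hw1' : w1 = 0 := Finset.sum_eq_zero fun j _ => (hdiff j).2
  rw [hw0', hw1'] at e0 e1
  -- If `μ ≠ 0`, then `v` vanishes at the node where `N` is largest, hence everywhere, against `hk`.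
  by_contra hμ0
  have ha0 : a = 0 := by simpa [hμ0] using e0
  have hb0 : b = 0 := by simpa [hμ0] using e1
  have hmax := hi k
  rw [ha0, hb0] at hmax
  obtain ⟨h1, h2⟩ := hNz (v (k, 0)) (v (k, 1)) (by simpa [N] using hmax)
  apply hk
  fin_cases c
  · exact h1
  · exact h2

theorem IsSensorNetwork.exists_isLyapunovFactor (h : IsSensorNetwork G γ α)
    (hA : HasSpanningTree G) {p q : ℝ} (hpq : p ^ 2 < q) :
    ∃ (m : ℕ) (L : Matrix (Fin m × Fin n × Fin 2) (Fin n × Fin 2) ℝ) (c : ℝ),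
      IsLyapunovFactor (systemMatrix α β γ p q) L c :=
  BlindCalibration.exists_isLyapunovFactor _ (h.systemMatrix_spectrum hpq)
    (h.systemMatrix_semisimple hA hpq)

/-- Kernel and range are complementary: they meet trivially and their dimensions add up. The first
two columns of `T` span the kernel, the others the range, so `T` is onto. On consensus vectors `T⁻¹`
has vanishing tail, so the tail of `T⁻¹ v` factors through `L v`. -/
theorem IsSensorNetwork.consensusTransform (h : IsSensorNetwork G γ α)
    (hA : HasSpanningTree G) {p q : ℝ} (hpq : p ^ 2 < q)
    {T : Matrix (Fin n × Fin 2) (Fin n × Fin 2) ℝ}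
    (hT : IsConsensusTransform (systemMatrix α β γ p q) T) {κ : Type*} [Fintype κ]
    (L : Matrix κ (Fin n × Fin 2) ℝ) (hL : ∀ v, L *ᵥ v = 0 → ∀ i j c, v (i, c) = v (j, c)) :
    IsUnit T.det ∧ ∃ C, 0 ≤ C ∧ ∀ v, disagreementSq T v ≤ C * sqNorm (L *ᵥ v) := by
  have hr : Nonempty (Fin n) := by obtain ⟨H, r, -⟩ := hA; exact ⟨r⟩
  obtain ⟨r⟩ := hr
  let o : Fin n := ⟨0, r.pos⟩
  set B := systemMatrix α β γ p q with hB
  have hcons : ∀ v : Fin n × Fin 2 → ℝ, (∀ i j c, v (i, c) = v (j, c)) →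
      v = T *ᵥ fun l => if l.1.val = 0 then v (o, l.2) else 0 := by
    intro v hv
    ext ⟨i, c⟩
    rw [Matrix.mulVec, dotProduct, Fintype.sum_prod_type, Finset.sum_eq_single o]
    · simp only [o, if_true]
      rw [Finset.sum_eq_single c]
      · rw [hT.first _ rfl]
        simp [hv i o c, o]
      · intro c' _ hc'
        rw [hT.first _ rfl]
        simp [hc'.symm]
      · simp
    · intro j _ hj
      refine Finset.sum_eq_zero fun c' _ => ?_
      rw [if_neg, mul_zero]
      intro h0
      exact hj (Fin.ext h0)
    · simp
  have hdisj : Disjoint (LinearMap.ker B.mulVecLin) (LinearMap.range B.mulVecLin) := by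
    rw [Submodule.disjoint_def]
    rintro _ hx ⟨w, rfl⟩
    exact h.systemMatrix_semisimple hA hpq w hx
  have hsup : LinearMap.ker B.mulVecLin ⊔ LinearMap.range B.mulVecLin = ⊤ := by
    apply Submodule.eq_top_of_disjoint _ _ _ hdisj
    rw [add_comm, LinearMap.finrank_range_add_finrank_ker]
  have hrange : LinearMap.range T.mulVecLin = ⊤ := by
    rw [eq_top_iff, ← hsup]
    refine sup_le ?_ ?_
    · intro v hv
      exact ⟨_, (hcons v ((h.systemMatrix_mulVec_eq_zero_iff hA hpq v).1 hv)).symm⟩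
    · rw [Matrix.range_mulVecLin, ← hT.span_eq, Matrix.range_mulVecLin]
      apply Submodule.span_mono
      rintro _ ⟨l, -, rfl⟩
      exact ⟨l, rfl⟩
  have hunit : IsUnit T := by
    rw [← Matrix.mulVec_surjective_iff_isUnit]
    exact LinearMap.range_eq_top.1 hrange
  have hdet : IsUnit T.det := (Matrix.isUnit_iff_isUnit_det T).1 hunit
  refine ⟨hdet, ?_⟩
  let A : Matrix (Fin n × Fin 2) (Fin n × Fin 2) ℝ :=
    Matrix.of fun k l => if k.1.val = 0 then 0 else T⁻¹ k l
  have hAv : ∀ v, A *ᵥ v = fun k => if k.1.val = 0 then 0 else (T⁻¹ *ᵥ v) k := by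
    intro v
    ext k
    by_cases hk : k.1.val = 0
    · simp [A, Matrix.mulVec, dotProduct, hk]
    · simp [A, Matrix.mulVec, dotProduct, hk]
  obtain ⟨C, hC0, hC⟩ := exists_sqNorm_mulVec_le A L (by
    intro v hv
    rw [hAv, hcons v (hL v hv), Matrix.mulVec_mulVec, Matrix.nonsing_inv_mul _ hdet,
      Matrix.one_mulVec]
    ext k
    simp only [Pi.zero_apply]
    split_ifs <;> rfl)
  refine ⟨C, hC0, fun v => ?_⟩
  have : disagreementSq T v = sqNorm (A *ᵥ v) := by
    rw [hAv, disagreementSq, sqNorm]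
    refine Finset.sum_congr rfl fun k _ => ?_
    split_ifs <;> simp
  rw [this]
  exact hC v

end Network

/-! ### Step sizes and scalar recursions -/

section StepSize

variable {δ : ℕ → ℝ} {ℓ : ℝ}

lemma IsStepSize.tendsto_zero (h : IsStepSize δ) : Tendsto δ atTop (𝓝 0) := by
  have h1 := h.summable_sq.tendsto_atTop_zero
  have h2 := (Real.continuous_sqrt.tendsto 0).comp h1
  simp only [Real.sqrt_zero] at h2
  refine h2.congr fun t => ?_
  simp [Real.sqrt_sq (h.pos t).le]

lemma IsStepSize.eventually_le (h : IsStepSize δ) {ε : ℝ} (hε : 0 < ε) :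
    ∃ t₀, ∀ t ≥ t₀, δ t ≤ ε :=
  eventually_atTop.1 (h.tendsto_zero.eventually_le_const hε)

/-- The step sizes vary slowly. -/
lemma IsStepSize.eventually_le_succ (h : IsStepSize δ)
    (hδ : Tendsto (fun t => (δ (t + 1))⁻¹ - (δ t)⁻¹) atTop (𝓝 ℓ)) :
    ∃ t₀, ∀ t ≥ t₀, δ t ≤ (1 + (ℓ + 1) * δ t) * δ (t + 1) := by
  obtain ⟨t₀, ht₀⟩ := eventually_atTop.1 (hδ.eventually_le_const (lt_add_one ℓ))
  refine ⟨t₀, fun t ht => ?_⟩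
  have h1 := ht₀ t ht
  have hp := h.pos t
  have hp1 := h.pos (t + 1)
  have h2 : (δ (t + 1))⁻¹ ≤ (δ t)⁻¹ + (ℓ + 1) := by linarith
  have h3 : δ t * (δ (t + 1))⁻¹ ≤ δ t * ((δ t)⁻¹ + (ℓ + 1)) := by gcongr
  rw [mul_add, mul_inv_cancel₀ hp.ne', ← div_eq_mul_inv, div_le_iff₀ hp1] at h3
  linarith

/-- The exponent of the convergence rate of a recursion with contraction constant `c`. -/
noncomputable def rateExponent (c ℓ : ℝ) : ℝ := min (1 / 2) (c / (2 * (ℓ + 1)))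

lemma rateExponent_pos {c : ℝ} (hc : 0 < c) (hℓ : 0 ≤ ℓ) : 0 < rateExponent c ℓ :=
  lt_min (by norm_num) (by positivity)

lemma rateExponent_lt_one (c ℓ : ℝ) : rateExponent c ℓ < 1 :=
  (min_le_left _ _).trans_lt (by norm_num)

/-- `M δ^s` is a supersolution. Half of the contraction `c δ` absorbs the term `C δ²`. The other
half absorbs the change of `δ^s`: eventually `1 / δ` grows by at most `ℓ + 1` per step, so by
Bernoulli `δ(t)^s ≤ (1 + c δ(t) / 2) δ(t+1)^s` as soon as `s (ℓ + 1) ≤ c / 2`. -/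
theorem IsStepSize.le_rpow_of_recursion (h : IsStepSize δ) (hℓ : 0 ≤ ℓ)
    (hδ : Tendsto (fun t => (δ (t + 1))⁻¹ - (δ t)⁻¹) atTop (𝓝 ℓ)) {c C : ℝ} (hc : 0 < c)
    (hC : 0 ≤ C) {V : ℕ → ℝ} {t₀ : ℕ}
    (hV : ∀ t ≥ t₀, V (t + 1) ≤ (1 - c * δ t) * V t + C * δ t ^ 2) :
    ∃ M, 0 ≤ M ∧ ∃ t₁, ∀ t ≥ t₁, V t ≤ M * δ t ^ rateExponent c ℓ := by
  set s := rateExponent c ℓ with hs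
  have hs0 : 0 < s := rateExponent_pos hc hℓ
  have hs1 : s ≤ 1 := (rateExponent_lt_one c ℓ).le
  have hsc : s * (ℓ + 1) ≤ c / 2 := by
    have : s ≤ c / (2 * (ℓ + 1)) := min_le_right _ _
    calc s * (ℓ + 1) ≤ c / (2 * (ℓ + 1)) * (ℓ + 1) := by gcongr
      _ = c / 2 := by field_simp
  obtain ⟨t₁, ht₁⟩ := h.eventually_le_succ hδ
  obtain ⟨t₂, ht₂⟩ := h.eventually_le (ε := min 1 (1 / c)) (lt_min one_pos (by positivity))
  set t₃ := max t₀ (max t₁ t₂) with ht₃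
  -- The first entry makes `C δ² ≤ (c / 2) δ · M δ^s`; the second one starts the induction.
  set M := max (2 * C / c) (V t₃ / δ t₃ ^ s) with hM
  have hM0 : 0 ≤ M := le_max_of_le_left (by positivity)
  refine ⟨M, hM0, t₃, fun t ht => ?_⟩
  induction t, ht using Nat.le_induction with
  | base =>
    have : 0 < δ t₃ ^ s := Real.rpow_pos_of_pos (h.pos _) _
    calc V t₃ = V t₃ / δ t₃ ^ s * δ t₃ ^ s := by field_simp
      _ ≤ M * δ t₃ ^ s := by gcongr; exact le_max_right _ _
  | succ t ht ih =>
    have hp := h.pos t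
    have hp1 := h.pos (t + 1)
    have hd := ht₁ t (by omega)
    have hd2 := ht₂ t (by omega)
    have hd3 : δ t ≤ 1 := hd2.trans (min_le_left _ _)
    have hd4 : c * δ t ≤ 1 := by
      have := hd2.trans (min_le_right _ _)
      rwa [le_div_iff₀ hc, mul_comm] at this
    have hr : δ t ^ s ≤ (1 + c / 2 * δ t) * δ (t + 1) ^ s := by
      calc δ t ^ s ≤ ((1 + (ℓ + 1) * δ t) * δ (t + 1)) ^ s := by gcongr
        _ = (1 + (ℓ + 1) * δ t) ^ s * δ (t + 1) ^ s :=
          Real.mul_rpow (by positivity) hp1.le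
        _ ≤ (1 + s * ((ℓ + 1) * δ t)) * δ (t + 1) ^ s := by
          gcongr
          exact rpow_one_add_le_one_add_mul_self
            (by have : 0 ≤ (ℓ + 1) * δ t := by positivity
                linarith) hs0.le hs1
        _ ≤ (1 + c / 2 * δ t) * δ (t + 1) ^ s := by
          have : s * ((ℓ + 1) * δ t) ≤ c / 2 * δ t := by
            rw [← mul_assoc]; gcongr
          gcongr
    have hsq : δ t ^ 2 ≤ δ t * δ t ^ s := by
      rw [sq]
      gcongr
      calc δ t = δ t ^ (1 : ℝ) := (Real.rpow_one _).symm
        _ ≤ δ t ^ s := Real.rpow_le_rpow_of_exponent_ge hp hd3 hs1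
    have hCM : C ≤ M * c / 2 := by
      have : 2 * C / c ≤ M := le_max_left _ _
      rw [div_le_iff₀ hc] at this
      linarith
    have hX : 0 < δ t ^ s := Real.rpow_pos_of_pos hp _
    have hY : 0 < δ (t + 1) ^ s := Real.rpow_pos_of_pos hp1 _
    calc V (t + 1) ≤ (1 - c * δ t) * V t + C * δ t ^ 2 := hV t (by omega)
      _ ≤ (1 - c * δ t) * (M * δ t ^ s) + M * c / 2 * (δ t * δ t ^ s) := by
        have : 0 ≤ 1 - c * δ t := by linarith
        gcongr
      _ = (1 - c / 2 * δ t) * (M * δ t ^ s) := by ring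
      _ ≤ (1 - c / 2 * δ t) * (M * ((1 + c / 2 * δ t) * δ (t + 1) ^ s)) := by
        have : 0 ≤ 1 - c / 2 * δ t := by linarith
        gcongr
      _ = (1 - (c / 2 * δ t) ^ 2) * (M * δ (t + 1) ^ s) := by ring
      _ ≤ 1 * (M * δ (t + 1) ^ s) := by
        gcongr
        linarith [sq_nonneg (c / 2 * δ t)]
      _ = _ := one_mul _

lemma IsStepSize.isLittleO_rpow (h : IsStepSize δ) {f : ℕ → ℝ} (hf : ∀ t, 0 ≤ f t) {s σ M : ℝ}
    (hσ : σ < s) {t₁ : ℕ} (hM : ∀ t ≥ t₁, f t ≤ M * δ t ^ s) :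
    f =o[atTop] fun t => δ t ^ σ := by
  have h1 : f =O[atTop] fun t => δ t ^ s := by
    refine IsBigO.of_bound M (eventually_atTop.2 ⟨t₁, fun t ht => ?_⟩)
    rw [Real.norm_of_nonneg (hf t), Real.norm_of_nonneg (Real.rpow_nonneg (h.pos t).le _)]
    exact hM t ht
  refine h1.trans_isLittleO ?_
  rw [isLittleO_iff_tendsto' (Eventually.of_forall fun t h0 =>
    absurd h0 (Real.rpow_pos_of_pos (h.pos t) _).ne')]
  have h2 : Tendsto (fun t => δ t ^ (s - σ)) atTop (𝓝 0) := by
    have := h.tendsto_zero.rpow_const (p := s - σ) (Or.inr (by linarith))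
    rwa [Real.zero_rpow (by linarith)] at this
  refine h2.congr fun t => ?_
  rw [Real.rpow_sub (h.pos t)]

/-- The right-hand side of the hypothesis involves only times before `T`, so it satisfies itself a
one-step recursion, to which the discrete Gronwall inequality applies. -/
lemma le_of_le_add_sum {f a : ℕ → ℝ} {C₀ S : ℝ} {s₀ : ℕ} (hC₀ : 0 ≤ C₀)
    (ha : ∀ t, 0 ≤ a t) (hS : ∀ T, ∑ s ∈ Finset.Ico s₀ T, a s ≤ S)
    (h : ∀ T ≥ s₀, f T ≤ C₀ + ∑ s ∈ Finset.Ico s₀ T, a s * f s) {T : ℕ} (hT : s₀ ≤ T) :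
    f T ≤ C₀ * Real.exp S := by
  set u : ℕ → ℝ := fun T => C₀ + ∑ s ∈ Finset.Ico s₀ T, a s * f s with hu
  have hrec : ∀ t ≥ s₀, u (t + 1) ≤ (1 + a t) * u t + 0 := by
    intro t ht
    simp only [hu, Finset.sum_Ico_succ_top ht]
    have := mul_le_mul_of_nonneg_left (h t ht) (ha t)
    linarith
  have hu0 : u s₀ = C₀ := by simp [hu]
  have h1 := discrete_gronwall (n₀ := s₀) (by rw [hu0]; exact hC₀) hrec (fun n _ => ha n)
    (fun _ _ => le_rfl) hT
  rw [hu0] at h1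
  calc f T ≤ u T := h T hT
    _ ≤ _ := h1
    _ ≤ C₀ * Real.exp S := by
      simp only [Finset.sum_const_zero, add_zero]
      gcongr
      exact hS T

end StepSize

/-! ### From a quadratic form to the rate -/

section Rate

variable {Ω : Type*} [MeasurableSpace Ω] {P : Measure Ω} {n : ℕ} {G : Digraph (Fin n)}
  {γ : Matrix (Fin n) (Fin n) ℝ} {α β : Fin n → ℝ} {δ : ℕ → ℝ}

/-- It suffices to bound a quadratic form which vanishes precisely on the consensus vectors. -/
theorem IsSensorNetwork.consensusRate (h : IsSensorNetwork G γ α)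
    (hA : HasSpanningTree G) (hstep : IsStepSize δ) {p q : ℝ} (hpq : p ^ 2 < q)
    {κ : Type*} [Fintype κ] (L : Matrix κ (Fin n × Fin 2) ℝ)
    (hL : ∀ v, L *ᵥ v = 0 → ∀ i j c, v (i, c) = v (j, c))
    {ρ : ℕ → Ω → Fin n × Fin 2 → ℝ} (hρ : ∀ t k, AEStronglyMeasurable (fun ω => ρ t ω k) P)
    (hint : ∀ t, Integrable (fun ω => sqNorm (L *ᵥ ρ t ω)) P)
    {s M : ℝ} (hs0 : 0 < s) (hs1 : s < 1) {t₁ : ℕ}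
    (hM : ∀ t ≥ t₁, ∫ ω, sqNorm (L *ᵥ ρ t ω) ∂P ≤ M * δ t ^ s) :
    ConsensusRate P δ (systemMatrix α β γ p q) ρ := by
  refine ⟨s, hs0, hs1, fun σ _ hσ T hT => ?_⟩
  obtain ⟨hdet, C, hC0, hC⟩ := h.consensusTransform hA hpq hT L hL
  have hnn : ∀ v, 0 ≤ disagreementSq T v := fun v =>
    Finset.sum_nonneg fun k _ => by split_ifs <;> positivity
  have hmeas : ∀ t, AEStronglyMeasurable (fun ω => disagreementSq T (ρ t ω)) P := by
    intro t
    have hv : AEMeasurable (fun ω => ρ t ω) P :=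
      aemeasurable_pi_iff.2 fun k => (hρ t k).aemeasurable
    have hc : Measurable (disagreementSq T) := by
      refine Continuous.measurable (continuous_finsetSum _ fun k _ => ?_)
      split_ifs
      · exact continuous_const
      · simp only [Matrix.mulVec, dotProduct]
        fun_prop
    exact (hc.comp_aemeasurable hv).aestronglyMeasurable
  have hI : ∀ t, Integrable (fun ω => disagreementSq T (ρ t ω)) P := fun t =>
    ((hint t).const_mul C).mono' (hmeas t) (Eventually.of_forall fun ω => by
      rw [Real.norm_of_nonneg (hnn _)]; exact hC _)
  refine ⟨hdet, hI, hstep.isLittleO_rpow (M := C * M) (fun t => integral_nonneg fun ω => hnn _)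
    hσ (t₁ := t₁) fun t ht => ?_⟩
  calc ∫ ω, disagreementSq T (ρ t ω) ∂P ≤ ∫ ω, C * sqNorm (L *ᵥ ρ t ω) ∂P :=
        integral_mono (hI t) ((hint t).const_mul C) fun ω => hC _
    _ = C * ∫ ω, sqNorm (L *ᵥ ρ t ω) ∂P := integral_const_mul _ _
    _ ≤ C * (M * δ t ^ s) := by gcongr; exact hM t ht
    _ = _ := by ring

end Rate

/-! ### Products of independent variables -/

section Independence

variable {Ω : Type*} {m₁ m₂ : MeasurableSpace Ω} [mΩ : MeasurableSpace Ω] {P : Measure Ω}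

lemma indepFun_of_indep (h : Indep m₁ m₂ P) {f g : Ω → ℝ} (hf : Measurable[m₁] f)
    (hg : Measurable[m₂] g) : IndepFun f g P := by
  rw [IndepFun_iff_Indep]
  exact indep_of_indep_of_le h hf.comap_le hg.comap_le

lemma integrable_mul_of_indep (h : Indep m₁ m₂ P) {f g : Ω → ℝ} (hf : Measurable[m₁] f)
    (hg : Measurable[m₂] g) (hfi : Integrable f P) (hgi : Integrable g P) :
    Integrable (fun ω => f ω * g ω) P :=
  (indepFun_of_indep h hf hg).integrable_mul hfi hgi

lemma integral_mul_of_indep (h₁ : m₁ ≤ mΩ) (h₂ : m₂ ≤ mΩ) (h : Indep m₁ m₂ P) {f g : Ω → ℝ}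
    (hf : Measurable[m₁] f) (hg : Measurable[m₂] g) :
    ∫ ω, f ω * g ω ∂P = (∫ ω, f ω ∂P) * ∫ ω, g ω ∂P :=
  (indepFun_of_indep h hf hg).integral_fun_mul_eq_mul_integral
    (hf.mono h₁ le_rfl).aestronglyMeasurable (hg.mono h₂ le_rfl).aestronglyMeasurable

lemma memLp_mul_of_indep (h : Indep m₁ m₂ P) {f g : Ω → ℝ}
    (hf : Measurable[m₁] f) (hg : Measurable[m₂] g) (hfi : MemLp f 2 P) (hgi : MemLp g 2 P) :
    MemLp (fun ω => f ω * g ω) 2 P := by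
  refine (memLp_two_iff_integrable_sq (hfi.aestronglyMeasurable.mul hgi.aestronglyMeasurable)).2 ?_
  simp only [Pi.mul_apply, mul_pow]
  exact integrable_mul_of_indep h (hf.pow_const 2) (hg.pow_const 2) hfi.integrable_sq
    hgi.integrable_sq

end Independence

/-! ### Second moments of one step -/

section VectorMoments

section

variable {Ω ι κ : Type*} [Fintype ι]

lemma measurable_mulVec {m : MeasurableSpace Ω} {A : Ω → Matrix κ ι ℝ} {X : Ω → ι → ℝ}
    (hA : ∀ k i, Measurable[m] fun ω => A ω k i) (hX : ∀ i, Measurable[m] fun ω => X ω i) (k : κ) :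
    Measurable[m] fun ω => (A ω *ᵥ X ω) k := by
  simp only [Matrix.mulVec, dotProduct]
  exact Finset.measurable_sum _ fun i _ => (hA k i).mul (hX i)

end

variable {Ω : Type*} {F H : MeasurableSpace Ω} [mΩ : MeasurableSpace Ω] {P : Measure Ω}
  {ι κ : Type*} [Fintype ι]

lemma integrable_sqNorm {X : Ω → ι → ℝ} (hX : ∀ i, MemLp (fun ω => X ω i) 2 P) :
    Integrable (fun ω => sqNorm (X ω)) P :=
  integrable_finsetSum _ fun i _ => (hX i).integrable_sq

lemma memLp_mulVec (L : Matrix κ ι ℝ) {X : Ω → ι → ℝ} (hX : ∀ i, MemLp (fun ω => X ω i) 2 P)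
    (k : κ) : MemLp (fun ω => (L *ᵥ X ω) k) 2 P := by
  simp only [Matrix.mulVec, dotProduct]
  exact memLp_finsetSum _ fun i _ => (hX i).const_mul (L k i)

lemma integrable_dotProduct {X Y : Ω → ι → ℝ} (hX : ∀ i, MemLp (fun ω => X ω i) 2 P)
    (hY : ∀ i, MemLp (fun ω => Y ω i) 2 P) : Integrable (fun ω => X ω ⬝ᵥ Y ω) P := by
  simp only [dotProduct]
  exact integrable_finsetSum _ fun i _ => (hX i).integrable_mul (hY i)

variable [Fintype κ]

/-- One step of a recursion driven by noise which is independent of the past. -/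
lemma integral_sqNorm_step [IsProbabilityMeasure P] (hF : F ≤ mΩ)
    (hH : H ≤ mΩ) (hFH : Indep F H P) {X : Ω → ι → ℝ} (hXm : ∀ i, Measurable[F] fun ω => X ω i)
    (hX : ∀ i, MemLp (fun ω => X ω i) 2 P) {A : Ω → Matrix ι ι ℝ}
    (hAm : ∀ i j, Measurable[H] fun ω => A ω i j) (hA : ∀ i j, MemLp (fun ω => A ω i j) 2 P)
    {N : Ω → ι → ℝ} (hNm : ∀ i, Measurable[H] fun ω => N ω i)
    (hN : ∀ i, MemLp (fun ω => N ω i) 2 P) {B : Matrix ι ι ℝ}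
    (hB : ∀ i j, ∫ ω, A ω i j ∂P = B i j) (hN0 : ∀ i, ∫ ω, N ω i ∂P = 0) {K : ℝ}
    (hKA : ∫ ω, frobSq (A ω) ∂P ≤ K) (hKN : ∫ ω, sqNorm (N ω) ∂P ≤ K) (d : ℝ) :
    (∀ i, MemLp (fun ω => (X ω + d • (A ω *ᵥ X ω + N ω)) i) 2 P) ∧
    ∀ L : Matrix κ ι ℝ, ∫ ω, sqNorm (L *ᵥ (X ω + d • (A ω *ᵥ X ω + N ω))) ∂P ≤
      ∫ ω, sqNorm (L *ᵥ X ω) ∂P + 2 * d * ∫ ω, (L *ᵥ X ω) ⬝ᵥ (L *ᵥ (B *ᵥ X ω)) ∂P +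
        d ^ 2 * (2 * frobSq L * K * (∫ ω, sqNorm (X ω) ∂P + 1)) := by
  have hAX : ∀ i j, MemLp (fun ω => A ω i j * X ω j) 2 P := by
    intro i j
    rw [memLp_two_iff_integrable_sq]
    · simp only [mul_pow]
      exact integrable_mul_of_indep hFH.symm ((hAm i j).pow_const 2) ((hXm j).pow_const 2)
        (hA i j).integrable_sq (hX j).integrable_sq
    · exact (hA i j).aestronglyMeasurable.mul (hX j).aestronglyMeasurable
  have hW : ∀ i, MemLp (fun ω => (A ω *ᵥ X ω + N ω) i) 2 P := by
    intro i
    simp only [Pi.add_apply, Matrix.mulVec, dotProduct]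
    exact (memLp_finsetSum _ fun j _ => hAX i j).add (hN i)
  have hX' : ∀ i, MemLp (fun ω => (X ω + d • (A ω *ᵥ X ω + N ω)) i) 2 P := fun i =>
    (hX i).add ((hW i).const_mul d)
  refine ⟨hX', fun L => ?_⟩
  -- Expansion around the mean matrix `B`: the third term is linear in the fluctuation and has mean
  -- zero, the last one is of second order in `d`.
  have hdec : ∀ ω, sqNorm (L *ᵥ (X ω + d • (A ω *ᵥ X ω + N ω))) =
      sqNorm (L *ᵥ X ω) + 2 * d * ((L *ᵥ X ω) ⬝ᵥ (L *ᵥ (B *ᵥ X ω))) +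
        2 * d * ((Lᵀ *ᵥ (L *ᵥ X ω)) ⬝ᵥ ((A ω *ᵥ X ω + N ω) - B *ᵥ X ω)) +
        d ^ 2 * sqNorm (L *ᵥ (A ω *ᵥ X ω + N ω)) := by
    intro ω
    have : (Lᵀ *ᵥ (L *ᵥ X ω)) ⬝ᵥ ((A ω *ᵥ X ω + N ω) - B *ᵥ X ω) =
        (L *ᵥ X ω) ⬝ᵥ (L *ᵥ ((A ω *ᵥ X ω + N ω) - B *ᵥ X ω)) := by
      rw [Matrix.mulVec_transpose, ← Matrix.dotProduct_mulVec]
    rw [this, Matrix.mulVec_add, Matrix.mulVec_smul, sqNorm_add, sqNorm_smul, dotProduct_smul,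
      smul_eq_mul, Matrix.mulVec_sub, dotProduct_sub]
    ring
  have hU : ∀ i, MemLp (fun ω => (Lᵀ *ᵥ (L *ᵥ X ω)) i) 2 P :=
    memLp_mulVec Lᵀ (memLp_mulVec L hX)
  have hUm : ∀ i, Measurable[F] fun ω => (Lᵀ *ᵥ (L *ᵥ X ω)) i :=
    measurable_mulVec (fun _ _ => measurable_const)
      (measurable_mulVec (fun _ _ => measurable_const) hXm)
  have hBX := memLp_mulVec B hX
  have hcross : ∫ ω, (Lᵀ *ᵥ (L *ᵥ X ω)) ⬝ᵥ ((A ω *ᵥ X ω + N ω) - B *ᵥ X ω) ∂P = 0 := by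
    -- Each summand is an `F`-measurable variable times an `H`-measurable one of mean zero.
    have hexp : ∀ ω, (Lᵀ *ᵥ (L *ᵥ X ω)) ⬝ᵥ ((A ω *ᵥ X ω + N ω) - B *ᵥ X ω) =
        ∑ i, (∑ j, ((Lᵀ *ᵥ (L *ᵥ X ω)) i * X ω j) * (A ω i j - B i j) +
          (Lᵀ *ᵥ (L *ᵥ X ω)) i * N ω i) := by
      intro ω
      rw [dotProduct]
      refine Finset.sum_congr rfl fun i _ => ?_
      simp only [Pi.sub_apply, Pi.add_apply]
      have : ∑ j, ((Lᵀ *ᵥ (L *ᵥ X ω)) i * X ω j) * (A ω i j - B i j) =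
          (Lᵀ *ᵥ (L *ᵥ X ω)) i * ((A ω *ᵥ X ω) i - (B *ᵥ X ω) i) := by
        have e : (A ω *ᵥ X ω) i - (B *ᵥ X ω) i = ∑ j, (A ω i j - B i j) * X ω j := by
          simp only [Matrix.mulVec, dotProduct, sub_mul, Finset.sum_sub_distrib]
        rw [e, Finset.mul_sum]
        exact Finset.sum_congr rfl fun j _ => by ring
      rw [this]
      ring
    simp only [hexp]
    have hI1 : ∀ i j, Integrable (fun ω =>
        ((Lᵀ *ᵥ (L *ᵥ X ω)) i * X ω j) * (A ω i j - B i j)) P := fun i j =>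
      integrable_mul_of_indep hFH ((hUm i).mul (hXm j)) ((hAm i j).sub measurable_const)
        ((hU i).integrable_mul (hX j))
        (((hA i j).integrable one_le_two).sub (integrable_const _))
    have hI2 : ∀ i, Integrable (fun ω => (Lᵀ *ᵥ (L *ᵥ X ω)) i * N ω i) P := fun i =>
      (hU i).integrable_mul (hN i)
    rw [integral_finsetSum _ fun i _ => (integrable_finsetSum _ fun j _ => hI1 i j).fun_add (hI2 i)]
    refine Finset.sum_eq_zero fun i _ => ?_
    rw [integral_add (integrable_finsetSum _ fun j _ => hI1 i j) (hI2 i),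
      integral_finsetSum _ fun j _ => hI1 i j, integral_mul_of_indep hF hH hFH (hUm i) (hNm i),
      hN0, mul_zero, add_zero]
    refine Finset.sum_eq_zero fun j _ => ?_
    rw [integral_mul_of_indep hF hH hFH (f := fun ω => (Lᵀ *ᵥ (L *ᵥ X ω)) i * X ω j)
        (g := fun ω => A ω i j - B i j) ((hUm i).mul (hXm j)) ((hAm i j).sub measurable_const),
      integral_sub ((hA i j).integrable one_le_two) (integrable_const _), hB]
    simp
  have hLX := memLp_mulVec L hX
  have hi1 := integrable_sqNorm hLX
  have hi2 := (integrable_dotProduct hLX (memLp_mulVec L hBX)).const_mul (2 * d)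
  have hi3 := (integrable_dotProduct hU (Y := fun ω => (A ω *ᵥ X ω + N ω) - B *ᵥ X ω)
    fun i => (hW i).sub (hBX i)).const_mul (2 * d)
  have hi4 := (integrable_sqNorm (memLp_mulVec L hW)).const_mul (d ^ 2)
  have hfrob : Integrable (fun ω => frobSq (A ω)) P :=
    integrable_finsetSum _ fun i _ => integrable_finsetSum _ fun j _ => (hA i j).integrable_sq
  have hfrobm : Measurable[H] fun ω => frobSq (A ω) :=
    Finset.measurable_sum _ fun i _ => Finset.measurable_sum _ fun j _ => (hAm i j).pow_const 2
  have hsqm : Measurable[F] fun ω => sqNorm (X ω) :=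
    Finset.measurable_sum _ fun i _ => (hXm i).pow_const 2
  have hprod := integrable_mul_of_indep hFH.symm hfrobm hsqm hfrob (integrable_sqNorm hX)
  have hlast : ∫ ω, sqNorm (L *ᵥ (A ω *ᵥ X ω + N ω)) ∂P ≤
      2 * frobSq L * K * (∫ ω, sqNorm (X ω) ∂P + 1) := by
    have hle : ∀ ω, sqNorm (L *ᵥ (A ω *ᵥ X ω + N ω)) ≤
        2 * frobSq L * (frobSq (A ω) * sqNorm (X ω)) + 2 * frobSq L * sqNorm (N ω) := by
      intro ω
      have h1 := sqNorm_mulVec_le L (A ω *ᵥ X ω + N ω)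
      have h2 := sqNorm_add_le_two (A ω *ᵥ X ω) (N ω)
      have h3 := sqNorm_mulVec_le (A ω) (X ω)
      have h4 := frobSq_nonneg L
      calc _ ≤ _ := h1
        _ ≤ frobSq L * (2 * (frobSq (A ω) * sqNorm (X ω)) + 2 * sqNorm (N ω)) := by
          gcongr
          linarith
        _ = _ := by ring
    calc _ ≤ ∫ ω, (2 * frobSq L * (frobSq (A ω) * sqNorm (X ω)) +
          2 * frobSq L * sqNorm (N ω)) ∂P :=
          integral_mono (integrable_sqNorm (memLp_mulVec L hW))
            ((hprod.const_mul _).add ((integrable_sqNorm hN).const_mul _)) hle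
      _ = 2 * frobSq L * ((∫ ω, frobSq (A ω) ∂P) * ∫ ω, sqNorm (X ω) ∂P) +
          2 * frobSq L * ∫ ω, sqNorm (N ω) ∂P := by
          rw [integral_add (hprod.const_mul _) ((integrable_sqNorm hN).const_mul _),
            integral_const_mul, integral_const_mul,
            integral_mul_of_indep hH hF hFH.symm hfrobm hsqm]
      _ ≤ 2 * frobSq L * (K * ∫ ω, sqNorm (X ω) ∂P) + 2 * frobSq L * K := by
          have := frobSq_nonneg L
          have h5 : 0 ≤ ∫ ω, sqNorm (X ω) ∂P := integral_nonneg fun ω => sqNorm_nonneg _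
          gcongr
      _ = _ := by ring
  simp only [hdec]
  rw [integral_add ((hi1.fun_add hi2).fun_add hi3) hi4, integral_add (hi1.fun_add hi2) hi3,
    integral_add hi1 hi2, integral_const_mul, integral_const_mul, integral_const_mul, hcross,
    mul_zero, add_zero]
  gcongr

end VectorMoments

/-! ### Recursions with coefficients independent of the past -/

section MartingaleNoise

variable {ι : Type*} [Fintype ι]

lemma sqNorm_fromRows_mulVec {κ κ' : Type*} [Fintype κ] [Fintype κ'] (L : Matrix κ ι ℝ)
    (R : Matrix κ' ι ℝ) (v : ι → ℝ) :
    sqNorm (Matrix.fromRows L R *ᵥ v) = sqNorm (L *ᵥ v) + sqNorm (R *ᵥ v) := by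
  rw [Matrix.fromRows_mulVec, sqNorm, Fintype.sum_sum_type]
  rfl

variable [DecidableEq ι]

/-- Together with a Lyapunov factor, the coordinates transversal to the range of `B` control the
norm. -/
lemma IsLyapunovFactor.exists_complement {κ : Type*} [Fintype κ] {B : Matrix ι ι ℝ}
    {L : Matrix κ ι ℝ} {c : ℝ} (hL : IsLyapunovFactor B L c)
    (hsemi : ∀ v : ι → ℝ, B *ᵥ (B *ᵥ v) = 0 → B *ᵥ v = 0) :
    ∃ (m : ℕ) (R : Matrix (Fin m) ι ℝ) (C : ℝ), 0 ≤ C ∧ (∀ v, R *ᵥ (B *ᵥ v) = 0) ∧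
      ∀ v, sqNorm v ≤ C * (sqNorm (L *ᵥ v) + sqNorm (R *ᵥ v)) := by
  -- `R` is the projection modulo `range B`, in coordinates. A vector killed by `L` and `R` lies in
  -- both kernel and range of `B`, hence is zero.
  let U : Submodule ℝ (ι → ℝ) := LinearMap.range B.mulVecLin
  let e := (Module.finBasis ℝ ((ι → ℝ) ⧸ U)).equivFun
  let R := LinearMap.toMatrix' (e.toLinearMap ∘ₗ U.mkQ)
  have hR : ∀ v, R *ᵥ v = 0 ↔ v ∈ U := by
    intro v
    rw [LinearMap.toMatrix'_mulVec]
    simp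
  obtain ⟨C, hC0, hC⟩ := exists_sqNorm_mulVec_le (1 : Matrix ι ι ℝ) (Matrix.fromRows L R) (by
    intro v hv
    rw [Matrix.one_mulVec]
    have h0 : sqNorm (L *ᵥ v) + sqNorm (R *ᵥ v) = 0 := by
      rw [← sqNorm_fromRows_mulVec, hv, sqNorm_zero]
    have h1 : L *ᵥ v = 0 := sqNorm_eq_zero.1 (by
      linarith [sqNorm_nonneg (L *ᵥ v), sqNorm_nonneg (R *ᵥ v)])
    have h2 : R *ᵥ v = 0 := sqNorm_eq_zero.1 (by
      linarith [sqNorm_nonneg (L *ᵥ v), sqNorm_nonneg (R *ᵥ v)])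
    obtain ⟨w, rfl⟩ := (hR v).1 h2
    exact hsemi w ((hL.ker_iff _).1 h1))
  refine ⟨_, R, C, hC0, fun v => (hR _).2 ⟨v, rfl⟩, fun v => ?_⟩
  have := hC v
  rwa [Matrix.one_mulVec, sqNorm_fromRows_mulVec] at this

variable {Ω : Type*} [mΩ : MeasurableSpace Ω] {P : Measure Ω} [IsProbabilityMeasure P]

/-- Mean square rate for a stochastic approximation recursion whose coefficients are independent of
the past. -/
theorem IsLyapunovFactor.integral_le_rpow {κ : Type*} [Fintype κ] {B : Matrix ι ι ℝ}
    {L : Matrix κ ι ℝ} {c : ℝ} (hL : IsLyapunovFactor B L c)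
    (hsemi : ∀ v : ι → ℝ, B *ᵥ (B *ᵥ v) = 0 → B *ᵥ v = 0)
    {δ : ℕ → ℝ} (hstep : IsStepSize δ) {ℓ : ℝ} (hℓ : 0 ≤ ℓ)
    (hδ : Tendsto (fun t => (δ (t + 1))⁻¹ - (δ t)⁻¹) atTop (𝓝 ℓ))
    {F H : ℕ → MeasurableSpace Ω} (hF : ∀ t, F t ≤ mΩ) (hH : ∀ t, H t ≤ mΩ)
    (hFH : ∀ t, Indep (F t) (H t) P) {X : ℕ → Ω → ι → ℝ}
    (hXm : ∀ t i, Measurable[F t] fun ω => X t ω i) (hX0 : ∀ i, MemLp (fun ω => X 0 ω i) 2 P)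
    {A : ℕ → Ω → Matrix ι ι ℝ} (hAm : ∀ t i j, Measurable[H t] fun ω => A t ω i j)
    (hA : ∀ t i j, MemLp (fun ω => A t ω i j) 2 P)
    {N : ℕ → Ω → ι → ℝ} (hNm : ∀ t i, Measurable[H t] fun ω => N t ω i)
    (hN : ∀ t i, MemLp (fun ω => N t ω i) 2 P)
    (hB : ∀ t i j, ∫ ω, A t ω i j ∂P = B i j) (hN0 : ∀ t i, ∫ ω, N t ω i ∂P = 0)
    {K : ℝ} (hKA : ∀ t, ∫ ω, frobSq (A t ω) ∂P ≤ K) (hKN : ∀ t, ∫ ω, sqNorm (N t ω) ∂P ≤ K)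
    (hrec : ∀ t ω, X (t + 1) ω = X t ω + δ t • (A t ω *ᵥ X t ω + N t ω)) :
    (∀ t i, MemLp (fun ω => X t ω i) 2 P) ∧ ∃ M t₁, ∀ t ≥ t₁,
      ∫ ω, sqNorm (L *ᵥ X t ω) ∂P ≤ M * δ t ^ rateExponent (2 * c) ℓ := by
  have hK0 : 0 ≤ K := (integral_nonneg fun ω => sqNorm_nonneg _).trans (hKN 0)
  have hX : ∀ t i, MemLp (fun ω => X t ω i) 2 P := by
    intro t
    induction t with
    | zero => exact hX0
    | succ t ih =>
      have := (integral_sqNorm_step (κ := ι) (hF t) (hH t) (hFH t) (hXm t) ih (hAm t) (hA t) (hNm t) (hN t)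
        (hB t) (hN0 t) (hKA t) (hKN t) (δ t)).1
      intro i
      simp only [hrec]
      exact this i
  refine ⟨hX, ?_⟩
  obtain ⟨m, R, C, hC0, hRB, hC⟩ := hL.exists_complement hsemi
  set V : ℕ → ℝ := fun t => ∫ ω, sqNorm (L *ᵥ X t ω) ∂P with hV
  set W : ℕ → ℝ := fun t => ∫ ω, sqNorm (R *ᵥ X t ω) ∂P with hW
  have hV0 : ∀ t, 0 ≤ V t := fun t => integral_nonneg fun ω => sqNorm_nonneg _
  have hW0 : ∀ t, 0 ≤ W t := fun t => integral_nonneg fun ω => sqNorm_nonneg _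
  have hLi := fun t => integrable_sqNorm (memLp_mulVec L (hX t))
  have hRi := fun t => integrable_sqNorm (memLp_mulVec R (hX t))
  have hXV : ∀ t, ∫ ω, sqNorm (X t ω) ∂P ≤ C * (V t + W t) := by
    intro t
    calc ∫ ω, sqNorm (X t ω) ∂P
        ≤ ∫ ω, C * (sqNorm (L *ᵥ X t ω) + sqNorm (R *ᵥ X t ω)) ∂P :=
          integral_mono (integrable_sqNorm (hX t)) (((hLi t).add (hRi t)).const_mul C)
            fun ω => hC _
      _ = _ := by rw [integral_const_mul, integral_add (hLi t) (hRi t)]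
  have hVrec : ∀ t, V (t + 1) ≤ (1 - 2 * c * δ t) * V t +
      δ t ^ 2 * (2 * frobSq L * K * (C * (V t + W t) + 1)) := by
    intro t
    have h1 := (integral_sqNorm_step (hF t) (hH t) (hFH t) (hXm t) (hX t) (hAm t) (hA t) (hNm t)
      (hN t) (hB t) (hN0 t) (hKA t) (hKN t) (δ t)).2 L
    simp only [← hrec] at h1
    have h2 : ∫ ω, (L *ᵥ X t ω) ⬝ᵥ (L *ᵥ (B *ᵥ X t ω)) ∂P ≤ -c * V t := by
      rw [← integral_const_mul]
      exact integral_mono (integrable_dotProduct (memLp_mulVec L (hX t))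
        (memLp_mulVec L (memLp_mulVec B (hX t)))) ((hLi t).const_mul _) fun ω => hL.decay _
    have h3 := hXV t
    have h4 := frobSq_nonneg L
    have h5 := hstep.pos t
    calc V (t + 1) ≤ _ := h1
      _ ≤ V t + 2 * δ t * (-c * V t) + δ t ^ 2 * (2 * frobSq L * K * (C * (V t + W t) + 1)) := by
        gcongr
      _ = _ := by ring
  have hWrec : ∀ t, W (t + 1) ≤ W t + δ t ^ 2 * (2 * frobSq R * K * (C * (V t + W t) + 1)) := by
    intro t
    have h1 := (integral_sqNorm_step (hF t) (hH t) (hFH t) (hXm t) (hX t) (hAm t) (hA t) (hNm t)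
      (hN t) (hB t) (hN0 t) (hKA t) (hKN t) (δ t)).2 R
    simp only [← hrec] at h1
    -- Since `R B = 0`, these coordinates have no drift; they move only by fluctuations of order
    -- `δ²`.
    simp only [hRB, dotProduct_zero, integral_zero, mul_zero, add_zero] at h1
    have h3 := hXV t
    have h4 := frobSq_nonneg R
    refine h1.trans ?_
    gcongr
  set D : ℝ := 2 * (frobSq L + frobSq R) * K with hD
  have hD0 : 0 ≤ D := by
    have := frobSq_nonneg L
    have := frobSq_nonneg R
    positivity
  -- `V + W` dominates `E|X|²`. Its drift has the favourable sign and can be ignored, so the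
  -- summability of `δ²` bounds it; inserting this bound into `hVrec` leaves a scalar recursion for
  -- `V` alone.
  have hYrec : ∀ t ≥ 0, (V (t + 1) + W (t + 1)) ≤
      (1 + D * C * δ t ^ 2) * (V t + W t) + D * δ t ^ 2 := by
    intro t _
    have h1 := hVrec t
    have h2 := hWrec t
    have h3 : 0 ≤ 2 * c * δ t * V t := by
      have := hL.pos
      have := (hstep.pos t).le
      have := hV0 t
      positivity
    have h4 : δ t ^ 2 * (2 * frobSq L * K * (C * (V t + W t) + 1)) +
        δ t ^ 2 * (2 * frobSq R * K * (C * (V t + W t) + 1)) =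
        D * C * δ t ^ 2 * (V t + W t) + D * δ t ^ 2 := by rw [hD]; ring
    linarith
  set S : ℝ := ∑' t, δ t ^ 2 with hS
  have hSle : ∀ t, ∑ k ∈ Finset.Ico 0 t, δ k ^ 2 ≤ S := fun t =>
    hstep.summable_sq.sum_le_tsum _ fun _ _ => sq_nonneg _
  set Y : ℝ := (V 0 + W 0 + D * S) * Real.exp (D * C * S) with hY
  have hbound : ∀ t, V t + W t ≤ Y := by
    intro t
    have := discrete_gronwall (u := fun t => V t + W t) (n₀ := 0) (add_nonneg (hV0 0) (hW0 0)) hYrec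
      (fun t _ => by positivity) (fun t _ => by positivity) (Nat.zero_le t)
    refine this.trans ?_
    rw [hY, ← Finset.mul_sum, ← Finset.mul_sum]
    have h1 := hSle t
    have h2 : 0 ≤ D * S := mul_nonneg hD0 (tsum_nonneg fun _ => sq_nonneg _)
    have h3 := hV0 0
    have h4 := hW0 0
    gcongr
  have hY0 : 0 ≤ Y := (add_nonneg (hV0 0) (hW0 0)).trans (hbound 0)
  have hfinal : ∀ t ≥ 0, V (t + 1) ≤ (1 - 2 * c * δ t) * V t +
      (2 * frobSq L * K * (C * Y + 1)) * δ t ^ 2 := by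
    intro t _
    refine (hVrec t).trans ?_
    rw [mul_comm _ (δ t ^ 2)]
    have := frobSq_nonneg L
    have := hbound t
    gcongr
  obtain ⟨M, -, t₁, hM⟩ := hstep.le_rpow_of_recursion hℓ hδ (by have := hL.pos; positivity)
    (by have := frobSq_nonneg L; positivity) hfinal
  exact ⟨M, t₁, hM⟩

end MartingaleNoise

/-! ### Recursions driven by i.i.d. inputs -/

section IIDRecursion

lemma comap_pi_eq_processSigma {Ω τ : Type*} (X : τ → Ω → ℝ) :
    MeasurableSpace.comap (fun ω t => X t ω) MeasurableSpace.pi = processSigma X := by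
  rw [MeasurableSpace.pi, MeasurableSpace.comap_iSup, processSigma]
  simp only [MeasurableSpace.comap_comp]
  rfl

/-- The `σ`-algebra generated by the members of a family with indices in `S`. -/
@[reducible] def sigmaOn {Ω τ : Type*} (Y : τ → Ω → ℝ) (S : Set τ) : MeasurableSpace Ω :=
  ⨆ p ∈ S, MeasurableSpace.comap (Y p) inferInstance

lemma measurable_sigmaOn {Ω τ : Type*} {Y : τ → Ω → ℝ} {S : Set τ} {p : τ} (hp : p ∈ S) :
    Measurable[sigmaOn Y S] (Y p) :=
  (comap_measurable (Y p)).mono (le_iSup₂_of_le p hp le_rfl) le_rfl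

lemma sigmaOn_mono {Ω τ : Type*} {Y : τ → Ω → ℝ} {S T : Set τ} (h : S ⊆ T) :
    sigmaOn Y S ≤ sigmaOn Y T :=
  iSup₂_le fun p hp => le_iSup₂_of_le p (h hp) le_rfl

variable {Ω : Type*} [mΩ : MeasurableSpace Ω] {P : Measure Ω} {I τ : Type*}

lemma sigmaOn_le {Y : τ → Ω → ℝ} (hY : ∀ p, Measurable (Y p)) (S : Set τ) : sigmaOn Y S ≤ mΩ :=
  iSup₂_le fun p _ => (hY p).comap_le

lemma indep_sigmaOn {Y : τ → Ω → ℝ} (hY : ∀ p, Measurable (Y p)) (h : iIndepFun Y P)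
    {S T : Set τ} (hST : Disjoint S T) : Indep (sigmaOn Y S) (sigmaOn Y T) P :=
  indep_iSup_of_disjoint (fun p => (hY p).comap_le) ((iIndepFun_iff_iIndep _ _ _).1 h) hST

lemma iIndepFun_of_iIndep_processSigma {X : I → τ → Ω → ℝ} (hX : ∀ i t, Measurable (X i t))
    (h1 : iIndep (fun i => processSigma (X i)) P) (h2 : ∀ i, iIndepFun (X i) P) :
    iIndepFun (fun p : I × τ => X p.1 p.2) P := by
  refine iIndepFun_uncurry' hX ?_ h2
  rw [iIndepFun_iff_iIndep]
  simpa only [comap_pi_eq_processSigma] using h1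

variable [IsProbabilityMeasure P] {ι : Type*} [Fintype ι] [DecidableEq ι]

/-- Mean square rate for a stochastic approximation recursion driven by independent identically
distributed noise. -/
theorem IsLyapunovFactor.integral_le_rpow_of_iid [Fintype I] {κ : Type*} [Fintype κ]
    {B : Matrix ι ι ℝ} {L : Matrix κ ι ℝ} {c : ℝ} (hL : IsLyapunovFactor B L c)
    (hsemi : ∀ v : ι → ℝ, B *ᵥ (B *ᵥ v) = 0 → B *ᵥ v = 0)
    {δ : ℕ → ℝ} (hstep : IsStepSize δ) {ℓ : ℝ} (hℓ : 0 ≤ ℓ)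
    (hδ : Tendsto (fun t => (δ (t + 1))⁻¹ - (δ t)⁻¹) atTop (𝓝 ℓ))
    {Y : I → ℕ → Ω → ℝ} (hYm : ∀ i t, Measurable (Y i t))
    (hYi : iIndepFun (fun p : I × ℕ => Y p.1 p.2) P)
    (hYd : ∀ i t, IdentDistrib (Y i t) (Y i 0) P P)
    {A : (I → ℝ) → Matrix ι ι ℝ} (hAm : ∀ i j, Measurable fun y => A y i j)
    {N : (I → ℝ) → ι → ℝ} (hNm : ∀ i, Measurable fun y => N y i)
    (hA : ∀ i j, MemLp (fun ω => A (Y · 0 ω) i j) 2 P)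
    (hN : ∀ i, MemLp (fun ω => N (Y · 0 ω) i) 2 P)
    (hB : ∀ i j, ∫ ω, A (Y · 0 ω) i j ∂P = B i j) (hN0 : ∀ i, ∫ ω, N (Y · 0 ω) i ∂P = 0)
    {X : ℕ → Ω → ι → ℝ} {x₀ : ι → ℝ} (hX0 : ∀ ω, X 0 ω = x₀)
    (hrec : ∀ t ω, X (t + 1) ω = X t ω + δ t • (A (Y · t ω) *ᵥ X t ω + N (Y · t ω))) :
    (∀ t i, MemLp (fun ω => X t ω i) 2 P) ∧ ∃ M t₁, ∀ t ≥ t₁,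
      ∫ ω, sqNorm (L *ᵥ X t ω) ∂P ≤ M * δ t ^ rateExponent (2 * c) ℓ := by
  set Z : I × ℕ → Ω → ℝ := fun p => Y p.1 p.2 with hZ
  have hZm : ∀ p, Measurable (Z p) := fun p => hYm p.1 p.2
  -- `F t` is the strict past and `H t` the present: the state at time `t` uses inputs only up to
  -- time `t - 1`.
  let F : ℕ → MeasurableSpace Ω := fun t => sigmaOn Z {p | p.2 < t}
  let H : ℕ → MeasurableSpace Ω := fun t => sigmaOn Z {p | p.2 = t}
  have hvec : ∀ t, IdentDistrib (fun ω i => Y i t ω) (fun ω i => Y i 0 ω) P P := by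
    intro t
    refine IdentDistrib.pi (fun i => hYd i t) ?_ ?_
    · exact hYi.precomp (g := fun i => (i, t)) (fun a b h => (Prod.mk.inj h).1)
    · exact hYi.precomp (g := fun i => (i, 0)) (fun a b h => (Prod.mk.inj h).1)
  have hcur : ∀ t, Measurable[H t] fun ω i => Y i t ω := fun t =>
    @measurable_pi_lambda _ _ _ (H t) _ _ fun i =>
      measurable_sigmaOn (Y := Z) (p := (i, t)) rfl
  have hHF : ∀ t, H t ≤ F (t + 1) := fun t => sigmaOn_mono fun p (hp : p.2 = t) => by
    simp only [Set.mem_ofPred_eq]; omega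
  have hFF : ∀ t, F t ≤ F (t + 1) := fun t => sigmaOn_mono fun p (hp : p.2 < t) => by
    simp only [Set.mem_ofPred_eq]; omega
  have hAH : ∀ t i j, Measurable[H t] fun ω => A (Y · t ω) i j := fun t i j =>
    (hAm i j).comp (hcur t)
  have hNH : ∀ t i, Measurable[H t] fun ω => N (Y · t ω) i := fun t i => (hNm i).comp (hcur t)
  have hXF : ∀ t i, Measurable[F t] fun ω => X t ω i := by
    intro t
    induction t with
    | zero => intro i; simp only [hX0]; exact measurable_const
    | succ t ih =>
      intro i
      simp only [hrec, Pi.add_apply, Pi.smul_apply, smul_eq_mul]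
      have h1 : ∀ i, Measurable[F (t + 1)] fun ω => X t ω i := fun i =>
        (ih i).mono (hFF t) le_rfl
      have h2 := measurable_mulVec (fun i j => (hAH t i j).mono (hHF t) le_rfl) h1 i
      exact (h1 i).add (measurable_const.mul (h2.add ((hNH t i).mono (hHF t) le_rfl)))
  have hAd : ∀ t i j, IdentDistrib (fun ω => A (Y · t ω) i j) (fun ω => A (Y · 0 ω) i j) P P :=
    fun t i j => (hvec t).comp (hAm i j)
  have hNd : ∀ t i, IdentDistrib (fun ω => N (Y · t ω) i) (fun ω => N (Y · 0 ω) i) P P :=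
    fun t i => (hvec t).comp (hNm i)
  have hfrob : ∀ t, ∫ ω, frobSq (A (Y · t ω)) ∂P = ∫ ω, frobSq (A (Y · 0 ω)) ∂P := fun t =>
    ((hvec t).comp (u := fun y => frobSq (A y)) (Finset.measurable_sum _ fun i _ =>
      Finset.measurable_sum _ fun j _ => (hAm i j).pow_const 2)).integral_eq
  have hsq : ∀ t, ∫ ω, sqNorm (N (Y · t ω)) ∂P = ∫ ω, sqNorm (N (Y · 0 ω)) ∂P := fun t =>
    ((hvec t).comp (u := fun y => sqNorm (N y)) (Finset.measurable_sum _ fun i _ =>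
      (hNm i).pow_const 2)).integral_eq
  exact hL.integral_le_rpow hsemi hstep hℓ hδ (F := F) (H := H) (fun t => sigmaOn_le hZm _)
    (fun t => sigmaOn_le hZm _)
    (fun t => indep_sigmaOn hZm hYi (Set.disjoint_left.2 fun p (h1 : p.2 < t) (h2 : p.2 = t) =>
      by omega)) hXF
    (fun i => by simp only [hX0]; exact memLp_const _) hAH
    (fun t i j => (hAd t i j).memLp_iff.2 (hA i j)) hNH
    (fun t i => (hNd t i).memLp_iff.2 (hN i))
    (fun t i j => (hAd t i j).integral_eq.trans (hB i j))
    (fun t i => (hNd t i).integral_eq.trans (hN0 i))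
    (K := max (∫ ω, frobSq (A (Y · 0 ω)) ∂P) (∫ ω, sqNorm (N (Y · 0 ω)) ∂P))
    (fun t => (hfrob t).le.trans (le_max_left _ _)) (fun t => (hsq t).le.trans (le_max_right _ _))
    hrec

end IIDRecursion

/-! ### Communication errors -/

section IIDCases

lemma processSigma_comp_le {Ω τ τ' : Type*} (X : τ → Ω → ℝ) (g : τ' → τ) :
    processSigma (fun t => X (g t)) ≤ processSigma X :=
  iSup_le fun t => le_iSup (fun t => MeasurableSpace.comap (X t) inferInstance) (g t)

variable {Ω : Type*} [mΩ : MeasurableSpace Ω] {P : Measure Ω}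

lemma memLp_mul_of_memLp_four {f g : Ω → ℝ} (hf : MemLp f 4 P) (hg : MemLp g 4 P) :
    MemLp (fun ω => f ω * g ω) 2 P := by
  have : ENNReal.HolderTriple 4 4 2 := ⟨by
    rw [← two_mul, show (4 : ENNReal) = 2 * 2 by norm_num, ENNReal.mul_inv (by simp) (by simp),
      ← mul_assoc, ENNReal.mul_inv_cancel (by simp) (by simp), one_mul]⟩
  exact hg.mul' hf

lemma MemLp.two_of_four [IsProbabilityMeasure P] {f : Ω → ℝ} (hf : MemLp f 4 P) : MemLp f 2 P :=
  hf.mono_exponent (by norm_num)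

variable {n : ℕ} {G : Digraph (Fin n)} {γ : Matrix (Fin n) (Fin n) ℝ} {α β : Fin n → ℝ}
  {δ : ℕ → ℝ} {ℓ : ℝ} {x : ℤ → Ω → ℝ} {xbar s : ℝ}

lemma IsSensorNetwork.weight_diag (h : IsSensorNetwork G γ α) (i : Fin n) : γ i i = 0 :=
  h.weight_zero i i (h.loopless i)

lemma IsIID.comp_injective {τ τ' : Type*} {X : τ → Ω → ℝ} (h : IsIID X P) {g : τ' → τ}
    (hg : Function.Injective g) : IsIID (fun t => X (g t)) P :=
  ⟨fun _ => h.measurable _, h.indep.precomp hg, fun _ _ => h.ident _ _⟩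

/-- Affine dependence on `(p, q)` lets expectations pass inside, and with `q = x²` it reduces square
integrability to the fourth moment of the signal. -/
lemma phiBlock_eq_affine (a b : ℝ) (c c' : Fin 2) :
    ∃ u v w : ℝ, ∀ p q, phiBlock a b p q c c' = u + v * p + w * q := by
  fin_cases c <;> fin_cases c'
  · exact ⟨0, a * b, a ^ 2, fun p q => by simp [phiBlock]⟩
  · exact ⟨a * b, a ^ 2, 0, fun p q => by simp [phiBlock]⟩
  · exact ⟨0, 1 + b ^ 2, a * b, fun p q => by simp [phiBlock]⟩
  · exact ⟨1 + b ^ 2, a * b, 0, fun p q => by simp [phiBlock]⟩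

/-- The components of `[α y, 1 + β y]ᵀ`, `y = α x + β`, are affine in `x`. -/
lemma regressor_eq_affine (a b : ℝ) (c : Fin 2) :
    ∃ u v : ℝ, ∀ z, (![a * (a * z + b), 1 + b * (a * z + b)] : Fin 2 → ℝ) c = u + v * z := by
  fin_cases c
  · exact ⟨a * b, a * a, fun z => by simp; ring⟩
  · exact ⟨1 + b * b, b * a, fun z => by simp; ring⟩

variable [IsProbabilityMeasure P]

lemma phiBlock_memLp {a b : ℝ} {f : Ω → ℝ} (hf : MemLp f 4 P) (c c' : Fin 2) :
    MemLp (fun ω => phiBlock a b (f ω) (f ω ^ 2) c c') 2 P := by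
  obtain ⟨u, v, w, h⟩ := phiBlock_eq_affine a b c c'
  simp only [h, sq]
  exact ((memLp_const u).add ((MemLp.two_of_four hf).const_mul v)).add
    ((memLp_mul_of_memLp_four hf hf).const_mul w)

lemma integral_phiBlock {a b m q : ℝ} {f : Ω → ℝ} (hf : MemLp f 4 P) (hm : ∫ ω, f ω ∂P = m)
    (hq : ∫ ω, f ω ^ 2 ∂P = q) (c c' : Fin 2) :
    ∫ ω, phiBlock a b (f ω) (f ω ^ 2) c c' ∂P = phiBlock a b m q c c' := by
  obtain ⟨u, v, w, h⟩ := phiBlock_eq_affine a b c c'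
  have h1 : Integrable (fun ω => v * f ω) P :=
    ((MemLp.two_of_four hf).integrable one_le_two).const_mul v
  have h2 : Integrable (fun ω => w * f ω ^ 2) P := (MemLp.two_of_four hf).integrable_sq.const_mul w
  simp only [h]
  rw [integral_add ((integrable_const u).fun_add h1) h2, integral_add (integrable_const u) h1,
    integral_const_mul, integral_const_mul, hm, hq]
  simp

lemma measurable_phiBlock (a b : ℝ) (c c' : Fin 2) :
    Measurable fun p : ℝ × ℝ => phiBlock a b p.1 p.2 c c' := by
  obtain ⟨u, v, w, h⟩ := phiBlock_eq_affine a b c c'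
  simp only [h]
  fun_prop

/-- Displays the entries as linear in the weights of a row, so that measurability, square
integrability and means are inherited from the individual dropout variables. -/
lemma weightMatrix_eq_sum (w : Matrix (Fin n) (Fin n) ℝ) (i j : Fin n) :
    weightMatrix w i j = ∑ k, (if i = j then (if k = i then 0 else -1) else if k = j then 1 else 0) *
      w i k := by
  simp only [weightMatrix, Matrix.of_apply]
  split_ifs with h
  · rw [← Finset.add_sum_erase _ _ (Finset.mem_univ i), if_pos rfl, zero_mul, zero_add,
      ← Finset.sum_neg_distrib]
    exact Finset.sum_congr rfl fun k hk => by rw [if_neg (Finset.ne_of_mem_erase hk)]; ring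
  · simp

lemma Dropouts.zero_or_one {u : Fin n → Fin n → ℕ → Ω → ℝ} {p : Matrix (Fin n) (Fin n) ℝ}
    (hu : Dropouts G u P p) (i j : Fin n) (t : ℕ) : ∀ᵐ ω ∂P, u i j t ω = 0 ∨ u i j t ω = 1 := by
  have hm := (hu.iid i j).measurable t
  have h0 : MeasurableSet {ω | u i j t ω = 0} := hm (measurableSet_singleton 0)
  have h1 : MeasurableSet {ω | u i j t ω = 1} := hm (measurableSet_singleton 1)
  have hd : Disjoint {ω | u i j t ω = 0} {ω | u i j t ω = 1} :=
    Set.disjoint_left.2 fun ω (e0 : u i j t ω = 0) (e1 : u i j t ω = 1) => by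
      rw [e0] at e1; exact zero_ne_one e1
  have h2 : P.real ({ω | u i j t ω = 0} ∪ {ω | u i j t ω = 1}) = 1 := by
    rw [measureReal_union hd h1, hu.one, hu.zero]
    ring
  have h3 : P ({ω | u i j t ω = 0} ∪ {ω | u i j t ω = 1}) = 1 := by
    rw [measureReal_def, ENNReal.toReal_eq_one_iff] at h2
    exact h2
  exact (prob_compl_eq_zero_iff (h0.union h1)).2 h3

lemma Dropouts.memLp {u : Fin n → Fin n → ℕ → Ω → ℝ} {p : Matrix (Fin n) (Fin n) ℝ}
    (hu : Dropouts G u P p) (i j : Fin n) (t : ℕ) : MemLp (u i j t) 2 P :=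
  MemLp.of_bound ((hu.iid i j).measurable t).aestronglyMeasurable 1 <| by
    filter_upwards [hu.zero_or_one i j t] with ω hω
    rcases hω with h | h <;> simp [h]

lemma Dropouts.integral_eq {u : Fin n → Fin n → ℕ → Ω → ℝ} {p : Matrix (Fin n) (Fin n) ℝ}
    (hu : Dropouts G u P p) (i j : Fin n) (t : ℕ) : ∫ ω, u i j t ω ∂P = p i j := by
  have h1 : MeasurableSet {ω | u i j t ω = 1} :=
    (hu.iid i j).measurable t (measurableSet_singleton 1)
  rw [← hu.one i j t, ← integral_indicator_one h1]
  refine integral_congr_ae ?_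
  filter_upwards [hu.zero_or_one i j t] with ω hω
  rcases hω with h | h <;> simp [Set.indicator, h]

/-- Dropouts and signal are independent, so the mean matrix is the product of means: again a system
matrix, with weights `p i j * γ i j` positive on the same arcs. The channel noise enters linearly
with a coefficient independent of it, so the additive term is centred. -/
theorem consensusRate_lossyEstimate (hnet : IsSensorNetwork G γ α) (hA : HasSpanningTree G)
    (hstep : IsStepSize δ) (hℓ : 0 ≤ ℓ)
    (hδ : Tendsto (fun t => (δ (t + 1))⁻¹ - (δ t)⁻¹) atTop (𝓝 ℓ))
    {u ξ : Fin n → Fin n → ℕ → Ω → ℝ} {p : Matrix (Fin n) (Fin n) ℝ}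
    (hx : IIDSignal x P xbar s) (hs : 0 < s ^ 2 - xbar ^ 2) (hu : Dropouts G u P p)
    (hξ : CommunicationNoise ξ P) (hind : IndepSignals x u ξ P) :
    ConsensusRate P δ (systemMatrix α β (Matrix.of fun i j => p i j * γ i j) xbar (s ^ 2))
      (lossyEstimate α β γ δ x u ξ) := by
  have hpq : xbar ^ 2 < s ^ 2 := by linarith
  have hnet' : IsSensorNetwork G (Matrix.of fun i j => p i j * γ i j) α :=
    ⟨hnet.loopless, fun i j hij => mul_pos (hu.pos i j hij) (hnet.weight_pos i j hij),
      fun i j hij => by simp [hnet.weight_zero i j hij], hnet.gain_ne⟩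
  obtain ⟨m, L, c, hL⟩ := hnet'.exists_isLyapunovFactor (β := β) hA hpq
  -- The inputs of one time instant: signal, dropouts, channel noises. Only nonnegative times of the
  -- signal are needed.
  let Y : Unit ⊕ (Fin n × Fin n) ⊕ (Fin n × Fin n) → ℕ → Ω → ℝ :=
    Sum.elim (fun _ t => x t) (Sum.elim (fun e t => u e.1 e.2 t) fun e t => ξ e.1 e.2 t)
  have hYiid : ∀ i, IsIID (Y i) P := by
    rintro (_ | e | e)
    · exact hx.iid.comp_injective Nat.cast_injective
    · exact hu.iid e.1 e.2
    · exact hξ.iid e.1 e.2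
  have hYi : iIndepFun (fun p : (Unit ⊕ (Fin n × Fin n) ⊕ (Fin n × Fin n)) × ℕ => Y p.1 p.2) P := by
    refine iIndepFun_of_iIndep_processSigma (fun i => (hYiid i).measurable) ?_
      fun i => (hYiid i).indep
    refine iIndep_of_iIndep_of_le hind ?_
    rintro (_ | e | e)
    · exact processSigma_comp_le x Nat.cast
    · exact le_rfl
    · exact le_rfl
  let A : (Unit ⊕ (Fin n × Fin n) ⊕ (Fin n × Fin n) → ℝ) →
      Matrix (Fin n × Fin 2) (Fin n × Fin 2) ℝ := fun y =>
    systemMatrix α β (Matrix.of fun i j => y (.inr (.inl (i, j))) * γ i j) (y (.inl ()))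
      (y (.inl ()) ^ 2)
  let N : (Unit ⊕ (Fin n × Fin n) ⊕ (Fin n × Fin n) → ℝ) → Fin n × Fin 2 → ℝ := fun y k =>
    ∑ j, γ k.1 j * y (.inr (.inl (k.1, j))) * y (.inr (.inr (k.1, j))) *
      ![α k.1 * (α k.1 * y (.inl ()) + β k.1), 1 + β k.1 * (α k.1 * y (.inl ()) + β k.1)] k.2
  have hgm : ∀ (a b : ℝ) (c : Fin 2), Measurable fun z : ℝ =>
      (![a * (a * z + b), 1 + b * (a * z + b)] : Fin 2 → ℝ) c := by
    intro a b c
    obtain ⟨u, v, h⟩ := regressor_eq_affine a b c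
    simp only [h]
    fun_prop
  have hwm : ∀ i j, Measurable fun y : Unit ⊕ (Fin n × Fin n) ⊕ (Fin n × Fin n) → ℝ =>
      weightMatrix (Matrix.of fun i j => y (.inr (.inl (i, j))) * γ i j) i j := by
    intro i j
    simp only [weightMatrix_eq_sum, Matrix.of_apply]
    fun_prop
  have hAm : ∀ k l, Measurable fun y => A y k l := by
    intro k l
    simp only [A, systemMatrix_apply]
    refine Measurable.mul ?_ (hwm _ _)
    exact (measurable_phiBlock (α k.1) (β k.1) k.2 l.2).comp
      (g := fun p : ℝ × ℝ => phiBlock (α k.1) (β k.1) p.1 p.2 k.2 l.2)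
      (f := fun y : Unit ⊕ (Fin n × Fin n) ⊕ (Fin n × Fin n) → ℝ => (y (.inl ()), y (.inl ()) ^ 2))
      (by fun_prop)
  have hNm : ∀ k, Measurable fun y => N y k := by
    intro k
    refine Finset.measurable_sum _ fun j _ => ?_
    refine Measurable.mul (by fun_prop) ?_
    exact (hgm _ _ _).comp (measurable_pi_apply _)
  set Z : (Unit ⊕ (Fin n × Fin n) ⊕ (Fin n × Fin n)) × ℕ → Ω → ℝ := fun p => Y p.1 p.2 with hZ
  have hZm : ∀ p, Measurable (Z p) := fun p => (hYiid p.1).measurable p.2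
  have hind1 : Indep (sigmaOn Z {(.inl (), 0)}) (sigmaOn Z {p | ∃ e, p = (.inr (.inl e), 0)}) P :=
    indep_sigmaOn hZm hYi (Set.disjoint_left.2 (by rintro _ rfl ⟨e, he⟩; simp at he))
  have hxm : Measurable[sigmaOn Z {(.inl (), 0)}] (x (0 : ℕ)) :=
    measurable_sigmaOn (Y := Z) (p := (.inl (), 0)) rfl
  have hum : ∀ i j, Measurable[sigmaOn Z {p | ∃ e, p = (.inr (.inl e), 0)}] (u i j 0) :=
    fun i j => measurable_sigmaOn (Y := Z) (p := (.inr (.inl (i, j)), 0)) ⟨(i, j), rfl⟩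
  have hwum : ∀ i j, Measurable[sigmaOn Z {p | ∃ e, p = (.inr (.inl e), 0)}] fun ω =>
      weightMatrix (Matrix.of fun i j => u i j 0 ω * γ i j) i j := by
    intro i j
    simp only [weightMatrix_eq_sum, Matrix.of_apply]
    exact Finset.measurable_sum _ fun k _ => measurable_const.mul ((hum i k).mul measurable_const)
  have hphim : ∀ a b c c', Measurable[sigmaOn Z {(.inl (), 0)}] fun ω =>
      phiBlock a b (x (0 : ℕ) ω) (x (0 : ℕ) ω ^ 2) c c' := fun a b c c' =>
    (measurable_phiBlock a b c c').comp (hxm.prodMk (hxm.pow_const 2))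
  have hwu : ∀ i j, MemLp (fun ω => weightMatrix (Matrix.of fun i j => u i j 0 ω * γ i j) i j) 2 P := by
    intro i j
    simp only [weightMatrix_eq_sum, Matrix.of_apply]
    exact memLp_finsetSum _ fun k _ => ((hu.memLp i k 0).mul_const (γ i k)).const_mul _
  have hwu_int : ∀ i j, ∫ ω, weightMatrix (Matrix.of fun i j => u i j 0 ω * γ i j) i j ∂P =
      weightMatrix (Matrix.of fun i j => p i j * γ i j) i j := by
    intro i j
    simp only [weightMatrix_eq_sum, Matrix.of_apply]
    rw [integral_finsetSum _ fun k _ =>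
      (((hu.memLp i k 0).integrable one_le_two).mul_const (γ i k)).const_mul _]
    refine Finset.sum_congr rfl fun k _ => ?_
    rw [integral_const_mul, integral_mul_const, hu.integral_eq]
  have hx4 := hx.memLp (0 : ℕ)
  -- Everything outside the process `ξ i j` against the single variable `ξ i j 0`; this contains the
  -- signal and dropout multiplying that noise.
  have hξind : ∀ i j, Indep (sigmaOn Z {p | p.1 ≠ .inr (.inr (i, j))})
      (sigmaOn Z {(.inr (.inr (i, j)), 0)}) P := fun i j =>
    indep_sigmaOn hZm hYi (Set.disjoint_left.2 (by rintro _ h rfl; exact h rfl))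
  have hg2 : ∀ (a b : ℝ) (c : Fin 2), MemLp (fun ω =>
      (![a * (a * x (0 : ℕ) ω + b), 1 + b * (a * x (0 : ℕ) ω + b)] : Fin 2 → ℝ) c) 2 P := by
    intro a b c
    have h1 : MemLp (x (0 : ℕ)) 2 P := MemLp.two_of_four hx4
    obtain ⟨u, v, h⟩ := regressor_eq_affine a b c
    simp only [h]
    exact (memLp_const u).add (h1.const_mul v)
  have hNterm : ∀ (k : Fin n × Fin 2) (j : Fin n), MemLp (fun ω => γ k.1 j * u k.1 j 0 ω *
      ![α k.1 * (α k.1 * x (0 : ℕ) ω + β k.1), 1 + β k.1 * (α k.1 * x (0 : ℕ) ω + β k.1)] k.2) 2 P :=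
    fun k j => memLp_mul_of_indep hind1.symm (measurable_const.mul (hum k.1 j))
      ((hgm _ _ _).comp hxm) ((hu.memLp k.1 j 0).const_mul _) (hg2 _ _ _)
  have hNtermm : ∀ (k : Fin n × Fin 2) (j : Fin n),
      Measurable[sigmaOn Z {p | p.1 ≠ .inr (.inr (k.1, j))}] (fun ω => γ k.1 j * u k.1 j 0 ω *
      ![α k.1 * (α k.1 * x (0 : ℕ) ω + β k.1), 1 + β k.1 * (α k.1 * x (0 : ℕ) ω + β k.1)] k.2) := by
    intro k j
    refine (measurable_const.mul ((hum k.1 j).mono (sigmaOn_mono ?_) le_rfl)).mul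
      ((hgm _ _ _).comp (hxm.mono (sigmaOn_mono ?_) le_rfl))
    · rintro _ ⟨e, rfl⟩; simp
    · rintro _ rfl; simp
  have hξm : ∀ i j, Measurable[sigmaOn Z {(.inr (.inr (i, j)), 0)}] (ξ i j 0) := fun i j =>
    measurable_sigmaOn (Y := Z) (p := (.inr (.inr (i, j)), 0)) rfl
  have hNeq : ∀ (k : Fin n × Fin 2) ω, N (Y · 0 ω) k = ∑ j, (γ k.1 j * u k.1 j 0 ω *
      ![α k.1 * (α k.1 * x (0 : ℕ) ω + β k.1), 1 + β k.1 * (α k.1 * x (0 : ℕ) ω + β k.1)] k.2) *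
      ξ k.1 j 0 ω := fun k ω => Finset.sum_congr rfl fun j _ => by simp only [Y, Sum.elim_inl, Sum.elim_inr]; ring
  have hNmem : ∀ (k : Fin n × Fin 2) (j : Fin n), MemLp (fun ω => (γ k.1 j * u k.1 j 0 ω *
      ![α k.1 * (α k.1 * x (0 : ℕ) ω + β k.1), 1 + β k.1 * (α k.1 * x (0 : ℕ) ω + β k.1)] k.2) *
      ξ k.1 j 0 ω) 2 P := fun k j =>
    memLp_mul_of_indep (hξind k.1 j) (hNtermm k j) (hξm k.1 j) (hNterm k j) (hξ.memLp k.1 j 0)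
  obtain ⟨hmem, M, t₁, hM⟩ := hL.integral_le_rpow_of_iid (hnet'.systemMatrix_semisimple hA hpq) hstep
    hℓ hδ (Y := Y) (fun i t => (hYiid i).measurable t) hYi (fun i t => (hYiid i).ident t 0)
    (A := A) hAm (N := N) hNm
    (by
      intro k l
      simp only [A, systemMatrix_apply]
      exact memLp_mul_of_indep hind1 (hphim _ _ _ _) (hwum _ _) (phiBlock_memLp hx4 _ _) (hwu _ _))
    (by
      intro k
      simp only [hNeq]
      exact memLp_finsetSum _ fun j _ => hNmem k j)
    (by
      intro k l
      simp only [A, systemMatrix_apply]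
      refine (integral_mul_of_indep (sigmaOn_le hZm _) (sigmaOn_le hZm _) hind1 (hphim _ _ _ _)
        (hwum _ _)).trans ?_
      rw [hwu_int, integral_phiBlock hx4 (hx.mean _) (hx.sq _)])
    (by
      intro k
      simp only [hNeq]
      rw [integral_finsetSum _ fun j _ => (hNmem k j).integrable one_le_two]
      refine Finset.sum_eq_zero fun j _ => ?_
      rw [integral_mul_of_indep (sigmaOn_le hZm _) (sigmaOn_le hZm _) (hξind k.1 j) (hNtermm k j)
        (hξm k.1 j), hξ.mean, mul_zero])
    (X := lossyEstimate α β γ δ x u ξ) (x₀ := fun k => ![α k.1, β k.1] k.2) (fun ω => rfl)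
    (by
      intro t ω
      rw [lossyEstimate, Matrix.add_mulVec, Matrix.one_mulVec, Matrix.smul_mulVec, add_assoc,
        ← smul_add]
      rfl)
  exact hnet'.consensusRate hA hstep hpq L
    (fun v hv => (hnet'.systemMatrix_mulVec_eq_zero_iff hA hpq v).1 ((hL.ker_iff v).1 hv))
    (fun t k => (hmem t k).aestronglyMeasurable)
    (fun t => integrable_sqNorm (memLp_mulVec L (hmem t)))
    (rateExponent_pos (by have := hL.pos; positivity) hℓ) (rateExponent_lt_one _ _) hM

end IIDCases

/-! ### The compensated algorithm in terms of equivalent parameters -/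

section OutputError

variable {Ω : Type*} {n : ℕ}

/-- In the equivalent parameters the output of node `j` is `ρ_{j0} (x + η_j / α_j) + ρ_{j1}`: all
nodes see the same signal, and gain and offset survive only as a scaling of the noise. -/
lemma sum_mul_outputError (γ : Matrix (Fin n) (Fin n) ℝ) (hα : ∀ i, α i ≠ 0) (x : ℤ → Ω → ℝ)
    (η : Fin n → ℤ → Ω → ℝ) (θ : Fin n → Fin 2 → ℝ) (t : ℤ) (ω : Ω) (i : Fin n) :
    ∑ j, γ i j * outputError α β x η θ t ω i j =
      ∑ j, weightMatrix γ i j * (equivParams α β θ (j, 0) * (x t ω + η j t ω / α j) +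
        equivParams α β θ (j, 1)) := by
  have := sum_weightMatrix_mul (𝕜 := ℝ) γ
    (fun j => θ j 0 * sensorOutput α β x η j t ω + θ j 1) i
  simp only [RCLike.ofReal_real_eq_id, id_eq] at this
  simp only [outputError]
  rw [← this]
  refine Finset.sum_congr rfl fun j _ => ?_
  have := hα j
  simp only [equivParams, sensorOutput, Matrix.cons_val_zero, Matrix.cons_val_one]
  field_simp
  ring

/-- The random matrix of the compensated algorithm as a function of the signal `y none` and of the
noise `y (some i)`. -/
noncomputable def compensatedMatrix (α β : Fin n → ℝ) (γ : Matrix (Fin n) (Fin n) ℝ)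
    (ση : Fin n → ℝ) (y : Option (Fin n) → ℝ) : Matrix (Fin n × Fin 2) (Fin n × Fin 2) ℝ :=
  Matrix.of fun k l => weightMatrix γ k.1 l.1 *
      (((![0, 1] : Fin 2 → ℝ) k.2 + (![α k.1, β k.1] : Fin 2 → ℝ) k.2 *
          (α k.1 * y none + β k.1 + y (some k.1))) *
        (if l.2 = 0 then y none + (α l.1)⁻¹ * y (some l.1) else 1)) +
    if k.1 = l.1 ∧ l.2 = 0 then
      ση k.1 ^ 2 * (∑ j, γ k.1 j) * ((![α k.1, β k.1] : Fin 2 → ℝ) k.2 / α k.1) else 0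

/-- Passing from `θ` to `ρ` turns the regressor `(y, 1)` into `e + h y` with `e = (0, 1)` and `h =
(α, β)`, and `â_i = ρ_{i0} / α_i`. Thus the recursion closes in `ρ` and is linear, without additive
noise. -/
lemma equivParams_compensatedParams_succ {α : Fin n → ℝ} (hα : ∀ i, α i ≠ 0) (β : Fin n → ℝ)
    (γ : Matrix (Fin n) (Fin n) ℝ) (δ : ℕ → ℝ) (ση : Fin n → ℝ) (x : ℤ → Ω → ℝ)
    (η : Fin n → ℤ → Ω → ℝ) (t : ℕ) (ω : Ω) :
    equivParams α β (compensatedParams α β γ δ ση x η (t + 1) ω) =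
      equivParams α β (compensatedParams α β γ δ ση x η t ω) + δ t •
        (compensatedMatrix α β γ ση (fun k => k.elim (x t ω) fun i => η i t ω) *ᵥ
          equivParams α β (compensatedParams α β γ δ ση x η t ω)) := by
  set y : Option (Fin n) → ℝ := fun k => k.elim (x t ω) fun i => η i t ω with hy
  set θ := compensatedParams α β γ δ ση x η t ω with hθ
  have hAv : ∀ i c, (compensatedMatrix α β γ ση y *ᵥ equivParams α β θ) (i, c) =
      ((![0, 1] : Fin 2 → ℝ) c + (![α i, β i] : Fin 2 → ℝ) c * sensorOutput α β x η i t ω) *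
        (∑ j, γ i j * outputError α β x η θ t ω i j) +
      ση i ^ 2 * (∑ j, γ i j) * ((![α i, β i] : Fin 2 → ℝ) c * θ i 0) := by
    intro i c
    rw [sum_mul_outputError γ hα, Matrix.mulVec, dotProduct, Fintype.sum_prod_type]
    have hαi := hα i
    simp only [compensatedMatrix, Matrix.of_apply]
    generalize (∑ j, γ i j) = S
    have e1 : ση i ^ 2 * S * ((![α i, β i] : Fin 2 → ℝ) c / α i) * equivParams α β θ (i, 0) =
        ση i ^ 2 * S * ((![α i, β i] : Fin 2 → ℝ) c * θ i 0) := by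
      simp only [equivParams, Matrix.cons_val_zero]
      field_simp
    generalize (![α i, β i] : Fin 2 → ℝ) c = h at e1 ⊢
    generalize (![0, 1] : Fin 2 → ℝ) c = e
    simp only [Fin.sum_univ_two, if_true, one_ne_zero, if_false, and_true,
      and_false, add_zero, add_mul _ (ite _ _ _), Finset.sum_add_distrib, ite_mul, zero_mul]
    rw [Finset.sum_ite_eq Finset.univ i, if_pos (Finset.mem_univ i), Finset.mul_sum]
    rw [e1]
    refine congrArg₂ _ ((Finset.sum_add_distrib ..).symm.trans ?_) rfl
    refine Finset.sum_congr rfl fun j _ => ?_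
    simp only [sensorOutput, y, Option.elim]
    ring
  ext ⟨i, c⟩
  rw [Pi.add_apply, Pi.smul_apply, hAv, smul_eq_mul]
  have hstep' : ∀ c, compensatedParams α β γ δ ση x η (t + 1) ω i c = θ i c +
      δ t * ((∑ j, γ i j * outputError α β x η θ t ω i j) *
        (![sensorOutput α β x η i t ω, 1] : Fin 2 → ℝ) c +
        (![ση i ^ 2 * (∑ j, γ i j) * θ i 0, 0] : Fin 2 → ℝ) c) := by
    intro c
    rw [compensatedParams, ← hθ]
    simp only [Pi.add_apply, Pi.smul_apply, smul_eq_mul, Finset.sum_apply, Finset.sum_mul]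
  fin_cases c
  · simp only [equivParams, hstep', Fin.zero_eta, Matrix.cons_val_zero, Matrix.cons_val_one]
    ring
  · simp only [equivParams, hstep', Fin.mk_one, Matrix.cons_val_zero, Matrix.cons_val_one]
    ring
end OutputError

/-! ### Measurement noise with known variances -/

section MeasurementNoise

variable {Ω : Type*} [mΩ : MeasurableSpace Ω] {P : Measure Ω}

/-- `f` is integrable with mean `c`. -/
structure HasMean (P : Measure Ω) (f : Ω → ℝ) (c : ℝ) : Prop where
  integrable : Integrable f P
  eq : ∫ ω, f ω ∂P = c

lemma HasMean.add {f g : Ω → ℝ} {a b : ℝ} (hf : HasMean P f a) (hg : HasMean P g b) :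
    HasMean P (fun ω => f ω + g ω) (a + b) :=
  ⟨hf.integrable.fun_add hg.integrable, by
    rw [integral_add hf.integrable hg.integrable, hf.eq, hg.eq]⟩

lemma HasMean.const_mul {f : Ω → ℝ} {a : ℝ} (hf : HasMean P f a) (c : ℝ) :
    HasMean P (fun ω => c * f ω) (c * a) :=
  ⟨hf.integrable.const_mul c, by rw [integral_const_mul, hf.eq]⟩

lemma HasMean.congr {f g : Ω → ℝ} {a b : ℝ} (hf : HasMean P f a) (h : ∀ ω, g ω = f ω)
    (hab : a = b) : HasMean P g b := by
  obtain rfl : g = f := funext h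
  exact hab ▸ hf

variable {n : ℕ} {G : Digraph (Fin n)} {γ : Matrix (Fin n) (Fin n) ℝ} {α β : Fin n → ℝ}
  {δ : ℕ → ℝ} {ℓ : ℝ} {x : ℤ → Ω → ℝ} {xbar s : ℝ}

lemma IsSensorNetwork.weightMatrix_diag (h : IsSensorNetwork G γ α) (i : Fin n) :
    weightMatrix γ i i = -∑ j, γ i j := by
  rw [weightMatrix, Matrix.of_apply, if_pos rfl, ← Finset.add_sum_erase _ _ (Finset.mem_univ i),
    h.weight_diag, zero_add]

lemma MeasurementNoise.memLp_two [IsProbabilityMeasure P] {η : Fin n → ℤ → Ω → ℝ} {ση : Fin n → ℝ}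
    (hη : MeasurementNoise x η P ση) (i : Fin n) (t : ℤ) : MemLp (η i t) 2 P :=
  MemLp.two_of_four (hη.memLp i t)

/-- Expand the product of regressor and output: the only noise term that survives is the correlation
`v` of the two noises. -/
lemma HasMean.mul_affine {f g g' : Ω → ℝ} {μ q v : ℝ} [IsProbabilityMeasure P] (hf : HasMean P f μ)
    (hff : HasMean P (fun ω => f ω ^ 2) q) (hg' : HasMean P g' 0)
    (hfg : HasMean P (fun ω => f ω * g ω) 0)
    (hfg' : HasMean P (fun ω => f ω * g' ω) 0)
    (hgg' : HasMean P (fun ω => g ω * g' ω) v) (e h a b a' : ℝ) :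
    HasMean P (fun ω => (e + h * (a * f ω + b + g ω)) * (f ω + a' * g' ω))
      ((e + h * b) * μ + h * a * q + h * a' * v) :=
  (((((hf.const_mul (e + h * b)).add (hff.const_mul (h * a))).add (hfg.const_mul h)).add
    (hg'.const_mul ((e + h * b) * a'))).add
    ((hfg'.const_mul (h * a * a')).add (hgg'.const_mul (h * a')))).congr (fun ω => by ring) (by ring)

lemma HasMean.affine {f g : Ω → ℝ} {μ : ℝ} [IsProbabilityMeasure P] (hf : HasMean P f μ)
    (hg : HasMean P g 0) (e h a b : ℝ) :
    HasMean P (fun ω => (e + h * (a * f ω + b + g ω)) * 1) (e + h * b + h * a * μ) :=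
  ((HasMean.mk (P := P) (f := fun _ => e + h * b) (c := e + h * b) (integrable_const _) (by simp)).add
    (hf.const_mul (h * a))).add (hg.const_mul h) |>.congr (fun ω => by ring) (by ring)

lemma phiBlock_eq_regressor (a b p q : ℝ) (c c' : Fin 2) : phiBlock a b p q c c' =
    if c' = 0 then ((![0, 1] : Fin 2 → ℝ) c + (![a, b] : Fin 2 → ℝ) c * b) * p +
        (![a, b] : Fin 2 → ℝ) c * a * q
      else (![0, 1] : Fin 2 → ℝ) c + (![a, b] : Fin 2 → ℝ) c * b +
        (![a, b] : Fin 2 → ℝ) c * a * p := by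
  fin_cases c <;> fin_cases c' <;> simp [phiBlock, mul_assoc] <;> ring_nf

lemma compensatedMatrix_memLp [IsProbabilityMeasure P] {f : Ω → ℝ} {g : Fin n → Ω → ℝ}
    (hf : MemLp f 4 P) (hg : ∀ i, MemLp (g i) 4 P) (ση : Fin n → ℝ) (k l : Fin n × Fin 2) :
    MemLp (fun ω => compensatedMatrix α β γ ση (fun k => k.elim (f ω) fun i => g i ω) k l) 2 P := by
  have h1 : MemLp (fun ω => if l.2 = 0 then f ω + (α l.1)⁻¹ * g l.1 ω else 1) 4 P := by
    split_ifs
    · exact hf.add ((hg _).const_mul _)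
    · exact memLp_const _
  have h2 : ∀ e h a b : ℝ, MemLp (fun ω => e + h * (a * f ω + b + g k.1 ω)) 4 P := fun e h a b =>
    (memLp_const e).add ((((hf.const_mul a).add (memLp_const b)).add (hg k.1)).const_mul h)
  have h3 := fun e h a b => (memLp_mul_of_memLp_four (h2 e h a b) h1).const_mul
    (weightMatrix γ k.1 l.1)
  simp only [compensatedMatrix, Matrix.of_apply, Option.elim]
  exact (h3 _ _ _ _).add (memLp_const _)

/-- Noises of different nodes are uncorrelated, so a bias arises only on the diagonal blocks. There
it is `weightMatrix γ i i * σ_i² h / α_i` with `weightMatrix γ i i = -∑ γ i j`, which the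
compensating term cancels exactly. -/
lemma integral_compensatedMatrix [IsProbabilityMeasure P] (hnet : IsSensorNetwork G γ α)
    {f : Ω → ℝ} {ση : Fin n → ℝ} {g : Fin n → Ω → ℝ} (hf : HasMean P f xbar)
    (hff : HasMean P (fun ω => f ω ^ 2) (s ^ 2)) (hg : ∀ i, HasMean P (g i) 0)
    (hfg : ∀ i, HasMean P (fun ω => f ω * g i ω) 0)
    (hgg : ∀ i j, HasMean P (fun ω => g i ω * g j ω) (if i = j then ση i ^ 2 else 0))
    (k l : Fin n × Fin 2) :
    ∫ ω, compensatedMatrix α β γ ση (fun k => k.elim (f ω) fun i => g i ω) k l ∂P =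
        systemMatrix α β γ xbar (s ^ 2) k l := by
  obtain ⟨i, c⟩ := k
  obtain ⟨j, c'⟩ := l
  have hαi := hnet.gain_ne i
  rw [systemMatrix_apply, phiBlock_eq_regressor]
  simp only [compensatedMatrix, Matrix.of_apply, Option.elim]
  have hdiag := hnet.weightMatrix_diag i
  generalize (∑ j, γ i j) = S at hdiag ⊢
  generalize (![α i, β i] : Fin 2 → ℝ) c = h
  generalize (![0, 1] : Fin 2 → ℝ) c = e
  have mone : ∀ a : ℝ, HasMean P (fun _ => a) a := fun a => ⟨integrable_const _, by simp⟩
  by_cases hc' : c' = 0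
  · simp only [hc', if_true, and_true]
    rw [((((hf.mul_affine hff (hg j) (hfg i) (hfg j) (hgg i j) e h (α i) (β i)
      (α j)⁻¹).const_mul (weightMatrix γ i j)).add (mone _))).eq]
    split_ifs with hij
    · subst hij
      rw [hdiag]
      field_simp
      ring
    · ring
  · simp only [hc', if_false, and_false, add_zero]
    rw [((hf.affine (hg i) e h (α i) (β i)).const_mul (weightMatrix γ i j)).eq]
    ring

variable [IsProbabilityMeasure P]

/-- The noise is purely multiplicative, hence the zero additive term below. The matrix entries are
products of two noisy outputs, which explains the fourth moments. -/
theorem consensusRate_compensatedParams (hnet : IsSensorNetwork G γ α) (hA : HasSpanningTree G)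
    (hstep : IsStepSize δ) (hℓ : 0 ≤ ℓ)
    (hδ : Tendsto (fun t => (δ (t + 1))⁻¹ - (δ t)⁻¹) atTop (𝓝 ℓ))
    {η : Fin n → ℤ → Ω → ℝ} {ση : Fin n → ℝ}
    (hx : IIDSignal x P xbar s) (hs : 0 < s ^ 2 - xbar ^ 2) (hη : MeasurementNoise x η P ση) :
    ConsensusRate P δ (systemMatrix α β γ xbar (s ^ 2))
      (fun t ω => equivParams α β (compensatedParams α β γ δ ση x η t ω)) := by
  have hpq : xbar ^ 2 < s ^ 2 := by linarith
  obtain ⟨m, L, c, hL⟩ := hnet.exists_isLyapunovFactor (β := β) hA hpq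
  let Y : Option (Fin n) → ℕ → Ω → ℝ := fun k t => k.elim (x t) (fun i => η i t)
  have hYiid : ∀ i, IsIID (Y i) P := by
    rintro (_ | i)
    · exact hx.iid.comp_injective Nat.cast_injective
    · exact (hη.iid i).comp_injective Nat.cast_injective
  have hYi : iIndepFun (fun p : Option (Fin n) × ℕ => Y p.1 p.2) P := by
    refine iIndepFun_of_iIndep_processSigma (fun i => (hYiid i).measurable) ?_
      fun i => (hYiid i).indep
    refine iIndep_of_iIndep_of_le hη.indep ?_
    rintro (_ | i)
    · exact processSigma_comp_le x Nat.cast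
    · exact processSigma_comp_le (η i) Nat.cast
  have hx4 := hx.memLp (0 : ℕ)
  have hpair : ∀ a b : Option (Fin n), a ≠ b →
      ∫ ω, Y a 0 ω * Y b 0 ω ∂P = (∫ ω, Y a 0 ω ∂P) * ∫ ω, Y b 0 ω ∂P := by
    intro a b hab
    exact (hYi.indepFun (i := (a, 0)) (j := (b, 0)) (by simp [hab])).integral_fun_mul_eq_mul_integral
      ((hYiid a).measurable 0).aestronglyMeasurable ((hYiid b).measurable 0).aestronglyMeasurable
  have hη0 : ∀ i, ∫ ω, Y (some i) 0 ω ∂P = 0 := fun i => hη.mean i _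
  have hx2 : MemLp (x (0 : ℕ)) 2 P := MemLp.two_of_four hx4
  have hη2 : ∀ i, MemLp (η i (0 : ℕ)) 2 P := fun i => hη.memLp_two i _
  have hgg : ∀ i j, HasMean P (fun ω => η i (0 : ℕ) ω * η j (0 : ℕ) ω)
      (if i = j then ση i ^ 2 else 0) := by
    intro i j
    refine ⟨(hη2 i).integrable_mul (hη2 j), ?_⟩
    split_ifs with hij
    · subst hij
      simp only [← sq]
      exact hη.sq i _
    · exact (hpair (some i) (some j) (by simpa using hij)).trans (by rw [hη0 i, zero_mul])
  have hmean : ∀ k l, _ := integral_compensatedMatrix (β := β) hnet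
    (f := x (0 : ℕ)) (g := fun i => η i (0 : ℕ))
    ⟨hx2.integrable one_le_two, hx.mean _⟩ ⟨hx2.integrable_sq, hx.sq _⟩
    (fun i => ⟨(hη2 i).integrable one_le_two, hη.mean i _⟩)
    (fun i => ⟨hx2.integrable_mul (hη2 i),
      (hpair none (some i) (by simp)).trans (by rw [hη0 i, mul_zero])⟩) hgg
  obtain ⟨hmem, M, t₁, hM⟩ := hL.integral_le_rpow_of_iid (hnet.systemMatrix_semisimple hA hpq) hstep
    hℓ hδ (Y := Y) (fun i t => (hYiid i).measurable t) hYi (fun i t => (hYiid i).ident t 0)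
    (A := compensatedMatrix α β γ ση) (fun k l => by
      simp only [compensatedMatrix, Matrix.of_apply]
      split_ifs <;> fun_prop)
    (N := fun _ => 0) (fun k => measurable_const)
    (compensatedMatrix_memLp hx4 (fun i => hη.memLp i (0 : ℕ)) ση) (fun k => memLp_const 0) hmean
    (fun k => by simp)
    (X := fun t ω => equivParams α β (compensatedParams α β γ δ ση x η t ω))
    (x₀ := equivParams α β fun _ => ![1, 0]) (fun ω => rfl)
    (fun t ω => by
      rw [add_zero]
      exact equivParams_compensatedParams_succ hnet.gain_ne β γ δ ση x η t ω)
  exact hnet.consensusRate hA hstep hpq L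
    (fun v hv => (hnet.systemMatrix_mulVec_eq_zero_iff hA hpq v).1 ((hL.ker_iff v).1 hv))
    (fun t k => (hmem t k).aestronglyMeasurable)
    (fun t => integrable_sqNorm (memLp_mulVec L (hmem t)))
    (rateExponent_pos (by have := hL.pos; positivity) hℓ) (rateExponent_lt_one _ _) hM

end MeasurementNoise

/-! ### Euclidean norms and the triangle inequality in `L²` -/

section EuclideanNorm

variable {ι κ : Type*} [Fintype ι] [Fintype κ]

/-- The Euclidean norm of a vector. -/
noncomputable def nrm (v : ι → ℝ) : ℝ := √(sqNorm v)

lemma nrm_eq (v : ι → ℝ) : nrm v = ‖WithLp.toLp 2 v‖ := by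
  rw [nrm, EuclideanSpace.norm_eq]
  simp [sqNorm]

lemma nrm_nonneg (v : ι → ℝ) : 0 ≤ nrm v := Real.sqrt_nonneg _

lemma nrm_sq (v : ι → ℝ) : nrm v ^ 2 = sqNorm v := Real.sq_sqrt (sqNorm_nonneg v)

lemma nrm_add_le (v w : ι → ℝ) : nrm (v + w) ≤ nrm v + nrm w := by
  simp only [nrm_eq, WithLp.toLp_add]
  exact norm_add_le _ _

lemma nrm_smul (a : ℝ) (v : ι → ℝ) : nrm (a • v) = |a| * nrm v := by
  simp only [nrm_eq, WithLp.toLp_smul, norm_smul, Real.norm_eq_abs]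

lemma nrm_neg (v : ι → ℝ) : nrm (-v) = nrm v := by
  simp only [nrm_eq, WithLp.toLp_neg, norm_neg]

lemma nrm_sub_le (v w : ι → ℝ) : nrm (v - w) ≤ nrm v + nrm w := by
  rw [sub_eq_add_neg, ← nrm_neg w]
  exact nrm_add_le _ _

lemma nrm_sum_le {J : Type*} (s : Finset J) (v : J → ι → ℝ) :
    nrm (∑ j ∈ s, v j) ≤ ∑ j ∈ s, nrm (v j) := by
  simp only [nrm_eq, WithLp.toLp_sum]
  exact norm_sum_le _ _

lemma abs_dotProduct_le (v w : ι → ℝ) : |v ⬝ᵥ w| ≤ nrm v * nrm w := by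
  have := abs_real_inner_le_norm (WithLp.toLp 2 w) (WithLp.toLp 2 v)
  rw [EuclideanSpace.inner_eq_star_dotProduct] at this
  rw [nrm_eq, nrm_eq, mul_comm]
  simpa using this

lemma sqNorm_le_of_nrm_le {v : ι → ℝ} {w : κ → ℝ} {a : ℝ} (h : nrm v ≤ a * nrm w) :
    sqNorm v ≤ a ^ 2 * sqNorm w := by
  rw [← nrm_sq, ← nrm_sq, ← mul_pow]
  exact pow_le_pow_left₀ (nrm_nonneg _) h 2

lemma nrm_le_of_sqNorm_le {v : ι → ℝ} {w : κ → ℝ} {a : ℝ} (ha : 0 ≤ a)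
    (h : sqNorm v ≤ a ^ 2 * sqNorm w) : nrm v ≤ a * nrm w := by
  rw [nrm, nrm, ← Real.sqrt_sq ha, ← Real.sqrt_mul (sq_nonneg a)]
  exact Real.sqrt_le_sqrt h

lemma nrm_mulVec_le (A : Matrix κ ι ℝ) (v : ι → ℝ) : nrm (A *ᵥ v) ≤ √(frobSq A) * nrm v :=
  nrm_le_of_sqNorm_le (Real.sqrt_nonneg _) (by
    rw [Real.sq_sqrt (frobSq_nonneg A)]; exact sqNorm_mulVec_le A v)

lemma measurable_sqNorm {Ω : Type*} {m : MeasurableSpace Ω} {X : Ω → ι → ℝ}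
    (hX : ∀ i, Measurable[m] fun ω => X ω i) : Measurable[m] fun ω => sqNorm (X ω) :=
  Finset.measurable_sum _ fun i _ => (hX i).pow_const 2

variable {Ω : Type*} [mΩ : MeasurableSpace Ω] {P : Measure Ω}

lemma memLp_of_sqNorm_le {X : Ω → ι → ℝ} (hX : ∀ i, Measurable fun ω => X ω i) {g : Ω → ℝ}
    (hg : Integrable g P) (h : ∀ ω, sqNorm (X ω) ≤ g ω) (i : ι) : MemLp (fun ω => X ω i) 2 P := by
  refine (memLp_two_iff_integrable_sq (hX i).aestronglyMeasurable).2
    (hg.mono' ((hX i).pow_const 2).aestronglyMeasurable (ae_of_all _ fun ω => ?_))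
  rw [Real.norm_eq_abs, abs_of_nonneg (sq_nonneg _)]
  exact (sq_le_sqNorm _ i).trans (h ω)

lemma integral_sqNorm_nonneg (X : Ω → ι → ℝ) : 0 ≤ ∫ ω, sqNorm (X ω) ∂P :=
  integral_nonneg fun _ => sqNorm_nonneg _

lemma integral_sqNorm_add {X Y : Ω → ι → ℝ} (hX : ∀ i, MemLp (fun ω => X ω i) 2 P)
    (hY : ∀ i, MemLp (fun ω => Y ω i) 2 P) : ∫ ω, sqNorm (X ω + Y ω) ∂P =
      ∫ ω, sqNorm (X ω) ∂P + 2 * ∫ ω, X ω ⬝ᵥ Y ω ∂P + ∫ ω, sqNorm (Y ω) ∂P := by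
  simp only [sqNorm_add]
  rw [integral_add ((integrable_sqNorm hX).fun_add ((integrable_dotProduct hX hY).const_mul 2))
    (integrable_sqNorm hY), integral_add (integrable_sqNorm hX)
    ((integrable_dotProduct hX hY).const_mul 2), integral_const_mul]

/-- The triangle inequality in `L²`. -/
lemma sqrt_integral_sqNorm_add_le {X Y : Ω → ι → ℝ} (hX : ∀ i, MemLp (fun ω => X ω i) 2 P)
    (hY : ∀ i, MemLp (fun ω => Y ω i) 2 P) : √(∫ ω, sqNorm (X ω + Y ω) ∂P) ≤
      √(∫ ω, sqNorm (X ω) ∂P) + √(∫ ω, sqNorm (Y ω) ∂P) := by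
  set a := ∫ ω, sqNorm (X ω) ∂P with ha
  set b := ∫ ω, X ω ⬝ᵥ Y ω ∂P with hb
  set c := ∫ ω, sqNorm (Y ω) ∂P with hc
  have ha0 : 0 ≤ a := integral_sqNorm_nonneg _
  have hc0 : 0 ≤ c := integral_sqNorm_nonneg _
  -- Cauchy-Schwarz for the cross term, from `E|X + θ Y|² ≥ 0` for all `θ`.
  have hd : discrim c (2 * b) a ≤ 0 := by
    refine discrim_le_zero fun θ => ?_
    have h1 := integral_sqNorm_add hX (Y := fun ω => θ • Y ω) fun i => (hY i).const_mul θ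
    simp only [dotProduct_smul, sqNorm_smul, smul_eq_mul, integral_const_mul] at h1
    rw [← ha, ← hb, ← hc] at h1
    have := integral_sqNorm_nonneg (P := P) fun ω => X ω + θ • Y ω
    linarith
  have hb2 : b ≤ √a * √c := by
    rw [← Real.sqrt_mul ha0]
    refine Real.le_sqrt_of_sq_le ?_
    rw [discrim] at hd
    linarith
  rw [integral_sqNorm_add hX hY]
  refine Real.sqrt_le_iff.2 ⟨by positivity, ?_⟩
  rw [add_sq, Real.sq_sqrt ha0, Real.sq_sqrt hc0]
  linarith

end EuclideanNorm

/-! ### Transition matrices -/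

section Flow

variable {Ω ι κ : Type*} [Fintype ι] [DecidableEq ι]

/-- The transition matrices from time `s` to time `T` of `y(t+1) = (I + δ(t) D(t)) y(t)`. -/
def flow (δ : ℕ → ℝ) (D : ℕ → Matrix ι ι ℝ) (s : ℕ) : ℕ → Matrix ι ι ℝ
  | 0 => 1
  | T + 1 => if s ≤ T then (1 + δ T • D T) * flow δ D s T else 1

variable {δ : ℕ → ℝ} {D : ℕ → Matrix ι ι ℝ} {s : ℕ}

lemma flow_self : flow δ D s s = 1 := by
  cases s <;> simp [flow]

lemma flow_succ {T : ℕ} (h : s ≤ T) : flow δ D s (T + 1) = (1 + δ T • D T) * flow δ D s T := by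
  rw [flow, if_pos h]

lemma flow_succ_mulVec {T : ℕ} (h : s ≤ T) (v : ι → ℝ) : flow δ D s (T + 1) *ᵥ v =
    flow δ D s T *ᵥ v + δ T • (D T *ᵥ (flow δ D s T *ᵥ v)) := by
  rw [flow_succ h, ← Matrix.mulVec_mulVec, Matrix.add_mulVec, Matrix.one_mulVec,
    Matrix.smul_mulVec]

lemma flow_eq_flow_succ_mul {T : ℕ} (h : s < T) :
    flow δ D s T = flow δ D (s + 1) T * (1 + δ s • D s) := by
  induction T, h using Nat.le_induction with
  | base => rw [flow_succ le_rfl, flow_self, Nat.succ_eq_add_one, flow_self, mul_one, one_mul]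
  | succ T hT ih =>
    rw [flow_succ (Nat.le_of_succ_le hT), flow_succ hT, ih, mul_assoc]

variable [Fintype κ]

/-- Each step changes `L y` by at most the fraction `ε` of its current size; compounding gives `(1 +
ε) ^ k - 1`. This allows the state to be replaced by its value a fixed number of steps earlier. -/
lemma nrm_sub_flow_le {L : Matrix κ ι ℝ} {b ε : ℝ} (hδ : ∀ t, 0 ≤ δ t) (hε0 : 0 ≤ ε)
    (hD : ∀ t v, nrm (L *ᵥ (D t *ᵥ v)) ≤ b * nrm (L *ᵥ v)) (hε : ∀ t ≥ s, b * δ t ≤ ε) (v : ι → ℝ)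
    {r : ℕ} (hr : s ≤ r) (k : ℕ) :
    nrm (L *ᵥ (flow δ D s (r + k) *ᵥ v) - L *ᵥ (flow δ D s r *ᵥ v)) ≤
      ((1 + ε) ^ k - 1) * nrm (L *ᵥ (flow δ D s r *ᵥ v)) := by
  induction k with
  | zero => simp [nrm, sqNorm_zero]
  | succ k ih =>
    set N := nrm (L *ᵥ (flow δ D s r *ᵥ v)) with hN
    have hN0 : 0 ≤ N := nrm_nonneg _
    have h1 : nrm (L *ᵥ (flow δ D s (r + k) *ᵥ v)) ≤ (1 + ε) ^ k * N := by
      have := nrm_add_le (L *ᵥ (flow δ D s (r + k) *ᵥ v) - L *ᵥ (flow δ D s r *ᵥ v))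
        (L *ᵥ (flow δ D s r *ᵥ v))
      rw [sub_add_cancel] at this
      linarith
    have h2 := hD (r + k) (flow δ D s (r + k) *ᵥ v)
    have h3 := hε (r + k) (by omega)
    rw [← add_assoc, flow_succ_mulVec (by omega), Matrix.mulVec_add, Matrix.mulVec_smul,
      add_sub_right_comm]
    refine (nrm_add_le _ _).trans ?_
    rw [nrm_smul, abs_of_nonneg (hδ _)]
    have h4 : δ (r + k) * nrm (L *ᵥ (D (r + k) *ᵥ (flow δ D s (r + k) *ᵥ v))) ≤
        ε * ((1 + ε) ^ k * N) := by
      calc _ ≤ δ (r + k) * (b * nrm (L *ᵥ (flow δ D s (r + k) *ᵥ v))) := by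
            have := hδ (r + k); gcongr
        _ = (b * δ (r + k)) * nrm (L *ᵥ (flow δ D s (r + k) *ᵥ v)) := by ring
        _ ≤ ε * nrm (L *ᵥ (flow δ D s (r + k) *ᵥ v)) := by
            have := nrm_nonneg (L *ᵥ (flow δ D s (r + k) *ᵥ v)); gcongr
        _ ≤ _ := by gcongr
    calc _ ≤ ((1 + ε) ^ k - 1) * N + ε * ((1 + ε) ^ k * N) := add_le_add ih h4
      _ = _ := by ring

end Flow

/-! ### Random transition matrices -/

section RandomFlow

variable {Ω ι : Type*} [Fintype ι] [DecidableEq ι]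

/-- The transition matrices of the random recursion. -/
abbrev randomFlow (δ : ℕ → ℝ) (D : ℕ → Ω → Matrix ι ι ℝ) (s T : ℕ) (ω : Ω) : Matrix ι ι ℝ :=
  flow δ (fun t => D t ω) s T

lemma measurable_randomFlow_entry {m : MeasurableSpace Ω} {δ : ℕ → ℝ}
    {D : ℕ → Ω → Matrix ι ι ℝ} {s T : ℕ}
    (hD : ∀ t < T, ∀ i j, Measurable[m] fun ω => D t ω i j) (i j : ι) :
    Measurable[m] fun ω => randomFlow δ D s T ω i j := by
  induction T generalizing i j with
  | zero => exact measurable_const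
  | succ T ih =>
    by_cases hsT : s ≤ T
    · simp only [randomFlow, flow_succ hsT, Matrix.mul_apply, Matrix.add_apply, Matrix.smul_apply,
        smul_eq_mul]
      refine Finset.measurable_sum _ fun k _ => ?_
      exact (measurable_const.add (measurable_const.mul (hD T (Nat.lt_succ_self T) i k))).mul
        (ih (fun t ht => hD t (ht.trans (Nat.lt_succ_self T))) k j)
    · simp only [randomFlow, flow, if_neg hsT]
      exact measurable_const

end RandomFlow

/-! ### Drift which is negative on average -/

section AveragedDrift

variable {Ω : Type*} [mΩ : MeasurableSpace Ω] {P : Measure Ω} {ι κ : Type*} [Fintype ι]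
  [Fintype κ]

/-- Random matrices `D t`, adapted to `𝒢`, which are controlled by `L` and which decrease the
norm of `L v` on average when `v` depends only on the `τ`-delayed past. -/
structure AveragedDrift (P : Measure Ω) (𝒢 : ℕ → MeasurableSpace Ω) (D : ℕ → Ω → Matrix ι ι ℝ)
    (L : Matrix κ ι ℝ) (b c : ℝ) (τ : ℕ) : Prop where
  b_nonneg : 0 ≤ b
  c_pos : 0 < c
  mono : Monotone 𝒢
  le : ∀ t, 𝒢 t ≤ mΩ
  measurable : ∀ t i j, Measurable[𝒢 t] fun ω => D t ω i j
  nrm_le : ∀ t ω v, nrm (D t ω *ᵥ v) ≤ b * nrm (L *ᵥ v)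
  nrm_apply_le : ∀ t ω v, nrm (L *ᵥ (D t ω *ᵥ v)) ≤ b * nrm (L *ᵥ v)
  drift : ∀ t ≥ τ, ∀ y : Ω → ι → ℝ, (∀ i, Measurable[𝒢 (t - τ)] fun ω => y ω i) →
    (∀ i, MemLp (fun ω => y ω i) 2 P) →
    ∫ ω, (L *ᵥ y ω) ⬝ᵥ (L *ᵥ (D t ω *ᵥ y ω)) ∂P ≤ -c * ∫ ω, sqNorm (L *ᵥ y ω) ∂P

variable {𝒢 : ℕ → MeasurableSpace Ω} {D : ℕ → Ω → Matrix ι ι ℝ} {L : Matrix κ ι ℝ} {b c : ℝ}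
  {τ : ℕ} {δ : ℕ → ℝ}

lemma AveragedDrift.memLp_apply (h : AveragedDrift P 𝒢 D L b c τ) (t : ℕ) {y : Ω → ι → ℝ}
    (hym : ∀ i, Measurable fun ω => y ω i) (hy : ∀ i, MemLp (fun ω => y ω i) 2 P) (i : ι) :
    MemLp (fun ω => (D t ω *ᵥ y ω) i) 2 P :=
  memLp_of_sqNorm_le
    (measurable_mulVec (fun i j => (h.measurable t i j).mono (h.le t) le_rfl) hym)
    ((integrable_sqNorm (memLp_mulVec L hy)).const_mul (b ^ 2))
    (fun ω => sqNorm_le_of_nrm_le (h.nrm_le t ω (y ω))) i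

variable [DecidableEq ι] {s : ℕ} {v : Ω → ι → ℝ}

lemma AveragedDrift.measurable_flow (h : AveragedDrift P 𝒢 D L b c τ)
    (hvm : ∀ i, Measurable[𝒢 s] fun ω => v ω i) {T : ℕ} (hT : s ≤ T) (i : ι) :
    Measurable[𝒢 T] fun ω => (randomFlow δ D s T ω *ᵥ v ω) i :=
  measurable_mulVec (measurable_randomFlow_entry fun t ht i j =>
    (h.measurable t i j).mono (h.mono ht.le) le_rfl)
    (fun i => (hvm i).mono (h.mono hT) le_rfl) i

lemma AveragedDrift.memLp_flow (h : AveragedDrift P 𝒢 D L b c τ)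
    (hvm : ∀ i, Measurable[𝒢 s] fun ω => v ω i) (hv : ∀ i, MemLp (fun ω => v ω i) 2 P) {T : ℕ}
    (hT : s ≤ T) (i : ι) : MemLp (fun ω => (randomFlow δ D s T ω *ᵥ v ω) i) 2 P := by
  induction T, hT using Nat.le_induction generalizing i with
  | base => simpa only [randomFlow, flow_self, Matrix.one_mulVec] using hv i
  | succ T hT ih =>
    simp only [randomFlow, flow_succ_mulVec hT]
    exact (ih i).add ((h.memLp_apply T
      (fun i => (h.measurable_flow hvm hT i).mono (h.le T) le_rfl) ih i).const_mul (δ T))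

lemma exists_pow_sub_one_le (τ : ℕ) {κ₀ : ℝ} (hκ : 0 < κ₀) : ∃ ε > 0, (1 + ε) ^ τ - 1 ≤ κ₀ := by
  have h1 : Tendsto (fun ε : ℝ => (1 + ε) ^ τ - 1) (𝓝[>] 0) (𝓝 0) :=
    ((by fun_prop : Continuous fun ε : ℝ => (1 + ε) ^ τ - 1).tendsto' 0 0 (by simp)).mono_left
      nhdsWithin_le_nhds
  obtain ⟨ε, h2, h3⟩ := ((h1.eventually_le_const hκ).and self_mem_nhdsWithin).exists
  exact ⟨ε, h3, h2⟩

/-- One step of the flow contracts `E|L y|²`, once the flow has run for `τ` steps. -/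
lemma AveragedDrift.integral_succ_le (h : AveragedDrift P 𝒢 D L b c τ) (hδ : ∀ t, 0 ≤ δ t)
    {κ₀ ε : ℝ} (hε0 : 0 ≤ ε) (hκ0 : (1 + ε) ^ τ - 1 ≤ κ₀) (hκ1 : κ₀ ≤ 2 / 5)
    (hκ2 : b * κ₀ ≤ c / 10) (hb1 : ∀ t ≥ s, b * δ t ≤ ε) (hb2 : ∀ t ≥ s, b ^ 2 * δ t ≤ c / 4)
    (hvm : ∀ i, Measurable[𝒢 s] fun ω => v ω i) (hv : ∀ i, MemLp (fun ω => v ω i) 2 P) {r : ℕ}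
    (hr : s ≤ r) :
    ∫ ω, sqNorm (L *ᵥ (randomFlow δ D s (r + τ + 1) ω *ᵥ v ω)) ∂P ≤
      (1 - c / 2 * δ (r + τ)) * ∫ ω, sqNorm (L *ᵥ (randomFlow δ D s (r + τ) ω *ᵥ v ω)) ∂P := by
  have hb := h.b_nonneg
  have hc := h.c_pos
  set t := r + τ with ht
  set y' : Ω → ι → ℝ := fun ω => randomFlow δ D s r ω *ᵥ v ω with hy'
  set y : Ω → ι → ℝ := fun ω => randomFlow δ D s t ω *ᵥ v ω with hy
  have hst : s ≤ t := by omega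
  have hκ00 : 0 ≤ κ₀ := le_trans (sub_nonneg.2 (one_le_pow₀ (by linarith))) hκ0
  have hym : ∀ i, Measurable fun ω => y ω i := fun i =>
    (h.measurable_flow hvm hst i).mono (h.le t) le_rfl
  have hy2 : ∀ i, MemLp (fun ω => y ω i) 2 P := h.memLp_flow hvm hv hst
  have hym' : ∀ i, Measurable fun ω => y' ω i := fun i =>
    (h.measurable_flow hvm hr i).mono (h.le r) le_rfl
  have hy2' : ∀ i, MemLp (fun ω => y' ω i) 2 P := h.memLp_flow hvm hv hr
  have hDy := h.memLp_apply t hym hy2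
  have hDy' := h.memLp_apply t hym' hy2'
  have hLy := memLp_mulVec L hy2
  have hLy' := memLp_mulVec L hy2'
  have hclose : ∀ ω, nrm (L *ᵥ y ω - L *ᵥ y' ω) ≤ κ₀ * nrm (L *ᵥ y' ω) := fun ω =>
    (nrm_sub_flow_le hδ hε0 (fun t v => h.nrm_apply_le t ω v) hb1 (v ω) hr τ).trans
      (mul_le_mul_of_nonneg_right hκ0 (nrm_nonneg _))
  have hle : ∀ ω, nrm (L *ᵥ y ω) ≤ (1 + κ₀) * nrm (L *ᵥ y' ω) := by
    intro ω
    have := nrm_add_le (L *ᵥ y ω - L *ᵥ y' ω) (L *ᵥ y' ω)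
    rw [sub_add_cancel] at this
    linarith [hclose ω]
  -- The drift hypothesis applies to `y'`, which is known `τ` steps before `t`. Exchanging `y` for
  -- `y'` costs `b κ₀ (2 + κ₀) |L y'|²`, at most `(c / 10)(12 / 5) < c / 4` times `|L y'|²`.
  have hcross : ∀ ω, (L *ᵥ y ω) ⬝ᵥ (L *ᵥ (D t ω *ᵥ y ω)) ≤
      (L *ᵥ y' ω) ⬝ᵥ (L *ᵥ (D t ω *ᵥ y' ω)) + c / 4 * sqNorm (L *ᵥ y' ω) := by
    intro ω
    set N := nrm (L *ᵥ y' ω) with hN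
    have hN0 : 0 ≤ N := nrm_nonneg _
    have e : (L *ᵥ y ω) ⬝ᵥ (L *ᵥ (D t ω *ᵥ y ω)) = (L *ᵥ y' ω) ⬝ᵥ (L *ᵥ (D t ω *ᵥ y' ω)) +
        (L *ᵥ y ω - L *ᵥ y' ω) ⬝ᵥ (L *ᵥ (D t ω *ᵥ y ω)) +
        (L *ᵥ y' ω) ⬝ᵥ (L *ᵥ (D t ω *ᵥ (y ω - y' ω))) := by
      simp only [Matrix.mulVec_sub, dotProduct_sub, sub_dotProduct]
      ring
    have h1 := (le_abs_self _).trans (abs_dotProduct_le (L *ᵥ y ω - L *ᵥ y' ω)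
      (L *ᵥ (D t ω *ᵥ y ω)))
    have h2 := (le_abs_self _).trans (abs_dotProduct_le (L *ᵥ y' ω)
      (L *ᵥ (D t ω *ᵥ (y ω - y' ω))))
    have h3 := h.nrm_apply_le t ω (y ω)
    have h4 := h.nrm_apply_le t ω (y ω - y' ω)
    rw [Matrix.mulVec_sub L] at h4
    have h5 : nrm (L *ᵥ y ω - L *ᵥ y' ω) * nrm (L *ᵥ (D t ω *ᵥ y ω)) ≤
        (κ₀ * N) * (b * ((1 + κ₀) * N)) := by
      have := hclose ω
      have := h3.trans (mul_le_mul_of_nonneg_left (hle ω) hb)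
      exact mul_le_mul (hclose ω) this (nrm_nonneg _) (by positivity)
    have h6 : nrm (L *ᵥ y' ω) * nrm (L *ᵥ (D t ω *ᵥ (y ω - y' ω))) ≤ N * (b * (κ₀ * N)) := by
      have := h4.trans (mul_le_mul_of_nonneg_left (hclose ω) hb)
      exact mul_le_mul_of_nonneg_left this hN0
    have h7 : (κ₀ * N) * (b * ((1 + κ₀) * N)) + N * (b * (κ₀ * N)) ≤ c / 4 * sqNorm (L *ᵥ y' ω) := by
      rw [← nrm_sq, ← hN]
      have : b * κ₀ * (2 + κ₀) ≤ c / 10 * (2 + 2 / 5) := by gcongr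
      have h8 : b * κ₀ * (2 + κ₀) ≤ c / 4 := by linarith
      calc _ = b * κ₀ * (2 + κ₀) * N ^ 2 := by ring
        _ ≤ _ := by gcongr
    rw [e]
    linarith
  have hdrift := h.drift t (by omega) y' (fun i => by
    have : t - τ = r := by omega
    rw [this]
    exact h.measurable_flow hvm hr i) hy2'
  set V := ∫ ω, sqNorm (L *ᵥ y ω) ∂P with hV
  set V' := ∫ ω, sqNorm (L *ᵥ y' ω) ∂P with hV'
  have hV0 : 0 ≤ V := integral_sqNorm_nonneg _
  have hV0' : 0 ≤ V' := integral_sqNorm_nonneg _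
  have hVV' : V ≤ 2 * V' := by
    rw [hV, hV', ← integral_const_mul]
    refine integral_mono (integrable_sqNorm hLy) ((integrable_sqNorm hLy').const_mul 2) fun ω => ?_
    refine (sqNorm_le_of_nrm_le (hle ω)).trans ?_
    have := sqNorm_nonneg (L *ᵥ y' ω)
    have : (1 + κ₀) ^ 2 ≤ 2 := by nlinarith
    gcongr
  have hI : ∫ ω, (L *ᵥ y ω) ⬝ᵥ (L *ᵥ (D t ω *ᵥ y ω)) ∂P ≤ -c * V' + c / 4 * V' := by
    have hi1 := integrable_dotProduct hLy' (memLp_mulVec L hDy')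
    have hi2 := (integrable_sqNorm hLy').const_mul (c / 4)
    have h1 := integral_mono (integrable_dotProduct hLy (memLp_mulVec L hDy)) (hi1.fun_add hi2)
      hcross
    rw [integral_add hi1 hi2, integral_const_mul] at h1
    linarith
  have hD2 : ∫ ω, sqNorm (L *ᵥ (D t ω *ᵥ y ω)) ∂P ≤ b ^ 2 * V := by
    rw [hV, ← integral_const_mul]
    exact integral_mono (integrable_sqNorm (memLp_mulVec L hDy))
      ((integrable_sqNorm hLy).const_mul _) fun ω => sqNorm_le_of_nrm_le (h.nrm_apply_le t ω _)
  have hstep : ∀ ω, L *ᵥ (randomFlow δ D s (t + 1) ω *ᵥ v ω) =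
      L *ᵥ y ω + δ t • (L *ᵥ (D t ω *ᵥ y ω)) := by
    intro ω
    rw [randomFlow, flow_succ_mulVec hst, Matrix.mulVec_add, Matrix.mulVec_smul]
  simp only [hstep]
  rw [integral_sqNorm_add hLy (Y := fun ω => δ t • (L *ᵥ (D t ω *ᵥ y ω)))
    (fun i => (memLp_mulVec L hDy i).const_mul (δ t))]
  simp only [dotProduct_smul, sqNorm_smul, smul_eq_mul, integral_const_mul]
  rw [← hV]
  have hδt := hδ t
  -- Budget: the drift gives `-(3c / 4) V' ≤ -(3c / 8) V`, doubled as a cross term; the quadratic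
  -- term costs `c / 4`, which leaves `c / 2`.
  have h1 : δ t * ∫ ω, (L *ᵥ y ω) ⬝ᵥ (L *ᵥ (D t ω *ᵥ y ω)) ∂P ≤ δ t * (-(3 / 4 * c) * V') :=
    mul_le_mul_of_nonneg_left (by linarith) hδt
  have h2 : δ t * (-(3 / 4 * c) * V') ≤ δ t * (-(3 / 8 * c) * V) := by
    refine mul_le_mul_of_nonneg_left ?_ hδt
    have : 3 / 4 * c * V ≤ 3 / 4 * c * (2 * V') := by gcongr
    linarith
  have h3 : δ t ^ 2 * ∫ ω, sqNorm (L *ᵥ (D t ω *ᵥ y ω)) ∂P ≤ c / 4 * δ t * V := by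
    calc _ ≤ δ t ^ 2 * (b ^ 2 * V) := by gcongr
      _ = (b ^ 2 * δ t) * δ t * V := by ring
      _ ≤ _ := by
        have := hb2 t hst
        gcongr
  linarith

/-- `∏_{s ≤ r < t} (1 - c δ(r))`. -/
def decay (δ : ℕ → ℝ) (c : ℝ) (s t : ℕ) : ℝ := ∏ r ∈ Finset.Ico s t, (1 - c * δ r)

lemma decay_self (c : ℝ) (s : ℕ) : decay δ c s s = 1 := by simp [decay]

lemma decay_succ (c : ℝ) {s t : ℕ} (h : s ≤ t) :
    decay δ c s (t + 1) = (1 - c * δ t) * decay δ c s t := by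
  rw [decay, Finset.prod_Ico_succ_top h, mul_comm, decay]

lemma decay_nonneg {c : ℝ} {s : ℕ} (hc : ∀ r ≥ s, c * δ r ≤ 1 / 2) (t : ℕ) : 0 ≤ decay δ c s t :=
  Finset.prod_nonneg fun r hr => by linarith [hc r (Finset.mem_Ico.1 hr).1]

/-- Since `√(1 - u) ≤ 1 - u / 2`, each summand is at most a decrement of `(2 / c) √decay`, and the
sum telescopes. The bound is uniform in `t`, which keeps the flow bounded although `∑ δ` diverges.
-/
lemma sum_mul_sqrt_decay_le {c : ℝ} {s : ℕ} (hc0 : 0 < c) (hc : ∀ r ≥ s, c * δ r ≤ 1 / 2) {t : ℕ}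
    (h : s ≤ t) : ∑ r ∈ Finset.Ico s t, δ r * √(decay δ c s r) ≤
      2 / c * (1 - √(decay δ c s t)) := by
  induction t, h using Nat.le_induction with
  | base => simp [decay_self]
  | succ t ht ih =>
    have h1 := hc t ht
    rw [Finset.sum_Ico_succ_top ht, decay_succ c ht, Real.sqrt_mul (by linarith)]
    set g := √(decay δ c s t) with hg
    have hg0 : 0 ≤ g := Real.sqrt_nonneg _
    have h2 : √(1 - c * δ t) ≤ 1 - c * δ t / 2 :=
      Real.sqrt_le_iff.2 ⟨by linarith, by nlinarith [sq_nonneg (c * δ t)]⟩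
    have h3 : √(1 - c * δ t) * g ≤ (1 - c * δ t / 2) * g := by gcongr
    have h4 : 2 / c * (√(1 - c * δ t) * g) ≤ 2 / c * ((1 - c * δ t / 2) * g) := by gcongr
    have h5 : 2 / c * ((1 - c * δ t / 2) * g) = 2 / c * g - δ t * g := by field_simp
    linarith

end AveragedDrift

/-! ### Contraction and boundedness of the averaged flow -/

section FlowBounds

variable {Ω : Type*} [mΩ : MeasurableSpace Ω] {P : Measure Ω} {ι κ : Type*} [Fintype ι]
  [Fintype κ] [DecidableEq ι] {𝒢 : ℕ → MeasurableSpace Ω} {D : ℕ → Ω → Matrix ι ι ℝ}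
  {L : Matrix κ ι ℝ} {b c : ℝ} {τ : ℕ} {δ : ℕ → ℝ}

/-- The averaged flow contracts `E|L y|²` and does not increase `E|y|²` by more than a constant
factor. -/
theorem AveragedDrift.exists_flow_bound (h : AveragedDrift P 𝒢 D L b c τ) (hstep : IsStepSize δ) :
    ∃ (s₀ : ℕ) (C : ℝ), 0 ≤ C ∧ (∀ r ≥ s₀, c / 2 * δ r ≤ 1 / 2) ∧ ∀ s ≥ s₀, ∀ v : Ω → ι → ℝ,
      (∀ i, Measurable[𝒢 s] fun ω => v ω i) → (∀ i, MemLp (fun ω => v ω i) 2 P) → ∀ T ≥ s,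
      ∫ ω, sqNorm (L *ᵥ (randomFlow δ D s T ω *ᵥ v ω)) ∂P ≤
          C * decay δ (c / 2) s T * ∫ ω, sqNorm (v ω) ∂P ∧
        ∫ ω, sqNorm (randomFlow δ D s T ω *ᵥ v ω) ∂P ≤ C * ∫ ω, sqNorm (v ω) ∂P := by
  have hb := h.b_nonneg
  have hc := h.c_pos
  have hδ : ∀ t, 0 ≤ δ t := fun t => (hstep.pos t).le
  set κ₀ : ℝ := min (2 / 5) (c / (10 * (b + 1))) with hκ₀
  have hκpos : 0 < κ₀ := lt_min (by norm_num) (by positivity)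
  obtain ⟨ε, hε0, hε⟩ := exists_pow_sub_one_le τ hκpos
  obtain ⟨s₀, hs₀⟩ := hstep.eventually_le
    (ε := min (ε / (b + 1)) (min (c / (4 * (b ^ 2 + 1))) (1 / c)))
    (lt_min (by positivity) (lt_min (by positivity) (by positivity)))
  have hδ1 : ∀ r ≥ s₀, b * δ r ≤ ε := by
    intro r hr
    have h1 := (hs₀ r hr).trans (min_le_left _ _)
    rw [le_div_iff₀ (by positivity)] at h1
    nlinarith [hδ r]
  have hδ2 : ∀ r ≥ s₀, b ^ 2 * δ r ≤ c / 4 := by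
    intro r hr
    have h1 := (hs₀ r hr).trans ((min_le_right _ _).trans (min_le_left _ _))
    rw [le_div_iff₀ (by positivity)] at h1
    nlinarith [hδ r]
  have hδ3 : ∀ r ≥ s₀, c / 2 * δ r ≤ 1 / 2 := by
    intro r hr
    have h1 := (hs₀ r hr).trans ((min_le_right _ _).trans (min_le_right _ _))
    rw [le_div_iff₀ hc] at h1
    linarith
  have hbκ : b * κ₀ ≤ c / 10 := by
    have h1 : κ₀ ≤ c / (10 * (b + 1)) := min_le_right _ _
    rw [le_div_iff₀ (by positivity)] at h1
    nlinarith
  -- No contraction is available during the first `τ` steps; there `E|L y|²` at most doubles, while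
  -- `decay` stays above `2 ^ (-τ)`. The constant covers both.
  set C₁ : ℝ := 2 * 2 ^ τ with hC₁
  have hC₁0 : 0 ≤ C₁ := by positivity
  set l := frobSq L with hl
  have hl0 : 0 ≤ l := frobSq_nonneg L
  refine ⟨s₀, max (C₁ * l) ((1 + b * √(C₁ * l) * (4 / c)) ^ 2), le_max_of_le_right (sq_nonneg _), hδ3,
    fun s hs v hvm hv => ?_⟩
  have hδ3' : ∀ r ≥ s, c / 2 * δ r ≤ 1 / 2 := fun r hr => hδ3 r (hs.trans hr)
  have hflow2 : ∀ {T}, s ≤ T → ∀ i, MemLp (fun ω => (randomFlow δ D s T ω *ᵥ v ω) i) 2 P :=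
    fun hT => h.memLp_flow hvm hv hT
  set V : ℕ → ℝ := fun T => ∫ ω, sqNorm (L *ᵥ (randomFlow δ D s T ω *ᵥ v ω)) ∂P with hV
  have hV0 : ∀ T, 0 ≤ V T := fun T => integral_sqNorm_nonneg _
  have hVs : V s ≤ l * ∫ ω, sqNorm (v ω) ∂P := by
    simp only [hV, randomFlow, flow_self, Matrix.one_mulVec]
    rw [← integral_const_mul]
    exact integral_mono (integrable_sqNorm (memLp_mulVec L hv))
      ((integrable_sqNorm hv).const_mul _) fun ω => sqNorm_mulVec_le L _
  have hg0 : ∀ T, 0 ≤ decay δ (c / 2) s T := decay_nonneg hδ3'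
  have hstart : ∀ k ≤ τ, V (s + k) ≤ C₁ * decay δ (c / 2) s (s + k) * V s := by
    intro k hk
    have h1 : V (s + k) ≤ 2 * V s := by
      rw [hV, ← integral_const_mul]
      refine integral_mono (integrable_sqNorm (memLp_mulVec L (hflow2 (by omega))))
        ((integrable_sqNorm (memLp_mulVec L (hflow2 le_rfl))).const_mul 2) fun ω => ?_
      have h2 := nrm_sub_flow_le hδ hε0.le (fun t v => h.nrm_apply_le t ω v)
        (fun t ht => hδ1 t (hs.trans ht)) (v ω) (le_refl s) k
      have h3 := nrm_add_le (L *ᵥ (randomFlow δ D s (s + k) ω *ᵥ v ω) -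
        L *ᵥ (randomFlow δ D s s ω *ᵥ v ω)) (L *ᵥ (randomFlow δ D s s ω *ᵥ v ω))
      rw [sub_add_cancel] at h3
      have h4 : (1 + ε) ^ k ≤ (1 + ε) ^ τ := pow_le_pow_right₀ (by linarith) hk
      have h5 : κ₀ ≤ 2 / 5 := min_le_left _ _
      have h6 : nrm (L *ᵥ (randomFlow δ D s (s + k) ω *ᵥ v ω)) ≤
          (1 + ε) ^ k * nrm (L *ᵥ (randomFlow δ D s s ω *ᵥ v ω)) := by linarith
      refine (sqNorm_le_of_nrm_le h6).trans ?_
      have h7 : ((1 + ε) ^ k) ^ 2 ≤ (1 + 2 / 5) ^ 2 :=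
        pow_le_pow_left₀ (by positivity) (by linarith) 2
      exact mul_le_mul_of_nonneg_right (by linarith) (sqNorm_nonneg _)
    have h2 : (1 / 2 : ℝ) ^ τ ≤ decay δ (c / 2) s (s + k) := by
      calc (1 / 2 : ℝ) ^ τ ≤ (1 / 2 : ℝ) ^ k := pow_le_pow_of_le_one (by norm_num) (by norm_num) hk
        _ = ∏ r ∈ Finset.Ico s (s + k), (1 / 2 : ℝ) := by simp
        _ ≤ _ := Finset.prod_le_prod (fun _ _ => by norm_num) fun r hr => by
          linarith [hδ3' r (Finset.mem_Ico.1 hr).1]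
    have h3 : (2 : ℝ) ≤ C₁ * decay δ (c / 2) s (s + k) := by
      calc (2 : ℝ) = C₁ * (1 / 2) ^ τ := by
            rw [hC₁, mul_assoc, ← mul_pow]; norm_num
        _ ≤ _ := by gcongr
    exact h1.trans (mul_le_mul_of_nonneg_right h3 (hV0 s))
  have hVT : ∀ T ≥ s, V T ≤ C₁ * decay δ (c / 2) s T * V s := by
    intro T hT
    by_cases hTτ : T ≤ s + τ
    · obtain ⟨k, rfl⟩ := Nat.exists_eq_add_of_le hT
      exact hstart k (by omega)
    · obtain ⟨k, rfl⟩ := Nat.exists_eq_add_of_le (not_le.1 hTτ).le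
      clear hT hTτ
      induction k with
      | zero => exact hstart τ le_rfl
      | succ k ih =>
        have h1 := h.integral_succ_le hδ hε0.le hε (min_le_left _ _) hbκ
          (fun t ht => hδ1 t (hs.trans ht)) (fun t ht => hδ2 t (hs.trans ht)) hvm hv
          (r := s + k) (by omega)
        have h2 : s + k + τ = s + τ + k := by ring
        rw [h2] at h1
        have h3 := hδ3' (s + τ + k) (by omega)
        calc V (s + τ + k + 1) ≤ _ := h1
          _ ≤ (1 - c / 2 * δ (s + τ + k)) * (C₁ * decay δ (c / 2) s (s + τ + k) * V s) :=
            mul_le_mul_of_nonneg_left ih (by linarith)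
          _ = _ := by
            rw [← add_assoc, decay_succ _ (by omega)]
            ring
  set S : ℕ → ℝ := fun T => ∫ ω, sqNorm (randomFlow δ D s T ω *ᵥ v ω) ∂P with hS
  have hSs : S s = ∫ ω, sqNorm (v ω) ∂P := by
    simp only [hS, randomFlow, flow_self, Matrix.one_mulVec]
  have hVs' : V s ≤ l * S s := hSs ▸ hVs
  have hVT' : ∀ T ≥ s, √(V T) ≤ √(C₁ * l) * √(decay δ (c / 2) s T) * √(S s) := by
    intro T hT
    rw [← Real.sqrt_mul (by positivity), ← Real.sqrt_mul (mul_nonneg (by positivity) (hg0 T))]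
    refine Real.sqrt_le_sqrt ((hVT T hT).trans ?_)
    have := hg0 T
    calc C₁ * decay δ (c / 2) s T * V s ≤ C₁ * decay δ (c / 2) s T * (l * S s) := by gcongr
      _ = _ := by ring
  -- An increment of the flow is at most `b δ |L y|`, and the `L²` norm of `L y` decays like
  -- `√decay`; so the increments are summed by the triangle inequality.
  have hST : ∀ T ≥ s, √(S T) ≤ √(S s) + b * √(C₁ * l) * √(S s) *
      ∑ r ∈ Finset.Ico s T, δ r * √(decay δ (c / 2) s r) := by
    intro T hT
    induction T, hT using Nat.le_induction with
    | base => simp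
    | succ T hT ih =>
      have hDy := h.memLp_apply T (fun i => (h.measurable_flow (δ := δ) hvm hT i).mono (h.le T) le_rfl)
        (hflow2 hT)
      have h1 := sqrt_integral_sqNorm_add_le (hflow2 hT)
        (Y := fun ω => δ T • (D T ω *ᵥ (randomFlow δ D s T ω *ᵥ v ω)))
        (fun i => (hDy i).const_mul (δ T))
      simp only [randomFlow, ← flow_succ_mulVec hT] at h1
      have h2 : √(∫ ω, sqNorm (δ T • (D T ω *ᵥ (randomFlow δ D s T ω *ᵥ v ω))) ∂P) ≤
          δ T * (b * √(V T)) := by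
        refine Real.sqrt_le_iff.2 ⟨by have := hδ T; positivity, ?_⟩
        simp only [sqNorm_smul]
        rw [integral_const_mul, mul_pow, mul_pow, Real.sq_sqrt (hV0 T)]
        refine mul_le_mul_of_nonneg_left ?_ (sq_nonneg _)
        rw [hV, ← integral_const_mul]
        exact integral_mono (integrable_sqNorm hDy)
          ((integrable_sqNorm (memLp_mulVec L (hflow2 hT))).const_mul _)
          fun ω => sqNorm_le_of_nrm_le (h.nrm_le T ω _)
      have h3 : δ T * (b * √(V T)) ≤
          δ T * (b * (√(C₁ * l) * √(decay δ (c / 2) s T) * √(S s))) := by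
        have := hVT' T hT
        have := hδ T
        gcongr
      rw [Finset.sum_Ico_succ_top hT, mul_add]
      calc √(S (T + 1)) ≤ _ := h1
        _ ≤ √(S T) + δ T * (b * (√(C₁ * l) * √(decay δ (c / 2) s T) * √(S s))) := by
          exact add_le_add le_rfl (h2.trans h3)
        _ ≤ _ := by
          have e : δ T * (b * (√(C₁ * l) * √(decay δ (c / 2) s T) * √(S s))) =
              b * √(C₁ * l) * √(S s) * (δ T * √(decay δ (c / 2) s T)) := by ring
          rw [e, ← add_assoc]
          exact add_le_add ih le_rfl
  refine fun T hT => ⟨?_, ?_⟩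
  · calc V T ≤ C₁ * decay δ (c / 2) s T * V s := hVT T hT
      _ ≤ C₁ * decay δ (c / 2) s T * (l * ∫ ω, sqNorm (v ω) ∂P) := by
        have := hg0 T
        gcongr
      _ = C₁ * l * decay δ (c / 2) s T * ∫ ω, sqNorm (v ω) ∂P := by ring
      _ ≤ _ := by
        have := hg0 T
        have := integral_sqNorm_nonneg (P := P) v
        gcongr
        exact le_max_left _ _
  · have h1 : √(S T) ≤ (1 + b * √(C₁ * l) * (4 / c)) * √(S s) := by
      have h2 := sum_mul_sqrt_decay_le (by positivity : 0 < c / 2) hδ3' hT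
      have h3 : 2 / (c / 2) * (1 - √(decay δ (c / 2) s T)) ≤ 4 / c := by
        have e : 2 / (c / 2) = 4 / c := by field_simp; norm_num
        rw [e]
        have := Real.sqrt_nonneg (decay δ (c / 2) s T)
        have : 0 < 4 / c := by positivity
        nlinarith
      have h4 : b * √(C₁ * l) * √(S s) * ∑ r ∈ Finset.Ico s T, δ r * √(decay δ (c / 2) s r) ≤
          b * √(C₁ * l) * √(S s) * (4 / c) := by
        have := h2.trans h3
        gcongr
      linarith [hST T hT]
    have hS0 : 0 ≤ S T := integral_sqNorm_nonneg _
    have hS0' : 0 ≤ S s := integral_sqNorm_nonneg _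
    calc S T = √(S T) ^ 2 := (Real.sq_sqrt hS0).symm
      _ ≤ ((1 + b * √(C₁ * l) * (4 / c)) * √(S s)) ^ 2 := by gcongr
      _ = (1 + b * √(C₁ * l) * (4 / c)) ^ 2 * S s := by rw [mul_pow, Real.sq_sqrt hS0']
      _ ≤ _ := by
        rw [hSs]
        have := integral_sqNorm_nonneg (P := P) v
        gcongr
        exact le_max_right _ _

end FlowBounds

/-! ### Windows of noise amplitudes -/

section Window

variable {Ω J : Type*}

/-- `∏_{j < k} e(r - 1 - j)`. -/
def window (e : ℤ → Ω → ℝ) (k : ℕ) (r : ℤ) (ω : Ω) : ℝ := ∏ j ∈ Finset.range k, e (r - 1 - j) ω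

variable {e : ℤ → Ω → ℝ} {k : ℕ} {r : ℤ} {ω : Ω}

lemma window_zero : window e 0 r ω = 1 := by simp [window]

lemma window_succ : window e (k + 1) r ω = window e k r ω * e (r - 1 - k) ω := by
  rw [window, Finset.prod_range_succ, window]

/-- Advancing time and length together keeps the oldest factor and only adds the newest one, the
factor to which independence of the past can be applied. -/
lemma window_succ_succ : window e (k + 1) (r + 1) ω = e r ω * window e k r ω := by
  rw [window, Finset.prod_range_succ', mul_comm, window]
  congr 1
  · congr 1; push_cast; ring
  · refine Finset.prod_congr rfl fun j _ => ?_
    congr 1; push_cast; ring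

lemma one_le_window (he : ∀ r ω, 1 ≤ e r ω) : 1 ≤ window e k r ω := by
  induction k with
  | zero => rw [window_zero]
  | succ k ih => rw [window_succ]; exact one_le_mul_of_one_le_of_one_le ih (he _ _)

lemma window_le_succ (he : ∀ r ω, 1 ≤ e r ω) : window e k r ω ≤ window e (k + 1) r ω := by
  rw [window_succ]
  exact le_mul_of_one_le_right (zero_le_one.trans (one_le_window he)) (he _ _)

lemma window_mono (he : ∀ r ω, 1 ≤ e r ω) {k' : ℕ} (h : k ≤ k') :
    window e k r ω ≤ window e k' r ω :=
  monotone_nat_of_le_succ (f := fun k => window e k r ω) (fun _ => window_le_succ he) h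

lemma le_window (he : ∀ r ω, 1 ≤ e r ω) {j : ℕ} (h : j < k) : e (r - 1 - j) ω ≤ window e k r ω := by
  refine le_trans ?_ (window_mono he h)
  rw [window_succ]
  exact le_mul_of_one_le_left (zero_le_one.trans (he _ _)) (one_le_window he)

lemma measurable_window {m : MeasurableSpace Ω} (he : ∀ j < k, Measurable[m] (e (r - 1 - j))) :
    Measurable[m] (window e k r) :=
  Finset.measurable_prod _ fun j hj => he j (Finset.mem_range.1 hj)

variable [Fintype J]

/-- `1 + ∑_j |w_j(r)|`. -/
def amplitude (w : J → ℤ → Ω → ℝ) (r : ℤ) (ω : Ω) : ℝ := 1 + ∑ j, |w j r ω|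

variable {w : J → ℤ → Ω → ℝ}

lemma one_le_amplitude (r : ℤ) (ω : Ω) : 1 ≤ amplitude w r ω :=
  le_add_of_nonneg_right (Finset.sum_nonneg fun _ _ => abs_nonneg _)

lemma sum_abs_le_amplitude : ∑ j, |w j r ω| ≤ amplitude w r ω := le_add_of_nonneg_left zero_le_one

lemma measurable_amplitude {m : MeasurableSpace Ω} (hw : ∀ j, Measurable[m] (w j r)) :
    Measurable[m] (amplitude w r) :=
  measurable_const.add (Finset.measurable_sum _ fun j _ => continuous_abs.measurable.comp (hw j))

variable {ι : Type*} [Fintype ι]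

lemma nrm_sum_smul_mulVec_le {A : J → Matrix ι ι ℝ} {x : J → ℝ} {v : ι → ℝ} {a s : ℝ} (ha : 0 ≤ a)
    (hA : ∀ j, nrm (A j *ᵥ v) ≤ a) (hx : ∑ j, |x j| ≤ s) :
    nrm ((∑ j, x j • A j) *ᵥ v) ≤ s * a := by
  rw [Matrix.sum_mulVec]
  refine (nrm_sum_le _ _).trans ?_
  calc ∑ j, nrm ((x j • A j) *ᵥ v) ≤ ∑ j, |x j| * a := Finset.sum_le_sum fun j _ => by
        rw [Matrix.smul_mulVec, nrm_smul]
        exact mul_le_mul_of_nonneg_left (hA j) (abs_nonneg _)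
    _ = (∑ j, |x j|) * a := (Finset.sum_mul ..).symm
    _ ≤ _ := mul_le_mul_of_nonneg_right hx ha

end Window

/-! ### Replacing delayed noise by present noise -/

section DelayedNoise

variable {Ω J ι : Type*} [Fintype J]

/-- Coefficient matrix driven by the noise of `d + 1` time steps before. -/
def delayedPart (w : J → ℤ → Ω → ℝ) (K : J → ℕ → Ω → Matrix ι ι ℝ) (d t : ℕ) (ω : Ω) :
    Matrix ι ι ℝ := ∑ j, w j ((t : ℤ) - 1 - d) ω • K j t ω

/-- Coefficient matrix driven by the present noise. -/
def currentPart (w : J → ℤ → Ω → ℝ) (M : J → ℕ → Ω → Matrix ι ι ℝ) (t : ℕ) (ω : Ω) :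
    Matrix ι ι ℝ := ∑ j, w j t ω • M j t ω

def noisyMatrix (w : J → ℤ → Ω → ℝ) (D : ℕ → Ω → Matrix ι ι ℝ) (K M : J → ℕ → Ω → Matrix ι ι ℝ)
    (d t : ℕ) (ω : Ω) : Matrix ι ι ℝ :=
  D t ω + delayedPart w K d t ω + currentPart w M t ω

/-- The corrector which replaces the delayed noise by the noise of `d + 1` steps later. -/
def corrector (δ : ℕ → ℝ) (w : J → ℤ → Ω → ℝ) (K : J → ℕ → Ω → Matrix ι ι ℝ) (d t : ℕ) (ω : Ω) :
    Matrix ι ι ℝ := ∑ k ∈ Finset.range (d + 1), δ (t + k) • delayedPart w K d (t + k) ω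

/-- Coefficient of the present noise after the correction. -/
def noiseCoeff (δ : ℕ → ℝ) (K M : J → ℕ → Ω → Matrix ι ι ℝ) (d t : ℕ) (ω : Ω) (j : J) :
    Matrix ι ι ℝ := δ t • M j t ω + δ (t + 1 + d) • K j (t + 1 + d) ω

variable {w : J → ℤ → Ω → ℝ} {D : ℕ → Ω → Matrix ι ι ℝ} {K M : J → ℕ → Ω → Matrix ι ι ℝ}
  {δ : ℕ → ℝ} {d t : ℕ} {ω : Ω}

/-- In the sum the term of time `t` leaves and the term of time `t + 1 + d` enters. -/
lemma corrector_succ : corrector δ w K d (t + 1) ω = corrector δ w K d t ω -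
    δ t • delayedPart w K d t ω + δ (t + 1 + d) • delayedPart w K d (t + 1 + d) ω := by
  rw [corrector, Finset.sum_range_succ, corrector, Finset.sum_range_succ', add_zero,
    add_sub_cancel_right]
  congr 1
  refine Finset.sum_congr rfl fun k _ => ?_
  rw [add_assoc, add_comm 1 k]

/-- The delayed part at time `t + 1 + d` carries exactly the noise of time `t`, so it joins the
present noise. -/
lemma sum_noiseCoeff : ∑ j, w j t ω • noiseCoeff δ K M d t ω j =
    δ t • currentPart w M t ω + δ (t + 1 + d) • delayedPart w K d (t + 1 + d) ω := by
  simp only [noiseCoeff, currentPart, delayedPart, smul_add, Finset.sum_add_distrib,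
    Finset.smul_sum]
  congr 1
  · exact Finset.sum_congr rfl fun j _ => smul_comm _ _ _
  · refine Finset.sum_congr rfl fun j _ => ?_
    have : (((t + 1 + d : ℕ) : ℤ) - 1 - d) = t := by push_cast; ring
    rw [this]
    exact smul_comm _ _ _

variable [Fintype ι]

/-- The second order term left by the correction. -/
def remainder (δ : ℕ → ℝ) (w : J → ℤ → Ω → ℝ) (D : ℕ → Ω → Matrix ι ι ℝ)
    (K M : J → ℕ → Ω → Matrix ι ι ℝ) (d t : ℕ) (ω : Ω) : Matrix ι ι ℝ :=
  δ t • (corrector δ w K d (t + 1) ω * noisyMatrix w D K M d t ω - D t ω * corrector δ w K d t ω)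

/-- The corrected state `(I + Q(t)) v`. -/
def corrected (δ : ℕ → ℝ) (w : J → ℤ → Ω → ℝ) (K : J → ℕ → Ω → Matrix ι ι ℝ) (d t : ℕ) (ω : Ω)
    (v : ι → ℝ) : ι → ℝ := v + corrector δ w K d t ω *ᵥ v

/-- The part of the corrected recursion which is not due to `D`. -/
def innovation (δ : ℕ → ℝ) (w : J → ℤ → Ω → ℝ) (D : ℕ → Ω → Matrix ι ι ℝ)
    (K M : J → ℕ → Ω → Matrix ι ι ℝ) (d t : ℕ) (ω : Ω) (v : ι → ℝ) : ι → ℝ :=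
  (∑ j, w j t ω • noiseCoeff δ K M d t ω j) *ᵥ v + remainder δ w D K M d t ω *ᵥ v

/-- The corrector trades the delayed noise of time `t` for a term with present noise. What is left
over is the corrector acting on the increment and the drift acting on the corrector; both are of
order `δ²` and form `remainder`. -/
lemma corrected_step (v : ι → ℝ) :
    corrected δ w K d (t + 1) ω (v + δ t • (noisyMatrix w D K M d t ω *ᵥ v)) =
      corrected δ w K d t ω v + δ t • (D t ω *ᵥ corrected δ w K d t ω v) +
        innovation δ w D K M d t ω v := by
  simp only [corrected, innovation, sum_noiseCoeff, remainder, Matrix.mulVec_add,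
    Matrix.mulVec_smul, Matrix.smul_mulVec, Matrix.sub_mulVec, ← Matrix.mulVec_mulVec,
    Matrix.add_mulVec, smul_sub, smul_add]
  have h1 : corrector δ w K d (t + 1) ω *ᵥ v = corrector δ w K d t ω *ᵥ v -
      δ t • (delayedPart w K d t ω *ᵥ v) +
        δ (t + 1 + d) • (delayedPart w K d (t + 1 + d) ω *ᵥ v) := by
    rw [corrector_succ, Matrix.add_mulVec, Matrix.sub_mulVec, Matrix.smul_mulVec,
      Matrix.smul_mulVec]
  have h2 : noisyMatrix w D K M d t ω *ᵥ v = D t ω *ᵥ v + delayedPart w K d t ω *ᵥ v +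
      currentPart w M t ω *ᵥ v := by
    rw [noisyMatrix, Matrix.add_mulVec, Matrix.add_mulVec]
  rw [h1, h2]
  simp only [smul_add]
  abel

/-! #### Pathwise bounds -/

/-- Pathwise bounds on the coefficients. -/
structure CoeffBound (w : J → ℤ → Ω → ℝ) (D : ℕ → Ω → Matrix ι ι ℝ)
    (K M : J → ℕ → Ω → Matrix ι ι ℝ) (b : ℝ) (d : ℕ) : Prop where
  nonneg : 0 ≤ b
  drift_le : ∀ t ω v, nrm (D t ω *ᵥ v) ≤ b * nrm v
  delayed_le : ∀ j t ω v, nrm (K j t ω *ᵥ v) ≤ b * nrm v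
  current_le : ∀ j (t : ℕ) ω v,
    nrm (M j t ω *ᵥ v) ≤ b * amplitude w ((t : ℤ) - 1 - d) ω * nrm v

variable {b : ℝ}

lemma CoeffBound.delayedPart_le (h : CoeffBound w D K M b d) (t : ℕ) (ω : Ω) (v : ι → ℝ) :
    nrm (delayedPart w K d t ω *ᵥ v) ≤ amplitude w ((t : ℤ) - 1 - d) ω * (b * nrm v) :=
  nrm_sum_smul_mulVec_le (mul_nonneg h.nonneg (nrm_nonneg _)) (fun j => h.delayed_le j t ω v)
    sum_abs_le_amplitude

lemma CoeffBound.noisyMatrix_le (h : CoeffBound w D K M b d) (t : ℕ) (ω : Ω) (v : ι → ℝ) :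
    nrm (noisyMatrix w D K M d t ω *ᵥ v) ≤
      3 * b * (amplitude w t ω * amplitude w ((t : ℤ) - 1 - d) ω) * nrm v := by
  set e₁ := amplitude w t ω with he₁
  set e₂ := amplitude w ((t : ℤ) - 1 - d) ω with he₂
  have h1 : 1 ≤ e₁ := one_le_amplitude _ _
  have h2 : 1 ≤ e₂ := one_le_amplitude _ _
  have hb := h.nonneg
  have hv := nrm_nonneg v
  rw [noisyMatrix, Matrix.add_mulVec, Matrix.add_mulVec]
  refine (nrm_add_le _ _).trans ((add_le_add ((nrm_add_le _ _).trans
    (add_le_add (h.drift_le t ω v) (h.delayedPart_le t ω v)))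
    (nrm_sum_smul_mulVec_le (by positivity) (fun j => h.current_le j t ω v)
      sum_abs_le_amplitude)).trans ?_)
  rw [← he₁, ← he₂]
  have h3 : 1 ≤ e₁ * e₂ := one_le_mul_of_one_le_of_one_le h1 h2
  have h4 : e₂ ≤ e₁ * e₂ := le_mul_of_one_le_left (by linarith) h1
  have h5 : b * nrm v ≤ e₁ * e₂ * (b * nrm v) := le_mul_of_one_le_left (by positivity) h3
  have h6 : e₂ * (b * nrm v) ≤ e₁ * e₂ * (b * nrm v) := by gcongr
  linarith

/-- The step sizes do not increase by more than the factor `R` over a window. -/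
def SlowlyVarying (δ : ℕ → ℝ) (R : ℝ) (d t : ℕ) : Prop :=
  0 ≤ δ t ∧ δ t ≤ 1 ∧ 1 ≤ R ∧ ∀ k ≤ d + 2, 0 ≤ δ (t + k) ∧ δ (t + k) ≤ R * δ t

variable {R : ℝ}

lemma CoeffBound.corrector_le_of_le (h : CoeffBound w D K M b d) {t : ℕ} {a : ℝ}
    (hδ : ∀ k ≤ d, 0 ≤ δ (t + k) ∧ δ (t + k) ≤ a) (ω : Ω) (v : ι → ℝ) :
    nrm (corrector δ w K d t ω *ᵥ v) ≤
      (d + 1) * b * a * window (amplitude w) (d + 1) t ω * nrm v := by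
  have hb := h.nonneg
  rw [corrector, Matrix.sum_mulVec]
  refine (nrm_sum_le _ _).trans ?_
  have h1 : ∀ k ∈ Finset.range (d + 1), nrm ((δ (t + k) • delayedPart w K d (t + k) ω) *ᵥ v) ≤
      b * a * window (amplitude w) (d + 1) t ω * nrm v := by
    intro k hk
    rw [Finset.mem_range] at hk
    obtain ⟨h0, h1⟩ := hδ k (by omega)
    rw [Matrix.smul_mulVec, nrm_smul, abs_of_nonneg h0]
    have h2 := h.delayedPart_le (t + k) ω v
    have h3 : (((t + k : ℕ) : ℤ) - 1 - d) = (t : ℤ) - 1 - (d - k : ℕ) := by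
      rw [Nat.cast_sub (by omega)]; push_cast; ring
    rw [h3] at h2
    have h4 : amplitude w ((t : ℤ) - 1 - (d - k : ℕ)) ω ≤ window (amplitude w) (d + 1) t ω :=
      le_window one_le_amplitude (by omega)
    have h5 := nrm_nonneg v
    have h6 : 0 ≤ window (amplitude w) (d + 1) t ω :=
      zero_le_one.trans (one_le_window one_le_amplitude)
    calc _ ≤ δ (t + k) * (window (amplitude w) (d + 1) t ω * (b * nrm v)) := by
          refine mul_le_mul_of_nonneg_left (h2.trans ?_) h0
          gcongr
      _ ≤ a * (window (amplitude w) (d + 1) t ω * (b * nrm v)) := by gcongr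
      _ = _ := by ring
  refine (Finset.sum_le_sum h1).trans (le_of_eq ?_)
  rw [Finset.sum_const, Finset.card_range, nsmul_eq_mul]
  push_cast
  ring

lemma CoeffBound.corrector_le (h : CoeffBound w D K M b d) (hδ : SlowlyVarying δ R d t) (ω : Ω)
    (v : ι → ℝ) : nrm (corrector δ w K d t ω *ᵥ v) ≤
      (d + 1) * b * R * δ t * window (amplitude w) (d + 1) t ω * nrm v := by
  have := h.corrector_le_of_le (δ := δ) (t := t) (a := R * δ t)
    (fun k hk => hδ.2.2.2 k (by omega)) ω v
  linarith

lemma CoeffBound.noiseCoeff_le (h : CoeffBound w D K M b d) (hδ : SlowlyVarying δ R d t) (ω : Ω)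
    (v : ι → ℝ) (j : J) : nrm (noiseCoeff δ K M d t ω j *ᵥ v) ≤
      2 * b * R * δ t * window (amplitude w) (d + 1) t ω * nrm v := by
  have hb := h.nonneg
  obtain ⟨hδ0, -, hR, hδR⟩ := hδ
  have h1 := hδR (d + 1) (by omega)
  rw [← add_assoc, add_right_comm] at h1
  have hv := nrm_nonneg v
  have hw1 : 1 ≤ window (amplitude w) (d + 1) t ω := one_le_window one_le_amplitude
  have h4 : amplitude w ((t : ℤ) - 1 - d) ω ≤ window (amplitude w) (d + 1) t ω :=
    le_window one_le_amplitude (by omega)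
  set q := window (amplitude w) (d + 1) t ω with hq
  rw [noiseCoeff, Matrix.add_mulVec, Matrix.smul_mulVec, Matrix.smul_mulVec]
  refine (nrm_add_le _ _).trans ?_
  rw [nrm_smul, nrm_smul, abs_of_nonneg hδ0, abs_of_nonneg h1.1]
  have h5 : δ t * nrm (M j t ω *ᵥ v) ≤ R * δ t * (b * q * nrm v) := by
    have h6 := h.current_le j t ω v
    calc _ ≤ δ t * (b * q * nrm v) := by
          refine mul_le_mul_of_nonneg_left (h6.trans ?_) hδ0
          gcongr
      _ ≤ _ := by
        refine mul_le_mul_of_nonneg_right (le_mul_of_one_le_left hδ0 hR) (by positivity)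
  have h7 : δ (t + 1 + d) * nrm (K j (t + 1 + d) ω *ᵥ v) ≤ R * δ t * (b * q * nrm v) := by
    have h6 := h.delayed_le j (t + 1 + d) ω v
    calc _ ≤ δ (t + 1 + d) * (b * q * nrm v) := by
          refine mul_le_mul_of_nonneg_left (h6.trans ?_) h1.1
          rw [mul_assoc b q]
          exact mul_le_mul_of_nonneg_left (le_mul_of_one_le_left hv hw1) hb
      _ ≤ _ := mul_le_mul_of_nonneg_right h1.2 (by positivity)
  linarith

lemma CoeffBound.sum_noiseCoeff_le (h : CoeffBound w D K M b d) (hδ : SlowlyVarying δ R d t)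
    (ω : Ω) (v : ι → ℝ) : nrm ((∑ j, w j t ω • noiseCoeff δ K M d t ω j) *ᵥ v) ≤
      amplitude w t ω * (2 * b * R * δ t * window (amplitude w) (d + 1) t ω * nrm v) := by
  have hb := h.nonneg
  have hw1 : 1 ≤ window (amplitude w) (d + 1) t ω := one_le_window one_le_amplitude
  have := hδ.1
  have := hδ.2.2.1
  have := nrm_nonneg v
  exact nrm_sum_smul_mulVec_le (by positivity) (h.noiseCoeff_le hδ ω v) sum_abs_le_amplitude

/-- The corrector at `t + 1` and the matrix at `t` both contain the amplitude of time `t`, hence its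
square; every other amplitude belongs to the window before `t` and occurs once. -/
lemma CoeffBound.remainder_le (h : CoeffBound w D K M b d) (hδ : SlowlyVarying δ R d t)
    (ω : Ω) (v : ι → ℝ) : nrm (remainder δ w D K M d t ω *ᵥ v) ≤
      4 * (d + 1) * b ^ 2 * R * δ t ^ 2 *
        (amplitude w t ω ^ 2 * window (amplitude w) (d + 1) t ω) * nrm v := by
  have hb := h.nonneg
  have hQ := h.corrector_le hδ ω v
  obtain ⟨hδ0, -, hR, hδR⟩ := hδ
  have hQ' := h.corrector_le_of_le (δ := δ) (t := t + 1) (a := R * δ t)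
    (fun k hk => by
      have := hδR (k + 1) (by omega)
      rwa [← add_assoc, add_right_comm] at this) ω (noisyMatrix w D K M d t ω *ᵥ v)
  have hA := h.noisyMatrix_le t ω v
  have hD := h.drift_le t ω (corrector δ w K d t ω *ᵥ v)
  have hv := nrm_nonneg v
  have he : 1 ≤ amplitude w t ω := one_le_amplitude _ _
  have hq1 : 1 ≤ window (amplitude w) d t ω := one_le_window one_le_amplitude
  have he2 : 1 ≤ amplitude w ((t : ℤ) - 1 - d) ω := one_le_amplitude _ _
  push_cast at hQ'
  rw [window_succ_succ] at hQ'
  rw [window_succ] at hQ ⊢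
  set e := amplitude w t ω with hedef
  set e₂ := amplitude w ((t : ℤ) - 1 - d) ω
  set q := window (amplitude w) d t ω
  rw [remainder, Matrix.smul_mulVec, Matrix.sub_mulVec, nrm_smul, abs_of_nonneg hδ0,
    ← Matrix.mulVec_mulVec, ← Matrix.mulVec_mulVec]
  have h1 : nrm (corrector δ w K d (t + 1) ω *ᵥ (noisyMatrix w D K M d t ω *ᵥ v)) ≤
      3 * ((d + 1) * b ^ 2 * R * δ t * (e ^ 2 * (q * e₂)) * nrm v) := by
    calc _ ≤ (d + 1) * b * (R * δ t) * (e * q) * (3 * b * (e * e₂) * nrm v) :=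
          hQ'.trans (mul_le_mul_of_nonneg_left hA (by positivity))
      _ = _ := by ring
  have h2 : nrm (D t ω *ᵥ (corrector δ w K d t ω *ᵥ v)) ≤
      (d + 1) * b ^ 2 * R * δ t * (e ^ 2 * (q * e₂)) * nrm v := by
    calc _ ≤ b * ((d + 1) * b * R * δ t * (q * e₂) * nrm v) :=
          hD.trans (mul_le_mul_of_nonneg_left hQ hb)
      _ = (d + 1) * b ^ 2 * R * δ t * (1 * (q * e₂)) * nrm v := by ring
      _ ≤ _ := by
        gcongr
        exact one_le_pow₀ he
  calc _ ≤ δ t * (3 * ((d + 1) * b ^ 2 * R * δ t * (e ^ 2 * (q * e₂)) * nrm v) +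
        (d + 1) * b ^ 2 * R * δ t * (e ^ 2 * (q * e₂)) * nrm v) :=
        mul_le_mul_of_nonneg_left ((nrm_sub_le _ _).trans (add_le_add h1 h2)) hδ0
    _ = _ := by ring

/-- The whole window grows by at most a factor of order `e(t)²`. -/
lemma CoeffBound.window_mul_step_le (h : CoeffBound w D K M b d) (hδ : SlowlyVarying δ R d t)
    (ω : Ω) (v : ι → ℝ) : window (amplitude w) (d + 1) ((t : ℤ) + 1) ω *
        nrm (v + δ t • (noisyMatrix w D K M d t ω *ᵥ v)) ≤
      (1 + 3 * b) * (amplitude w t ω ^ 2) * (window (amplitude w) (d + 1) t ω * nrm v) := by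
  have hb := h.nonneg
  have hA := h.noisyMatrix_le t ω v
  obtain ⟨hδ0, hδ1, -⟩ := hδ
  have hv := nrm_nonneg v
  have he : 1 ≤ amplitude w t ω := one_le_amplitude _ _
  have hq1 : 1 ≤ window (amplitude w) d t ω := one_le_window one_le_amplitude
  have he2 : 1 ≤ amplitude w ((t : ℤ) - 1 - d) ω := one_le_amplitude _ _
  rw [window_succ_succ, window_succ]
  set e := amplitude w t ω with hedef
  set e₂ := amplitude w ((t : ℤ) - 1 - d) ω
  set q := window (amplitude w) d t ω
  have h1 : nrm (v + δ t • (noisyMatrix w D K M d t ω *ᵥ v)) ≤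
      nrm v + 3 * b * (e * e₂) * nrm v := by
    refine (nrm_add_le _ _).trans (add_le_add le_rfl ?_)
    rw [nrm_smul, abs_of_nonneg hδ0]
    exact (mul_le_of_le_one_left (nrm_nonneg _) hδ1).trans hA
  have h2 : nrm v ≤ e * e₂ * nrm v :=
    le_mul_of_one_le_left hv (one_le_mul_of_one_le_of_one_le he he2)
  calc _ ≤ e * q * (e * e₂ * nrm v + 3 * b * (e * e₂) * nrm v) := by
        refine mul_le_mul_of_nonneg_left (h1.trans (by linarith)) (by positivity)
    _ = _ := by ring

/-- The leading term keeps the short window, because `v` itself brings no noise. Only the increment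
has the amplitude of time `t - 1 - d` and requires the full window, and it comes with the factor
`δ²`. -/
lemma CoeffBound.sq_window_mul_step_le (h : CoeffBound w D K M b d) {k : ℕ} (hk : k ≤ d) (ω : Ω)
    (v : ι → ℝ) : window (amplitude w) (k + 1) ((t : ℤ) + 1) ω ^ 2 *
        sqNorm (v + δ t • (noisyMatrix w D K M d t ω *ᵥ v)) ≤
      2 * (amplitude w t ω ^ 4 * (window (amplitude w) k t ω ^ 2 * sqNorm v)) +
      18 * b ^ 2 * δ t ^ 2 * (amplitude w t ω ^ 4 *
        (window (amplitude w) (d + 1) t ω ^ 2 * sqNorm v)) := by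
  have hb := h.nonneg
  have hA := sqNorm_le_of_nrm_le (h.noisyMatrix_le t ω v)
  have hv := sqNorm_nonneg v
  have he : 1 ≤ amplitude w t ω := one_le_amplitude _ _
  have hq1 : 1 ≤ window (amplitude w) k t ω := one_le_window one_le_amplitude
  have hqd : window (amplitude w) k t ω ≤ window (amplitude w) d t ω :=
    window_mono one_le_amplitude hk
  have he2 : 1 ≤ amplitude w ((t : ℤ) - 1 - d) ω := one_le_amplitude _ _
  rw [window_succ_succ, window_succ]
  set e := amplitude w t ω with hedef
  set e₂ := amplitude w ((t : ℤ) - 1 - d) ω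
  set q := window (amplitude w) d t ω
  set q' := window (amplitude w) k t ω
  have h1 := sqNorm_add_le_two v (δ t • (noisyMatrix w D K M d t ω *ᵥ v))
  rw [sqNorm_smul] at h1
  have h2 : e ^ 2 ≤ e ^ 4 := pow_le_pow_right₀ he (by norm_num)
  calc _ ≤ (e * q') ^ 2 * (2 * sqNorm v + 2 * (δ t ^ 2 * ((3 * b * (e * e₂)) ^ 2 * sqNorm v))) := by
        refine mul_le_mul_of_nonneg_left (h1.trans ?_) (by positivity)
        gcongr
    _ = 2 * (e ^ 2 * (q' ^ 2 * sqNorm v)) +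
        18 * b ^ 2 * δ t ^ 2 * (e ^ 4 * ((q' * e₂) ^ 2 * sqNorm v)) := by ring
    _ ≤ _ := by gcongr

end DelayedNoise

/-! ### Weighted second moments of solutions -/

section DelayedNoiseMoments

variable {Ω J ι κ : Type*} [mΩ : MeasurableSpace Ω] {P : Measure Ω} [Fintype J] [Fintype ι]
  [Fintype κ]

/-- Coefficients driven by noise `w` which is independent of the past `𝒜` and has bounded fourth
moments. -/
structure DelayedNoise (P : Measure Ω) (𝒢 𝒜 𝒩 : ℕ → MeasurableSpace Ω) (w : J → ℤ → Ω → ℝ)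
    (D : ℕ → Ω → Matrix ι ι ℝ) (K M : J → ℕ → Ω → Matrix ι ι ℝ) (b μ : ℝ) (d : ℕ) : Prop
    extends CoeffBound w D K M b d where
  past_mono : Monotone 𝒜
  past_le : ∀ t, 𝒜 t ≤ mΩ
  noise_le : ∀ t, 𝒩 t ≤ mΩ
  indep : ∀ t, Indep (𝒜 t) (𝒩 t) P
  w_noise : ∀ j (t : ℕ), Measurable[𝒩 t] (w j t)
  w_past : ∀ j (r : ℤ) (t : ℕ), r < t → Measurable[𝒜 t] (w j r)
  w_adapted : ∀ j r t, Measurable[𝒢 t] (w j r)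
  w_integrable : ∀ j (t : ℕ), Integrable (w j t) P
  w_mean : ∀ j (t : ℕ), ∫ ω, w j t ω ∂P = 0
  amp_integrable : ∀ t : ℕ, Integrable (fun ω => amplitude w t ω ^ 4) P
  amp_moment : ∀ t : ℕ, ∫ ω, amplitude w t ω ^ 4 ∂P ≤ μ
  D_past : ∀ s t i j, Measurable[𝒜 t] fun ω => D s ω i j
  K_past : ∀ j s t i i', Measurable[𝒜 t] fun ω => K j s ω i i'
  K_adapted : ∀ j s t i i', s ≤ t + (d + 1) → Measurable[𝒢 t] fun ω => K j s ω i i'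
  M_past : ∀ j t i i', Measurable[𝒜 t] fun ω => M j t ω i i'
  M_adapted : ∀ j t i i', Measurable[𝒢 t] fun ω => M j t ω i i'

variable {𝒢 𝒜 𝒩 : ℕ → MeasurableSpace Ω} {w : J → ℤ → Ω → ℝ} {D : ℕ → Ω → Matrix ι ι ℝ}
  {K M : J → ℕ → Ω → Matrix ι ι ℝ} {b μ : ℝ} {d : ℕ} {δ : ℕ → ℝ} {R : ℝ}

section Measurability

variable {Ω J ι : Type*} {m : MeasurableSpace Ω} [Fintype J] {w : J → ℤ → Ω → ℝ}
  {D : ℕ → Ω → Matrix ι ι ℝ} {K M : J → ℕ → Ω → Matrix ι ι ℝ} {d : ℕ} {δ : ℕ → ℝ} {t : ℕ}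

lemma measurable_sum_smul {A : J → Ω → Matrix ι ι ℝ} {x : J → Ω → ℝ}
    (hx : ∀ j, Measurable[m] (x j)) (hA : ∀ j i i', Measurable[m] fun ω => A j ω i i') (i i' : ι) :
    Measurable[m] fun ω => (∑ j, x j ω • A j ω) i i' := by
  simp only [Matrix.sum_apply, Matrix.smul_apply, smul_eq_mul]
  exact Finset.measurable_sum _ fun j _ => (hx j).mul (hA j i i')

lemma measurable_noisyMatrix (hD : ∀ i i', Measurable[m] fun ω => D t ω i i')
    (hK : ∀ j i i', Measurable[m] fun ω => K j t ω i i')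
    (hM : ∀ j i i', Measurable[m] fun ω => M j t ω i i')
    (hw : ∀ j, Measurable[m] (w j t)) (hw' : ∀ j, Measurable[m] (w j ((t : ℤ) - 1 - d)))
    (i i' : ι) : Measurable[m] fun ω => noisyMatrix w D K M d t ω i i' := by
  simp only [noisyMatrix, Matrix.add_apply]
  exact ((hD i i').add (measurable_sum_smul hw' hK i i')).add (measurable_sum_smul hw hM i i')

lemma measurable_corrector (hK : ∀ j, ∀ s ≤ t + d, ∀ i i', Measurable[m] fun ω => K j s ω i i')
    (hw : ∀ j, ∀ r < (t : ℤ), Measurable[m] (w j r)) (i i' : ι) :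
    Measurable[m] fun ω => corrector δ w K d t ω i i' := by
  simp only [corrector, Matrix.sum_apply, Matrix.smul_apply, smul_eq_mul]
  refine Finset.measurable_sum _ fun k hk => measurable_const.mul ?_
  rw [Finset.mem_range] at hk
  exact measurable_sum_smul (fun j => hw j _ (by push_cast; omega))
    (fun j => hK j (t + k) (by omega)) i i'

end Measurability

lemma DelayedNoise.integrable_amp_mul (h : DelayedNoise P 𝒢 𝒜 𝒩 w D K M b μ d) (t : ℕ) {g : Ω → ℝ}
    (hgm : Measurable[𝒜 t] g) (hg : Integrable g P) :
    Integrable (fun ω => amplitude w t ω ^ 4 * g ω) P :=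
  integrable_mul_of_indep (h.indep t).symm ((measurable_amplitude fun j => h.w_noise j t).pow_const 4)
    hgm (h.amp_integrable t) hg

lemma DelayedNoise.integral_amp_mul_le (h : DelayedNoise P 𝒢 𝒜 𝒩 w D K M b μ d) (t : ℕ) {g : Ω → ℝ}
    (hgm : Measurable[𝒜 t] g) (hg : 0 ≤ ∫ ω, g ω ∂P) :
    ∫ ω, amplitude w t ω ^ 4 * g ω ∂P ≤ μ * ∫ ω, g ω ∂P := by
  rw [integral_mul_of_indep (h.noise_le t) (h.past_le t) (h.indep t).symm
    ((measurable_amplitude fun j => h.w_noise j t).pow_const 4) hgm]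
  exact mul_le_mul_of_nonneg_right (h.amp_moment t) hg

lemma DelayedNoise.one_le_moment [IsProbabilityMeasure P]
    (h : DelayedNoise P 𝒢 𝒜 𝒩 w D K M b μ d) : 1 ≤ μ := by
  refine le_trans ?_ (h.amp_moment 0)
  calc (1 : ℝ) = ∫ _, (1 : ℝ) ∂P := by simp
    _ ≤ _ := integral_mono (integrable_const _) (h.amp_integrable 0)
      fun ω => one_le_pow₀ (one_le_amplitude _ _)

/-- A solution of `X(t+1) = (I + δ(t) A(t)) X(t)`, `t ≥ s₀`, with square integrable initial value. -/
structure IsSolution (P : Measure Ω) (𝒢 𝒜 : ℕ → MeasurableSpace Ω) (δ : ℕ → ℝ)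
    (w : J → ℤ → Ω → ℝ) (D : ℕ → Ω → Matrix ι ι ℝ) (K M : J → ℕ → Ω → Matrix ι ι ℝ) (d s₀ : ℕ)
    (X : ℕ → Ω → ι → ℝ) : Prop where
  step : ∀ t ≥ s₀, ∀ ω, X (t + 1) ω = X t ω + δ t • (noisyMatrix w D K M d t ω *ᵥ X t ω)
  past : ∀ i, Measurable[𝒜 s₀] fun ω => X s₀ ω i
  adapted : ∀ i, Measurable[𝒢 s₀] fun ω => X s₀ ω i
  integrable : Integrable (fun ω => window (amplitude w) (d + 1) s₀ ω ^ 2 * sqNorm (X s₀ ω)) P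

variable {L : Matrix κ ι ℝ} {bL c : ℝ} {τ s₀ : ℕ} {X : ℕ → Ω → ι → ℝ}

lemma IsSolution.measurable_past (hX : IsSolution P 𝒢 𝒜 δ w D K M d s₀ X)
    (h : DelayedNoise P 𝒢 𝒜 𝒩 w D K M b μ d) {t : ℕ} (ht : s₀ ≤ t) (i : ι) :
    Measurable[𝒜 t] fun ω => X t ω i := by
  induction t, ht using Nat.le_induction generalizing i with
  | base => exact hX.past i
  | succ t ht ih =>
    simp only [hX.step t ht]
    have ih' : ∀ i, Measurable[𝒜 (t + 1)] fun ω => X t ω i := fun i =>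
      (ih i).mono (h.past_mono (Nat.le_succ t)) le_rfl
    exact (ih' i).add (measurable_const.mul (measurable_mulVec
      (measurable_noisyMatrix (h.D_past t _) (fun j => h.K_past j t _)
        (fun j i i' => (h.M_past j t i i').mono (h.past_mono (Nat.le_succ t)) le_rfl)
        (fun j => h.w_past j _ _ (by push_cast; omega))
        (fun j => h.w_past j _ _ (by push_cast; omega))) ih' i))

lemma IsSolution.measurable_adapted (hX : IsSolution P 𝒢 𝒜 δ w D K M d s₀ X)
    (h : DelayedNoise P 𝒢 𝒜 𝒩 w D K M b μ d) (hD : AveragedDrift P 𝒢 D L bL c τ) {t : ℕ}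
    (ht : s₀ ≤ t) (i : ι) : Measurable[𝒢 t] fun ω => X t ω i := by
  induction t, ht using Nat.le_induction generalizing i with
  | base => exact hX.adapted i
  | succ t ht ih =>
    simp only [hX.step t ht]
    have hm := hD.mono (Nat.le_succ t)
    have ih' : ∀ i, Measurable[𝒢 (t + 1)] fun ω => X t ω i := fun i => (ih i).mono hm le_rfl
    exact (ih' i).add (measurable_const.mul (measurable_mulVec
      (measurable_noisyMatrix (fun i i' => (hD.measurable t i i').mono hm le_rfl)
        (fun j i i' => h.K_adapted j t _ i i' (by omega))
        (fun j i i' => (h.M_adapted j t i i').mono hm le_rfl)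
        (fun j => h.w_adapted j _ _) (fun j => h.w_adapted j _ _)) ih' i))

/-- The weighted second moments over partial windows. -/
noncomputable def windowMoment (P : Measure Ω) (w : J → ℤ → Ω → ℝ) (X : ℕ → Ω → ι → ℝ) (k t : ℕ) : ℝ :=
  ∫ ω, window (amplitude w) k t ω ^ 2 * sqNorm (X t ω) ∂P

lemma windowMoment_nonneg (k t : ℕ) : 0 ≤ windowMoment P w X k t :=
  integral_nonneg fun _ => mul_nonneg (sq_nonneg _) (sqNorm_nonneg _)

lemma IsSolution.measurable_window_mul (hX : IsSolution P 𝒢 𝒜 δ w D K M d s₀ X)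
    (h : DelayedNoise P 𝒢 𝒜 𝒩 w D K M b μ d) (k : ℕ) {t : ℕ} (ht : s₀ ≤ t) :
    Measurable[𝒜 t] fun ω => window (amplitude w) k t ω ^ 2 * sqNorm (X t ω) :=
  ((measurable_window fun j _ => measurable_amplitude fun i => h.w_past i _ _ (by omega)).pow_const
    2).mul (measurable_sqNorm (hX.measurable_past h ht))

/-- Induction on time: one step multiplies the weighted norm by at most a constant times the squared
amplitude of time `t`, whose square is integrable and independent of the past. -/
lemma IsSolution.integrable_window_mul_full (hX : IsSolution P 𝒢 𝒜 δ w D K M d s₀ X)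
    (h : DelayedNoise P 𝒢 𝒜 𝒩 w D K M b μ d) (hδ : ∀ t ≥ s₀, SlowlyVarying δ R d t) {t : ℕ}
    (ht : s₀ ≤ t) :
    Integrable (fun ω => window (amplitude w) (d + 1) t ω ^ 2 * sqNorm (X t ω)) P := by
  induction t, ht using Nat.le_induction with
  | base => exact hX.integrable
  | succ t ht ih =>
    refine ((h.integrable_amp_mul t (hX.measurable_window_mul h _ ht) ih).const_mul
      ((1 + 3 * b) ^ 2)).mono'
      ((hX.measurable_window_mul h (d + 1) (ht.trans (Nat.le_succ t))).mono (h.past_le _)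
        le_rfl).aestronglyMeasurable (ae_of_all _ fun ω => ?_)
    rw [Real.norm_of_nonneg (mul_nonneg (sq_nonneg _) (sqNorm_nonneg _)), ← nrm_sq, ← nrm_sq,
      ← mul_pow, hX.step t ht]
    have h1 := h.window_mul_step_le (hδ t ht) ω (X t ω)
    push_cast
    have h2 : 0 ≤ window (amplitude w) (d + 1) ((t : ℤ) + 1) ω :=
      zero_le_one.trans (one_le_window one_le_amplitude)
    refine (pow_le_pow_left₀ (mul_nonneg h2 (nrm_nonneg _)) h1 2).trans (le_of_eq ?_)
    ring

lemma IsSolution.integrable_window_mul (hX : IsSolution P 𝒢 𝒜 δ w D K M d s₀ X)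
    (h : DelayedNoise P 𝒢 𝒜 𝒩 w D K M b μ d) (hδ : ∀ t ≥ s₀, SlowlyVarying δ R d t) {t : ℕ}
    (ht : s₀ ≤ t) {k : ℕ} (hk : k ≤ d + 1) :
    Integrable (fun ω => window (amplitude w) k t ω ^ 2 * sqNorm (X t ω)) P := by
  refine (hX.integrable_window_mul_full h hδ ht).mono'
    ((hX.measurable_window_mul h k ht).mono (h.past_le _) le_rfl).aestronglyMeasurable
    (ae_of_all _ fun ω => ?_)
  rw [Real.norm_of_nonneg (mul_nonneg (sq_nonneg _) (sqNorm_nonneg _))]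
  have h1 : 0 ≤ window (amplitude w) k t ω := zero_le_one.trans (one_le_window one_le_amplitude)
  exact mul_le_mul_of_nonneg_right (pow_le_pow_left₀ h1 (window_mono one_le_amplitude hk) 2)
    (sqNorm_nonneg _)

lemma IsSolution.memLp (hX : IsSolution P 𝒢 𝒜 δ w D K M d s₀ X)
    (h : DelayedNoise P 𝒢 𝒜 𝒩 w D K M b μ d) (hδ : ∀ t ≥ s₀, SlowlyVarying δ R d t) {t : ℕ}
    (ht : s₀ ≤ t) (i : ι) : MemLp (fun ω => X t ω i) 2 P :=
  memLp_of_sqNorm_le (fun i => (hX.measurable_past h ht i).mono (h.past_le _) le_rfl)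
    (hX.integrable_window_mul h hδ ht (Nat.zero_le _)) (fun ω => by
      rw [window_zero, one_pow, one_mul]) i

lemma windowMoment_zero (t : ℕ) : windowMoment P w X 0 t = ∫ ω, sqNorm (X t ω) ∂P := by
  simp [windowMoment, window_zero]

lemma IsSolution.windowMoment_succ_le (hX : IsSolution P 𝒢 𝒜 δ w D K M d s₀ X)
    (h : DelayedNoise P 𝒢 𝒜 𝒩 w D K M b μ d) (hδ : ∀ t ≥ s₀, SlowlyVarying δ R d t) {t : ℕ}
    (ht : s₀ ≤ t) {k : ℕ} (hk : k ≤ d) : windowMoment P w X (k + 1) (t + 1) ≤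
      2 * μ * windowMoment P w X k t + 18 * b ^ 2 * μ * (δ t ^ 2 * windowMoment P w X (d + 1) t) := by
  have hm := fun k => hX.measurable_window_mul h k ht
  have hi : ∀ k ≤ d + 1, _ := fun k hk => hX.integrable_window_mul h hδ ht (k := k) hk
  have hi1 := (h.integrable_amp_mul t (hm k) (hi k (by omega))).const_mul 2
  have hi2 := (h.integrable_amp_mul t (hm (d + 1)) (hi (d + 1) le_rfl)).const_mul
    (18 * b ^ 2 * δ t ^ 2)
  have h1 : windowMoment P w X (k + 1) (t + 1) ≤ _ :=
    integral_mono (hX.integrable_window_mul h hδ (ht.trans (Nat.le_succ t)) (by omega))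
      (hi1.fun_add hi2) fun ω => by
        have := h.sq_window_mul_step_le (δ := δ) (t := t) hk ω (X t ω)
        rw [← hX.step t ht] at this
        push_cast
        exact this
  rw [integral_add hi1 hi2, integral_const_mul, integral_const_mul] at h1
  have h2 := h.integral_amp_mul_le t (hm k) (windowMoment_nonneg k t)
  have h3 := h.integral_amp_mul_le t (hm (d + 1)) (windowMoment_nonneg (d + 1) t)
  have h4 : 0 ≤ 18 * b ^ 2 * δ t ^ 2 := by positivity
  have h5 := mul_le_mul_of_nonneg_left h3 h4
  simp only [windowMoment] at h1 ⊢
  linarith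

/-- The window is built up from the empty one, one factor per step, each factor being independent of
what precedes it. So the weighted moment is controlled by the plain second moment `k` steps earlier,
up to terms with the summable weight `δ²`. -/
lemma IsSolution.windowMoment_le [IsProbabilityMeasure P]
    (hX : IsSolution P 𝒢 𝒜 δ w D K M d s₀ X)
    (h : DelayedNoise P 𝒢 𝒜 𝒩 w D K M b μ d) (hδ : ∀ t ≥ s₀, SlowlyVarying δ R d t) {t : ℕ}
    (ht : s₀ ≤ t) {k : ℕ} (hk : k ≤ d + 1) : windowMoment P w X k (t + k) ≤
      (2 * μ) ^ k * (windowMoment P w X 0 t + 18 * b ^ 2 * μ *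
        ∑ r ∈ Finset.Ico t (t + k), δ r ^ 2 * windowMoment P w X (d + 1) r) := by
  have hμ := h.one_le_moment
  induction k with
  | zero => simp
  | succ k ih =>
    have h1 := hX.windowMoment_succ_le h hδ (t := t + k) (by omega) (k := k) (by omega)
    have h2 := ih (by omega)
    rw [← add_assoc, Finset.sum_Ico_succ_top (by omega), mul_add, mul_add, mul_add, pow_succ]
    set W := δ (t + k) ^ 2 * windowMoment P w X (d + 1) (t + k) with hW
    have hW0 : 0 ≤ W := mul_nonneg (sq_nonneg _) (windowMoment_nonneg _ _)
    have h3 : 18 * b ^ 2 * μ * W ≤ (2 * μ) ^ k * (2 * μ) * (18 * b ^ 2 * μ * W) :=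
      le_mul_of_one_le_left (by positivity)
        (one_le_mul_of_one_le_of_one_le (one_le_pow₀ (by linarith)) (by linarith))
    refine (h1.trans (add_le_add (mul_le_mul_of_nonneg_left h2 (by positivity)) h3)).trans
      (le_of_eq (by ring))

end DelayedNoiseMoments

/-! ### The corrected state and its one-step estimate -/

section CorrectedProcess

variable {Ω J ι κ : Type*} [mΩ : MeasurableSpace Ω] {P : Measure Ω} [Fintype J] [Fintype ι]
  [Fintype κ] {𝒢 𝒜 𝒩 : ℕ → MeasurableSpace Ω} {w : J → ℤ → Ω → ℝ} {D : ℕ → Ω → Matrix ι ι ℝ}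
  {K M : J → ℕ → Ω → Matrix ι ι ℝ} {b μ : ℝ} {d : ℕ} {δ : ℕ → ℝ} {R : ℝ}
  {L : Matrix κ ι ℝ} {bL c : ℝ} {τ s₀ : ℕ} {X : ℕ → Ω → ι → ℝ}

lemma IsSolution.corrector_mulVec (hX : IsSolution P 𝒢 𝒜 δ w D K M d s₀ X)
    (h : DelayedNoise P 𝒢 𝒜 𝒩 w D K M b μ d) (hδ : ∀ t ≥ s₀, SlowlyVarying δ R d t) {t : ℕ}
    (ht : s₀ ≤ t) : (∀ i, MemLp (fun ω => (corrector δ w K d t ω *ᵥ X t ω) i) 2 P) ∧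
      ∫ ω, sqNorm (corrector δ w K d t ω *ᵥ X t ω) ∂P ≤
        ((d + 1) * b * R) ^ 2 * δ t ^ 2 * windowMoment P w X (d + 1) t := by
  have hle : ∀ ω, sqNorm (corrector δ w K d t ω *ᵥ X t ω) ≤ ((d + 1) * b * R) ^ 2 * δ t ^ 2 *
      (window (amplitude w) (d + 1) t ω ^ 2 * sqNorm (X t ω)) := fun ω =>
    (sqNorm_le_of_nrm_le (h.corrector_le (hδ t ht) ω (X t ω))).trans (le_of_eq (by ring))
  have hi := (hX.integrable_window_mul_full h hδ ht).const_mul (((d + 1) * b * R) ^ 2 * δ t ^ 2)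
  have hm : ∀ i, MemLp (fun ω => (corrector δ w K d t ω *ᵥ X t ω) i) 2 P :=
    memLp_of_sqNorm_le (measurable_mulVec (fun i i' => (measurable_corrector
      (fun j s _ => h.K_past j s t) (fun j r hr => h.w_past j r t hr) i i').mono (h.past_le t) le_rfl)
      fun i => (hX.measurable_past h ht i).mono (h.past_le t) le_rfl) hi hle
  refine ⟨hm, ?_⟩
  rw [windowMoment, ← integral_const_mul]
  exact integral_mono (integrable_sqNorm hm) hi hle

lemma IsSolution.memLp_corrected (hX : IsSolution P 𝒢 𝒜 δ w D K M d s₀ X)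
    (h : DelayedNoise P 𝒢 𝒜 𝒩 w D K M b μ d) (hδ : ∀ t ≥ s₀, SlowlyVarying δ R d t) {t : ℕ}
    (ht : s₀ ≤ t) (i : ι) : MemLp (fun ω => corrected δ w K d t ω (X t ω) i) 2 P :=
  (hX.memLp h hδ ht i).add ((hX.corrector_mulVec h hδ ht).1 i)

lemma IsSolution.measurable_corrected_past (hX : IsSolution P 𝒢 𝒜 δ w D K M d s₀ X)
    (h : DelayedNoise P 𝒢 𝒜 𝒩 w D K M b μ d) {t : ℕ} (ht : s₀ ≤ t) (i : ι) :
    Measurable[𝒜 t] fun ω => corrected δ w K d t ω (X t ω) i :=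
  (hX.measurable_past h ht i).add (measurable_mulVec (measurable_corrector
    (fun j s _ => h.K_past j s t) (fun j r hr => h.w_past j r t hr)) (hX.measurable_past h ht) i)

lemma IsSolution.measurable_corrected_adapted (hX : IsSolution P 𝒢 𝒜 δ w D K M d s₀ X)
    (h : DelayedNoise P 𝒢 𝒜 𝒩 w D K M b μ d) (hD : AveragedDrift P 𝒢 D L bL c τ) {t : ℕ}
    (ht : s₀ ≤ t) (i : ι) : Measurable[𝒢 t] fun ω => corrected δ w K d t ω (X t ω) i :=
  (hX.measurable_adapted h hD ht i).add (measurable_mulVec (measurable_corrector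
    (fun j s hs i i' => h.K_adapted j s t i i' (by omega)) (fun j r _ => h.w_adapted j r t))
    (hX.measurable_adapted h hD ht) i)

/-- The contribution of the present noise. -/
lemma IsSolution.noise_mulVec (hX : IsSolution P 𝒢 𝒜 δ w D K M d s₀ X)
    (h : DelayedNoise P 𝒢 𝒜 𝒩 w D K M b μ d) (hδ : ∀ t ≥ s₀, SlowlyVarying δ R d t) {t : ℕ}
    (ht : s₀ ≤ t) :
    (∀ i, MemLp (fun ω => ((∑ j, w j t ω • noiseCoeff δ K M d t ω j) *ᵥ X t ω) i) 2 P) ∧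
      ∫ ω, sqNorm ((∑ j, w j t ω • noiseCoeff δ K M d t ω j) *ᵥ X t ω) ∂P ≤
        (2 * b * R) ^ 2 * μ * (δ t ^ 2 * windowMoment P w X (d + 1) t) := by
  have hle : ∀ ω, sqNorm ((∑ j, w j t ω • noiseCoeff δ K M d t ω j) *ᵥ X t ω) ≤
      (2 * b * R) ^ 2 * δ t ^ 2 * (amplitude w t ω ^ 4 *
      (window (amplitude w) (d + 1) t ω ^ 2 * sqNorm (X t ω))) := by
    intro ω
    have h1 := h.sum_noiseCoeff_le (hδ t ht) ω (X t ω)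
    rw [← mul_assoc] at h1
    refine (sqNorm_le_of_nrm_le h1).trans ?_
    have h2 : amplitude w t ω ^ 2 ≤ amplitude w t ω ^ 4 :=
      pow_le_pow_right₀ (one_le_amplitude _ _) (by norm_num)
    have h3 := sqNorm_nonneg (X t ω)
    calc _ = (2 * b * R) ^ 2 * δ t ^ 2 * (amplitude w t ω ^ 2 *
          (window (amplitude w) (d + 1) t ω ^ 2 * sqNorm (X t ω))) := by ring
      _ ≤ _ := by gcongr
  have hg := hX.measurable_window_mul h (d + 1) ht
  have hgi := hX.integrable_window_mul_full h hδ ht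
  have hi := (h.integrable_amp_mul t hg hgi).const_mul ((2 * b * R) ^ 2 * δ t ^ 2)
  have hwm : ∀ j, Measurable (w j t) := fun j => (h.w_noise j t).mono (h.noise_le t) le_rfl
  have hm : ∀ i, MemLp (fun ω => ((∑ j, w j t ω • noiseCoeff δ K M d t ω j) *ᵥ X t ω) i) 2 P :=
    memLp_of_sqNorm_le (measurable_mulVec (measurable_sum_smul hwm fun j i i' => by
      simp only [noiseCoeff, Matrix.add_apply, Matrix.smul_apply, smul_eq_mul]
      exact (measurable_const.mul ((h.M_past j t i i').mono (h.past_le t) le_rfl)).add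
        (measurable_const.mul ((h.K_past j _ t i i').mono (h.past_le t) le_rfl)))
      fun i => (hX.measurable_past h ht i).mono (h.past_le t) le_rfl) hi hle
  refine ⟨hm, ?_⟩
  have h1 := integral_mono (integrable_sqNorm hm) hi hle
  rw [integral_const_mul] at h1
  have h2 := h.integral_amp_mul_le t hg (windowMoment_nonneg (d + 1) t)
  have h3 : 0 ≤ (2 * b * R) ^ 2 * δ t ^ 2 := by positivity
  refine h1.trans ((mul_le_mul_of_nonneg_left h2 h3).trans (le_of_eq ?_))
  rw [windowMoment]
  ring

lemma IsSolution.remainder_mulVec (hX : IsSolution P 𝒢 𝒜 δ w D K M d s₀ X)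
    (h : DelayedNoise P 𝒢 𝒜 𝒩 w D K M b μ d) (hδ : ∀ t ≥ s₀, SlowlyVarying δ R d t) {t : ℕ}
    (ht : s₀ ≤ t) :
    (∀ i, MemLp (fun ω => (remainder δ w D K M d t ω *ᵥ X t ω) i) 2 P) ∧
      ∫ ω, sqNorm (remainder δ w D K M d t ω *ᵥ X t ω) ∂P ≤
        (4 * (d + 1) * b ^ 2 * R) ^ 2 * μ * (δ t ^ 4 * windowMoment P w X (d + 1) t) := by
  have hle : ∀ ω, sqNorm (remainder δ w D K M d t ω *ᵥ X t ω) ≤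
      (4 * (d + 1) * b ^ 2 * R) ^ 2 * δ t ^ 4 * (amplitude w t ω ^ 4 *
      (window (amplitude w) (d + 1) t ω ^ 2 * sqNorm (X t ω))) := fun ω =>
    (sqNorm_le_of_nrm_le (h.remainder_le (hδ t ht) ω (X t ω))).trans (le_of_eq (by ring))
  have hg := hX.measurable_window_mul h (d + 1) ht
  have hgi := hX.integrable_window_mul_full h hδ ht
  have hi := (h.integrable_amp_mul t hg hgi).const_mul ((4 * (d + 1) * b ^ 2 * R) ^ 2 * δ t ^ 4)
  have hpast : ∀ j (r : ℤ), r < (t + 1 : ℕ) → Measurable (w j r) := fun j r hr =>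
    (h.w_past j r (t + 1) hr).mono (h.past_le _) le_rfl
  have hKm : ∀ j s i i', Measurable fun ω => K j s ω i i' := fun j s i i' =>
    (h.K_past j s t i i').mono (h.past_le t) le_rfl
  have hDm : ∀ i i', Measurable fun ω => D t ω i i' := fun i i' =>
    (h.D_past t t i i').mono (h.past_le t) le_rfl
  have hXm : ∀ i, Measurable fun ω => X t ω i := fun i =>
    (hX.measurable_past h ht i).mono (h.past_le t) le_rfl
  have hm : ∀ i, MemLp (fun ω => (remainder δ w D K M d t ω *ᵥ X t ω) i) 2 P := by
    refine memLp_of_sqNorm_le (fun i => ?_) hi hle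
    simp only [remainder, Matrix.smul_mulVec, Matrix.sub_mulVec, ← Matrix.mulVec_mulVec]
    exact measurable_const.mul ((measurable_mulVec (measurable_corrector
      (fun j s _ => hKm j s) hpast) (measurable_mulVec
      (measurable_noisyMatrix hDm (fun j => hKm j t)
        (fun j i i' => (h.M_past j t i i').mono (h.past_le t) le_rfl)
        (fun j => hpast j _ (by push_cast; omega)) (fun j => hpast j _ (by push_cast; omega)))
      hXm) i).sub (measurable_mulVec hDm (measurable_mulVec (measurable_corrector
      (fun j s _ => hKm j s) (fun j r hr => hpast j r (by push_cast; omega))) hXm) i))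
  refine ⟨hm, ?_⟩
  have h1 := integral_mono (integrable_sqNorm hm) hi hle
  rw [integral_const_mul] at h1
  have h2 := h.integral_amp_mul_le t hg (windowMoment_nonneg (d + 1) t)
  have h3 : 0 ≤ (4 * (d + 1) * b ^ 2 * R) ^ 2 * δ t ^ 4 := by positivity
  refine h1.trans ((mul_le_mul_of_nonneg_left h2 h3).trans (le_of_eq ?_))
  rw [windowMoment]
  ring

variable [DecidableEq ι] {κ' : Type*} [Fintype κ']

/-- The present noise is orthogonal to the past. -/
lemma IsSolution.integral_dotProduct_noise_eq_zero (hX : IsSolution P 𝒢 𝒜 δ w D K M d s₀ X)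
    (h : DelayedNoise P 𝒢 𝒜 𝒩 w D K M b μ d) (hD : AveragedDrift P 𝒢 D L bL c τ)
    (hδ : ∀ t ≥ s₀, SlowlyVarying δ R d t) (Λ : Matrix κ' ι ℝ) {t T : ℕ} (ht : s₀ ≤ t) (hT : t < T) :
    ∫ ω, (Λ *ᵥ (randomFlow δ D t T ω *ᵥ corrected δ w K d t ω (X t ω))) ⬝ᵥ
      (Λ *ᵥ (randomFlow δ D (t + 1) T ω *ᵥ
        ((∑ j, w j t ω • noiseCoeff δ K M d t ω j) *ᵥ X t ω))) ∂P = 0 := by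
  set g : J → Ω → ℝ := fun j ω =>
    (Λ *ᵥ (randomFlow δ D t T ω *ᵥ corrected δ w K d t ω (X t ω))) ⬝ᵥ
      (Λ *ᵥ (randomFlow δ D (t + 1) T ω *ᵥ (noiseCoeff δ K M d t ω j *ᵥ X t ω))) with hg
  have hexp : ∀ ω, (Λ *ᵥ (randomFlow δ D t T ω *ᵥ corrected δ w K d t ω (X t ω))) ⬝ᵥ
      (Λ *ᵥ (randomFlow δ D (t + 1) T ω *ᵥ
        ((∑ j, w j t ω • noiseCoeff δ K M d t ω j) *ᵥ X t ω))) = ∑ j, w j t ω * g j ω := by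
    intro ω
    simp only [Matrix.sum_mulVec, Matrix.smul_mulVec, Matrix.mulVec_sum, Matrix.mulVec_smul,
      dotProduct_sum, dotProduct_smul, smul_eq_mul, hg]
  have hXm := hX.measurable_past h ht
  have hNm : ∀ {m : MeasurableSpace Ω} (j : J), (∀ i i', Measurable[m] fun ω => M j t ω i i') →
      (∀ i i', Measurable[m] fun ω => K j (t + 1 + d) ω i i') → ∀ i i',
      Measurable[m] fun ω => noiseCoeff δ K M d t ω j i i' := by
    intro m j h1 h2 i i'
    simp only [noiseCoeff, Matrix.add_apply, Matrix.smul_apply, smul_eq_mul]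
    exact (measurable_const.mul (h1 i i')).add (measurable_const.mul (h2 i i'))
  -- `𝒜 t` contains the matrices `D` of all times, so even the transition matrices beyond `t` count
  -- as past; only the noise `w j t` is new.
  have hflow : ∀ s i i', Measurable[𝒜 t] fun ω => randomFlow δ D s T ω i i' := fun s =>
    measurable_randomFlow_entry fun r _ => h.D_past r t
  have hgm : ∀ j, Measurable[𝒜 t] (g j) := by
    intro j
    refine Finset.measurable_sum _ fun k _ => ?_
    refine Measurable.mul ?_ ?_
    · exact measurable_mulVec (A := fun _ => Λ) (fun _ _ => measurable_const)
        (measurable_mulVec (hflow t) (hX.measurable_corrected_past h ht)) k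
    · exact measurable_mulVec (A := fun _ => Λ) (fun _ _ => measurable_const) (measurable_mulVec (hflow (t + 1))
        (measurable_mulVec (hNm j (h.M_past j t) (h.K_past j _ t)) hXm)) k
  have hN2 : ∀ j i, MemLp (fun ω => (noiseCoeff δ K M d t ω j *ᵥ X t ω) i) 2 P := by
    intro j
    refine memLp_of_sqNorm_le (fun i => (measurable_mulVec (hNm j (h.M_past j t) (h.K_past j _ t))
      hXm i).mono (h.past_le t) le_rfl) ((hX.integrable_window_mul_full h hδ ht).const_mul
      ((2 * b * R * δ t) ^ 2)) fun ω => ?_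
    refine (sqNorm_le_of_nrm_le (h.noiseCoeff_le (hδ t ht) ω (X t ω) j)).trans (le_of_eq ?_)
    ring
  have hgi : ∀ j, Integrable (g j) P := by
    intro j
    refine integrable_dotProduct (memLp_mulVec Λ (hD.memLp_flow
      (hX.measurable_corrected_adapted h hD ht) (hX.memLp_corrected h hδ ht) hT.le))
      (memLp_mulVec Λ (hD.memLp_flow (s := t + 1) (fun i => ?_) (hN2 j) hT))
    refine measurable_mulVec (hNm j (fun i i' => (h.M_adapted j t i i').mono
      (hD.mono (Nat.le_succ t)) le_rfl) fun i i' => h.K_adapted j _ _ i i' (by omega)) (fun i => ?_) i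
    exact (hX.measurable_adapted h hD ht i).mono (hD.mono (Nat.le_succ t)) le_rfl
  simp only [hexp]
  rw [integral_finsetSum _ fun j _ => integrable_mul_of_indep (h.indep t).symm (h.w_noise j t)
    (hgm j) (h.w_integrable j t) (hgi j)]
  refine Finset.sum_eq_zero fun j _ => ?_
  rw [integral_mul_of_indep (h.noise_le t) (h.past_le t) (h.indep t).symm (h.w_noise j t) (hgm j),
    h.w_mean, zero_mul]

lemma sqNorm_add_three_le (u n r : κ' → ℝ) {a : ℝ} (ha : 0 < a) :
    sqNorm (u + n + r) ≤ (1 + a) * sqNorm u + 2 * (u ⬝ᵥ n) + 2 * sqNorm n +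
      (a⁻¹ + 2) * sqNorm r := by
  have h1 := two_mul_abs_dotProduct_le u r ha
  have h2 := le_abs_self (u ⬝ᵥ r)
  have h3 := sqNorm_add_le_two n r
  rw [add_assoc, sqNorm_add, dotProduct_add]
  linarith

/-- With the final time `T` fixed, moving the start of the averaged flow from `t` to `t + 1` adds
the noise and the remainder of time `t`, transported to `T`. The noise is orthogonal to the rest of
the past; the remainder is split off by Young's inequality with weight `δ(t)²`. -/
lemma IsSolution.integral_flow_succ_le (hX : IsSolution P 𝒢 𝒜 δ w D K M d s₀ X)
    (h : DelayedNoise P 𝒢 𝒜 𝒩 w D K M b μ d) (hD : AveragedDrift P 𝒢 D L bL c τ)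
    (hδ : ∀ t ≥ s₀, SlowlyVarying δ R d t) (hδpos : ∀ t, 0 < δ t) (hμ : 0 ≤ μ)
    (Λ : Matrix κ' ι ℝ) {t T : ℕ} (ht : s₀ ≤ t) (hT : t < T) {g : ℝ} (hg0 : 0 ≤ g)
    (hg : ∀ v : Ω → ι → ℝ, (∀ i, Measurable[𝒢 (t + 1)] fun ω => v ω i) →
      (∀ i, MemLp (fun ω => v ω i) 2 P) →
      ∫ ω, sqNorm (Λ *ᵥ (randomFlow δ D (t + 1) T ω *ᵥ v ω)) ∂P ≤ g * ∫ ω, sqNorm (v ω) ∂P) :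
    ∫ ω, sqNorm (Λ *ᵥ (randomFlow δ D (t + 1) T ω *ᵥ
        corrected δ w K d (t + 1) ω (X (t + 1) ω))) ∂P ≤
      (1 + δ t ^ 2) * ∫ ω, sqNorm (Λ *ᵥ (randomFlow δ D t T ω *ᵥ
        corrected δ w K d t ω (X t ω))) ∂P +
      (2 * (2 * b * R) ^ 2 + 3 * (4 * (d + 1) * b ^ 2 * R) ^ 2) * μ *
        (δ t ^ 2 * g * windowMoment P w X (d + 1) t) := by
  set U : Ω → κ' → ℝ := fun ω =>
    Λ *ᵥ (randomFlow δ D t T ω *ᵥ corrected δ w K d t ω (X t ω)) with hU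
  set n : Ω → ι → ℝ := fun ω => (∑ j, w j t ω • noiseCoeff δ K M d t ω j) *ᵥ X t ω with hn
  set r : Ω → ι → ℝ := fun ω => remainder δ w D K M d t ω *ᵥ X t ω with hr
  obtain ⟨hn2, hnle⟩ := hX.noise_mulVec h hδ ht
  obtain ⟨hr2, hrle⟩ := hX.remainder_mulVec h hδ ht
  have hle := Nat.le_succ t
  have hmono := hD.mono hle
  have hXm : ∀ i, Measurable[𝒢 (t + 1)] fun ω => X t ω i := fun i =>
    (hX.measurable_adapted h hD ht i).mono hmono le_rfl
  have hDm : ∀ i i', Measurable[𝒢 (t + 1)] fun ω => D t ω i i' := fun i i' =>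
    (hD.measurable t i i').mono hmono le_rfl
  have hnm : ∀ i, Measurable[𝒢 (t + 1)] fun ω => n ω i :=
    measurable_mulVec (measurable_sum_smul (fun j => h.w_adapted j _ _) fun j i i' => by
      simp only [noiseCoeff, Matrix.add_apply, Matrix.smul_apply, smul_eq_mul]
      exact (measurable_const.mul ((h.M_adapted j t i i').mono hmono le_rfl)).add
        (measurable_const.mul (h.K_adapted j _ _ i i' (by omega)))) hXm
  have hrm : ∀ i, Measurable[𝒢 (t + 1)] fun ω => r ω i := by
    intro i
    simp only [hr, remainder, Matrix.smul_mulVec, Matrix.sub_mulVec, ← Matrix.mulVec_mulVec]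
    exact measurable_const.mul ((measurable_mulVec (measurable_corrector
      (fun j s hs i i' => h.K_adapted j s _ i i' (by omega)) (fun j r _ => h.w_adapted j r _))
      (measurable_mulVec (measurable_noisyMatrix hDm
        (fun j i i' => h.K_adapted j t _ i i' (by omega))
        (fun j i i' => (h.M_adapted j t i i').mono hmono le_rfl)
        (fun j => h.w_adapted j _ _) (fun j => h.w_adapted j _ _))
      hXm) i).sub (measurable_mulVec hDm (measurable_mulVec (measurable_corrector
      (fun j s hs i i' => h.K_adapted j s _ i i' (by omega))
      (fun j r _ => h.w_adapted j r _)) hXm) i))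
  set Φ := fun ω => randomFlow δ D (t + 1) T ω with hΦ
  have hU2 : ∀ k, MemLp (fun ω => U ω k) 2 P := memLp_mulVec Λ (hD.memLp_flow
    (hX.measurable_corrected_adapted h hD ht) (hX.memLp_corrected h hδ ht) hT.le)
  have hΦn2 : ∀ k, MemLp (fun ω => (Λ *ᵥ (Φ ω *ᵥ n ω)) k) 2 P :=
    memLp_mulVec Λ (hD.memLp_flow hnm hn2 hT)
  have hΦr2 : ∀ k, MemLp (fun ω => (Λ *ᵥ (Φ ω *ᵥ r ω)) k) 2 P :=
    memLp_mulVec Λ (hD.memLp_flow hrm hr2 hT)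
  have hstep : ∀ ω, Λ *ᵥ (Φ ω *ᵥ corrected δ w K d (t + 1) ω (X (t + 1) ω)) =
      U ω + Λ *ᵥ (Φ ω *ᵥ n ω) + Λ *ᵥ (Φ ω *ᵥ r ω) := by
    intro ω
    have e1 : randomFlow δ D t T ω = Φ ω * (1 + δ t • D t ω) := flow_eq_flow_succ_mul hT
    rw [hX.step t ht, corrected_step]
    simp only [hU, e1, innovation, ← Matrix.mulVec_mulVec, Matrix.add_mulVec, Matrix.one_mulVec,
      Matrix.smul_mulVec, Matrix.mulVec_add, hn, hr]
    abel
  have hcross := hX.integral_dotProduct_noise_eq_zero h hD hδ Λ ht hT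
  have hd2 : 0 < δ t ^ 2 := by have := hδpos t; positivity
  have hi1 := (integrable_sqNorm hU2).const_mul (1 + δ t ^ 2)
  have hi2 := (integrable_dotProduct hU2 hΦn2).const_mul 2
  have hi3 := (integrable_sqNorm hΦn2).const_mul 2
  have hi4 := (integrable_sqNorm hΦr2).const_mul ((δ t ^ 2)⁻¹ + 2)
  have hlast2 : ∀ k, MemLp (fun ω => (U ω + Λ *ᵥ (Φ ω *ᵥ n ω) + Λ *ᵥ (Φ ω *ᵥ r ω)) k) 2 P :=
    fun k => ((hU2 k).add (hΦn2 k)).add (hΦr2 k)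
  have hmain := integral_mono (integrable_sqNorm hlast2) (((hi1.fun_add hi2).fun_add hi3).fun_add hi4)
    fun ω => sqNorm_add_three_le (U ω) _ _ hd2
  rw [integral_add ((hi1.fun_add hi2).fun_add hi3) hi4, integral_add (hi1.fun_add hi2) hi3,
    integral_add hi1 hi2, integral_const_mul, integral_const_mul, integral_const_mul,
    integral_const_mul, hcross] at hmain
  rw [integral_congr_ae (ae_of_all _ fun ω => congrArg sqNorm (hstep ω))]
  refine hmain.trans ?_
  have hW := windowMoment_nonneg (P := P) (w := w) (X := X) (d + 1) t
  set W := windowMoment P w X (d + 1) t with hWdef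
  have h1 : ∫ ω, sqNorm (Λ *ᵥ (Φ ω *ᵥ n ω)) ∂P ≤ g * ((2 * b * R) ^ 2 * μ * (δ t ^ 2 * W)) :=
    (hg n hnm hn2).trans (mul_le_mul_of_nonneg_left hnle hg0)
  have h2 : ((δ t ^ 2)⁻¹ + 2) * ∫ ω, sqNorm (Λ *ᵥ (Φ ω *ᵥ r ω)) ∂P ≤
      3 * (4 * (d + 1) * b ^ 2 * R) ^ 2 * μ * (δ t ^ 2 * g * W) := by
    have h3 := (hg r hrm hr2).trans (mul_le_mul_of_nonneg_left hrle hg0)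
    -- The remainder has second moment of order `δ⁴`, so Young's factor `δ⁻²` still leaves `δ²`.
    have h4 : ((δ t ^ 2)⁻¹ + 2) * δ t ^ 4 ≤ 3 * δ t ^ 2 := by
      have e1 : ((δ t ^ 2)⁻¹ + 2) * δ t ^ 4 = (1 + 2 * δ t ^ 2) * δ t ^ 2 := by
        have := (hδpos t).ne'
        field_simp
      have h5 : δ t ^ 2 ≤ 1 := pow_le_one₀ (hδpos t).le (hδ t ht).2.1
      rw [e1]
      exact mul_le_mul_of_nonneg_right (by linarith) hd2.le
    calc _ ≤ ((δ t ^ 2)⁻¹ + 2) *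
          (g * ((4 * (d + 1) * b ^ 2 * R) ^ 2 * μ * (δ t ^ 4 * W))) :=
          mul_le_mul_of_nonneg_left h3 (by positivity)
      _ = (((δ t ^ 2)⁻¹ + 2) * δ t ^ 4) * (g * ((4 * (d + 1) * b ^ 2 * R) ^ 2 * μ * W)) := by ring
      _ ≤ (3 * δ t ^ 2) * (g * ((4 * (d + 1) * b ^ 2 * R) ^ 2 * μ * W)) := by gcongr
      _ = _ := by ring
  calc _ ≤ (1 + δ t ^ 2) * ∫ ω, sqNorm (U ω) ∂P + 2 * 0 +
        2 * (g * ((2 * b * R) ^ 2 * μ * (δ t ^ 2 * W))) +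
        3 * (4 * (d + 1) * b ^ 2 * R) ^ 2 * μ * (δ t ^ 2 * g * W) := by gcongr
    _ = _ := by ring

end CorrectedProcess

/-! ### The rate for present and delayed noise -/

section DelayedNoiseRate

/-- Eventually `1 / δ` drops by at most one per step and is at least two, so `δ` at most doubles in
one step. -/
lemma IsStepSize.eventually_slowlyVarying {δ : ℕ → ℝ} {ℓ : ℝ} (h : IsStepSize δ) (hℓ : 0 ≤ ℓ)
    (hδ : Tendsto (fun t => (δ (t + 1))⁻¹ - (δ t)⁻¹) atTop (𝓝 ℓ)) (d : ℕ) :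
    ∃ t₀, ∀ t ≥ t₀, SlowlyVarying δ (2 ^ (d + 2)) d t := by
  obtain ⟨t₁, ht₁⟩ := eventually_atTop.1 (hδ.eventually_const_le (by linarith : (-1 : ℝ) < ℓ))
  obtain ⟨t₂, ht₂⟩ := h.eventually_le (ε := 1 / 2) (by norm_num)
  have hsucc : ∀ t ≥ max t₁ t₂, δ (t + 1) ≤ 2 * δ t := by
    intro t ht
    have hp := h.pos t
    have hp1 := h.pos (t + 1)
    have h1 := ht₁ t ((le_max_left _ _).trans ht)
    have h2 := ht₂ t ((le_max_right _ _).trans ht)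
    have h3 : 2 ≤ (δ t)⁻¹ := by
      rw [le_inv_comm₀ (by norm_num) hp]
      linarith
    have h4 : (2 * δ t)⁻¹ ≤ (δ (t + 1))⁻¹ := by
      rw [mul_inv]
      linarith
    exact (inv_le_inv₀ (by positivity) hp1).1 h4
  refine ⟨max t₁ t₂, fun t ht => ⟨(h.pos t).le,
    (ht₂ t ((le_max_right _ _).trans ht)).trans (by norm_num), one_le_pow₀ (by norm_num),
    fun k hk => ⟨(h.pos _).le, ?_⟩⟩⟩
  have hpow : δ (t + k) ≤ 2 ^ k * δ t := by
    clear hk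
    induction k with
    | zero => simp
    | succ k ih =>
      rw [← add_assoc, pow_succ]
      linarith [hsucc (t + k) (by omega)]
  refine hpow.trans (mul_le_mul_of_nonneg_right ?_ (h.pos t).le)
  exact pow_le_pow_right₀ (by norm_num) hk

/-- Gronwall on a finite horizon: in the application `u` and `b` themselves depend on `T`, so the
recursion is available only before `T`. -/
lemma le_exp_mul_of_recursion {u a b : ℕ → ℝ} {s₀ T : ℕ} (hT : s₀ ≤ T) (hu : 0 ≤ u s₀)
    (ha : ∀ s, 0 ≤ a s) (hb : ∀ s, s₀ ≤ s → s < T → 0 ≤ b s)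
    (h : ∀ s, s₀ ≤ s → s < T → u (s + 1) ≤ (1 + a s) * u s + b s) :
    u T ≤ Real.exp (∑ s ∈ Finset.Ico s₀ T, a s) * (u s₀ + ∑ s ∈ Finset.Ico s₀ T, b s) := by
  induction T, hT using Nat.le_induction with
  | base => simp
  | succ T hT ih =>
    have h1 := ih (fun s h1 h2 => hb s h1 (h2.trans (Nat.lt_succ_self T)))
      fun s h1 h2 => h s h1 (h2.trans (Nat.lt_succ_self T))
    have h2 := h T hT (Nat.lt_succ_self T)
    have h3 := hb T hT (Nat.lt_succ_self T)
    rw [Finset.sum_Ico_succ_top hT, Finset.sum_Ico_succ_top hT, Real.exp_add]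
    set A := ∑ s ∈ Finset.Ico s₀ T, a s
    set B := ∑ s ∈ Finset.Ico s₀ T, b s with hB
    have hA0 : 0 ≤ A := Finset.sum_nonneg fun s _ => ha s
    have hB0 : 0 ≤ B := Finset.sum_nonneg fun s hs =>
      hb s (Finset.mem_Ico.1 hs).1 ((Finset.mem_Ico.1 hs).2.trans (Nat.lt_succ_self T))
    have haT := ha T
    have h4 : 1 + a T ≤ Real.exp (a T) := by linarith [Real.add_one_le_exp (a T)]
    have h5 : 1 ≤ Real.exp A * Real.exp (a T) :=
      one_le_mul_of_one_le_of_one_le (Real.one_le_exp hA0) (Real.one_le_exp haT)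
    calc u (T + 1) ≤ (1 + a T) * (Real.exp A * (u s₀ + B)) + b T :=
          h2.trans (add_le_add (mul_le_mul_of_nonneg_left h1 (by positivity)) le_rfl)
      _ ≤ Real.exp (a T) * (Real.exp A * (u s₀ + B)) + Real.exp A * Real.exp (a T) * b T :=
          add_le_add (mul_le_mul_of_nonneg_right h4 (by positivity)) (le_mul_of_one_le_left h3 h5)
      _ = _ := by ring

variable {Ω J ι κ : Type*} [mΩ : MeasurableSpace Ω] {P : Measure Ω} [Fintype J] [Fintype ι]
  [Fintype κ] {𝒢 𝒜 𝒩 : ℕ → MeasurableSpace Ω} {w : J → ℤ → Ω → ℝ} {D : ℕ → Ω → Matrix ι ι ℝ}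
  {K M : J → ℕ → Ω → Matrix ι ι ℝ} {b μ : ℝ} {d : ℕ} {δ : ℕ → ℝ} {R : ℝ}
  {L : Matrix κ ι ℝ} {bL c : ℝ} {τ s₀ : ℕ} {X : ℕ → Ω → ι → ℝ}

lemma IsSolution.integral_le_corrected (hX : IsSolution P 𝒢 𝒜 δ w D K M d s₀ X)
    (h : DelayedNoise P 𝒢 𝒜 𝒩 w D K M b μ d) (hδ : ∀ t ≥ s₀, SlowlyVarying δ R d t)
    {κ' : Type*} [Fintype κ'] (Λ : Matrix κ' ι ℝ) {t : ℕ} (ht : s₀ ≤ t) :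
    ∫ ω, sqNorm (Λ *ᵥ X t ω) ∂P ≤ 2 * ∫ ω, sqNorm (Λ *ᵥ corrected δ w K d t ω (X t ω)) ∂P +
      2 * frobSq Λ * ((d + 1) * b * R) ^ 2 * (δ t ^ 2 * windowMoment P w X (d + 1) t) := by
  obtain ⟨hQ, hQle⟩ := hX.corrector_mulVec h hδ ht
  have hi1 := (integrable_sqNorm (memLp_mulVec Λ (hX.memLp_corrected h hδ ht))).const_mul 2
  have hi2 := (integrable_sqNorm hQ).const_mul (2 * frobSq Λ)
  have h1 := integral_mono (integrable_sqNorm (memLp_mulVec Λ (hX.memLp h hδ ht)))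
    (hi1.fun_add hi2) fun ω => by
      have e : Λ *ᵥ X t ω = Λ *ᵥ corrected δ w K d t ω (X t ω) +
          -(Λ *ᵥ (corrector δ w K d t ω *ᵥ X t ω)) := by
        rw [corrected, Matrix.mulVec_add]
        abel
      have h2 := sqNorm_add_le_two (Λ *ᵥ corrected δ w K d t ω (X t ω))
        (-(Λ *ᵥ (corrector δ w K d t ω *ᵥ X t ω)))
      rw [← e, ← nrm_sq (-_), nrm_neg, nrm_sq] at h2
      have h3 := sqNorm_mulVec_le Λ (corrector δ w K d t ω *ᵥ X t ω)
      change _ ≤ 2 * _ + 2 * frobSq Λ * _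
      linarith
  rw [integral_add hi1 hi2, integral_const_mul, integral_const_mul] at h1
  have h2 := mul_le_mul_of_nonneg_left hQle (mul_nonneg zero_le_two (frobSq_nonneg Λ))
  linarith

variable [DecidableEq ι]

/-- Iteration of the one-step estimate from `s₀` to `T`. -/
lemma IsSolution.integral_corrected_le (hX : IsSolution P 𝒢 𝒜 δ w D K M d s₀ X)
    (h : DelayedNoise P 𝒢 𝒜 𝒩 w D K M b μ d) (hD : AveragedDrift P 𝒢 D L bL c τ)
    (hδ : ∀ t ≥ s₀, SlowlyVarying δ R d t) (hstep : IsStepSize δ) (hμ0 : 0 ≤ μ)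
    {κ' : Type*} [Fintype κ'] (Λ : Matrix κ' ι ℝ) (g : ℕ → ℕ → ℝ)
    (hg0 : ∀ s t, s ≥ s₀ → 0 ≤ g s t)
    (hg : ∀ s ≥ s₀, ∀ T ≥ s, ∀ v : Ω → ι → ℝ, (∀ i, Measurable[𝒢 s] fun ω => v ω i) →
      (∀ i, MemLp (fun ω => v ω i) 2 P) →
      ∫ ω, sqNorm (Λ *ᵥ (randomFlow δ D s T ω *ᵥ v ω)) ∂P ≤ g s T * ∫ ω, sqNorm (v ω) ∂P)
    {T : ℕ} (hT : s₀ ≤ T) :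
    ∫ ω, sqNorm (Λ *ᵥ corrected δ w K d T ω (X T ω)) ∂P ≤ Real.exp (∑' t, δ t ^ 2) *
      (g s₀ T * ∫ ω, sqNorm (corrected δ w K d s₀ ω (X s₀ ω)) ∂P +
        ∑ s ∈ Finset.Ico s₀ T, (2 * (2 * b * R) ^ 2 + 3 * (4 * (d + 1) * b ^ 2 * R) ^ 2) * μ *
          (δ s ^ 2 * g (s + 1) T * windowMoment P w X (d + 1) s)) := by
  set A₁ : ℝ := (2 * (2 * b * R) ^ 2 + 3 * (4 * (d + 1) * b ^ 2 * R) ^ 2) * μ with hA₁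
  have hA₁0 : 0 ≤ A₁ := by positivity
  set u : ℕ → ℝ := fun s => ∫ ω, sqNorm (Λ *ᵥ (randomFlow δ D s T ω *ᵥ
    corrected δ w K d s ω (X s ω))) ∂P with hu
  have hb0 : ∀ s, s₀ ≤ s → 0 ≤ A₁ * (δ s ^ 2 * g (s + 1) T * windowMoment P w X (d + 1) s) :=
    fun s hs => mul_nonneg hA₁0 (mul_nonneg (mul_nonneg (sq_nonneg _) (hg0 _ _ (by omega)))
      (windowMoment_nonneg _ s))
  have h1 := le_exp_mul_of_recursion (u := u) (a := fun s => δ s ^ 2) hT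
    (integral_sqNorm_nonneg _) (fun s => sq_nonneg _) (fun s hs _ => hb0 s hs)
    fun s hs hsT => hX.integral_flow_succ_le h hD hδ hstep.pos hμ0 Λ hs hsT
      (hg0 (s + 1) T (by omega)) fun v hv hv2 => hg (s + 1) (by omega) T hsT v hv hv2
  have h2 : u T = ∫ ω, sqNorm (Λ *ᵥ corrected δ w K d T ω (X T ω)) ∂P := by
    simp only [hu, randomFlow, flow_self, Matrix.one_mulVec]
  rw [← h2]
  have h3 : u s₀ ≤ g s₀ T * ∫ ω, sqNorm (corrected δ w K d s₀ ω (X s₀ ω)) ∂P :=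
    hg s₀ le_rfl T hT _ (hX.measurable_corrected_adapted h hD le_rfl)
      (hX.memLp_corrected h hδ le_rfl)
  refine h1.trans (mul_le_mul (Real.exp_le_exp.2 (hstep.summable_sq.sum_le_tsum _
    fun _ _ => sq_nonneg _)) (add_le_add h3 le_rfl)
    (add_nonneg (integral_sqNorm_nonneg _) (Finset.sum_nonneg fun s hs =>
      hb0 s (Finset.mem_Ico.1 hs).1)) (Real.exp_nonneg _))

variable [IsProbabilityMeasure P]

/-- Mean square rate for a linear recursion whose coefficients average out and are perturbed by
present and delayed noise. -/
theorem DelayedNoise.exists_integral_le_rpow (h : DelayedNoise P 𝒢 𝒜 𝒩 w D K M b μ d)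
    (hD : AveragedDrift P 𝒢 D L bL c τ) (hstep : IsStepSize δ) {ℓ : ℝ} (hℓ : 0 ≤ ℓ)
    (hδ : Tendsto (fun t => (δ (t + 1))⁻¹ - (δ t)⁻¹) atTop (𝓝 ℓ)) :
    ∃ s₁, ∀ s₀ ≥ s₁, ∀ X, IsSolution P 𝒢 𝒜 δ w D K M d s₀ X →
      (∀ t ≥ s₀, ∀ i, MemLp (fun ω => X t ω i) 2 P) ∧ ∃ A t₁, ∀ t ≥ t₁,
        ∫ ω, sqNorm (L *ᵥ X t ω) ∂P ≤ A * δ t ^ rateExponent (c / 2) ℓ := by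
  obtain ⟨t₀, ht₀⟩ := hstep.eventually_slowlyVarying hℓ hδ d
  obtain ⟨s₂, C, hC0, hdecay, hflow⟩ := hD.exists_flow_bound hstep
  set R : ℝ := 2 ^ (d + 2) with hR
  refine ⟨max t₀ s₂, fun s₀ hs₀ X hX => ?_⟩
  have hSV : ∀ t ≥ s₀, SlowlyVarying δ R d t := fun t ht =>
    ht₀ t ((le_max_left _ _).trans (hs₀.le.trans ht))
  have hs₂ : s₂ ≤ s₀ := (le_max_right _ _).trans hs₀
  have hμ := h.one_le_moment
  have hμ0 : 0 ≤ μ := by linarith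
  have hc := hD.c_pos
  refine ⟨fun t ht => hX.memLp h hSV ht, ?_⟩
  set Xc : ℕ → Ω → ι → ℝ := fun t ω => corrected δ w K d t ω (X t ω) with hXc
  have hXcm : ∀ t ≥ s₀, ∀ i, Measurable[𝒢 t] fun ω => Xc t ω i := fun t ht =>
    hX.measurable_corrected_adapted h hD ht
  have hXc2 : ∀ t ≥ s₀, ∀ i, MemLp (fun ω => Xc t ω i) 2 P := fun t ht =>
    hX.memLp_corrected h hSV ht
  set W : ℕ → ℝ := windowMoment P w X (d + 1) with hW
  have hW0 : ∀ t, 0 ≤ W t := windowMoment_nonneg _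
  set x₀ : ℝ := ∫ ω, sqNorm (Xc s₀ ω) ∂P with hx₀
  have hx₀0 : 0 ≤ x₀ := integral_sqNorm_nonneg _
  set A₁ : ℝ := (2 * (2 * b * R) ^ 2 + 3 * (4 * (d + 1) * b ^ 2 * R) ^ 2) * μ with hA₁
  have hA₁0 : 0 ≤ A₁ := by positivity
  set S : ℝ := ∑' t, δ t ^ 2 with hS
  have hSle : ∀ T, ∑ k ∈ Finset.Ico s₀ T, δ k ^ 2 ≤ S := fun T =>
    hstep.summable_sq.sum_le_tsum _ fun _ _ => sq_nonneg _
  have hsum : ∀ {f : ℕ → ℝ} {t T : ℕ}, (∀ s, 0 ≤ f s) → T ≤ t →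
      ∑ s ∈ Finset.Ico s₀ T, f s ≤ ∑ s ∈ Finset.Ico s₀ t, f s := fun hf hT =>
    Finset.sum_le_sum_of_subset_of_nonneg (Finset.Ico_subset_Ico le_rfl hT) fun s _ _ => hf s
  have hfW0 : ∀ s, 0 ≤ δ s ^ 2 * W s := fun s => mul_nonneg (sq_nonneg _) (hW0 s)
  -- Here only the boundedness of the flow is used, with `Λ = 1` and constant `g`; the contraction
  -- enters in `hLc`.
  have hnorm : ∀ T ≥ s₀, ∫ ω, sqNorm (Xc T ω) ∂P ≤
      Real.exp S * C * (x₀ + A₁ * ∑ s ∈ Finset.Ico s₀ T, δ s ^ 2 * W s) := by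
    intro T hT
    have h1 := hX.integral_corrected_le h hD hSV hstep hμ0 (1 : Matrix ι ι ℝ) (fun _ _ => C)
      (fun _ _ _ => hC0)
      (fun s hs T hT v hv hv2 => by
        simp only [Matrix.one_mulVec]
        exact (hflow s (hs₂.trans hs) v hv hv2 T hT).2) hT
    simp only [Matrix.one_mulVec] at h1
    change _ ≤ Real.exp S * (C * x₀ + ∑ s ∈ Finset.Ico s₀ T, A₁ * (δ s ^ 2 * C * W s)) at h1
    have e1 : ∑ s ∈ Finset.Ico s₀ T, A₁ * (δ s ^ 2 * C * W s) =
        C * A₁ * ∑ s ∈ Finset.Ico s₀ T, δ s ^ 2 * W s := by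
      rw [Finset.mul_sum]
      exact Finset.sum_congr rfl fun s _ => by ring
    rw [e1] at h1
    exact h1.trans (le_of_eq (by ring))
  set f₁ := frobSq (1 : Matrix ι ι ℝ) with hf₁
  have hf₁0 : 0 ≤ f₁ := frobSq_nonneg _
  set a₁ : ℝ := ((d + 1) * b * R) ^ 2 with ha₁
  have ha₁0 : 0 ≤ a₁ := sq_nonneg _
  set B₁ : ℝ := 2 * (Real.exp S * C * x₀) with hB₁
  set B₂ : ℝ := 2 * (Real.exp S * C * A₁) + 2 * f₁ * a₁ with hB₂
  have hB₁0 : 0 ≤ B₁ := by positivity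
  have hB₂0 : 0 ≤ B₂ := by positivity
  -- The sum includes time `T`, because removing the corrector at `T` costs a multiple of `δ(T)²
  -- W(T)`.
  have hmom0 : ∀ T ≥ s₀, windowMoment P w X 0 T ≤
      B₁ + B₂ * ∑ s ∈ Finset.Ico s₀ (T + 1), δ s ^ 2 * W s := by
    intro T hT
    have h1 := hX.integral_le_corrected h hSV (1 : Matrix ι ι ℝ) hT
    simp only [Matrix.one_mulVec] at h1
    rw [windowMoment_zero]
    have h2 := hnorm T hT
    have h3 : ∑ s ∈ Finset.Ico s₀ T, δ s ^ 2 * W s ≤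
        ∑ s ∈ Finset.Ico s₀ (T + 1), δ s ^ 2 * W s := hsum hfW0 (Nat.le_succ T)
    have h4 : δ T ^ 2 * W T ≤ ∑ s ∈ Finset.Ico s₀ (T + 1), δ s ^ 2 * W s :=
      Finset.single_le_sum (f := fun s => δ s ^ 2 * W s) (fun s _ => hfW0 s)
        (Finset.mem_Ico.2 ⟨hT, Nat.lt_succ_self T⟩)
    set Y₁ := ∑ s ∈ Finset.Ico s₀ (T + 1), δ s ^ 2 * W s
    calc _ ≤ 2 * (Real.exp S * C * (x₀ + A₁ * Y₁)) + 2 * f₁ * a₁ * Y₁ := by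
          refine h1.trans (add_le_add ?_ ?_)
          · exact mul_le_mul_of_nonneg_left (h2.trans (by gcongr)) zero_le_two
          · exact mul_le_mul_of_nonneg_left h4 (by positivity)
      _ = _ := by rw [hB₁, hB₂]; ring
  set C₀ : ℝ := (2 * μ) ^ (d + 1) * B₁ + ∑ t ∈ Finset.Ico s₀ (s₀ + (d + 1)), W t with hC₀
  set C₁ : ℝ := (2 * μ) ^ (d + 1) * (B₂ + 18 * b ^ 2 * μ) with hC₁
  have hC₀0 : 0 ≤ C₀ := add_nonneg (by positivity) (Finset.sum_nonneg fun t _ => hW0 t)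
  have hC₁0 : 0 ≤ C₁ := by positivity
  -- Going back `d + 1` steps makes the right-hand side involve times before `T` only, as Gronwall
  -- requires; the first `d + 1` values of `W` are put into `C₀`.
  have hWrec : ∀ T ≥ s₀, W T ≤ C₀ + ∑ s ∈ Finset.Ico s₀ T, C₁ * δ s ^ 2 * W s := by
    intro T hT
    have hrest : 0 ≤ ∑ s ∈ Finset.Ico s₀ T, C₁ * δ s ^ 2 * W s := Finset.sum_nonneg fun s _ =>
      mul_nonneg (mul_nonneg hC₁0 (sq_nonneg _)) (hW0 s)
    by_cases hTd : T < s₀ + (d + 1)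
    · have h1 : W T ≤ ∑ t ∈ Finset.Ico s₀ (s₀ + (d + 1)), W t :=
        Finset.single_le_sum (f := W) (fun s _ => hW0 s) (Finset.mem_Ico.2 ⟨hT, hTd⟩)
      have : 0 ≤ (2 * μ) ^ (d + 1) * B₁ := by positivity
      linarith
    · obtain ⟨t, rfl⟩ : ∃ t, T = t + (d + 1) := ⟨T - (d + 1), by omega⟩
      have ht : s₀ ≤ t := by omega
      have h1 := hX.windowMoment_le h hSV ht (k := d + 1) le_rfl
      have h2 := hmom0 t ht
      have h3 : ∑ s ∈ Finset.Ico s₀ (t + 1), δ s ^ 2 * W s ≤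
          ∑ s ∈ Finset.Ico s₀ (t + (d + 1)), δ s ^ 2 * W s := hsum hfW0 (by omega)
      have h4 : ∑ s ∈ Finset.Ico t (t + (d + 1)), δ s ^ 2 * W s ≤
          ∑ s ∈ Finset.Ico s₀ (t + (d + 1)), δ s ^ 2 * W s :=
        Finset.sum_le_sum_of_subset_of_nonneg (Finset.Ico_subset_Ico ht le_rfl) fun s _ _ => hfW0 s
      have h5 : ∑ s ∈ Finset.Ico s₀ (t + (d + 1)), C₁ * δ s ^ 2 * W s =
          C₁ * ∑ s ∈ Finset.Ico s₀ (t + (d + 1)), δ s ^ 2 * W s := by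
        rw [Finset.mul_sum]
        exact Finset.sum_congr rfl fun s _ => by ring
      have h6 : 0 ≤ ∑ t ∈ Finset.Ico s₀ (s₀ + (d + 1)), W t := Finset.sum_nonneg fun t _ => hW0 t
      rw [h5]
      set Y₁ := ∑ s ∈ Finset.Ico s₀ (t + (d + 1)), δ s ^ 2 * W s
      calc W (t + (d + 1)) ≤ (2 * μ) ^ (d + 1) * ((B₁ + B₂ * Y₁) + 18 * b ^ 2 * μ * Y₁) := by
            refine h1.trans (mul_le_mul_of_nonneg_left (add_le_add (h2.trans ?_) ?_) (by positivity))
            · gcongr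
            · exact mul_le_mul_of_nonneg_left h4 (by positivity)
        _ = (2 * μ) ^ (d + 1) * B₁ + C₁ * Y₁ := by rw [hC₁]; ring
        _ ≤ _ := by linarith
  set Wm : ℝ := C₀ * Real.exp (C₁ * S) with hWm
  have hWm0 : 0 ≤ Wm := by positivity
  have hWle : ∀ T ≥ s₀, W T ≤ Wm := fun T hT =>
    le_of_le_add_sum (a := fun s => C₁ * δ s ^ 2) hC₀0
      (fun s => mul_nonneg hC₁0 (sq_nonneg _))
      (fun T => by rw [← Finset.mul_sum]; exact mul_le_mul_of_nonneg_left (hSle T) hC₁0) hWrec hT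
  -- The variation-of-constants solution of `V(T+1) = (1 - c δ / 2) V(T) + δ²`; the bounds on the
  -- transported noise have exactly this shape.
  set V : ℕ → ℝ := fun T => decay δ (c / 2) s₀ T +
    ∑ s ∈ Finset.Ico s₀ T, δ s ^ 2 * decay δ (c / 2) (s + 1) T with hV
  have hVrec : ∀ T ≥ s₀, V (T + 1) ≤ (1 - c / 2 * δ T) * V T + 1 * δ T ^ 2 := by
    intro T hT
    simp only [hV]
    rw [decay_succ _ hT, Finset.sum_Ico_succ_top hT, decay_self, mul_add, Finset.mul_sum, mul_one,
      one_mul, ← add_assoc]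
    refine le_of_eq ?_
    congr 2
    refine Finset.sum_congr rfl fun s hs => ?_
    rw [decay_succ _ (Finset.mem_Ico.1 hs).2]
    ring
  obtain ⟨M₁, hM₁0, t₁, hM₁⟩ := hstep.le_rpow_of_recursion hℓ hδ (by positivity : 0 < c / 2)
    zero_le_one hVrec
  have hg0 : ∀ s t, s ≥ s₀ → 0 ≤ decay δ (c / 2) s t := fun s t hs =>
    decay_nonneg (fun r hr => hdecay r (hs₂.trans (le_trans hs hr))) t
  set Γ : ℝ := Real.exp S * C * (x₀ + A₁ * Wm) with hΓ
  have hΓ0 : 0 ≤ Γ := by positivity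
  have hLc : ∀ T ≥ s₀, ∫ ω, sqNorm (L *ᵥ Xc T ω) ∂P ≤ Γ * V T := by
    intro T hT
    have h1 := hX.integral_corrected_le h hD hSV hstep hμ0 L (fun s T => C * decay δ (c / 2) s T)
      (fun s t hs => mul_nonneg hC0 (hg0 s t hs))
      (fun s hs T hT v hv hv2 => (hflow s (hs₂.trans hs) v hv hv2 T hT).1) hT
    have hV1 : decay δ (c / 2) s₀ T ≤ V T := le_add_of_nonneg_right
      (Finset.sum_nonneg fun s hs => mul_nonneg (sq_nonneg _)
        (hg0 _ _ (by have := (Finset.mem_Ico.1 hs).1; omega)))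
    have hV2 : ∑ s ∈ Finset.Ico s₀ T, δ s ^ 2 * decay δ (c / 2) (s + 1) T ≤ V T :=
      le_add_of_nonneg_left (hg0 _ _ le_rfl)
    have h2 : ∑ s ∈ Finset.Ico s₀ T, A₁ * (δ s ^ 2 * (C * decay δ (c / 2) (s + 1) T) * W s) ≤
        A₁ * C * Wm * ∑ s ∈ Finset.Ico s₀ T, δ s ^ 2 * decay δ (c / 2) (s + 1) T := by
      rw [Finset.mul_sum]
      refine Finset.sum_le_sum fun s hs => ?_
      have h3 := hWle s (Finset.mem_Ico.1 hs).1
      have h4 := hg0 (s + 1) T (by have := (Finset.mem_Ico.1 hs).1; omega)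
      calc _ = A₁ * C * (δ s ^ 2 * decay δ (c / 2) (s + 1) T) * W s := by ring
        _ ≤ A₁ * C * (δ s ^ 2 * decay δ (c / 2) (s + 1) T) * Wm := by gcongr
        _ = _ := by ring
    calc _ ≤ Real.exp S * (C * V T * x₀ + A₁ * C * Wm * V T) := by
          refine h1.trans (mul_le_mul_of_nonneg_left (add_le_add ?_ (h2.trans ?_))
            (Real.exp_nonneg _))
          · gcongr
          · gcongr
      _ = _ := by rw [hΓ]; ring
  set fL := frobSq L with hfL
  have hfL0 : 0 ≤ fL := frobSq_nonneg L
  refine ⟨2 * (Γ * M₁) + 2 * fL * a₁ * Wm, max s₀ t₁, fun t ht => ?_⟩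
  have hts : s₀ ≤ t := (le_max_left _ _).trans ht
  have h1 := hX.integral_le_corrected h hSV L hts
  have h2 := hLc t hts
  have h3 := hM₁ t ((le_max_right _ _).trans ht)
  have h4 : δ t ^ 2 ≤ δ t ^ rateExponent (c / 2) ℓ := by
    rw [← Real.rpow_natCast]
    refine Real.rpow_le_rpow_of_exponent_ge (hstep.pos t) (hSV t hts).2.1 ?_
    have := rateExponent_lt_one (c / 2) ℓ
    push_cast
    linarith
  have hr0 : 0 ≤ δ t ^ rateExponent (c / 2) ℓ := Real.rpow_nonneg (hstep.pos t).le _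
  set ρ := δ t ^ rateExponent (c / 2) ℓ
  calc _ ≤ 2 * (Γ * (M₁ * ρ)) + 2 * fL * a₁ * (ρ * Wm) := by
        refine h1.trans (add_le_add ?_ ?_)
        · exact mul_le_mul_of_nonneg_left (h2.trans (by gcongr)) zero_le_two
        · have := hWle t hts
          have := hW0 t
          exact mul_le_mul_of_nonneg_left (by gcongr) (by positivity)
    _ = _ := by ring

end DelayedNoiseRate

/-! ### Mixing in the presence of independent noise -/

section Mixing

lemma sup_eq_generateFrom_image2_inter {Ω : Type*} (F E : MeasurableSpace Ω) :
    F ⊔ E = MeasurableSpace.generateFrom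
      (Set.image2 (· ∩ ·) {s | MeasurableSet[F] s} {s | MeasurableSet[E] s}) := by
  refine le_antisymm (sup_le (fun s hs => ?_) fun s hs => ?_)
    (MeasurableSpace.generateFrom_le ?_)
  · exact MeasurableSpace.measurableSet_generateFrom ⟨s, hs, Set.univ, MeasurableSet.univ, by simp⟩
  · exact MeasurableSpace.measurableSet_generateFrom ⟨Set.univ, MeasurableSet.univ, s, hs, by simp⟩
  · rintro _ ⟨s, hs, t, ht, rfl⟩
    exact MeasurableSet.inter ((le_sup_left : F ≤ F ⊔ E) s hs) ((le_sup_right : E ≤ F ⊔ E) t ht)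

lemma isPiSystem_image2_inter {Ω : Type*} (F E : MeasurableSpace Ω) :
    IsPiSystem (Set.image2 (· ∩ ·) {s | MeasurableSet[F] s} {s | MeasurableSet[E] s}) := by
  rintro _ ⟨s, hs, t, ht, rfl⟩ _ ⟨s', hs', t', ht', rfl⟩ -
  exact ⟨s ∩ s', @MeasurableSet.inter _ F _ _ hs hs', t ∩ t', @MeasurableSet.inter _ E _ _ ht ht',
    Set.inter_inter_inter_comm ..⟩

variable {Ω : Type*} {F E X : MeasurableSpace Ω} [mΩ : MeasurableSpace Ω] {P : Measure Ω}
  {f g : Ω → ℝ}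

lemma setIntegral_inter_of_indep (hX : X ≤ mΩ) (hE : E ≤ mΩ) (h : Indep X E P)
    (hf : Measurable[X] f) {s t : Set Ω} (hs : MeasurableSet[X] s)
    (ht : MeasurableSet[E] t) :
    ∫ ω in s ∩ t, f ω ∂P = (∫ ω in s, f ω ∂P) * P.real t := by
  have h1 : Measurable[X] (s.indicator f) := hf.indicator hs
  have h2 : Measurable[E] (t.indicator fun _ => (1 : ℝ)) := measurable_const.indicator ht
  have := integral_mul_of_indep hX hE h h1 h2
  rw [integral_indicator (hX s hs), integral_indicator (hE t ht), setIntegral_const, smul_eq_mul,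
    mul_one] at this
  rw [← this, ← integral_indicator ((hX s hs).inter (hE t ht))]
  refine integral_congr_ae (ae_of_all _ fun ω => ?_)
  by_cases h3 : ω ∈ s <;> by_cases h4 : ω ∈ t <;> simp [h3, h4]

variable [IsProbabilityMeasure P]

/-- An independent `σ`-algebra adds no information: over `a ∩ b` with `a` in `F` and `b` in `E` the
probability of `b` factors out of both integrals, and such sets form a generating π-system. -/
lemma condExp_sup_of_indep (hFX : F ≤ X) (hX : X ≤ mΩ) (hE : E ≤ mΩ) (h : Indep X E P)
    (hf : Measurable[X] f) (hfi : Integrable f P) : P[f | F] =ᵐ[P] P[f | F ⊔ E] := by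
  have hF : F ≤ mΩ := hFX.trans hX
  have hm : F ⊔ E ≤ mΩ := sup_le hF hE
  have hc : Measurable[X] (P[f | F]) := stronglyMeasurable_condExp.measurable.mono hFX le_rfl
  refine ae_eq_condExp_of_forall_setIntegral_eq hm hfi
    (fun s _ _ => integrable_condExp.integrableOn) (fun s hs _ => ?_)
    ⟨P[f | F], stronglyMeasurable_condExp.mono le_sup_left, EventuallyEq.rfl⟩
  induction s, hs using MeasurableSpace.induction_on_inter
    (sup_eq_generateFrom_image2_inter F E) (isPiSystem_image2_inter F E) with
  | empty => simp
  | basic s hs =>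
    obtain ⟨a, ha, b, hb, rfl⟩ := hs
    rw [setIntegral_inter_of_indep hX hE h hc (hFX a ha) hb,
      setIntegral_inter_of_indep hX hE h hf (hFX a ha) hb, setIntegral_condExp hF hfi ha]
  | compl s hs ih =>
    have h1 := integral_add_compl (hm s hs) (integrable_condExp (m := F) (μ := P) (f := f))
    have h2 := integral_add_compl (hm s hs) hfi
    have h3 := ih (measure_lt_top _ _)
    rw [integral_condExp hF] at h1
    linarith
  | iUnion s hd hs ih =>
    rw [integral_iUnion (fun i => hm _ (hs i)) hd integrable_condExp.integrableOn,
      integral_iUnion (fun i => hm _ (hs i)) hd hfi.integrableOn]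
    exact tsum_congr fun i => ih i (measure_lt_top _ _)

/-- A variable `f` whose conditional expectation given `F` is close to `c` is nearly uncorrelated
with every variable which depends only on `F` and on an independent `σ`-algebra `E`. -/
lemma abs_integral_sub_mul_le_of_condExp (hFX : F ≤ X) (hX : X ≤ mΩ) (hE : E ≤ mΩ)
    (h : Indep X E P) (hf : Measurable[X] f) {K : ℝ} (hfK : ∀ ω, |f ω| ≤ K) {c ε : ℝ}
    (hε : ∀ᵐ ω ∂P, |(P[f | F]) ω - c| ≤ ε) (hg : Measurable[F ⊔ E] g) (hgi : Integrable g P) :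
    |∫ ω, (f ω - c) * g ω ∂P| ≤ ε * ∫ ω, |g ω| ∂P := by
  have hm : F ⊔ E ≤ mΩ := sup_le (hFX.trans hX) hE
  have hfm : Measurable f := hf.mono hX le_rfl
  have hfi : Integrable f P := Integrable.of_bound hfm.aestronglyMeasurable K (ae_of_all _ hfK)
  have hfg : Integrable (f * g) P := hgi.bdd_mul hfm.aestronglyMeasurable (ae_of_all _ hfK)
  have h1 : P[f * g | F ⊔ E] =ᵐ[P] P[f | F ⊔ E] * g :=
    condExp_mul_of_stronglyMeasurable_right hg.stronglyMeasurable hfg hfi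
  have h2 := condExp_sup_of_indep hFX hX hE h hf hfi
  have h3 : P[f * g | F ⊔ E] =ᵐ[P] P[f | F] * g := by
    filter_upwards [h1, h2] with ω h1 h2
    rw [h1, Pi.mul_apply, Pi.mul_apply, h2]
  have h4 : Integrable (P[f | F] * g) P := integrable_condExp.congr h3
  have h5 : ∫ ω, (f ω - c) * g ω ∂P = ∫ ω, ((P[f | F]) ω - c) * g ω ∂P := by
    have e1 : ∫ ω, f ω * g ω ∂P = ∫ ω, (P[f | F]) ω * g ω ∂P := by
      exact (integral_condExp hm).symm.trans (integral_congr_ae h3)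
    simp only [sub_mul]
    exact (integral_sub hfg (hgi.const_mul c)).trans ((congrArg (· - _) e1).trans
      (integral_sub h4 (hgi.const_mul c)).symm)
  rw [h5]
  refine abs_integral_le_integral_abs.trans ?_
  rw [← integral_const_mul]
  refine integral_mono_ae (f := fun ω => |((P[f | F]) ω - c) * g ω|)
    (g := fun ω => ε * |g ω|) ?_ (hgi.abs.const_mul ε) ?_
  · simp only [sub_mul]
    exact (h4.sub (hgi.const_mul c)).abs
  · filter_upwards [hε] with ω hω
    rw [abs_mul]
    exact mul_le_mul_of_nonneg_right hω (abs_nonneg _)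

end Mixing

/-! ### Averaged drift of mixing coefficients -/

section DriftOfMixing

variable {ι κ I : Type*} [Fintype ι] [Fintype κ] [Fintype I]

lemma exists_nrm_mulVec_le (A : I → Matrix κ ι ℝ) {κ' : Type*} [Fintype κ'] (L : Matrix κ' ι ℝ)
    (h : ∀ m v, L *ᵥ v = 0 → A m *ᵥ v = 0) :
    ∃ a : ℝ, 0 ≤ a ∧ ∀ m v, nrm (A m *ᵥ v) ≤ a * nrm (L *ᵥ v) := by
  choose C hC0 hC using fun m => exists_sqNorm_mulVec_le (A m) L (h m)
  refine ⟨∑ m, √(C m), Finset.sum_nonneg fun _ _ => Real.sqrt_nonneg _, fun m v => ?_⟩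
  refine (nrm_le_of_sqNorm_le (Real.sqrt_nonneg (C m))
    (by rw [Real.sq_sqrt (hC0 m)]; exact hC m v)).trans ?_
  exact mul_le_mul_of_nonneg_right (Finset.single_le_sum (f := fun m => √(C m))
    (fun _ _ => Real.sqrt_nonneg _) (Finset.mem_univ m)) (nrm_nonneg _)

lemma nrm_mulVec_sum_smul_le {A : I → Matrix ι ι ℝ} {x : I → ℝ} {K r s : ℝ} (hK : 0 ≤ K)
    (hx : ∀ m, |x m| ≤ K) (L : Matrix κ ι ℝ) {v : ι → ℝ}
    (h : ∀ m, nrm (L *ᵥ (A m *ᵥ v)) ≤ r * s) :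
    nrm (L *ᵥ ((∑ m, x m • A m) *ᵥ v)) ≤ Fintype.card I * (K * r) * s := by
  rw [Matrix.sum_mulVec, Matrix.mulVec_sum]
  refine (nrm_sum_le _ _).trans ?_
  calc _ ≤ ∑ _m : I, K * (r * s) := Finset.sum_le_sum fun m _ => by
        rw [Matrix.smul_mulVec, Matrix.mulVec_smul, nrm_smul]
        exact mul_le_mul (hx m) (h m) (nrm_nonneg _) hK
    _ = _ := by
      rw [Finset.sum_const, Finset.card_univ, nsmul_eq_mul]
      ring

variable {Ω : Type*} [mΩ : MeasurableSpace Ω] {P : Measure Ω} {𝒢 : ℕ → MeasurableSpace Ω}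
  {f : I → ℕ → Ω → ℝ} {A : I → Matrix ι ι ℝ} {a : I → ℝ} {L : Matrix κ ι ℝ} {c K : ℝ}

/-- A matrix which is a combination of mixing scalar processes has an averaged drift if the matrix
with averaged coefficients has a Lyapunov factor. -/
lemma IsLyapunovFactor.exists_averagedDrift (hL : IsLyapunovFactor (∑ m, a m • A m) L c)
    (hA : ∀ m v, L *ᵥ v = 0 → A m *ᵥ v = 0) (hmono : Monotone 𝒢) (hle : ∀ t, 𝒢 t ≤ mΩ)
    (hf : ∀ m t, Measurable[𝒢 t] (f m t)) (hfK : ∀ m t ω, |f m t ω| ≤ K) (hK : 0 ≤ K)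
    (hmix : ∀ ε > 0, ∃ τ : ℕ, ∀ t ≥ τ, ∀ m, ∀ g : Ω → ℝ, Measurable[𝒢 (t - τ)] g →
      Integrable g P → |∫ ω, (f m t ω - a m) * g ω ∂P| ≤ ε * ∫ ω, |g ω| ∂P) :
    ∃ b τ, AveragedDrift P 𝒢 (fun t ω => ∑ m, f m t ω • A m) L b (c / 2) τ := by
  have hc := hL.pos
  obtain ⟨a₁, ha₁, h₁⟩ := exists_nrm_mulVec_le A L hA
  obtain ⟨a₂, ha₂, h₂⟩ := exists_nrm_mulVec_le (fun m => L * A m) L fun m v hv => by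
    rw [← Matrix.mulVec_mulVec, hA m v hv, Matrix.mulVec_zero]
  simp only [← Matrix.mulVec_mulVec] at h₂
  set N := (Fintype.card I : ℝ) with hN
  have hN0 : 0 ≤ N := Nat.cast_nonneg _
  -- The `N` mixing errors cost at most `ε N a₂ E|L y|²`; this `ε` keeps them below half of the
  -- contraction, and the `+ 1` guards against a zero denominator.
  obtain ⟨τ, hτ⟩ := hmix (c / 2 / (N * a₂ + 1)) (by positivity)
  classical
  refine ⟨N * (K * (a₁ + a₂)), τ, by positivity, by positivity, hmono, hle, fun t i j => ?_,
    fun t ω v => ?_, fun t ω v => ?_, fun t ht y hy hy2 => ?_⟩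
  · simp only [Matrix.sum_apply, Matrix.smul_apply, smul_eq_mul]
    exact Finset.measurable_sum _ fun m _ => (hf m t).mul_const _
  · have := nrm_mulVec_sum_smul_le (r := a₁ + a₂) hK (hfK · t ω) (1 : Matrix ι ι ℝ) fun m => by
      rw [Matrix.one_mulVec]
      exact (h₁ m v).trans (mul_le_mul_of_nonneg_right (by linarith) (nrm_nonneg _))
    rwa [Matrix.one_mulVec] at this
  · exact nrm_mulVec_sum_smul_le (r := a₁ + a₂) hK (hfK · t ω) L fun m => (h₂ m v).trans
      (mul_le_mul_of_nonneg_right (by linarith) (nrm_nonneg _))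
  · have hLy := memLp_mulVec L hy2
    have hLA := fun m => memLp_mulVec L (memLp_mulVec (A m) hy2)
    have hgi := fun m => integrable_dotProduct hLy (hLA m)
    have hLm : ∀ k, Measurable[𝒢 (t - τ)] fun ω => (L *ᵥ y ω) k :=
      measurable_mulVec (A := fun _ => L) (fun _ _ => measurable_const) hy
    have hgm : ∀ m, Measurable[𝒢 (t - τ)] fun ω => (L *ᵥ y ω) ⬝ᵥ (L *ᵥ (A m *ᵥ y ω)) := by
      intro m
      have h3 := measurable_mulVec (m := 𝒢 (t - τ)) (A := fun _ => L)
        (fun _ _ => measurable_const) (measurable_mulVec (m := 𝒢 (t - τ)) (A := fun _ => A m)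
        (fun _ _ => measurable_const) hy)
      simp only [dotProduct]
      exact Finset.measurable_sum _ fun k _ => (hLm k).mul (h3 k)
    have hft : ∀ m, Integrable (fun ω => (f m t ω - a m) *
        ((L *ᵥ y ω) ⬝ᵥ (L *ᵥ (A m *ᵥ y ω)))) P := fun m =>
      (hgi m).bdd_mul (c := K + |a m|)
        (((hf m t).mono (hle t) le_rfl).sub_const (a m)).aestronglyMeasurable
        (ae_of_all _ fun ω => (abs_sub _ _).trans (by have := hfK m t ω; linarith))
    have hsplit : ∀ ω, (L *ᵥ y ω) ⬝ᵥ (L *ᵥ ((∑ m, f m t ω • A m) *ᵥ y ω)) =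
        (L *ᵥ y ω) ⬝ᵥ (L *ᵥ ((∑ m, a m • A m) *ᵥ y ω)) +
          ∑ m, (f m t ω - a m) * ((L *ᵥ y ω) ⬝ᵥ (L *ᵥ (A m *ᵥ y ω))) := by
      intro ω
      simp only [Matrix.sum_mulVec, Matrix.mulVec_sum, dotProduct_sum, Matrix.smul_mulVec,
        Matrix.mulVec_smul, dotProduct_smul, smul_eq_mul, ← Finset.sum_add_distrib]
      exact Finset.sum_congr rfl fun m _ => by ring
    have hB := integrable_dotProduct hLy (memLp_mulVec L (memLp_mulVec (∑ m, a m • A m) hy2))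
    have hS := integrable_sqNorm hLy
    simp only [hsplit]
    rw [integral_add hB (integrable_finsetSum _ fun m _ => hft m),
      integral_finsetSum _ fun m _ => hft m]
    have h4 : ∫ ω, (L *ᵥ y ω) ⬝ᵥ (L *ᵥ ((∑ m, a m • A m) *ᵥ y ω)) ∂P ≤
        -c * ∫ ω, sqNorm (L *ᵥ y ω) ∂P := by
      rw [← integral_const_mul]
      exact integral_mono hB (hS.const_mul _) fun ω => hL.decay (y ω)
    set S := ∫ ω, sqNorm (L *ᵥ y ω) ∂P with hSdef
    have hS0 : 0 ≤ S := integral_sqNorm_nonneg _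
    have h5 : ∀ m, ∫ ω, (f m t ω - a m) * ((L *ᵥ y ω) ⬝ᵥ (L *ᵥ (A m *ᵥ y ω))) ∂P ≤
        c / 2 / (N * a₂ + 1) * (a₂ * S) := by
      intro m
      refine (le_abs_self _).trans ((hτ t ht m _ (hgm m) (hgi m)).trans ?_)
      refine mul_le_mul_of_nonneg_left ?_ (by positivity)
      rw [hSdef, ← integral_const_mul]
      refine integral_mono (hgi m).abs (hS.const_mul a₂) fun ω => ?_
      refine (abs_dotProduct_le _ _).trans ?_
      calc _ ≤ nrm (L *ᵥ y ω) * (a₂ * nrm (L *ᵥ y ω)) :=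
            mul_le_mul_of_nonneg_left (h₂ m (y ω)) (nrm_nonneg _)
        _ = _ := by rw [← nrm_sq]; ring
    have h6 := Finset.sum_le_sum fun m (_ : m ∈ Finset.univ) => h5 m
    rw [Finset.sum_const, Finset.card_univ, nsmul_eq_mul, ← hN] at h6
    have h7 : N * (c / 2 / (N * a₂ + 1) * (a₂ * S)) ≤ c / 2 * S := by
      rw [show N * (c / 2 / (N * a₂ + 1) * (a₂ * S)) =
        c / 2 * S * (N * a₂ / (N * a₂ + 1)) by ring]
      exact mul_le_of_le_one_right (by positivity)
        ((div_le_one (by positivity)).2 (by linarith))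
    linarith

end DriftOfMixing

/-! ### Entrywise bounds -/

section EntryBound

lemma nrm_mulVec_le_of_abs_le {ι κ : Type*} [Fintype ι] [Fintype κ] {A : Matrix κ ι ℝ} {a : ℝ}
    (h : ∀ k i, |A k i| ≤ a) (ha : 0 ≤ a) (v : ι → ℝ) :
    nrm (A *ᵥ v) ≤ √(Fintype.card κ * Fintype.card ι) * a * nrm v := by
  refine (nrm_mulVec_le A v).trans (mul_le_mul_of_nonneg_right ?_ (nrm_nonneg _))
  rw [Real.sqrt_le_left (by positivity), mul_pow, Real.sq_sqrt (by positivity)]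
  calc frobSq A ≤ ∑ _k : κ, ∑ _i : ι, a ^ 2 := Finset.sum_le_sum fun k _ =>
        Finset.sum_le_sum fun i _ => sq_le_sq' (neg_le_of_abs_le (h k i)) (le_of_abs_le (h k i))
    _ = _ := by
      simp only [Finset.sum_const, Finset.card_univ, nsmul_eq_mul]
      ring

lemma exists_abs_le {I : Type*} [Fintype I] (f : I → ℝ) : ∃ a, 0 ≤ a ∧ ∀ i, |f i| ≤ a :=
  ⟨∑ i, |f i|, Finset.sum_nonneg fun _ _ => abs_nonneg _, fun i =>
    Finset.single_le_sum (f := fun i => |f i|) (fun _ _ => abs_nonneg _) (Finset.mem_univ i)⟩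

end EntryBound

/-! ### Matrices of the instrumental variable algorithm -/

section InstrumentalMatrix

variable {n : ℕ}

/-- The coefficient of the noise of node `k.1` in the regressor of the `k`-th equation. -/
def noiseGain (α β : Fin n → ℝ) (k : Fin n × Fin 2) : ℝ :=
  (![α k.1, β k.1] : Fin 2 → ℝ) k.2

/-- The coefficient of the signal in the regressor of the `k`-th equation. -/
def signalGain (α β : Fin n → ℝ) (k : Fin n × Fin 2) : ℝ := noiseGain α β k * α k.1

/-- The constant term in the regressor of the `k`-th equation. -/
def offsetGain (α β : Fin n → ℝ) (k : Fin n × Fin 2) : ℝ :=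
  (![0, 1] : Fin 2 → ℝ) k.2 + noiseGain α β k * β k.1

/-- The noise-free matrix of the instrumental variable recursion with signal `p` and delayed
signal `z`. -/
def driftCoeff (α β : Fin n → ℝ) (γ : Matrix (Fin n) (Fin n) ℝ) (p z : ℝ) :
    Matrix (Fin n × Fin 2) (Fin n × Fin 2) ℝ :=
  Matrix.of fun k l => (offsetGain α β k + signalGain α β k * z) * weightMatrix γ k.1 l.1 *
    if l.2 = 0 then p else 1

/-- The coefficient of the delayed noise of the node `i`. -/
def delayedCoeff (α β : Fin n → ℝ) (γ : Matrix (Fin n) (Fin n) ℝ) (i : Fin n) (p : ℝ) :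
    Matrix (Fin n × Fin 2) (Fin n × Fin 2) ℝ :=
  Matrix.of fun k l => if k.1 = i then noiseGain α β k * weightMatrix γ k.1 l.1 *
    (if l.2 = 0 then p else 1) else 0

/-- The coefficient of the present noise of the node `j`, when `y` is the delayed noise. -/
noncomputable def currentCoeff (α β : Fin n → ℝ) (γ : Matrix (Fin n) (Fin n) ℝ) (j : Fin n) (z : ℝ)
    (y : Fin n → ℝ) : Matrix (Fin n × Fin 2) (Fin n × Fin 2) ℝ :=
  Matrix.of fun k l => if l.1 = j then (if l.2 = 0 then
    (offsetGain α β k + signalGain α β k * z + noiseGain α β k * y k.1) * weightMatrix γ k.1 l.1 *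
      (α j)⁻¹ else 0) else 0

variable {α β : Fin n → ℝ} {γ : Matrix (Fin n) (Fin n) ℝ}

/-- An entry is regressor times weight times output. The regressor has the delayed noise of the row
node, the output the present noise of the column node; expanding gives the three parts, the product
of both noises being counted as present noise. -/
lemma instrumentalMatrix_apply (p z : ℝ) (y y' : Fin n → ℝ) (k l : Fin n × Fin 2) :
    (driftCoeff α β γ p z + ∑ i, y i • delayedCoeff α β γ i p +
      ∑ j, y' j • currentCoeff α β γ j z y) k l =
    (offsetGain α β k + signalGain α β k * z + noiseGain α β k * y k.1) * weightMatrix γ k.1 l.1 *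
      if l.2 = 0 then p + (α l.1)⁻¹ * y' l.1 else 1 := by
  simp only [Matrix.add_apply, Matrix.sum_apply, Matrix.smul_apply, driftCoeff, delayedCoeff,
    currentCoeff, Matrix.of_apply, smul_eq_mul, mul_ite, mul_zero]
  rw [Finset.sum_ite_eq Finset.univ k.1, if_pos (Finset.mem_univ _),
    Finset.sum_ite_eq Finset.univ l.1, if_pos (Finset.mem_univ _)]
  split_ifs <;> ring

variable {Ω : Type*} {δ : ℕ → ℝ} {d : ℕ} {x : ℤ → Ω → ℝ} {η : Fin n → ℤ → Ω → ℝ}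

/-- With the delay written as `d + 1`, the regressor has time `t - 1 - d`, strictly before `t`. So
no noise is multiplied by itself, and no bias has to be compensated. -/
lemma equivParams_instrumentalParams_succ (hα : ∀ i, α i ≠ 0) (t : ℕ) (ω : Ω) :
    equivParams α β (instrumentalParams α β γ δ (d + 1) x η (t + 1) ω) =
      equivParams α β (instrumentalParams α β γ δ (d + 1) x η t ω) + δ t •
        (noisyMatrix η
          (fun t ω => driftCoeff α β γ (x t ω) (x ((t : ℤ) - 1 - d) ω))
          (fun i t ω => delayedCoeff α β γ i (x t ω))
          (fun j t ω => currentCoeff α β γ j (x ((t : ℤ) - 1 - d) ω)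
            fun i => η i ((t : ℤ) - 1 - d) ω) d t ω *ᵥ
          equivParams α β (instrumentalParams α β γ δ (d + 1) x η t ω)) := by
  set θ := instrumentalParams α β γ δ (d + 1) x η t ω with hθ
  have hlag : (t : ℤ) - ((d + 1 : ℕ) : ℤ) = (t : ℤ) - 1 - d := by push_cast; ring
  have hAv : ∀ i c, (noisyMatrix η (fun t ω => driftCoeff α β γ (x t ω) (x ((t : ℤ) - 1 - d) ω))
      (fun i t ω => delayedCoeff α β γ i (x t ω))
      (fun j t ω => currentCoeff α β γ j (x ((t : ℤ) - 1 - d) ω)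
        fun i => η i ((t : ℤ) - 1 - d) ω) d t ω *ᵥ equivParams α β θ) (i, c) =
      ((![0, 1] : Fin 2 → ℝ) c + (![α i, β i] : Fin 2 → ℝ) c *
        sensorOutput α β x η i ((t : ℤ) - 1 - d) ω) *
        (∑ j, γ i j * outputError α β x η θ t ω i j) := by
    intro i c
    rw [sum_mul_outputError γ hα, Matrix.mulVec, dotProduct, Fintype.sum_prod_type]
    simp only [noisyMatrix, delayedPart, currentPart, instrumentalMatrix_apply, offsetGain,
      signalGain, noiseGain, Fin.sum_univ_two, if_true, one_ne_zero, if_false]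
    generalize (![α i, β i] : Fin 2 → ℝ) c = h
    generalize (![0, 1] : Fin 2 → ℝ) c = e
    rw [Finset.mul_sum]
    refine Finset.sum_congr rfl fun j _ => ?_
    simp only [sensorOutput]
    ring
  ext ⟨i, c⟩
  rw [Pi.add_apply, Pi.smul_apply, hAv, smul_eq_mul]
  have hstep' : ∀ c, instrumentalParams α β γ δ (d + 1) x η (t + 1) ω i c = θ i c +
      δ t * ((∑ j, γ i j * outputError α β x η θ t ω i j) *
        (![sensorOutput α β x η i ((t : ℤ) - 1 - d) ω, 1] : Fin 2 → ℝ) c) := by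
    intro c
    rw [instrumentalParams, ← hθ, hlag]
    simp only [Pi.add_apply, Pi.smul_apply, smul_eq_mul, Finset.sum_apply, Finset.sum_mul]
  fin_cases c
  · simp only [equivParams, hstep', Fin.zero_eta, Matrix.cons_val_zero, Matrix.cons_val_one]
    ring
  · simp only [equivParams, hstep', Fin.mk_one, Matrix.cons_val_zero, Matrix.cons_val_one]
    ring

/-- The constant depends on the signals only through `K`, so it serves both for the true delayed
signal and for its modification. The delayed noise inside `currentCoeff` is the reason for the
amplitude of time `t - 1 - d` in its bound. -/
lemma exists_coeffBound (α β : Fin n → ℝ) (γ : Matrix (Fin n) (Fin n) ℝ) (η : Fin n → ℤ → Ω → ℝ)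
    (d : ℕ) {K : ℝ} (hK : 0 ≤ K) :
    ∃ b, ∀ p z : ℕ → Ω → ℝ, (∀ t ω, |p t ω| ≤ K) → (∀ t ω, |z t ω| ≤ K) →
      CoeffBound η (fun t ω => driftCoeff α β γ (p t ω) (z t ω))
        (fun i t ω => delayedCoeff α β γ i (p t ω))
        (fun j t ω => currentCoeff α β γ j (z t ω) fun i => η i ((t : ℤ) - 1 - d) ω) b d := by
  obtain ⟨R₁, h₁0, h₁⟩ := exists_abs_le (offsetGain α β)
  obtain ⟨R₂, h₂0, h₂⟩ := exists_abs_le (signalGain α β)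
  obtain ⟨R₃, h₃0, h₃⟩ := exists_abs_le (noiseGain α β)
  obtain ⟨R₄, h₄0, h₄⟩ := exists_abs_le fun e : Fin n × Fin n => weightMatrix γ e.1 e.2
  obtain ⟨R₅, h₅0, h₅⟩ := exists_abs_le fun j => (α j)⁻¹
  have hite : ∀ (c : Fin 2) {q : ℝ}, |q| ≤ K → |if c = 0 then q else 1| ≤ K + 1 := by
    intro c q hq
    split_ifs
    · linarith
    · rw [abs_one]; linarith
  set N := √(Fintype.card (Fin n × Fin 2) * Fintype.card (Fin n × Fin 2)) with hN
  have hN0 : 0 ≤ N := Real.sqrt_nonneg _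
  set S₁ := (R₁ + R₂ * K) * R₄ * (K + 1) with hS₁
  set S₂ := R₃ * R₄ * (K + 1) with hS₂
  set S₃ := (R₁ + R₂ * K + R₃) * R₄ * R₅ with hS₃
  have hS₁0 : 0 ≤ S₁ := by positivity
  have hS₂0 : 0 ≤ S₂ := by positivity
  have hS₃0 : 0 ≤ S₃ := by positivity
  have hdrift : ∀ (k) {q : ℝ}, |q| ≤ K → |offsetGain α β k + signalGain α β k * q| ≤ R₁ + R₂ * K := by
    intro k q hq
    refine (abs_add_le _ _).trans (add_le_add (h₁ k) ?_)
    rw [abs_mul]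
    exact mul_le_mul (h₂ k) hq (abs_nonneg _) h₂0
  refine ⟨N * (S₁ + S₂ + S₃), fun p z hp hz => ⟨by positivity, fun t ω v => ?_, fun i t ω v => ?_,
    fun j t ω v => ?_⟩⟩
  · refine (nrm_mulVec_le_of_abs_le (a := S₁) (fun k l => ?_) hS₁0 v).trans
      (mul_le_mul_of_nonneg_right (mul_le_mul_of_nonneg_left (by linarith) hN0) (nrm_nonneg _))
    rw [driftCoeff, Matrix.of_apply, abs_mul, abs_mul]
    have e1 := hdrift k (hz t ω)
    have e2 := h₄ (k.1, l.1)
    have e3 := hite l.2 (hp t ω)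
    rw [hS₁]
    gcongr
  · refine (nrm_mulVec_le_of_abs_le (a := S₂) (fun k l => ?_) hS₂0 v).trans
      (mul_le_mul_of_nonneg_right (mul_le_mul_of_nonneg_left (by linarith) hN0) (nrm_nonneg _))
    rw [delayedCoeff, Matrix.of_apply]
    have e1 := h₃ k
    have e2 := h₄ (k.1, l.1)
    have e3 := hite l.2 (hp t ω)
    by_cases hk : k.1 = i
    · rw [if_pos hk, abs_mul, abs_mul, hS₂]
      gcongr
    · rw [if_neg hk, abs_zero]
      exact hS₂0
  · set a := amplitude η ((t : ℤ) - 1 - d) ω with ha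
    have ha1 : 1 ≤ a := one_le_amplitude _ _
    have ha0 : 0 ≤ a := zero_le_one.trans ha1
    have hle : N * (S₃ * a) * nrm v ≤ N * (S₁ + S₂ + S₃) * a * nrm v := by
      rw [← mul_assoc]
      have := nrm_nonneg v
      gcongr
      linarith
    refine (nrm_mulVec_le_of_abs_le (a := S₃ * a) (fun k l => ?_) (by positivity) v).trans hle
    rw [currentCoeff, Matrix.of_apply]
    split_ifs
    · have e1 := hdrift k (hz t ω)
      have e2 := h₄ (k.1, l.1)
      have e3 := h₅ j
      have e4 : |η k.1 ((t : ℤ) - 1 - d) ω| ≤ a :=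
        (Finset.single_le_sum (f := fun i => |η i ((t : ℤ) - 1 - d) ω|)
          (fun _ _ => abs_nonneg _) (Finset.mem_univ k.1)).trans sum_abs_le_amplitude
      have e5 : |offsetGain α β k + signalGain α β k * z t ω +
          noiseGain α β k * η k.1 ((t : ℤ) - 1 - d) ω| ≤ (R₁ + R₂ * K + R₃) * a := by
        refine (abs_add_le _ _).trans ?_
        rw [abs_mul, add_mul]
        refine add_le_add (e1.trans (le_mul_of_one_le_right (by positivity) ha1)) ?_
        exact mul_le_mul (h₃ k) e4 (abs_nonneg _) h₃0
      rw [abs_mul, abs_mul]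
      calc _ ≤ (R₁ + R₂ * K + R₃) * a * R₄ * R₅ := by gcongr
        _ = _ := by rw [hS₃]; ring
    all_goals simpa using by positivity

/-- A rank-one-type matrix: `weightMatrix γ` acting on the components `c₀`, multiplied by gains. -/
def gainMatrix (γ : Matrix (Fin n) (Fin n) ℝ) (r : Fin n × Fin 2 → ℝ) (c₀ : Fin 2) :
    Matrix (Fin n × Fin 2) (Fin n × Fin 2) ℝ :=
  Matrix.of fun k l => if l.2 = c₀ then r k * weightMatrix γ k.1 l.1 else 0

lemma gainMatrix_mulVec_eq_zero (r : Fin n × Fin 2 → ℝ) (c₀ : Fin 2) {v : Fin n × Fin 2 → ℝ}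
    (hv : ∀ i j c, v (i, c) = v (j, c)) : gainMatrix γ r c₀ *ᵥ v = 0 := by
  ext ⟨i, c⟩
  have h := sum_weightMatrix_mul (𝕜 := ℝ) γ (fun j => v (j, c₀)) i
  simp only [RCLike.ofReal_real_eq_id, id_eq, hv _ i, sub_self, mul_zero,
    Finset.sum_const_zero] at h
  simp only [Matrix.mulVec, dotProduct, gainMatrix, Matrix.of_apply, ite_mul, zero_mul,
    Fintype.sum_prod_type, Finset.sum_ite_eq', Finset.mem_univ, if_true, Pi.zero_apply,
    hv _ i c₀]
  rw [← Finset.sum_mul, ← Finset.mul_sum, mul_assoc, Finset.sum_mul, h, mul_zero]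

/-- The matrices of the products `1`, `p`, `z`, `p z` in `driftCoeff`. -/
def driftTerm (α β : Fin n → ℝ) (γ : Matrix (Fin n) (Fin n) ℝ) :
    Fin 4 → Matrix (Fin n × Fin 2) (Fin n × Fin 2) ℝ :=
  ![gainMatrix γ (offsetGain α β) 1, gainMatrix γ (offsetGain α β) 0,
    gainMatrix γ (signalGain α β) 1, gainMatrix γ (signalGain α β) 0]

/-- Each term separately, not only their average, vanishes on consensus vectors; this is what lets
the random drift be bounded by `L v`. -/
lemma driftTerm_mulVec_eq_zero (m : Fin 4) {v : Fin n × Fin 2 → ℝ}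
    (hv : ∀ i j c, v (i, c) = v (j, c)) : driftTerm α β γ m *ᵥ v = 0 := by
  fin_cases m <;> exact gainMatrix_mulVec_eq_zero _ _ hv

lemma sum_smul_driftTerm (a : Fin 4 → ℝ) (k l : Fin n × Fin 2) :
    (∑ m, a m • driftTerm α β γ m) k l = (if l.2 = 0 then
      offsetGain α β k * a 1 + signalGain α β k * a 3 else
      offsetGain α β k * a 0 + signalGain α β k * a 2) * weightMatrix γ k.1 l.1 := by
  have hc : l.2 = 0 ∨ l.2 = 1 := by
    rcases l.2 with ⟨c, hc⟩
    interval_cases c <;> simp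
  simp only [Fin.sum_univ_four, driftTerm, Matrix.cons_val_zero, Matrix.cons_val_one,
    Matrix.cons_val, Matrix.add_apply, Matrix.smul_apply, gainMatrix, Matrix.of_apply, smul_eq_mul]
  rcases hc with h | h <;> simp only [h, if_true, zero_ne_one, one_ne_zero, if_false] <;> ring

lemma driftCoeff_eq_sum (p z : ℝ) :
    driftCoeff α β γ p z = ∑ m, (![1, p, z, p * z] : Fin 4 → ℝ) m • driftTerm α β γ m := by
  ext k l
  rw [sum_smul_driftTerm, driftCoeff, Matrix.of_apply]
  simp only [Matrix.cons_val_zero, Matrix.cons_val_one, Matrix.cons_val]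
  split_ifs <;> ring

/-- Compared with `driftCoeff_eq_sum`: replacing `1, p, z, p z` by the means `1, xbar, xbar, m(d₀)`
yields the system matrix with `q = m(d₀)`. -/
lemma systemMatrix_eq_sum (p q : ℝ) :
    systemMatrix α β γ p q = ∑ m, (![1, p, p, q] : Fin 4 → ℝ) m • driftTerm α β γ m := by
  ext ⟨i, c⟩ ⟨j, c'⟩
  rw [sum_smul_driftTerm, systemMatrix_apply, phiBlock_eq_regressor]
  simp only [Matrix.cons_val_zero, Matrix.cons_val_one, Matrix.cons_val, offsetGain, signalGain,
    noiseGain]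
  generalize (![α i, β i] : Fin 2 → ℝ) c = h
  generalize (![0, 1] : Fin 2 → ℝ) c = e
  split_ifs <;> ring

end InstrumentalMatrix

/-! ### Independence of joins -/

section IndepSup

/-- `P (a ∩ b ∩ c)` factors completely by applying the two hypotheses in turn, and the sets `a ∩ b`
form a π-system generating the join. -/
lemma indep_sup_left_of_indep {Ω : Type*} {X B C : MeasurableSpace Ω} [mΩ : MeasurableSpace Ω]
    {P : Measure Ω} [IsProbabilityMeasure P] (hX : X ≤ mΩ) (hB : B ≤ mΩ) (hC : C ≤ mΩ)
    (h : Indep X (B ⊔ C) P) (hBC : Indep B C P) : Indep (X ⊔ B) C P := by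
  refine IndepSets.indep (sup_le hX hB) hC (isPiSystem_image2_inter X B)
    (@MeasurableSpace.isPiSystem_measurableSet _ C) (sup_eq_generateFrom_image2_inter X B)
    (@MeasurableSpace.generateFrom_measurableSet _ C).symm ?_
  rw [IndepSets_iff]
  rintro _ c ⟨a, ha, b, hb, rfl⟩ hc
  have hb' : MeasurableSet[B ⊔ C] b := (le_sup_left : B ≤ B ⊔ C) b hb
  have hc' : MeasurableSet[B ⊔ C] c := (le_sup_right : C ≤ B ⊔ C) c hc
  rw [Indep_iff] at h hBC
  rw [Set.inter_assoc, h a (b ∩ c) ha (@MeasurableSet.inter _ (B ⊔ C) _ _ hb' hc'), hBC b c hb hc,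
    h a b ha hb', mul_assoc]

end IndepSup

/-! ### Moments of the amplitude -/

section Amplitude

variable {Ω : Type*} [mΩ : MeasurableSpace Ω] {P : Measure Ω} [IsProbabilityMeasure P]
  {n : ℕ} {x : ℤ → Ω → ℝ} {η : Fin n → ℤ → Ω → ℝ} {ση : Fin n → ℝ}

lemma memLp_amplitude (hη : MeasurementNoise x η P ση) (t : ℤ) : MemLp (amplitude η t) 4 P := by
  have h1 : MemLp (fun ω => ∑ i, ‖η i t ω‖) 4 P := memLp_finsetSum _ fun i _ => (hη.memLp i t).norm
  exact (memLp_const (1 : ℝ)).add h1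

lemma integrable_amplitude_pow (hη : MeasurementNoise x η P ση) (t : ℤ) :
    Integrable (fun ω => amplitude η t ω ^ 4) P := by
  refine ((memLp_amplitude hη t).integrable_norm_pow (by norm_num)).congr (ae_of_all _ fun ω => ?_)
  simp only [Real.norm_eq_abs]
  exact Even.pow_abs (by decide) _

/-- Convexity of the fourth power over the `n + 1` summands (`none` stands for the constant one);
identical distribution makes the bound uniform in time. -/
lemma exists_amplitude_moment (hη : MeasurementNoise x η P ση) :
    ∃ μ, ∀ t, ∫ ω, amplitude η t ω ^ 4 ∂P ≤ μ := by
  have h4 : ∀ i t, Integrable (fun ω => |η i t ω| ^ 4) P := fun i t =>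
    (hη.memLp i t).integrable_norm_pow (by norm_num)
  have hid : ∀ i t, ∫ ω, |η i t ω| ^ 4 ∂P = ∫ ω, |η i 0 ω| ^ 4 ∂P := fun i t =>
    ((((hη.iid i).ident t 0).comp (u := fun y : ℝ => |y| ^ 4) (by fun_prop))).integral_eq
  refine ⟨(Fintype.card (Option (Fin n)) : ℝ) ^ 3 * (1 + ∑ i, ∫ ω, |η i 0 ω| ^ 4 ∂P), fun t => ?_⟩
  have hle : ∀ ω, amplitude η t ω ^ 4 ≤
      (Fintype.card (Option (Fin n)) : ℝ) ^ 3 * (1 + ∑ i, |η i t ω| ^ 4) := by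
    intro ω
    have h := pow_sum_div_card_le_sum_pow (s := Finset.univ)
      (f := fun k : Option (Fin n) => k.elim 1 fun i => |η i t ω|)
      (fun k _ => by cases k <;> simp) 3
    rw [div_le_iff₀ (by rw [Finset.card_univ]; positivity)] at h
    simp only [Fintype.sum_option, Option.elim, one_pow, Finset.card_univ] at h
    rw [mul_comm]
    exact h
  calc _ ≤ ∫ ω, (Fintype.card (Option (Fin n)) : ℝ) ^ 3 * (1 + ∑ i, |η i t ω| ^ 4) ∂P :=
        integral_mono (integrable_amplitude_pow hη t) (((integrable_const 1).fun_add
          (integrable_finsetSum _ fun i _ => h4 i t)).const_mul _) hle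
    _ = _ := by
      rw [integral_const_mul, integral_add (integrable_const 1)
        (integrable_finsetSum _ fun i _ => h4 i t), integral_finsetSum _ fun i _ => h4 i t]
      simp [hid]

end Amplitude

/-! ### `σ`-algebras of the noise -/

section NoiseSigma

variable {Ω : Type*} {n : ℕ}

/-- The `σ`-algebra generated by the noise at the times in `S`. -/
@[reducible] def noiseSigma (η : Fin n → ℤ → Ω → ℝ) (S : Set ℤ) : MeasurableSpace Ω :=
  sigmaOn (fun p : Fin n × ℤ => η p.1 p.2) {p | p.2 ∈ S}

lemma measurable_noiseSigma {η : Fin n → ℤ → Ω → ℝ} {S : Set ℤ} {r : ℤ} (hr : r ∈ S) (i : Fin n) :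
    Measurable[noiseSigma η S] (η i r) :=
  measurable_sigmaOn (Y := fun p : Fin n × ℤ => η p.1 p.2) (p := (i, r)) hr

lemma noiseSigma_mono (η : Fin n → ℤ → Ω → ℝ) {S T : Set ℤ} (h : S ⊆ T) :
    noiseSigma η S ≤ noiseSigma η T :=
  sigmaOn_mono fun _ hp => h hp

variable [mΩ : MeasurableSpace Ω] {P : Measure Ω} {x : ℤ → Ω → ℝ} {η : Fin n → ℤ → Ω → ℝ}
  {ση : Fin n → ℝ}

lemma MeasurementNoise.noiseSigma_le (hη : MeasurementNoise x η P ση) (S : Set ℤ) :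
    noiseSigma η S ≤ mΩ :=
  sigmaOn_le (Y := fun p : Fin n × ℤ => η p.1 p.2) (fun p => (hη.iid p.1).measurable p.2) _

lemma MeasurementNoise.indep_noiseSigma (hη : MeasurementNoise x η P ση) {S T : Set ℤ}
    (h : Disjoint S T) : Indep (noiseSigma η S) (noiseSigma η T) P := by
  refine indep_sigmaOn (Y := fun p : Fin n × ℤ => η p.1 p.2) (fun p => (hη.iid p.1).measurable p.2) ?_
    (Set.disjoint_left.2 fun p hp hp' => Set.disjoint_left.1 h hp hp')
  exact iIndepFun_of_iIndep_processSigma (fun i => (hη.iid i).measurable)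
    (hη.indep.precomp (g := some) (Option.some_injective _)) fun i => (hη.iid i).indep

lemma MeasurementNoise.indep_signal (hη : MeasurementNoise x η P ση) (hx : processSigma x ≤ mΩ)
    (S : Set ℤ) : Indep (processSigma x) (noiseSigma η S) P := by
  have h := indep_iSup_of_disjoint (S := {none}) (T := {none}ᶜ) (fun k => ?_) hη.indep
    disjoint_compl_right
  · refine indep_of_indep_of_le_left (indep_of_indep_of_le_right h ?_) ?_
    · exact iSup₂_le fun p _ => (le_iSup (fun t => MeasurableSpace.comap (η p.1 t) inferInstance)
        p.2).trans (le_iSup₂_of_le (some p.1) (by simp) le_rfl)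
    · exact le_iSup₂_of_le none rfl le_rfl
  · cases k with
    | none => exact hx
    | some i => exact iSup_le fun t => ((hη.iid i).measurable t).comap_le

end NoiseSigma

/-! ### Truncated signal and the two filtrations -/

section Clipped

variable {Ω : Type*}

/-- The signal `x` truncated to `[-K, K]`. -/
def clipped (K : ℝ) (x : ℤ → Ω → ℝ) (t : ℤ) (ω : Ω) : ℝ := max (-K) (min K (x t ω))

/-- The truncated signal of `d + 1` time steps before, set to zero before time `0`. -/
def delayedSignal (K : ℝ) (x : ℤ → Ω → ℝ) (d t : ℕ) (ω : Ω) : ℝ :=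
  if d + 1 ≤ t then clipped K x ((t : ℤ) - 1 - d) ω else 0

variable {K : ℝ} {x : ℤ → Ω → ℝ}

lemma abs_clipped_le (hK : 0 ≤ K) (t : ℤ) (ω : Ω) : |clipped K x t ω| ≤ K :=
  abs_le.2 ⟨le_max_left _ _, max_le (by linarith) (min_le_left _ _)⟩

lemma clipped_eq {t : ℤ} {ω : Ω} (h : |x t ω| ≤ K) : clipped K x t ω = x t ω := by
  rw [clipped, min_eq_right (abs_le.1 h).2, max_eq_right (abs_le.1 h).1]

lemma abs_delayedSignal_le (hK : 0 ≤ K) (d t : ℕ) (ω : Ω) : |delayedSignal K x d t ω| ≤ K := by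
  rw [delayedSignal]
  split_ifs
  · exact abs_clipped_le hK _ _
  · simpa using hK

lemma measurable_clipped {m : MeasurableSpace Ω} {t : ℤ} (h : Measurable[m] (x t)) :
    Measurable[m] (clipped K x t) :=
  measurable_const.max (measurable_const.min h)

lemma measurable_history {s k : ℤ} (h0 : 0 ≤ s) (hk : s ≤ k) : Measurable[history x k] (x s) :=
  (comap_measurable (x s)).mono (le_iSup₂_of_le s ⟨h0, hk⟩ le_rfl) le_rfl

lemma history_le_processSigma (k : ℤ) : history x k ≤ processSigma x :=
  iSup₂_le fun s _ => le_iSup (fun s => MeasurableSpace.comap (x s) inferInstance) s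

lemma history_mono {k k' : ℤ} (h : k ≤ k') : history x k ≤ history x k' :=
  iSup₂_le fun s hs => le_iSup₂_of_le s ⟨hs.1, hs.2.trans h⟩ le_rfl

lemma measurable_processSigma (t : ℤ) : Measurable[processSigma x] (x t) :=
  (comap_measurable (x t)).mono (le_iSup (fun s => MeasurableSpace.comap (x s) inferInstance) t)
    le_rfl

lemma measurable_delayedSignal {m : MeasurableSpace Ω} {d t : ℕ}
    (h : d + 1 ≤ t → Measurable[m] (x ((t : ℤ) - 1 - d))) :
    Measurable[m] (delayedSignal K x d t) := by
  by_cases ht : d + 1 ≤ t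
  · have : delayedSignal K x d t = clipped K x ((t : ℤ) - 1 - d) := by
      ext ω; rw [delayedSignal, if_pos ht]
    rw [this]
    exact measurable_clipped (h ht)
  · have : delayedSignal K x d t = fun _ => 0 := by
      ext ω; rw [delayedSignal, if_neg ht]
    rw [this]
    exact measurable_const

/-- The signal up to time `t + d + 1` and the whole noise. -/
@[reducible] def signalFiltration {n : ℕ} (x : ℤ → Ω → ℝ) (η : Fin n → ℤ → Ω → ℝ) (d t : ℕ) :
    MeasurableSpace Ω :=
  history x (t + (d + 1)) ⊔ noiseSigma η Set.univ

/-- The whole signal and the noise before time `t`. -/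
@[reducible] def noiseFiltration {n : ℕ} (x : ℤ → Ω → ℝ) (η : Fin n → ℤ → Ω → ℝ) (t : ℕ) :
    MeasurableSpace Ω :=
  processSigma x ⊔ noiseSigma η (Set.Iio t)

variable {n : ℕ} {η : Fin n → ℤ → Ω → ℝ} {d : ℕ}

lemma signalFiltration_mono (x : ℤ → Ω → ℝ) (η : Fin n → ℤ → Ω → ℝ) (d : ℕ) :
    Monotone (signalFiltration x η d) := fun _ _ h =>
  sup_le_sup_right (history_mono (by exact_mod_cast Nat.add_le_add_right h (d + 1))) _

lemma measurable_clipped_signalFiltration {t u : ℕ} (h : u ≤ t + (d + 1)) :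
    Measurable[signalFiltration x η d t] (clipped K x u) :=
  measurable_clipped ((measurable_history (by positivity) (by exact_mod_cast h)).mono
    le_sup_left le_rfl)

lemma measurable_delayedSignal_signalFiltration (t : ℕ) :
    Measurable[signalFiltration x η d t] (delayedSignal K x d t) :=
  measurable_delayedSignal fun h => (measurable_history (by omega) (by omega)).mono
    le_sup_left le_rfl

end Clipped

/-! ### Measurability of the coefficients -/

section Coefficients

variable {Ω : Type*} {n : ℕ} {α β : Fin n → ℝ} {γ : Matrix (Fin n) (Fin n) ℝ}
  {m : MeasurableSpace Ω} {p z : Ω → ℝ}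

lemma measurable_driftCoeff (hp : Measurable[m] p) (hz : Measurable[m] z) (k l : Fin n × Fin 2) :
    Measurable[m] fun ω => driftCoeff α β γ (p ω) (z ω) k l := by
  simp only [driftCoeff, Matrix.of_apply]
  refine ((measurable_const.add (measurable_const.mul hz)).mul_const _).mul ?_
  split_ifs
  · exact hp
  · exact measurable_const

lemma measurable_delayedCoeff (hp : Measurable[m] p) (i : Fin n) (k l : Fin n × Fin 2) :
    Measurable[m] fun ω => delayedCoeff α β γ i (p ω) k l := by
  simp only [delayedCoeff, Matrix.of_apply]
  split_ifs
  · exact measurable_const.mul hp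
  · exact measurable_const
  · exact measurable_const

lemma measurable_currentCoeff (hz : Measurable[m] z) {y : Fin n → Ω → ℝ}
    (hy : ∀ i, Measurable[m] (y i)) (j : Fin n) (k l : Fin n × Fin 2) :
    Measurable[m] fun ω => currentCoeff α β γ j (z ω) (fun i => y i ω) k l := by
  simp only [currentCoeff, Matrix.of_apply]
  split_ifs
  · exact (((measurable_const.add (measurable_const.mul hz)).add
      (measurable_const.mul (hy k.1))).mul_const _).mul_const _
  · exact measurable_const
  · exact measurable_const

end Coefficients

/-! ### Stationary signals satisfy the abstract hypotheses -/

section Stationary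

variable {Ω : Type*} [mΩ : MeasurableSpace Ω] {P : Measure Ω}
  {n : ℕ} {G : Digraph (Fin n)} {γ : Matrix (Fin n) (Fin n) ℝ} {α β : Fin n → ℝ}
  {x : ℤ → Ω → ℝ} {η : Fin n → ℤ → Ω → ℝ} {ση : Fin n → ℝ} {xbar s K : ℝ} {m : ℕ → ℝ} {d : ℕ}

lemma StationarySignal.processSigma_le (hx : StationarySignal x P xbar s m) :
    processSigma x ≤ mΩ := iSup_le fun t => (hx.measurable t).comap_le

variable [IsProbabilityMeasure P]

/-- The conditional moments given the remote signal are close to constants, and adding the whole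
noise to the conditioning changes nothing, because it is independent of the signal. -/
lemma exists_mixing (hx : StationarySignal x P xbar s m) (hη : MeasurementNoise x η P ση)
    (hK : 0 ≤ K) (hxK : ∀ t, ∀ᵐ ω ∂P, |x t ω| ≤ K) (d : ℕ) {ε : ℝ} (hε : 0 < ε) :
    ∃ τ : ℕ, ∀ t ≥ τ, ∀ k : Fin 4, ∀ g : Ω → ℝ,
      Measurable[signalFiltration x η d (t - τ)] g → Integrable g P →
      |∫ ω, ((![1, clipped K x t ω, delayedSignal K x d t ω,
          clipped K x t ω * delayedSignal K x d t ω] : Fin 4 → ℝ) k -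
        (![1, xbar, xbar, m (d + 1)] : Fin 4 → ℝ) k) * g ω ∂P| ≤ ε * ∫ ω, |g ω| ∂P := by
  obtain ⟨φ, hφ0, hφ⟩ := hx.mixing_mean
  obtain ⟨ψ, hψ0, hψ⟩ := hx.mixing_corr (d + 1)
  obtain ⟨N, hN⟩ := eventually_atTop.1 ((hφ0.eventually_le_const hε).and
    (hψ0.eventually_le_const hε))
  have hae : ∀ t, clipped K x t =ᵐ[P] x t := fun t => by
    filter_upwards [hxK t] with ω hω using clipped_eq hω
  have hI := hη.indep_signal hx.processSigma_le Set.univ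
  have hkey : ∀ (k : ℤ) (f : Ω → ℝ) (c C : ℝ) (g : Ω → ℝ), Measurable[processSigma x] f →
      (∀ ω, |f ω| ≤ C) → (∀ᵐ ω ∂P, |(P[f | history x k]) ω - c| ≤ ε) →
      Measurable[history x k ⊔ noiseSigma η Set.univ] g → Integrable g P →
      |∫ ω, (f ω - c) * g ω ∂P| ≤ ε * ∫ ω, |g ω| ∂P := fun k f c C g hf hC h hg hgi =>
    abs_integral_sub_mul_le_of_condExp (history_le_processSigma k) hx.processSigma_le
      (hη.noiseSigma_le _) hI hf hC h hg hgi
  have hpm : ∀ t, Measurable[processSigma x] (clipped K x t) := fun t =>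
    measurable_clipped (measurable_processSigma t)
  -- The filtration looks `d + 1` steps ahead and the delayed signal lies `d + 1` steps back, so its
  -- effective lag is `τ - 2 (d + 1) ≥ N`. For the product the lag `τ - (d + 1)` must also exceed `d
  -- + 1`.
  refine ⟨N + 2 * (d + 2), fun t ht k g hg hgi => ?_⟩
  set τ := N + 2 * (d + 2) with hτ
  have hdt : d + 1 ≤ t := by omega
  have hz : ∀ ω, delayedSignal K x d t ω = clipped K x ((t : ℤ) - 1 - d) ω := fun ω => by
    rw [delayedSignal, if_pos hdt]
  simp only [hz]
  rw [signalFiltration, Nat.cast_sub ht] at hg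
  fin_cases k
  · simp only [Fin.zero_eta, Matrix.cons_val_zero, sub_self, zero_mul, integral_zero, abs_zero]
    have : 0 ≤ ∫ ω, |g ω| ∂P := integral_nonneg fun _ => abs_nonneg _
    positivity
  · refine hkey _ (clipped K x t) xbar K g (hpm t) (abs_clipped_le hK t) ?_ hg hgi
    have h1 := hφ t (τ - (d + 1)) (by omega)
    rw [show (t : ℤ) - (τ - (d + 1) : ℕ) = t - τ + (d + 1) by omega] at h1
    filter_upwards [h1, condExp_congr_ae (m := history x (t - τ + (d + 1))) (hae t)] with ω h1 h2
    rw [h2]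
    exact h1.trans (hN _ (by omega)).1
  · refine hkey _ (clipped K x ((t : ℤ) - 1 - d)) xbar K g (hpm _) (abs_clipped_le hK _) ?_ hg hgi
    have h1 := hφ ((t : ℤ) - 1 - d) (τ - 2 * (d + 1)) (by omega)
    rw [show (t : ℤ) - 1 - d - (τ - 2 * (d + 1) : ℕ) = t - τ + (d + 1) by omega] at h1
    filter_upwards [h1, condExp_congr_ae (m := history x (t - τ + (d + 1)))
      (hae ((t : ℤ) - 1 - d))] with ω h1 h2
    rw [h2]
    exact h1.trans (hN _ (by omega)).1
  · refine hkey _ (fun ω => clipped K x t ω * clipped K x ((t : ℤ) - 1 - d) ω) (m (d + 1)) (K * K) g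
      ((hpm t).mul (hpm _)) (fun ω => ?_) ?_ hg hgi
    · rw [abs_mul]
      exact mul_le_mul (abs_clipped_le hK _ _) (abs_clipped_le hK _ _) (abs_nonneg _) hK
    have h1 := hψ t (τ - (d + 1)) (by omega) (by omega)
    rw [show (t : ℤ) - (τ - (d + 1) : ℕ) = t - τ + (d + 1) by omega,
      show (t : ℤ) - ((d + 1 : ℕ) : ℤ) = (t : ℤ) - 1 - d by omega] at h1
    have h3 : (fun ω => clipped K x t ω * clipped K x ((t : ℤ) - 1 - d) ω) =ᵐ[P]
        fun ω => x t ω * x ((t : ℤ) - 1 - d) ω := (hae t).mul (hae _)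
    filter_upwards [h1, condExp_congr_ae (m := history x (t - τ + (d + 1))) h3] with ω h1 h2
    rw [h2]
    exact h1.trans (hN _ (by omega)).2

lemma exists_averagedDrift_driftCoeff (hnet : IsSensorNetwork G γ α) (hA : HasSpanningTree G)
    (hx : StationarySignal x P xbar s m) (hη : MeasurementNoise x η P ση)
    (hK : 0 ≤ K) (hxK : ∀ t, ∀ᵐ ω ∂P, |x t ω| ≤ K) (hm : xbar ^ 2 < m (d + 1))
    {κ : Type*} [Fintype κ] {L : Matrix κ (Fin n × Fin 2) ℝ} {c : ℝ}
    (hL : IsLyapunovFactor (systemMatrix α β γ xbar (m (d + 1))) L c) :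
    ∃ b τ, AveragedDrift P (signalFiltration x η d) (fun t ω => driftCoeff α β γ (clipped K x t ω)
      (delayedSignal K x d t ω)) L b (c / 2) τ := by
  have hcons := fun v (hv : L *ᵥ v = 0) =>
    (hnet.systemMatrix_mulVec_eq_zero_iff hA hm v).1 ((hL.ker_iff v).1 hv)
  rw [systemMatrix_eq_sum] at hL
  simp only [driftCoeff_eq_sum]
  refine hL.exists_averagedDrift
    (f := fun k t ω => (![1, clipped K x t ω, delayedSignal K x d t ω,
          clipped K x t ω * delayedSignal K x d t ω] : Fin 4 → ℝ) k) (K := 1 + K + K * K)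
    (fun k v hv => driftTerm_mulVec_eq_zero k (hcons v hv)) (signalFiltration_mono x η d)
    (fun t => sup_le ((history_le_processSigma _).trans hx.processSigma_le) (hη.noiseSigma_le _))
    (fun k t => ?_) (fun k t ω => ?_) (by positivity)
    (fun ε hε => exists_mixing hx hη hK hxK d hε)
  · have h1 : Measurable[signalFiltration x η d t] (clipped K x t) :=
      measurable_clipped_signalFiltration (by omega)
    have h2 : Measurable[signalFiltration x η d t] (delayedSignal K x d t) :=
      measurable_delayedSignal_signalFiltration t
    fin_cases k
    · exact measurable_const
    · exact h1
    · exact h2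
    · exact h1.mul h2
  · have h1 : |clipped K x t ω| ≤ K := abs_clipped_le hK _ _
    have h2 : |delayedSignal K x d t ω| ≤ K := abs_delayedSignal_le hK _ _ _
    have h3 : 0 ≤ K * K := by positivity
    fin_cases k
    · simp only [Fin.zero_eta, Matrix.cons_val_zero, abs_one]; linarith
    · simp only [Fin.mk_one, Matrix.cons_val_one, Matrix.cons_val_zero]; linarith
    · simp only [Fin.reduceFinMk, Matrix.cons_val]; linarith
    · simp only [Fin.reduceFinMk, Matrix.cons_val, abs_mul]
      have := mul_le_mul h1 h2 (abs_nonneg _) hK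
      linarith

/-- The two filtrations have opposite roles. `noiseFiltration` contains the whole signal, so that
the averaged flow is part of the past when orthogonality of the noise is used. `signalFiltration`
contains the whole noise, which is harmless for mixing, and looks `d + 1` steps ahead in the signal,
as the corrector does. -/
lemma exists_delayedNoise (α β : Fin n → ℝ) (γ : Matrix (Fin n) (Fin n) ℝ)
    (hx : StationarySignal x P xbar s m) (hη : MeasurementNoise x η P ση) (hK : 0 ≤ K) (d : ℕ) :
    ∃ b μ, DelayedNoise P (signalFiltration x η d) (noiseFiltration x η)
      (fun t => noiseSigma η {(t : ℤ)}) η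
      (fun t ω => driftCoeff α β γ (clipped K x t ω) (delayedSignal K x d t ω))
      (fun i t ω => delayedCoeff α β γ i (clipped K x t ω))
      (fun j t ω => currentCoeff α β γ j (delayedSignal K x d t ω)
        fun i => η i ((t : ℤ) - 1 - d) ω) b μ d := by
  obtain ⟨b, hb⟩ := exists_coeffBound α β γ η d hK
  obtain ⟨μ, hμ⟩ := exists_amplitude_moment hη
  have hcb := hb (fun t => clipped K x t) (delayedSignal K x d) (fun t ω => abs_clipped_le hK _ _)
    (fun t ω => abs_delayedSignal_le hK _ _ _)
  have hX := hx.processSigma_le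
  have hpA : ∀ (u t : ℕ), Measurable[noiseFiltration x η t] (clipped K x u) := fun u t =>
    measurable_clipped ((measurable_processSigma u).mono le_sup_left le_rfl)
  have hzA : ∀ (u t : ℕ), Measurable[noiseFiltration x η t] (delayedSignal K x d u) := fun u t =>
    measurable_delayedSignal fun _ => (measurable_processSigma _).mono le_sup_left le_rfl
  have hwA : ∀ j (r : ℤ) (t : ℕ), r < t → Measurable[noiseFiltration x η t] (η j r) :=
    fun j r t h => (measurable_noiseSigma (S := Set.Iio (t : ℤ)) h j).mono le_sup_right le_rfl
  have hwG : ∀ j (r : ℤ) (t : ℕ), Measurable[signalFiltration x η d t] (η j r) :=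
    fun j r t => (measurable_noiseSigma (Set.mem_univ r) j).mono le_sup_right le_rfl
  refine ⟨b, μ, ⟨hcb, ?_, ?_, ?_, ?_, ?_, hwA, hwG, ?_, ?_, ?_, ?_, ?_, ?_, ?_, ?_, ?_⟩⟩
  · exact fun t u h => sup_le_sup_left (noiseSigma_mono η (Set.Iio_subset_Iio (by exact_mod_cast h))) _
  · exact fun t => sup_le hX (hη.noiseSigma_le _)
  · exact fun t => hη.noiseSigma_le _
  · intro t
    refine indep_sup_left_of_indep hX (hη.noiseSigma_le _) (hη.noiseSigma_le _) ?_
      (hη.indep_noiseSigma (by simp))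
    exact indep_of_indep_of_le_right (hη.indep_signal hX Set.univ)
      (sup_le (noiseSigma_mono η (Set.subset_univ _)) (noiseSigma_mono η (Set.subset_univ _)))
  · exact fun j t => measurable_noiseSigma (Set.mem_singleton (t : ℤ)) j
  · exact fun j t => (hη.memLp_two j _).integrable one_le_two
  · exact fun j t => hη.mean j _
  · exact fun t => integrable_amplitude_pow hη _
  · exact fun t => hμ _
  · exact fun u t i j => measurable_driftCoeff (hpA u t) (hzA u t) i j
  · exact fun j u t i i' => measurable_delayedCoeff (hpA u t) j i i'
  · exact fun j u t i i' h => measurable_delayedCoeff (measurable_clipped_signalFiltration h) j i i'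
  · exact fun j t i i' => measurable_currentCoeff (hzA t t) (fun i => hwA i _ t (by omega)) j i i'
  · exact fun j t i i' => measurable_currentCoeff (measurable_delayedSignal_signalFiltration t)
      (fun i => hwG i _ t) j i i'

end Stationary

/-! ### Crude pathwise growth -/

section PathBound

variable {Ω : Type*} {J ι : Type*} [Fintype J] [Fintype ι]

/-- `∏_{r < t} e(r) e(r - 1 - d)`, where `e` is the amplitude of the noise. -/
def growth (w : J → ℤ → Ω → ℝ) (d t : ℕ) (ω : Ω) : ℝ :=
  ∏ r ∈ Finset.range t, amplitude w r ω * amplitude w ((r : ℤ) - 1 - d) ω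

variable {w : J → ℤ → Ω → ℝ} {d t : ℕ} {ω : Ω}

lemma growth_succ : growth w d (t + 1) ω =
    growth w d t ω * (amplitude w t ω * amplitude w ((t : ℤ) - 1 - d) ω) := by
  rw [growth, Finset.prod_range_succ, growth]

lemma one_le_growth : 1 ≤ growth w d t ω := by
  induction t with
  | zero => simp [growth]
  | succ t ih =>
    rw [growth_succ]
    exact one_le_mul_of_one_le_of_one_le ih
      (one_le_mul_of_one_le_of_one_le (one_le_amplitude _ _) (one_le_amplitude _ _))

/-- On the left each amplitude of the times from `-1 - d` to `t - 1` occurs at most twice: the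
delayed factors and the window together run once through this range, the present factors once
through its nonnegative part. -/
lemma growth_mul_window_le : growth w d t ω * window (amplitude w) (d + 1) t ω ≤
    window (amplitude w) (t + (d + 1)) t ω ^ 2 := by
  induction t with
  | zero =>
    rw [growth, Finset.prod_range_zero, one_mul, zero_add]
    exact le_self_pow₀ (one_le_window one_le_amplitude) two_ne_zero
  | succ t ih =>
    rw [growth_succ, Nat.cast_succ, window_succ_succ, Nat.add_right_comm t 1, window_succ_succ]
    rw [window_succ] at ih
    calc _ = amplitude w t ω ^ 2 * (growth w d t ω * (window (amplitude w) d t ω *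
          amplitude w ((t : ℤ) - 1 - d) ω)) := by ring
      _ ≤ amplitude w t ω ^ 2 * window (amplitude w) (t + (d + 1)) t ω ^ 2 :=
        mul_le_mul_of_nonneg_left ih (sq_nonneg _)
      _ = _ := by ring

lemma growth_le : growth w d t ω ≤ window (amplitude w) (t + (d + 1)) t ω ^ 2 :=
  (le_mul_of_one_le_right (zero_le_one.trans one_le_growth)
    (one_le_window one_le_amplitude)).trans growth_mul_window_le

lemma measurable_growth {m : MeasurableSpace Ω} (hw : ∀ j, ∀ r < (t : ℤ), Measurable[m] (w j r)) :
    Measurable[m] (growth w d t) :=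
  Finset.measurable_prod _ fun r hr => by
    rw [Finset.mem_range] at hr
    exact (measurable_amplitude fun j => hw j r (by exact_mod_cast hr)).mul
      (measurable_amplitude fun j => hw j _ (by omega))

/-- The bound depends on the noise alone. In the application it is therefore measurable for both
filtrations, unlike the state, which also involves the signal at negative times. -/
lemma CoeffBound.exists_nrm_le_growth {D : ℕ → Ω → Matrix ι ι ℝ} {K M : J → ℕ → Ω → Matrix ι ι ℝ}
    {b : ℝ} (h : CoeffBound w D K M b d) {δ : ℕ → ℝ} (hδ : ∀ t, 0 ≤ δ t) {X : ℕ → Ω → ι → ℝ}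
    {x₀ : ι → ℝ} (h0 : ∀ ω, X 0 ω = x₀)
    (hX : ∀ t ω, X (t + 1) ω = X t ω + δ t • (noisyMatrix w D K M d t ω *ᵥ X t ω)) (t : ℕ) :
    ∃ C, 0 ≤ C ∧ ∀ ω, nrm (X t ω) ≤ C * growth w d t ω := by
  induction t with
  | zero => exact ⟨nrm x₀, nrm_nonneg _, fun ω => by simp [h0, growth]⟩
  | succ t ih =>
    obtain ⟨C, hC0, hC⟩ := ih
    have hb := h.nonneg
    have hδt := hδ t
    refine ⟨(1 + δ t * (3 * b)) * C, by positivity, fun ω => ?_⟩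
    rw [hX, growth_succ]
    refine (nrm_add_le _ _).trans ?_
    rw [nrm_smul, abs_of_nonneg hδt]
    have h1 := h.noisyMatrix_le t ω (X t ω)
    set a := amplitude w t ω * amplitude w ((t : ℤ) - 1 - d) ω with ha
    have ha1 : 1 ≤ a := one_le_mul_of_one_le_of_one_le (one_le_amplitude _ _) (one_le_amplitude _ _)
    have hg := one_le_growth (w := w) (d := d) (t := t) (ω := ω)
    have hn := nrm_nonneg (X t ω)
    calc _ ≤ a * nrm (X t ω) + δ t * (3 * b * a * nrm (X t ω)) :=
          add_le_add (le_mul_of_one_le_left hn ha1) (mul_le_mul_of_nonneg_left h1 hδt)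
      _ = (1 + δ t * (3 * b)) * a * nrm (X t ω) := by ring
      _ ≤ (1 + δ t * (3 * b)) * a * (C * growth w d t ω) :=
        mul_le_mul_of_nonneg_left (hC ω) (by positivity)
      _ = _ := by ring

end PathBound

/-! ### Initial values dominated by adapted variables -/

section Dominated

lemma mulVec_mulVec_eq_sum {ι κ : Type*} [Fintype ι] [DecidableEq ι]
    (L : Matrix κ ι ℝ) (F : Matrix ι ι ℝ) (v : ι → ℝ) :
    L *ᵥ (F *ᵥ v) = ∑ k, v k • (L *ᵥ (F *ᵥ Pi.single k (1 : ℝ))) := by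
  have hsum : v = ∑ k, v k • (Pi.single k (1 : ℝ) : ι → ℝ) := by
    ext i
    simp [Finset.sum_apply, Pi.single_apply]
  conv_lhs => rw [hsum, Matrix.mulVec_sum, Matrix.mulVec_sum]
  simp only [Matrix.mulVec_smul]

lemma nrm_mulVec_mulVec_le_sum {ι κ : Type*} [Fintype ι] [Fintype κ] [DecidableEq ι]
    (L : Matrix κ ι ℝ) (F : Matrix ι ι ℝ) (v : ι → ℝ) {h : ℝ} (hv : nrm v ≤ h) :
    nrm (L *ᵥ (F *ᵥ v)) ≤ ∑ k, nrm (L *ᵥ (F *ᵥ (h • Pi.single k (1 : ℝ)))) := by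
  have h0 : 0 ≤ h := (nrm_nonneg v).trans hv
  have hv' : ∀ k, |v k| ≤ h := fun k => by
    refine le_trans ?_ hv
    rw [nrm, ← Real.sqrt_sq_eq_abs]
    exact Real.sqrt_le_sqrt (sq_le_sqNorm v k)
  rw [mulVec_mulVec_eq_sum]
  refine (nrm_sum_le _ _).trans (Finset.sum_le_sum fun k _ => ?_)
  rw [Matrix.mulVec_smul, Matrix.mulVec_smul, nrm_smul, nrm_smul, abs_of_nonneg h0]
  exact mul_le_mul_of_nonneg_right (hv' k) (nrm_nonneg _)

lemma sqNorm_mulVec_le_sum {ι κ : Type*} [Fintype ι] [Fintype κ] [DecidableEq ι]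
    (L : Matrix κ ι ℝ) (F : Matrix ι ι ℝ) (v : ι → ℝ) {h : ℝ} (hv : nrm v ≤ h) :
    sqNorm (L *ᵥ (F *ᵥ v)) ≤
      Fintype.card ι * ∑ k, sqNorm (L *ᵥ (F *ᵥ (h • Pi.single k (1 : ℝ)))) := by
  have h1 := pow_le_pow_left₀ (nrm_nonneg _) (nrm_mulVec_mulVec_le_sum L F v hv) 2
  have h2 := sq_sum_le_card_mul_sum_sq (s := Finset.univ)
    (f := fun k => nrm (L *ᵥ (F *ᵥ (h • Pi.single k (1 : ℝ)))))
  simp only [nrm_sq, Finset.card_univ] at h1 h2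
  exact h1.trans h2

variable {Ω : Type*} [mΩ : MeasurableSpace Ω] {P : Measure Ω} [IsProbabilityMeasure P]
  {J ι κ : Type*} [Fintype J] [Fintype ι] [DecidableEq ι] [Fintype κ]
  {𝒢 𝒜 𝒩 : ℕ → MeasurableSpace Ω} {w : J → ℤ → Ω → ℝ} {D : ℕ → Ω → Matrix ι ι ℝ}
  {K M : J → ℕ → Ω → Matrix ι ι ℝ} {b bL c μ ℓ : ℝ} {d τ : ℕ} {δ : ℕ → ℝ} {L : Matrix κ ι ℝ}

/-- The initial value need not be adapted if it is dominated by an adapted variable. -/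
theorem DelayedNoise.exists_integral_le_rpow_of_dominated
    (h : DelayedNoise P 𝒢 𝒜 𝒩 w D K M b μ d) (hD : AveragedDrift P 𝒢 D L bL c τ)
    (hstep : IsStepSize δ) (hℓ : 0 ≤ ℓ)
    (hδ : Tendsto (fun t => (δ (t + 1))⁻¹ - (δ t)⁻¹) atTop (𝓝 ℓ)) :
    ∃ s₁, ∀ s₀ ≥ s₁, ∀ (X : ℕ → Ω → ι → ℝ) (g : Ω → ℝ),
      (∀ t ≥ s₀, ∀ ω, X (t + 1) ω = X t ω + δ t • (noisyMatrix w D K M d t ω *ᵥ X t ω)) →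
      (∀ ω, nrm (X s₀ ω) ≤ g ω) → Measurable[𝒜 s₀] g → Measurable[𝒢 s₀] g →
      Integrable (fun ω => window (amplitude w) (d + 1) s₀ ω ^ 2 * g ω ^ 2) P →
      (∀ t, Integrable (fun ω => sqNorm (L *ᵥ X t ω)) P) →
      ∃ A t₁, ∀ t ≥ t₁, ∫ ω, sqNorm (L *ᵥ X t ω) ∂P ≤ A * δ t ^ rateExponent (c / 2) ℓ := by
  obtain ⟨s₁, hs₁⟩ := h.exists_integral_le_rpow hD hstep hℓ hδ
  refine ⟨s₁, fun s₀ hs X g hX hg hgA hgG hgi hXi => ?_⟩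
  -- By linearity `X t = F t X(s₀)`, and for `|v| ≤ g` the size of `L F v` is controlled by the
  -- solutions starting from `g e_k`, whose initial values are adapted.
  set F : ℕ → Ω → Matrix ι ι ℝ := fun t ω => flow δ (fun t => noisyMatrix w D K M d t ω) s₀ t with hF
  have hsol : ∀ k, IsSolution P 𝒢 𝒜 δ w D K M d s₀
      fun t ω => F t ω *ᵥ (g ω • Pi.single k (1 : ℝ)) := by
    intro k
    have hinit : ∀ ω, F s₀ ω *ᵥ (g ω • Pi.single k (1 : ℝ)) = g ω • Pi.single k (1 : ℝ) :=
      fun ω => by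
        rw [hF]
        simp only [flow_self, Matrix.one_mulVec]
    refine ⟨fun t ht ω => flow_succ_mulVec ht _, fun i => ?_, fun i => ?_, ?_⟩
    · simp only [hinit, Pi.smul_apply, smul_eq_mul]
      exact hgA.mul_const _
    · simp only [hinit, Pi.smul_apply, smul_eq_mul]
      exact hgG.mul_const _
    · simp only [hinit, sqNorm_smul, ← mul_assoc]
      exact hgi.mul_const _
  have hflow : ∀ t ≥ s₀, ∀ ω, X t ω = F t ω *ᵥ X s₀ ω := by
    intro t ht ω
    induction t, ht using Nat.le_induction with
    | base => rw [hF]; simp only [flow_self, Matrix.one_mulVec]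
    | succ t ht ih =>
      rw [hX t ht, ih, hF]
      simp only [flow_succ_mulVec ht]
  choose hmem A t₁ hA₁ using fun k => hs₁ s₀ hs _ (hsol k)
  refine ⟨Fintype.card ι * ∑ k, A k, max s₀ (∑ k, t₁ k), fun t ht => ?_⟩
  have hts : s₀ ≤ t := (le_max_left _ _).trans ht
  have hi := fun k => integrable_sqNorm (memLp_mulVec L (hmem k t hts))
  calc ∫ ω, sqNorm (L *ᵥ X t ω) ∂P ≤ ∫ ω, Fintype.card ι * ∑ k,
        sqNorm (L *ᵥ (F t ω *ᵥ (g ω • Pi.single k (1 : ℝ)))) ∂P := by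
        refine integral_mono (hXi t)
          ((integrable_finsetSum _ fun k _ => hi k).const_mul _) fun ω => ?_
        simp only [hflow t hts ω]
        exact sqNorm_mulVec_le_sum L (F t ω) (X s₀ ω) (hg ω)
    _ = Fintype.card ι * ∑ k, ∫ ω,
        sqNorm (L *ᵥ (F t ω *ᵥ (g ω • Pi.single k (1 : ℝ)))) ∂P := by
        rw [integral_const_mul, integral_finsetSum _ fun k _ => hi k]
    _ ≤ Fintype.card ι * ∑ k, A k * δ t ^ rateExponent (c / 2) ℓ := by
        refine mul_le_mul_of_nonneg_left (Finset.sum_le_sum fun k _ => ?_) (Nat.cast_nonneg _)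
        exact hA₁ k t ((Finset.single_le_sum (f := t₁) (fun _ _ => Nat.zero_le _)
          (Finset.mem_univ k)).trans ((le_max_right _ _).trans ht))
    _ = _ := by rw [← Finset.sum_mul, mul_assoc]

end Dominated

/-! ### Fourth moments of windows -/

section WindowMoment

variable {Ω : Type*} [mΩ : MeasurableSpace Ω] {P : Measure Ω} [IsProbabilityMeasure P]
  {n : ℕ} {x : ℤ → Ω → ℝ} {η : Fin n → ℤ → Ω → ℝ} {ση : Fin n → ℝ}

lemma integrable_window_pow (hη : MeasurementNoise x η P ση) (k : ℕ) (r : ℤ) :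
    Integrable (fun ω => window (amplitude η) k r ω ^ 4) P := by
  induction k with
  | zero => simpa only [window_zero] using integrable_const _
  | succ k ih =>
    simp only [window_succ, mul_pow]
    have hd : Disjoint (Set.Ioi (r - 1 - k)) {r - 1 - (k : ℤ)} := by simp
    refine integrable_mul_of_indep (hη.indep_noiseSigma hd) ?_ ?_ ih
      (integrable_amplitude_pow hη _)
    · exact (measurable_window fun j hj => measurable_amplitude fun i =>
        measurable_noiseSigma (S := Set.Ioi (r - 1 - k)) (by rw [Set.mem_Ioi]; omega) i).pow_const 4
    · exact (measurable_amplitude fun i => measurable_noiseSigma (Set.mem_singleton _) i).pow_const 4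

end WindowMoment

/-! ### Almost sure modifications -/

section Transfer

variable {Ω : Type*} {n : ℕ} {δ : ℕ → ℝ}

lemma instrumentalParams_congr {α β : Fin n → ℝ} {γ : Matrix (Fin n) (Fin n) ℝ} {d : ℕ}
    {x x' : ℤ → Ω → ℝ} {η : Fin n → ℤ → Ω → ℝ} {ω : Ω} (h : ∀ t, x t ω = x' t ω) (t : ℕ) :
    instrumentalParams α β γ δ d x η t ω = instrumentalParams α β γ δ d x' η t ω := by
  induction t with
  | zero => rfl
  | succ t ih => simp only [instrumentalParams, outputError, sensorOutput, h, ih]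

variable [mΩ : MeasurableSpace Ω] {P : Measure Ω}

lemma ConsensusRate.congr {B : Matrix (Fin n × Fin 2) (Fin n × Fin 2) ℝ}
    {ρ ρ' : ℕ → Ω → Fin n × Fin 2 → ℝ} (h : ConsensusRate P δ B ρ)
    (hρ : ∀ t, ∀ᵐ ω ∂P, ρ t ω = ρ' t ω) : ConsensusRate P δ B ρ' := by
  have hd : ∀ T t, (fun ω => disagreementSq T (ρ t ω)) =ᵐ[P] fun ω => disagreementSq T (ρ' t ω) :=
    fun T t => by filter_upwards [hρ t] with ω hω using by rw [hω]
  obtain ⟨σ', h0, h1, h2⟩ := h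
  refine ⟨σ', h0, h1, fun σ hσ hσ' T hT => ?_⟩
  obtain ⟨h3, h4, h5⟩ := h2 σ hσ hσ' T hT
  refine ⟨h3, fun t => (h4 t).congr (hd T t), ?_⟩
  simpa only [integral_congr_ae (hd T _)] using h5

end Transfer

/-! ### The rate of the instrumental variable algorithm -/

section InstrumentalRate

variable {Ω : Type*} [mΩ : MeasurableSpace Ω] {P : Measure Ω} [IsProbabilityMeasure P]
  {n : ℕ} {G : Digraph (Fin n)} {γ : Matrix (Fin n) (Fin n) ℝ} {α β : Fin n → ℝ}
  {x : ℤ → Ω → ℝ} {η : Fin n → ℤ → Ω → ℝ} {ση : Fin n → ℝ} {xbar s K ℓ : ℝ} {m : ℕ → ℝ} {d : ℕ}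
  {δ : ℕ → ℝ}

/-- From `E (x(0) - x(-d))² ≥ 0`. If `m d` exceeds `xbar²`, then so does `s²`, and the system
matrices for both values of `q` have the same kernel. -/
lemma StationarySignal.corr_le (hx : StationarySignal x P xbar s m) (d : ℕ) : m d ≤ s ^ 2 := by
  obtain ⟨K, hK⟩ := hx.bounded
  have hL : ∀ t, MemLp (x t) 2 P := fun t =>
    MemLp.of_bound (hx.measurable t).aestronglyMeasurable K (hK t)
  have hsq : ∀ t, ∫ ω, x t ω ^ 2 ∂P = s ^ 2 := fun t => by
    have := hx.corr t 0
    rw [hx.corr_zero] at this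
    simpa only [Nat.cast_zero, sub_zero, ← sq] using this
  have h1 := hx.corr 0 d
  have hi : Integrable (fun ω => x 0 ω * x (0 - d) ω) P := (hL 0).integrable_mul (hL (0 - d))
  have h0 : 0 ≤ ∫ ω, (x 0 ω ^ 2 + x (0 - d) ω ^ 2 - 2 * (x 0 ω * x (0 - d) ω)) ∂P :=
    integral_nonneg fun ω => by
      have := sq_nonneg (x 0 ω - x (0 - d) ω)
      simp only [Pi.zero_apply]
      linarith
  rw [integral_sub ((hL 0).integrable_sq.fun_add (hL _).integrable_sq) (hi.const_mul 2),
    integral_add (hL 0).integrable_sq (hL _).integrable_sq, integral_const_mul, hsq, hsq, h1] at h0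
  linarith

/-- The rate for bounded signals. -/
theorem consensusRate_instrumentalParams_clipped (hnet : IsSensorNetwork G γ α)
    (hA : HasSpanningTree G) (hstep : IsStepSize δ) (hℓ : 0 ≤ ℓ)
    (hδ : Tendsto (fun t => (δ (t + 1))⁻¹ - (δ t)⁻¹) atTop (𝓝 ℓ))
    (hx : StationarySignal x P xbar s m) (hm : xbar ^ 2 < m (d + 1))
    (hη : MeasurementNoise x η P ση) (hK : 0 ≤ K) (hxK : ∀ t, ∀ᵐ ω ∂P, |x t ω| ≤ K) :
    ConsensusRate P δ (systemMatrix α β γ xbar (s ^ 2)) (fun t ω =>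
      equivParams α β (instrumentalParams α β γ δ (d + 1) (clipped K x) η t ω)) := by
  set X : ℕ → Ω → Fin n × Fin 2 → ℝ := fun t ω =>
    equivParams α β (instrumentalParams α β γ δ (d + 1) (clipped K x) η t ω) with hXdef
  have hδ0 : ∀ t, 0 ≤ δ t := fun t => (hstep.pos t).le
  -- The Lyapunov factor belongs to `q = m (d + 1)`, the mean of the actual drift. For the
  -- transformation, which refers to `q = s²`, only its kernel matters.
  obtain ⟨N, L, c, hL⟩ := hnet.exists_isLyapunovFactor (β := β) hA hm
  obtain ⟨bL, τ, hD⟩ := exists_averagedDrift_driftCoeff (d := d) hnet hA hx hη hK hxK hm hL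
  obtain ⟨b, μ, hN⟩ := exists_delayedNoise α β γ hx hη hK d
  obtain ⟨s₁, hs₁⟩ := hN.exists_integral_le_rpow_of_dominated hD hstep hℓ hδ
  obtain ⟨b', hb'⟩ := exists_coeffBound α β γ η d hK
  -- The true delayed signal, including negative times: for the crude growth bound only its size
  -- matters.
  have hCB := hb' (fun t => clipped K x t) (fun t => clipped K x ((t : ℤ) - 1 - d))
    (fun t ω => abs_clipped_le hK _ _) (fun t ω => abs_clipped_le hK _ _)
  have hXstep : ∀ t ω, X (t + 1) ω = _ := fun t ω =>
    equivParams_instrumentalParams_succ (β := β) (γ := γ) (δ := δ) (d := d) (x := clipped K x)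
      (η := η) hnet.gain_ne t ω
  have hX0 : ∀ ω, X 0 ω = equivParams α β fun _ => ![1, 0] := fun ω => rfl
  have hgrow := hCB.exists_nrm_le_growth hδ0 hX0 hXstep
  have hηm : ∀ i r, Measurable (η i r) := fun i r => (hη.iid i).measurable r
  have hxm : ∀ r, Measurable (clipped K x r) := fun r => measurable_clipped (hx.measurable r)
  have hXm : ∀ t k, Measurable fun ω => X t ω k := by
    intro t
    induction t with
    | zero => intro k; simp only [hX0]; exact measurable_const
    | succ t ih =>
      intro k
      simp only [hXstep]
      exact (ih k).add (measurable_const.mul (measurable_mulVec (measurable_noisyMatrix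
        (measurable_driftCoeff (hxm _) (hxm _)) (fun j => measurable_delayedCoeff (hxm _) j)
        (fun j => measurable_currentCoeff (hxm _) (fun i => hηm i _) j) (fun j => hηm j _)
        (fun j => hηm j _)) ih k))
  have hXL : ∀ t k, MemLp (fun ω => X t ω k) 2 P := by
    intro t k
    obtain ⟨C, hC0, hC⟩ := hgrow t
    refine memLp_of_sqNorm_le (hXm t) ((integrable_window_pow hη (t + (d + 1)) t).const_mul (C ^ 2))
      (fun ω => ?_) k
    rw [← nrm_sq]
    calc _ ≤ (C * window (amplitude η) (t + (d + 1)) t ω ^ 2) ^ 2 :=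
          pow_le_pow_left₀ (nrm_nonneg _)
            ((hC ω).trans (mul_le_mul_of_nonneg_left growth_le hC0)) 2
      _ = _ := by ring
  -- From time `d + 1` on the lagged time is nonnegative, and `delayedSignal` coincides with the
  -- truncated signal.
  set s₀ := max s₁ (d + 1) with hs₀
  obtain ⟨C, hC0, hC⟩ := hgrow s₀
  have hXi := fun t => integrable_sqNorm (memLp_mulVec L (hXL t))
  obtain ⟨A, t₁, hA₁⟩ := hs₁ s₀ (le_max_left _ _) X (fun ω => C * growth η d s₀ ω)
    (fun t ht ω => by
      have hz : delayedSignal K x d t ω = clipped K x ((t : ℤ) - 1 - d) ω := by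
        rw [delayedSignal, if_pos ((le_max_right _ _).trans ht)]
      rw [hXstep]
      simp only [noisyMatrix, delayedPart, currentPart, hz]
      rfl) hC
    (measurable_const.mul (measurable_growth fun j r hr => hN.w_past j r s₀ hr))
    (measurable_const.mul (measurable_growth fun j r _ => hN.w_adapted j r s₀)) (by
      refine ((integrable_window_pow hη (s₀ + (d + 1)) s₀).const_mul (C ^ 2)).mono' ?_
        (ae_of_all _ fun ω => ?_)
      · exact Measurable.aestronglyMeasurable (((measurable_window fun j _ =>
          measurable_amplitude fun i => hηm i _).pow_const 2).mul
          ((measurable_const.mul (measurable_growth fun j r _ => hηm j r)).pow_const 2))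
      · have hg := zero_le_one.trans (one_le_growth (w := η) (d := d) (t := s₀) (ω := ω))
        have hw : 0 ≤ window (amplitude η) (d + 1) s₀ ω :=
          zero_le_one.trans (one_le_window one_le_amplitude)
        have h2 := pow_le_pow_left₀ (mul_nonneg hg hw) growth_mul_window_le 2
        rw [Real.norm_eq_abs, abs_of_nonneg (mul_nonneg (sq_nonneg _) (sq_nonneg _))]
        calc _ = C ^ 2 * (growth η d s₀ ω * window (amplitude η) (d + 1) s₀ ω) ^ 2 := by ring
          _ ≤ C ^ 2 * (window (amplitude η) (s₀ + (d + 1)) s₀ ω ^ 2) ^ 2 :=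
            mul_le_mul_of_nonneg_left h2 (by positivity)
          _ = _ := by ring) hXi
  exact hnet.consensusRate hA hstep (hm.trans_le (hx.corr_le _)) L
    (fun v hv => (hnet.systemMatrix_mulVec_eq_zero_iff hA hm v).1 ((hL.ker_iff v).1 hv))
    (fun t k => (hXL t k).aestronglyMeasurable) hXi
    (rateExponent_pos (c := c / 2 / 2) (by have := hL.pos; positivity) hℓ) (rateExponent_lt_one _ _)
    hA₁

theorem consensusRate_instrumentalParams (hnet : IsSensorNetwork G γ α)
    (hA : HasSpanningTree G) (hstep : IsStepSize δ) (hℓ : 0 ≤ ℓ)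
    (hδ : Tendsto (fun t => (δ (t + 1))⁻¹ - (δ t)⁻¹) atTop (𝓝 ℓ))
    (hx : StationarySignal x P xbar s m) {d₀ : ℕ} (hd : 1 ≤ d₀) (hm : xbar ^ 2 < m d₀)
    (hη : MeasurementNoise x η P ση) :
    ConsensusRate P δ (systemMatrix α β γ xbar (s ^ 2)) (fun t ω =>
      equivParams α β (instrumentalParams α β γ δ d₀ x η t ω)) := by
  obtain ⟨d, rfl⟩ := Nat.exists_eq_add_of_le' hd
  obtain ⟨K, hK⟩ := hx.bounded
  have hK' : ∀ t, ∀ᵐ ω ∂P, |x t ω| ≤ max K 0 := fun t => by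
    filter_upwards [hK t] with ω hω using hω.trans (le_max_left _ _)
  refine (consensusRate_instrumentalParams_clipped hnet hA hstep hℓ hδ hx hm hη (le_max_right _ _)
    hK').congr fun t => ?_
  -- A single null set serves all integer times; outside it the signal and its truncation produce
  -- the same parameters.
  filter_upwards [ae_all_iff.2 hK'] with ω hω
  rw [instrumentalParams_congr fun t => clipped_eq (hω t)]

end InstrumentalRate

end BlindCalibration

theorem mainTheorem11 {Ω : Type*} [MeasurableSpace Ω] (P : Measure Ω) [IsProbabilityMeasure P]
    {n : ℕ} (G : Digraph (Fin n)) (γ : Matrix (Fin n) (Fin n) ℝ) (α β : Fin n → ℝ)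
    (hnet : BlindCalibration.IsSensorNetwork G γ α)
    (hA3 : BlindCalibration.HasSpanningTree G)
    (δ : ℕ → ℝ) (hA8 : BlindCalibration.IsStepSize δ)
    (ℓ : ℝ) (hℓ : 0 ≤ ℓ) (hδ : Tendsto (fun t => (δ (t + 1))⁻¹ - (δ t)⁻¹) atTop (𝓝 ℓ))
    (x : ℤ → Ω → ℝ) (xbar s : ℝ) :
    -- communication dropouts and additive communication noise
    (∀ (u ξ : Fin n → Fin n → ℕ → Ω → ℝ) (p : Matrix (Fin n) (Fin n) ℝ),
      BlindCalibration.IIDSignal x P xbar s → 0 < s ^ 2 - xbar ^ 2 →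
      BlindCalibration.Dropouts G u P p → BlindCalibration.CommunicationNoise ξ P →
      BlindCalibration.IndepSignals x u ξ P →
      BlindCalibration.ConsensusRate P δ
        (BlindCalibration.systemMatrix α β (Matrix.of fun i j => p i j * γ i j) xbar (s ^ 2))
        (BlindCalibration.lossyEstimate α β γ δ x u ξ)) ∧
    -- measurement noise with known variances
    (∀ (η : Fin n → ℤ → Ω → ℝ) (ση : Fin n → ℝ),
      BlindCalibration.IIDSignal x P xbar s → 0 < s ^ 2 - xbar ^ 2 →
      BlindCalibration.MeasurementNoise x η P ση →
      BlindCalibration.ConsensusRate P δ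
        (BlindCalibration.systemMatrix α β γ xbar (s ^ 2))
        (fun t ω => BlindCalibration.equivParams α β
          (BlindCalibration.compensatedParams α β γ δ ση x η t ω))) ∧
    -- measurement noise, correlated signal, instrumental variables
    (∀ (η : Fin n → ℤ → Ω → ℝ) (ση : Fin n → ℝ) (m : ℕ → ℝ) (d₀ : ℕ),
      BlindCalibration.StationarySignal x P xbar s m → 1 ≤ d₀ → xbar ^ 2 < m d₀ →
      BlindCalibration.MeasurementNoise x η P ση →
      BlindCalibration.ConsensusRate P δ
        (BlindCalibration.systemMatrix α β γ xbar (s ^ 2))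
        (fun t ω => BlindCalibration.equivParams α β
          (BlindCalibration.instrumentalParams α β γ δ d₀ x η t ω))) := ⟨fun _ _ _ hx hs hu hξ hind =>
    BlindCalibration.consensusRate_lossyEstimate hnet hA3 hA8 hℓ hδ hx hs hu hξ hind,
  fun _ _ hx hs hη =>
    BlindCalibration.consensusRate_compensatedParams hnet hA3 hA8 hℓ hδ hx hs hη,
  fun _ _ _ _ hx hd hm hη =>
    BlindCalibration.consensusRate_instrumentalParams hnet hA3 hA8 hℓ hδ hx hd hm hη⟩
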